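/- All manifolds are smooth, Hausdorff and second countable; vector bundles are real, smooth and of finite rank. An **N2-manifold** $\mathcal M$ over a manifold $M$ is a sheaf of $\mathbb N_0$-graded algebras on $M$ (as a sheaf, degree by degree) that is locally isomorphic, as a sheaf of graded $C^\infty_M$-algebras, to $C^\infty\otimes\Lambda[\xi^1,\dots,\xi^r]\otimes\mathbb R[b^1,\dots,b^s]$ with $\deg\xi^a=1$, $\deg b^D=2$. A **Q2-manifold** $(\mathcal M,Q)$ is an N2-manifold with a derivation $Q$ of degree $+1$ of its structure sheaf such that $Q^2=0$. For vector bundles $E,V\to M$ let $E[1]\oplus V[2]$ denote the sheaf of (finite sums of homogeneous) sections of $\Lambda E^*\otimes S V^*$, with $E^*$ in degree $1$ and $V^*$ in degree $2$. A **splitting** of $\mathcal M$ is an isomorphism $\mathcal M\cong E[1]\oplus V[2]$ over $\mathrm{id}_M$. A **(semi-strict) Lie 2-algebroid** structure on $(E,V)$ consists of bundle maps $V\xrightarrow{t}E\xrightarrow{\rho}TM$ with $\rho\circ t=0$, an antisymmetric bracket on $\Gamma(E)$ with $[\psi_1,f\psi_2]=(\rho(\psi_1)f)\psi_2+f[\psi_1,\psi_2]$,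 an $E$-connection $\nabla$ on $V$ (that is, $\nabla_{f\psi}v=f\nabla_\psi v$ and $\nabla_\psi(fv)=(\rho(\psi)f)v+f\nabla_\psi v$), and $H\in\Gamma(\Lambda^3E^*\otimes V)$, such that for all sections $$t(\nabla_\psi v)=[\psi,t(v)],\qquad \nabla_{t(v)}w=-\nabla_{t(w)}v,\qquad [\psi_1,[\psi_2,\psi_3]]+\mathrm{cycl.}=t(H(\psi_1,\psi_2,\psi_3)),$$ $$[\nabla_{\psi_1},\nabla_{\psi_2}]v-\nabla_{[\psi_1,\psi_2]}v=H(\psi_1,\psi_2,t(v)),\qquad {}^E\!D H=0,$$ where, for a $V$-valued $E$-$p$-form $\omega$, $${}^E\!D\omega(\psi_0,\dots,\psi_p)=\sum_i(-1)^i\nabla_{\psi_i}\omega(\dots,\widehat{\psi_i},\dots)+\sum_{i<j}(-1)^{i+j}\omega([\psi_i,\psi_j],\dots,\widehat{\psi_i},\dots,\widehat{\psi_j},\dots).$$ For $B\in\Gamma(\Lambda^2E^*\otimes V)$, the **change by $B$** leaves $\rho$ and $t$ unmodified and is $$[\psi_1,\psi_2]\mapsto[\psi_1,\psi_2]+t(B(\psi_1,\psi_2)),\qquad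 \nabla_\psi v\mapsto\nabla_\psi v+B(\psi,t(v)),\qquad H\mapsto H+{}^E\!DB-C,$$ with $C(\psi_1,\psi_2,\psi_3)=B(t(B(\psi_1,\psi_2)),\psi_3)+\mathrm{cycl.}$ An **isomorphism** of Lie 2-algebroids $(E,V,L)\to(E',V',L')$ over a diffeomorphism $\varphi:M\to M'$ is a triple $(F,G,B)$ of vector bundle isomorphisms $F:E\to E'$, $G:V\to V'$ covering $\varphi$ and $B\in\Gamma(\Lambda^2E^*\otimes V)$ such that $(F,G)$ identifies the change of $L$ by $B$ with $L'$ (the anchors being intertwined by $d\varphi$). **Theorem.** A Q2-manifold is the same, up to isomorphism, as a semi-strict Lie 2-algebroid. In detail: 1. Every $E[1]\oplus V[2]$ is an N2-manifold, and every N2-manifold with $r$ coordinates of degree $1$ and $s$ coordinates of degree $2$ admits a splitting $\mathcal M\cong E[1]\oplus V[2]$ with $\operatorname{rk}E=r$, $\operatorname{rk}V=s$. 2. Let a splitting $\mathcal M\cong E[1]\oplus V[2]$ be given. Then the formulas $$Qf=\rho(\cdot)f,\quad (Q\alpha)(\psi_1,\psi_2)=\rho(\psi_1)\alpha(\psi_2)-\rho(\psi_2)\alpha(\psi_1)-\alpha([\psi_1,\psi_2]),\quad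 (Q\alpha)(v)=\alpha(t(v)),$$ $$(Q\beta)(\psi;v)=\rho(\psi)\beta(v)-\beta(\nabla_\psi v),\qquad (Q\beta)(\psi_1,\psi_2,\psi_3)=\beta(H(\psi_1,\psi_2,\psi_3))$$ for $f\in C^\infty(M)$, $\alpha\in\Gamma(E^*)$, $\beta\in\Gamma(V^*)$ define a bijection between the degree $+1$ derivations $Q$ with $Q^2=0$ and the Lie 2-algebroid structures on $(E,V)$. In particular every Lie 2-algebroid on $(E,V)$ comes from a unique $Q$ on $E[1]\oplus V[2]$. 3. Let $(\mathcal M,Q)$, $(\mathcal M',Q')$ be Q2-manifolds with splittings and corresponding Lie 2-algebroids $L$, $L'$, and let $\varphi:M\to M'$ be a diffeomorphism. The isomorphisms $(\mathcal M,Q)\to(\mathcal M',Q')$ covering $\varphi$ correspond bijectively to the isomorphisms $(F,G,B):L\to L'$ covering $\varphi$, the pullback of functions being $\alpha'\mapsto\alpha'\circ F$, $\beta'\mapsto\beta'\circ G+\beta'\circ G\circ B$ for $\alpha'\in\Gamma(E'^*)$, $\beta'\in\Gamma(V'^*)$. 4. Two splittings of $\mathcal M$ that induce the same identification of the underlying vector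 bundles with $E$ and $V$ differ by a unique $B\in\Gamma(\Lambda^2E^*\otimes V)$, meaning $\tilde\xi^a=\xi^a$, $\tilde b^D=b^D+\tfrac12B^D_{ab}\xi^a\xi^b$. Conversely, given one splitting, every $B$ arises from a unique second one. The Lie 2-algebroid of $Q$ in the new splitting is the change by $B$ of the one in the old splitting, and $[v,w]_V:=\nabla_{t(v)}w$ changes to $[v,w]_V+B(t(v),t(w))$. 5. In every Lie 2-algebroid, $[v,w]_V=\nabla_{t(v)}w$ is an antisymmetric $C^\infty(M)$-bilinear bracket on $\Gamma(V)$ satisfying $t([v,w]_V)=[t(v),t(w)]$, $$[v_1,[v_2,v_3]_V]_V+\mathrm{cycl.}=H(tv_1,tv_2,tv_3),\qquad \nabla_\psi[v,w]_V=[\nabla_\psi v,w]_V+[v,\nabla_\psi w]_V+H(\psi,tv,tw).$$ -/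

import Mathlib

open Bundle TopologicalSpace
open scoped Manifold ContDiff TensorProduct

universe u u' v v' w w' w₁ w₂ w₁' w₂'

noncomputable section

namespace QTwo

/-! ### Smooth vector bundles, sections, bundle maps, forms -/

/-- A real smooth (`C^∞`) vector bundle of finite rank over an `n`-dimensional smooth manifold. -/
structure SmoothVB (n : ℕ) (M : Type u) [TopologicalSpace M]
    [ChartedSpace (EuclideanSpace ℝ (Fin n)) M] where
  rank : ℕ
  fiber : M → Type w
  [addCommGroup : ∀ x, AddCommGroup (fiber x)]
  [module : ∀ x, Module ℝ (fiber x)]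
  [topFiber : ∀ x, TopologicalSpace (fiber x)]
  [topTotal : TopologicalSpace (TotalSpace (EuclideanSpace ℝ (Fin rank)) fiber)]
  [fiberBundle : FiberBundle (EuclideanSpace ℝ (Fin rank)) fiber]
  [vectorBundle : VectorBundle ℝ (EuclideanSpace ℝ (Fin rank)) fiber]
  [smoothBundle : ContMDiffVectorBundle ∞ (EuclideanSpace ℝ (Fin rank)) fiber (𝓡 n)]

attribute [instance] SmoothVB.addCommGroup SmoothVB.module SmoothVB.topFiber SmoothVB.topTotal
  SmoothVB.fiberBundle SmoothVB.vectorBundle SmoothVB.smoothBundle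

section Base

variable {n : ℕ} {M : Type u} [TopologicalSpace M] [ChartedSpace (EuclideanSpace ℝ (Fin n)) M]
  [IsManifold (𝓡 n) ∞ M]

set_option linter.unusedSectionVars false

/-- The `C^∞(M)`-module `Γ(E)` of global smooth sections. -/
abbrev Sec (E : SmoothVB.{u, w} n M) : Type (max u w) :=
  ContMDiffSection (𝓡 n) (EuclideanSpace ℝ (Fin E.rank)) ∞ E.fiber

/-- The algebra `C^∞(U)` of smooth real functions on an open set `U`. -/
abbrev SmoothFun (n : ℕ) {M : Type u} [TopologicalSpace M]
    [ChartedSpace (EuclideanSpace ℝ (Fin n)) M] (U : Opens M) : Type u :=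
  C^∞⟮𝓡 n, U; 𝓘(ℝ, ℝ), ℝ⟯

/-- The algebra `C^∞(M)`. -/
abbrev GlobalFun (n : ℕ) (M : Type u) [TopologicalSpace M]
    [ChartedSpace (EuclideanSpace ℝ (Fin n)) M] : Type u :=
  C^∞⟮𝓡 n, M; 𝓘(ℝ, ℝ), ℝ⟯

/-- The product `f ψ` of a smooth function and a section. -/
def smulSec {E : SmoothVB.{u, w} n M} (f : GlobalFun n M) (ψ : Sec E) : Sec E :=
  ⟨fun x => f x • ψ x, ContMDiff.smul_section f.contMDiff ψ.contMDiff⟩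

/-- The derivative `X f` of a real function at `x` along a tangent vector `X`. -/
def dirDeriv (f : M → ℝ) (x : M) (X : TangentSpace (𝓡 n) x) : ℝ :=
  mfderiv (𝓡 n) 𝓘(ℝ, ℝ) f x X

/-- A smooth bundle map `ρ : E → TM` over the identity. -/
@[ext] structure Anchor (E : SmoothVB.{u, w} n M) where
  map : ∀ x, E.fiber x →ₗ[ℝ] TangentSpace (𝓡 n) x
  smooth : ∀ ψ : Sec E, ContMDiff (𝓡 n) (𝓡 n).tangent ∞
    (fun x => (⟨x, map x (ψ x)⟩ : TangentBundle (𝓡 n) M))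

/-- A smooth vector bundle map `V → E` over the identity. -/
@[ext] structure BundleMap (V : SmoothVB.{u, w'} n M) (E : SmoothVB.{u, w} n M) where
  map : ∀ x, V.fiber x →ₗ[ℝ] E.fiber x
  smooth : ∀ v : Sec V, ContMDiff (𝓡 n) ((𝓡 n).prod 𝓘(ℝ, EuclideanSpace ℝ (Fin E.rank))) ∞
    (fun x => TotalSpace.mk' (EuclideanSpace ℝ (Fin E.rank)) x (map x (v x)))

/-- The action of a bundle map on sections. -/
def BundleMap.onSec {V : SmoothVB.{u, w'} n M} {E : SmoothVB.{u, w} n M} (t : BundleMap V E)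
    (v : Sec V) : Sec E :=
  ⟨fun x => t.map x (v x), t.smooth v⟩

/-- `V`-valued `E`-forms: smooth sections of `Λ^p E^* ⊗ V`. -/
@[ext] structure EForm (p : ℕ) (E : SmoothVB.{u, w} n M) (V : SmoothVB.{u, w'} n M) where
  form : ∀ x, E.fiber x [⋀^Fin p]→ₗ[ℝ] V.fiber x
  smooth : ∀ ψ : Fin p → Sec E,
    ContMDiff (𝓡 n) ((𝓡 n).prod 𝓘(ℝ, EuclideanSpace ℝ (Fin V.rank))) ∞
      (fun x => TotalSpace.mk' (EuclideanSpace ℝ (Fin V.rank)) x (form x (fun i => ψ i x)))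

/-- The section `η(ψ₁, …, ψ_p)` of `V`. -/
def EForm.onSec {p : ℕ} {E : SmoothVB.{u, w} n M} {V : SmoothVB.{u, w'} n M} (η : EForm p E V)
    (ψ : Fin p → Sec E) : Sec V :=
  ⟨fun x => η.form x (fun i => ψ i x), η.smooth ψ⟩

/-- Global smooth sections of the dual bundle `E^*`. -/
@[ext] structure DualSec (E : SmoothVB.{u, w} n M) where
  form : ∀ x, Module.Dual ℝ (E.fiber x)
  smooth : ∀ ψ : Sec E, ContMDiff (𝓡 n) 𝓘(ℝ, ℝ) ∞ (fun x => form x (ψ x))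

/-! ### Lie 2-algebroids -/

/-- The generalized Cartan formula for the exterior `E`-covariant derivative of `η`, evaluated on
sections `ψ₀, …, ψ_{p+1}` of `E`; it is used with the bracket of `E` and an `E`-connection. In the
double sum the pair `(i, j)` runs over `i < j`, and the arguments `ψ_i`, `ψ_j` are left out. -/
def extCovDeriv {E : SmoothVB.{u, w} n M} {V : SmoothVB.{u, w'} n M}
    (br : Sec E → Sec E → Sec E) (conn : Sec E → Sec V → Sec V) {p : ℕ}
    (η : EForm (p + 1) E V) (ψ : Fin (p + 2) → Sec E) : Sec V :=
  (∑ i : Fin (p + 2), (-1 : ℝ) ^ (i : ℕ) • conn (ψ i) (η.onSec fun k => ψ (i.succAbove k))) +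
  ∑ j : Fin (p + 2), ∑ i : Fin (p + 1), if i.castSucc < j then
    (-1 : ℝ) ^ ((i : ℕ) + (j : ℕ)) • η.onSec
      (Fin.cons (br (ψ i.castSucc) (ψ j)) fun k => ψ (j.succAbove (i.succAbove k)))
  else 0

/-- A (semi-strict) Lie 2-algebroid structure on a pair `(E, V)` of vector bundles. -/
@[ext] structure LieTwoAlgebroid (E : SmoothVB.{u, w} n M) (V : SmoothVB.{u, w'} n M) where
  /-- the anchor `ρ : E → TM` -/
  anchor : Anchor E
  /-- the bundle map `t : V → E` -/
  t : BundleMap V E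
  /-- the bracket on `Γ(E)` -/
  bracket : Sec E → Sec E → Sec E
  /-- the `E`-connection on `V` -/
  conn : Sec E → Sec V → Sec V
  /-- the `V`-valued `E`-3-form `H` -/
  H : EForm 3 E V
  anchor_t : ∀ x (v : V.fiber x), anchor.map x (t.map x v) = 0
  bracket_add : ∀ ψ₁ ψ₂ ψ₃, bracket ψ₁ (ψ₂ + ψ₃) = bracket ψ₁ ψ₂ + bracket ψ₁ ψ₃
  bracket_skew : ∀ ψ₁ ψ₂, bracket ψ₁ ψ₂ = - bracket ψ₂ ψ₁
  bracket_leibniz : ∀ ψ₁ (f : GlobalFun n M) ψ₂ x, bracket ψ₁ (smulSec f ψ₂) x =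
    dirDeriv f x (anchor.map x (ψ₁ x)) • ψ₂ x + f x • bracket ψ₁ ψ₂ x
  conn_add_left : ∀ ψ₁ ψ₂ v, conn (ψ₁ + ψ₂) v = conn ψ₁ v + conn ψ₂ v
  conn_smul_left : ∀ (f : GlobalFun n M) ψ v, conn (smulSec f ψ) v = smulSec f (conn ψ v)
  conn_add_right : ∀ ψ v₁ v₂, conn ψ (v₁ + v₂) = conn ψ v₁ + conn ψ v₂
  conn_leibniz : ∀ ψ (f : GlobalFun n M) v x, conn ψ (smulSec f v) x =
    dirDeriv f x (anchor.map x (ψ x)) • v x + f x • conn ψ v x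
  t_conn : ∀ ψ v, t.onSec (conn ψ v) = bracket ψ (t.onSec v)
  conn_t_skew : ∀ v₁ v₂, conn (t.onSec v₁) v₂ = - conn (t.onSec v₂) v₁
  jacobiator : ∀ ψ₁ ψ₂ ψ₃, bracket ψ₁ (bracket ψ₂ ψ₃) + bracket ψ₂ (bracket ψ₃ ψ₁) +
    bracket ψ₃ (bracket ψ₁ ψ₂) = t.onSec (H.onSec ![ψ₁, ψ₂, ψ₃])
  curvature : ∀ ψ₁ ψ₂ v, conn ψ₁ (conn ψ₂ v) - conn ψ₂ (conn ψ₁ v) - conn (bracket ψ₁ ψ₂) v =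
    H.onSec ![ψ₁, ψ₂, t.onSec v]
  closed : ∀ ψ : Fin 4 → Sec E, extCovDeriv bracket conn H ψ = 0

/-- The bracket `[v, w]_V = ∇_{t(v)} w` on `Γ(V)`. -/
def LieTwoAlgebroid.bracketV {E : SmoothVB.{u, w} n M} {V : SmoothVB.{u, w'} n M}
    (L : LieTwoAlgebroid E V) (v₁ v₂ : Sec V) : Sec V :=
  L.conn (L.t.onSec v₁) v₂

/-- The 3-form `C(ψ₁, ψ₂, ψ₃) = B(t(B(ψ₁, ψ₂)), ψ₃) + cycl.` -/
def cubicB {E : SmoothVB.{u, w} n M} {V : SmoothVB.{u, w'} n M} (t : BundleMap V E)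
    (B : EForm 2 E V) (ψ₁ ψ₂ ψ₃ : Sec E) : Sec V :=
  B.onSec ![t.onSec (B.onSec ![ψ₁, ψ₂]), ψ₃] + B.onSec ![t.onSec (B.onSec ![ψ₂, ψ₃]), ψ₁] +
    B.onSec ![t.onSec (B.onSec ![ψ₃, ψ₁]), ψ₂]

/-- `L'` arises from `L` by the change of splitting `B`. -/
structure IsChangeOfSplitting {E : SmoothVB.{u, w} n M} {V : SmoothVB.{u, w'} n M}
    (B : EForm 2 E V) (L L' : LieTwoAlgebroid E V) : Prop where
  anchor_eq : L'.anchor = L.anchor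
  t_eq : L'.t = L.t
  bracket_eq : ∀ ψ₁ ψ₂, L'.bracket ψ₁ ψ₂ = L.bracket ψ₁ ψ₂ + L.t.onSec (B.onSec ![ψ₁, ψ₂])
  conn_eq : ∀ ψ v, L'.conn ψ v = L.conn ψ v + B.onSec ![ψ, L.t.onSec v]
  H_eq : ∀ ψ₁ ψ₂ ψ₃, L'.H.onSec ![ψ₁, ψ₂, ψ₃] = L.H.onSec ![ψ₁, ψ₂, ψ₃] +
    extCovDeriv L.bracket L.conn B ![ψ₁, ψ₂, ψ₃] - cubicB L.t B ψ₁ ψ₂ ψ₃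
  bracketV_eq : ∀ v₁ v₂, L'.bracketV v₁ v₂ = L.bracketV v₁ v₂ +
    B.onSec ![L.t.onSec v₁, L.t.onSec v₂]

/-! ### Graded algebras in generators of degree one and two -/

/-- The graded-commutative algebra freely generated by `W₁` in degree one and `W₂` in degree two.
The second factor is even, so that the product is the one of the ordinary tensor product. -/
abbrev GrAlg (W₁ : Type v) (W₂ : Type v') [AddCommGroup W₁] [Module ℝ W₁] [AddCommGroup W₂]
    [Module ℝ W₂] : Type (max v v') :=
  ExteriorAlgebra ℝ W₁ ⊗[ℝ] SymmetricAlgebra ℝ W₂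

section GrAlg

variable (W₁ : Type v) (W₂ : Type v') [AddCommGroup W₁] [Module ℝ W₁] [AddCommGroup W₂]
  [Module ℝ W₂]

/-- The degree `k` part `⨁_{p + 2q = k} Λ^p W₁ ⊗ S^q W₂`. -/
def grDeg (k : ℕ) : Submodule ℝ (GrAlg W₁ W₂) :=
  ⨆ (p : ℕ) (q : ℕ) (_ : p + 2 * q = k), Submodule.map₂
    (TensorProduct.mk ℝ (ExteriorAlgebra ℝ W₁) (SymmetricAlgebra ℝ W₂))
    (⋀[ℝ]^p W₁) (LinearMap.range (SymmetricAlgebra.ι ℝ W₂) ^ q)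

variable {W₁ W₂}

/-- The inclusion of the degree one generators. -/
def ιOne (a : W₁) : GrAlg W₁ W₂ := ExteriorAlgebra.ι ℝ a ⊗ₜ[ℝ] 1

/-- The inclusion of the degree two generators. -/
def ιTwo (b : W₂) : GrAlg W₁ W₂ := 1 ⊗ₜ[ℝ] SymmetricAlgebra.ι ℝ W₂ b

end GrAlg

/-- For `E`, `V` vector spaces, an element of `Λ E^* ⊗ S V^*` is a polynomial function on `V` with
values in `Λ E^*`; this is its value at `v`. -/
def evalAt {E : Type v} {V : Type v'} [AddCommGroup E] [Module ℝ E] [AddCommGroup V] [Module ℝ V]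
    (v : V) : GrAlg (Module.Dual ℝ E) (Module.Dual ℝ V) →ₐ[ℝ] ExteriorAlgebra ℝ (Module.Dual ℝ E) :=
  (Algebra.TensorProduct.rid ℝ ℝ (ExteriorAlgebra ℝ (Module.Dual ℝ E))).toAlgHom.comp
    (Algebra.TensorProduct.map (AlgHom.id ℝ (ExteriorAlgebra ℝ (Module.Dual ℝ E)))
      (SymmetricAlgebra.lift (Module.Dual.eval ℝ V v)))

/-- The contraction of an element of `Λ E^*` with a vector of `E`. -/
def contract {E : Type v} [AddCommGroup E] [Module ℝ E] (e : E) :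
    ExteriorAlgebra ℝ (Module.Dual ℝ E) →ₗ[ℝ] ExteriorAlgebra ℝ (Module.Dual ℝ E) :=
  CliffordAlgebra.contractLeft (Q := (0 : QuadraticForm ℝ (Module.Dual ℝ E)))
    (Module.Dual.eval ℝ E e)

/-- The value `a(e₁, …, e_p; v)` of `a ∈ Λ E^* ⊗ S V^*`: the `Λ^p E^*`-component of the polynomial
function `a` at the point `v`, evaluated on the list of vectors `e₁, …, e_p`. -/
def evalGr {E : Type v} {V : Type v'} [AddCommGroup E] [Module ℝ E] [AddCommGroup V] [Module ℝ V]
    (a : GrAlg (Module.Dual ℝ E) (Module.Dual ℝ V)) (l : List E) (v : V) : ℝ :=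
  ExteriorAlgebra.algebraMapInv (l.foldl (fun b e => contract e b) (evalAt v a))

/-! ### N2-manifolds -/

/-- The data of a presheaf of `ℕ`-graded algebras over the structure sheaf `C^∞` of `M`. -/
structure GradedSpace (n : ℕ) (M : Type u) [TopologicalSpace M]
    [ChartedSpace (EuclideanSpace ℝ (Fin n)) M] where
  /-- the functions over the open set `U` -/
  A : Opens M → Type v
  [ring : ∀ U, Ring (A U)]
  [algebra : ∀ U, Algebra ℝ (A U)]
  /-- the functions of degree `k` over `U` -/
  deg : ∀ U, ℕ → Submodule ℝ (A U)
  /-- restriction to smaller open sets -/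
  res : ∀ {U W : Opens M}, W ≤ U → A U →ₐ[ℝ] A W
  /-- smooth functions on the body, as functions of the graded space -/
  base : ∀ U, SmoothFun n U →ₐ[ℝ] A U

attribute [instance] GradedSpace.ring GradedSpace.algebra

/-- The coordinate algebra `C^∞(W) ⊗ Λ[ξ¹, …, ξ^r] ⊗ ℝ[b¹, …, b^s]` over an open set `W`. -/
abbrev CoordAlg (n : ℕ) {M : Type u} [TopologicalSpace M]
    [ChartedSpace (EuclideanSpace ℝ (Fin n)) M] (r s : ℕ) (W : Opens M) : Type u :=
  SmoothFun n W ⊗[ℝ] GrAlg (Fin r → ℝ) (Fin s → ℝ)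

/-- The degree `k` part of the coordinate algebra. -/
def coordDeg (n : ℕ) {M : Type u} [TopologicalSpace M]
    [ChartedSpace (EuclideanSpace ℝ (Fin n)) M] (r s : ℕ) (W : Opens M) (k : ℕ) :
    Submodule ℝ (CoordAlg n r s W) :=
  Submodule.map₂ (TensorProduct.mk ℝ (SmoothFun n W) (GrAlg (Fin r → ℝ) (Fin s → ℝ))) ⊤
    (grDeg (Fin r → ℝ) (Fin s → ℝ) k)

/-- Restriction of smooth functions to a smaller open set. -/
def resFun {W' W : Opens M} (h : W' ≤ W) : SmoothFun n W →ₐ[ℝ] SmoothFun n W' :=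
  { ContMDiffMap.restrictRingHom (𝓡 n) 𝓘(ℝ, ℝ) ℝ h with commutes' := fun _ => rfl }

/-- Restriction of the coordinate algebra to a smaller open set. -/
def resCoord (r s : ℕ) {W' W : Opens M} (h : W' ≤ W) :
    CoordAlg n r s W →ₐ[ℝ] CoordAlg n r s W' :=
  Algebra.TensorProduct.map (resFun h) (AlgHom.id ℝ _)

/-- A graded coordinate system over an open set `U`: an isomorphism, over `U`, of sheaves of graded
`C^∞`-algebras with `C^∞ ⊗ Λ[ξ¹, …, ξ^r] ⊗ ℝ[b¹, …, b^s]`. -/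
structure GradedSpace.Coordinates (X : GradedSpace.{u, v} n M) (r s : ℕ) (U : Opens M) where
  equiv : ∀ W : Opens M, W ≤ U → CoordAlg n r s W ≃ₐ[ℝ] X.A W
  natural : ∀ (W W' : Opens M) (h : W ≤ U) (h' : W' ≤ W) (a : CoordAlg n r s W),
    X.res h' (equiv W h a) = equiv W' (h'.trans h) (resCoord r s h' a)
  map_deg : ∀ (W : Opens M) (h : W ≤ U) (k : ℕ) (a : CoordAlg n r s W),
    a ∈ coordDeg n r s W k ↔ equiv W h a ∈ X.deg W k
  map_base : ∀ (W : Opens M) (h : W ≤ U) (f : SmoothFun n W),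
    equiv W h (f ⊗ₜ[ℝ] 1) = X.base W f

/-- `X` is an N2-manifold with body `M` and with `r` coordinates of degree one and `s` coordinates
of degree two: a sheaf of `ℕ`-graded algebras (in each degree sections glue uniquely) which is
locally of the form `C^∞ ⊗ Λ[ξ¹, …, ξ^r] ⊗ ℝ[b¹, …, b^s]`. Graded commutativity and the
identification of the degree zero part with `C^∞` are consequences of the local form. -/
structure GradedSpace.IsNTwoManifold (X : GradedSpace.{u, v} n M) (r s : ℕ) : Prop where
  res_id : ∀ (U : Opens M) (a : X.A U), X.res (le_refl U) a = a
  res_comp : ∀ (U W W' : Opens M) (h : W ≤ U) (h' : W' ≤ W) (a : X.A U),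
    X.res h' (X.res h a) = X.res (h'.trans h) a
  res_deg : ∀ (U W : Opens M) (h : W ≤ U) (k : ℕ) (a : X.A U), a ∈ X.deg U k →
    X.res h a ∈ X.deg W k
  res_base : ∀ (U W : Opens M) (h : W ≤ U) (f : SmoothFun n U),
    X.res h (X.base U f) = X.base W (resFun h f)
  gradedMonoid : ∀ U, SetLike.GradedMonoid (X.deg U)
  internal : ∀ U, DirectSum.IsInternal (X.deg U)
  glue : ∀ (ι : Type u) (U : ι → Opens M) (k : ℕ)
    (a : ∀ i, X.A (U i)), (∀ i, a i ∈ X.deg (U i) k) →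
    (∀ i j, X.res (inf_le_left : U i ⊓ U j ≤ U i) (a i) =
      X.res (inf_le_right : U i ⊓ U j ≤ U j) (a j)) →
    ∃! b : X.A (iSup U), b ∈ X.deg (iSup U) k ∧ ∀ i, X.res (le_iSup U i) b = a i
  locallyTrivial : ∀ x : M, ∃ U : Opens M, x ∈ U ∧ Nonempty (X.Coordinates r s U)

/-- A homological vector field of degree `+1`: a degree `+1` derivation `Q` of the structure sheaf
with `Q² = 0`. -/
@[ext] structure HomologicalVF (X : GradedSpace.{u, v} n M) where
  app : ∀ U, X.A U →ₗ[ℝ] X.A U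
  natural : ∀ (U W : Opens M) (h : W ≤ U) (a : X.A U), X.res h (app U a) = app W (X.res h a)
  degree : ∀ U k (a : X.A U), a ∈ X.deg U k → app U a ∈ X.deg U (k + 1)
  leibniz : ∀ U k (a b : X.A U), a ∈ X.deg U k →
    app U (a * b) = app U a * b + (-1 : ℝ) ^ k • (a * app U b)
  square : ∀ U (a : X.A U), app U (app U a) = 0

/-! ### The split N2-manifold `E[1] ⊕ V[2]` -/

section Split

variable (E : SmoothVB.{u, w} n M) (V : SmoothVB.{u, w'} n M)

/-- The algebra `Λ E_x^* ⊗ S V_x^*`. -/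
abbrev FibAlg (x : M) : Type (max w w') :=
  GrAlg (Module.Dual ℝ (E.fiber x)) (Module.Dual ℝ (V.fiber x))

/-- The smooth functions on `W` and the smooth sections of `E^*` and of `V^*` over `W`. -/
def splitGens (W : Opens M) : Set (∀ x : W, FibAlg E V x) :=
  {g | ∃ f : SmoothFun n W, g = fun x : W => algebraMap ℝ (FibAlg E V x) (f x)} ∪
  {g | ∃ α : ∀ x : W, Module.Dual ℝ (E.fiber x),
    (∀ ψ : Sec E, ContMDiff (𝓡 n) 𝓘(ℝ, ℝ) ∞ (fun x : W => α x (ψ x))) ∧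
    g = fun x => ιOne (α x)} ∪
  {g | ∃ β : ∀ x : W, Module.Dual ℝ (V.fiber x),
    (∀ v : Sec V, ContMDiff (𝓡 n) 𝓘(ℝ, ℝ) ∞ (fun x : W => β x (v x))) ∧
    g = fun x => ιTwo (β x)}

/-- Smooth sections over `U` of the bundle of algebras `Λ E^* ⊗ S V^*`: locally they are polynomial
expressions in smooth functions and smooth sections of `E^*` and `V^*`. -/
def IsSmoothSplit (U : Opens M) (f : ∀ x : U, FibAlg E V x) : Prop :=
  ∀ x : U, ∃ (W : Opens M) (h : W ≤ U), x.1 ∈ W ∧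
    (fun y : W => f ⟨y.1, h y.2⟩) ∈ Algebra.adjoin ℝ (splitGens E V W)

/-- The functions on `E[1] ⊕ V[2]` over `U`: finite sums of homogeneous smooth sections of
`Λ E^* ⊗ S V^*`. -/
def splitAlg (U : Opens M) : Subalgebra ℝ (∀ x : U, FibAlg E V x) :=
  Algebra.adjoin ℝ {f | IsSmoothSplit E V U f ∧ ∃ k, ∀ x, f x ∈ grDeg _ _ k}

variable {E V}

theorem one_mem_grDeg {W₁ : Type v} {W₂ : Type v'} [AddCommGroup W₁] [Module ℝ W₁]
    [AddCommGroup W₂] [Module ℝ W₂] (c : ℝ) :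
    algebraMap ℝ (GrAlg W₁ W₂) c ∈ grDeg W₁ W₂ 0 := by
  have h : (c • (1 : ExteriorAlgebra ℝ W₁)) ⊗ₜ[ℝ] (1 : SymmetricAlgebra ℝ W₂) ∈
      Submodule.map₂ (TensorProduct.mk ℝ (ExteriorAlgebra ℝ W₁) (SymmetricAlgebra ℝ W₂))
        (⋀[ℝ]^0 W₁) (LinearMap.range (SymmetricAlgebra.ι ℝ W₂) ^ 0) := by
    refine Submodule.apply_mem_map₂ _ (Submodule.smul_mem _ _ ?_) ?_
    · simp
    · simp
  have h2 := Submodule.mem_iSup_of_mem (p := fun p => ⨆ (q : ℕ) (_ : p + 2 * q = 0),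
    Submodule.map₂ (TensorProduct.mk ℝ (ExteriorAlgebra ℝ W₁) (SymmetricAlgebra ℝ W₂))
      (⋀[ℝ]^p W₁) (LinearMap.range (SymmetricAlgebra.ι ℝ W₂) ^ q)) 0
    (Submodule.mem_iSup_of_mem 0 (Submodule.mem_iSup_of_mem (by simp) h))
  have e : algebraMap ℝ (GrAlg W₁ W₂) c =
      (c • (1 : ExteriorAlgebra ℝ W₁)) ⊗ₜ[ℝ] (1 : SymmetricAlgebra ℝ W₂) := by
    rw [Algebra.algebraMap_eq_smul_one, Algebra.TensorProduct.one_def, TensorProduct.smul_tmul']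
  rw [e]
  exact h2

theorem ιOne_mem_grDeg {W₁ : Type v} {W₂ : Type v'} [AddCommGroup W₁] [Module ℝ W₁]
    [AddCommGroup W₂] [Module ℝ W₂] (a : W₁) :
    (ιOne a : GrAlg W₁ W₂) ∈ grDeg W₁ W₂ 1 := by
  refine Submodule.mem_iSup_of_mem 1 (Submodule.mem_iSup_of_mem 0
    (Submodule.mem_iSup_of_mem (by simp) ?_))
  refine Submodule.apply_mem_map₂ _ ?_ ?_
  · simp
  · simp

theorem ιTwo_mem_grDeg {W₁ : Type v} {W₂ : Type v'} [AddCommGroup W₁] [Module ℝ W₁]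
    [AddCommGroup W₂] [Module ℝ W₂] (b : W₂) :
    (ιTwo b : GrAlg W₁ W₂) ∈ grDeg W₁ W₂ 2 := by
  refine Submodule.mem_iSup_of_mem 0 (Submodule.mem_iSup_of_mem 1
    (Submodule.mem_iSup_of_mem (by simp) ?_))
  refine Submodule.apply_mem_map₂ _ ?_ ?_
  · simp
  · simp

theorem mem_splitAlg {U : Opens M} {f : ∀ x : U, FibAlg E V x} (k : ℕ)
    (hf : ∀ x, f x ∈ grDeg _ _ k) (hg : f ∈ splitGens E V U) : f ∈ splitAlg E V U :=
  Algebra.subset_adjoin ⟨fun x => ⟨U, le_rfl, x.2, Algebra.subset_adjoin hg⟩, k, hf⟩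

variable (E V)

/-- Restriction of (not necessarily smooth) sections of `Λ E^* ⊗ S V^*`. -/
def resPi {U W : Opens M} (h : W ≤ U) : (∀ x : U, FibAlg E V x) →ₐ[ℝ] (∀ x : W, FibAlg E V x) where
  toFun f := fun x => f ⟨x.1, h x.2⟩
  map_one' := rfl
  map_mul' _ _ := rfl
  map_zero' := rfl
  map_add' _ _ := rfl
  commutes' _ := rfl

theorem resPi_gens {U W : Opens M} (h : W ≤ U) {g : ∀ x : U, FibAlg E V x}
    (hg : g ∈ splitGens E V U) : resPi E V h g ∈ splitGens E V W := by
  rcases hg with (⟨f, rfl⟩ | ⟨α, hα, rfl⟩) | ⟨β, hβ, rfl⟩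
  · exact Or.inl (Or.inl ⟨resFun h f, rfl⟩)
  · exact Or.inl (Or.inr ⟨fun x => α ⟨x.1, h x.2⟩,
      fun ψ => (hα ψ).comp (contMDiff_inclusion h), rfl⟩)
  · exact Or.inr ⟨fun x => β ⟨x.1, h x.2⟩,
      fun ψ => (hβ ψ).comp (contMDiff_inclusion h), rfl⟩

theorem resPi_adjoin {U W : Opens M} (h : W ≤ U) {g : ∀ x : U, FibAlg E V x}
    (hg : g ∈ Algebra.adjoin ℝ (splitGens E V U)) :
    resPi E V h g ∈ Algebra.adjoin ℝ (splitGens E V W) := by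
  have : Algebra.adjoin ℝ (splitGens E V U) ≤
      (Algebra.adjoin ℝ (splitGens E V W)).comap (resPi E V h) :=
    Algebra.adjoin_le fun g hg => Algebra.subset_adjoin (resPi_gens E V h hg)
  exact this hg

theorem resPi_smooth {U W : Opens M} (h : W ≤ U) {f : ∀ x : U, FibAlg E V x}
    (hf : IsSmoothSplit E V U f) : IsSmoothSplit E V W (resPi E V h f) := by
  intro x
  obtain ⟨W', h', hx, hm⟩ := hf ⟨x.1, h x.2⟩
  exact ⟨W' ⊓ W, inf_le_right, ⟨hx, x.2⟩, resPi_adjoin E V (inf_le_left : W' ⊓ W ≤ W') hm⟩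

theorem resPi_mem {U W : Opens M} (h : W ≤ U) {f : ∀ x : U, FibAlg E V x}
    (hf : f ∈ splitAlg E V U) : resPi E V h f ∈ splitAlg E V W := by
  have : splitAlg E V U ≤ (splitAlg E V W).comap (resPi E V h) :=
    Algebra.adjoin_le fun g hg => Algebra.subset_adjoin
      ⟨resPi_smooth E V h hg.1, hg.2.choose, fun x => hg.2.choose_spec ⟨x.1, h x.2⟩⟩
  exact this hf

/-- The functions of degree `k` on `E[1] ⊕ V[2]`. -/
def splitDeg (U : Opens M) (k : ℕ) : Submodule ℝ (splitAlg E V U) where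
  carrier := {f | ∀ x, f.1 x ∈ grDeg _ _ k}
  add_mem' := fun ha hb x => Submodule.add_mem _ (ha x) (hb x)
  zero_mem' := fun _ => Submodule.zero_mem _
  smul_mem' := fun c _ ha x => Submodule.smul_mem _ c (ha x)

/-- Smooth functions on `U`, as sections of `Λ^0 E^* ⊗ S^0 V^*`. -/
def basePi (U : Opens M) : SmoothFun n U →ₐ[ℝ] (∀ x : U, FibAlg E V x) where
  toFun f := fun x => algebraMap ℝ (FibAlg E V x) (f x)
  map_one' := funext fun x => map_one (algebraMap ℝ (FibAlg E V x))
  map_mul' f g := funext fun x => map_mul (algebraMap ℝ (FibAlg E V x)) (f x) (g x)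
  map_zero' := funext fun x => map_zero (algebraMap ℝ (FibAlg E V x))
  map_add' f g := funext fun x => map_add (algebraMap ℝ (FibAlg E V x)) (f x) (g x)
  commutes' _ := rfl

/-- The split graded manifold `E[1] ⊕ V[2]`. -/
def splitSpace : GradedSpace.{u, max u w w'} n M where
  A U := splitAlg E V U
  deg U k := splitDeg E V U k
  res h := ((resPi E V h).comp (splitAlg E V _).val).codRestrict (splitAlg E V _)
    fun f => resPi_mem E V h f.2
  base U := (basePi E V U).codRestrict (splitAlg E V U)
    fun f => mem_splitAlg 0 (fun x => one_mem_grDeg (f x)) (Or.inl (Or.inl ⟨f, rfl⟩))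

/-- The value at `x` of a global function on `E[1] ⊕ V[2]`. -/
def splitVal {E : SmoothVB.{u, w} n M} {V : SmoothVB.{u, w'} n M} (a : (splitSpace E V).A ⊤) (x : M) : FibAlg E V x := a.1 ⟨x, trivial⟩

/-- A smooth function on `M`, as a function of degree zero on `E[1] ⊕ V[2]`. -/
def ofFun (f : GlobalFun n M) : (splitSpace E V).A ⊤ :=
  ⟨fun x => algebraMap ℝ (FibAlg E V x) (f x),
    mem_splitAlg 0 (fun x => one_mem_grDeg (f x)) (Or.inl (Or.inl
      ⟨⟨fun x => f x, f.contMDiff.comp contMDiff_subtype_val⟩, rfl⟩))⟩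

/-- A section of `E^*`, as a function of degree one on `E[1] ⊕ V[2]`. -/
def ofDualE (α : DualSec E) : (splitSpace E V).A ⊤ :=
  ⟨fun x => ιOne (α.form x), mem_splitAlg 1 (fun x => ιOne_mem_grDeg (α.form x)) (Or.inl (Or.inr
    ⟨fun x => α.form x, fun ψ => (α.smooth ψ).comp contMDiff_subtype_val, rfl⟩))⟩

/-- A section of `V^*`, as a function of degree two on `E[1] ⊕ V[2]`. -/
def ofDualV (β : DualSec V) : (splitSpace E V).A ⊤ :=
  ⟨fun x => ιTwo (β.form x), mem_splitAlg 2 (fun x => ιTwo_mem_grDeg (β.form x)) (Or.inr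
    ⟨fun x => β.form x, fun v => (β.smooth v).comp contMDiff_subtype_val, rfl⟩)⟩

end Split

/-! ### Splittings and the data extracted from a homological vector field -/

/-- A splitting of `X`: an isomorphism `X ≅ E[1] ⊕ V[2]` of graded manifolds over the identity
of `M`, given by its action on functions. -/
@[ext] structure Splitting (X : GradedSpace.{u, v} n M) (E : SmoothVB.{u, w} n M)
    (V : SmoothVB.{u, w'} n M) where
  equiv : ∀ U, X.A U ≃ₐ[ℝ] (splitSpace E V).A U
  natural : ∀ (U W : Opens M) (h : W ≤ U) (a : X.A U),
    (splitSpace E V).res h (equiv U a) = equiv W (X.res h a)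
  map_deg : ∀ U k (a : X.A U), a ∈ X.deg U k ↔ equiv U a ∈ (splitSpace E V).deg U k
  map_base : ∀ U (f : SmoothFun n U), equiv U (X.base U f) = (splitSpace E V).base U f

/-- The tautological splitting of `E[1] ⊕ V[2]`. -/
def Splitting.refl (E : SmoothVB.{u, w} n M) (V : SmoothVB.{u, w'} n M) :
    Splitting (splitSpace E V) E V where
  equiv _ := AlgEquiv.refl
  natural _ _ _ _ := rfl
  map_deg _ _ _ := Iff.rfl
  map_base _ _ := rfl

/-- The value `(Q a)(e₁, …, e_p; v)` at `x`, where the vector field `Q` on `X` is transported to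
`E[1] ⊕ V[2]` by a splitting and `a` is a global function on `E[1] ⊕ V[2]`. -/
def qVal {X : GradedSpace.{u, v} n M} {E : SmoothVB.{u, w} n M} {V : SmoothVB.{u, w'} n M}
    (σ : Splitting X E V) (Q : HomologicalVF X) (a : (splitSpace E V).A ⊤) (x : M)
    (l : List (E.fiber x)) (v : V.fiber x) : ℝ :=
  evalGr (splitVal (σ.equiv ⊤ (Q.app ⊤ ((σ.equiv ⊤).symm a))) x) l v

/-- `L` consists of the coefficients of `Q` with respect to the splitting `σ`. In a local frame,
with coordinates `x^i`, `ξ^a`, `b^D`, this says that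
`Q = ρ^i_a ξ^a ∂/∂x^i - ½ C^a_{bc} ξ^b ξ^c ∂/∂ξ^a + t^a_D b^D ∂/∂ξ^a - Γ^D_{aC} ξ^a b^C ∂/∂b^D
+ ⅙ H^D_{abc} ξ^a ξ^b ξ^c ∂/∂b^D`. -/
structure IsData {X : GradedSpace.{u, v} n M} {E : SmoothVB.{u, w} n M}
    {V : SmoothVB.{u, w'} n M} (σ : Splitting X E V) (Q : HomologicalVF X)
    (L : LieTwoAlgebroid E V) : Prop where
  on_fun : ∀ (f : GlobalFun n M) x (e : E.fiber x) (v : V.fiber x),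
    qVal σ Q (ofFun E V f) x [e] v = dirDeriv f x (L.anchor.map x e)
  on_dualE_two : ∀ (α : DualSec E) (ψ₁ ψ₂ : Sec E) x (v : V.fiber x),
    qVal σ Q (ofDualE E V α) x [ψ₁ x, ψ₂ x] v =
      dirDeriv (fun y => α.form y (ψ₂ y)) x (L.anchor.map x (ψ₁ x)) -
      dirDeriv (fun y => α.form y (ψ₁ y)) x (L.anchor.map x (ψ₂ x)) -
      α.form x (L.bracket ψ₁ ψ₂ x)
  on_dualE_zero : ∀ (α : DualSec E) x (v : V.fiber x),
    qVal σ Q (ofDualE E V α) x [] v = α.form x (L.t.map x v)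
  on_dualV_one : ∀ (β : DualSec V) (ψ : Sec E) (v : Sec V) x,
    qVal σ Q (ofDualV E V β) x [ψ x] (v x) =
      dirDeriv (fun y => β.form y (v y)) x (L.anchor.map x (ψ x)) - β.form x (L.conn ψ v x)
  on_dualV_three : ∀ (β : DualSec V) x (e₁ e₂ e₃ : E.fiber x) (v : V.fiber x),
    qVal σ Q (ofDualV E V β) x [e₁, e₂, e₃] v = β.form x (L.H.form x ![e₁, e₂, e₃])

/-- The expression of a function `a` of the splitting `σ'` in terms of the splitting `σ`, evaluated
at `x`. -/
def changeVal {X : GradedSpace.{u, v} n M} {E : SmoothVB.{u, w} n M} {V : SmoothVB.{u, w'} n M}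
    (σ σ' : Splitting X E V) (a : (splitSpace E V).A ⊤) (x : M)
    (l : List (E.fiber x)) (v : V.fiber x) : ℝ :=
  evalGr (splitVal (σ.equiv ⊤ ((σ'.equiv ⊤).symm a)) x) l v

/-- Two splittings induce the same identification of the vector bundles of `X` with `E` and `V`:
`ξ̃^a = ξ^a` and `b̃^D = b^D` modulo products of functions of degree one. -/
structure SameBundles {X : GradedSpace.{u, v} n M} {E : SmoothVB.{u, w} n M}
    {V : SmoothVB.{u, w'} n M} (σ σ' : Splitting X E V) : Prop where
  on_dualE : ∀ (α : DualSec E) x (e : E.fiber x) (v : V.fiber x),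
    changeVal σ σ' (ofDualE E V α) x [e] v = α.form x e
  on_dualV : ∀ (β : DualSec V) x (v : V.fiber x),
    changeVal σ σ' (ofDualV E V β) x [] v = β.form x v

/-- The splittings `σ'` and `σ` differ by `B`: `ξ̃^a = ξ^a` and `b̃^D = b^D + ½ B^D_{ab} ξ^a ξ^b`. -/
structure DifferBy {X : GradedSpace.{u, v} n M} {E : SmoothVB.{u, w} n M}
    {V : SmoothVB.{u, w'} n M} (B : EForm 2 E V) (σ σ' : Splitting X E V) : Prop
    extends SameBundles σ σ' where
  on_dualV_two : ∀ (β : DualSec V) x (e₁ e₂ : E.fiber x) (v : V.fiber x),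
    changeVal σ σ' (ofDualV E V β) x [e₁, e₂] v = β.form x (B.form x ![e₁, e₂])

end Base

/-! ### Isomorphisms covering a diffeomorphism of the bases -/

section Iso

variable {n : ℕ} {M : Type u} [TopologicalSpace M] [ChartedSpace (EuclideanSpace ℝ (Fin n)) M]
  [IsManifold (𝓡 n) ∞ M]
variable {n' : ℕ} {M' : Type u'} [TopologicalSpace M']
  [ChartedSpace (EuclideanSpace ℝ (Fin n')) M'] [IsManifold (𝓡 n') ∞ M']

set_option linter.unusedSectionVars false

/-- The preimage of an open set under a diffeomorphism. -/
def preim (φ : M ≃ₘ⟮𝓡 n, 𝓡 n'⟯ M') (U : Opens M') : Opens M :=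
  ⟨φ ⁻¹' U, U.isOpen.preimage φ.continuous⟩

theorem preim_mono (φ : M ≃ₘ⟮𝓡 n, 𝓡 n'⟯ M') {U W : Opens M'} (h : W ≤ U) :
    preim φ W ≤ preim φ U := fun _ hx => h hx

/-- An isomorphism of Q2-manifolds `(X, Q) → (X', Q')` covering the diffeomorphism `φ` of the
bodies, given by the pullback of functions. -/
@[ext] structure QIso (φ : M ≃ₘ⟮𝓡 n, 𝓡 n'⟯ M') {X : GradedSpace.{u, v} n M}
    (Q : HomologicalVF X) {X' : GradedSpace.{u', v'} n' M'} (Q' : HomologicalVF X') where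
  pull : ∀ U : Opens M', X'.A U ≃ₐ[ℝ] X.A (preim φ U)
  natural : ∀ (U W : Opens M') (h : W ≤ U) (a : X'.A U),
    X.res (preim_mono φ h) (pull U a) = pull W (X'.res h a)
  map_deg : ∀ U k (a : X'.A U), a ∈ X'.deg U k ↔ pull U a ∈ X.deg (preim φ U) k
  map_base : ∀ (U : Opens M') (f' : SmoothFun n' U) (f : SmoothFun n (preim φ U)),
    (∀ x : preim φ U, f x = f' ⟨φ x.1, x.2⟩) → pull U (X'.base U f') = X.base (preim φ U) f
  intertwines : ∀ U (a : X'.A U), Q.app (preim φ U) (pull U a) = pull U (Q'.app U a)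

/-- The section `ψ'` of `E'` is the image of the section `ψ` of `E` under the fibrewise maps `F`
covering `φ`. -/
def Related (φ : M ≃ₘ⟮𝓡 n, 𝓡 n'⟯ M') {E : SmoothVB.{u, w} n M} {E' : SmoothVB.{u', w'} n' M'}
    (F : ∀ x, E.fiber x ≃ₗ[ℝ] E'.fiber (φ x)) (ψ : Sec E) (ψ' : Sec E') : Prop :=
  ∀ x, ψ' (φ x) = F x (ψ x)

/-- An isomorphism of Lie 2-algebroids `L → L'` covering the diffeomorphism `φ`: isomorphisms of
vector bundles `F : E → E'`, `G : V → V'` covering `φ`, together with a `B ∈ Γ(Λ² E^* ⊗ V)`, such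
that `F` and `G` identify the structure obtained from `L` by the change of splitting `B`
with `L'`. -/
@[ext] structure LieTwoIso (φ : M ≃ₘ⟮𝓡 n, 𝓡 n'⟯ M')
    {E : SmoothVB.{u, w₁} n M} {V : SmoothVB.{u, w₂} n M} (L : LieTwoAlgebroid E V)
    {E' : SmoothVB.{u', w₁'} n' M'} {V' : SmoothVB.{u', w₂'} n' M'}
    (L' : LieTwoAlgebroid E' V') where
  F : ∀ x, E.fiber x ≃ₗ[ℝ] E'.fiber (φ x)
  G : ∀ x, V.fiber x ≃ₗ[ℝ] V'.fiber (φ x)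
  B : EForm 2 E V
  F_smooth : ∀ ψ : Sec E, ∃ ψ' : Sec E', Related φ F ψ ψ'
  G_smooth : ∀ v : Sec V, ∃ v' : Sec V', Related φ G v v'
  anchor_comm : ∀ x (e : E.fiber x),
    L'.anchor.map (φ x) (F x e) = mfderiv (𝓡 n) (𝓡 n') φ x (L.anchor.map x e)
  t_comm : ∀ x (v : V.fiber x), L'.t.map (φ x) (G x v) = F x (L.t.map x v)
  bracket_comm : ∀ ψ₁ ψ₂ ψ₁' ψ₂', Related φ F ψ₁ ψ₁' → Related φ F ψ₂ ψ₂' →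
    Related φ F (L.bracket ψ₁ ψ₂ + L.t.onSec (B.onSec ![ψ₁, ψ₂])) (L'.bracket ψ₁' ψ₂')
  conn_comm : ∀ ψ v ψ' v', Related φ F ψ ψ' → Related φ G v v' →
    Related φ G (L.conn ψ v + B.onSec ![ψ, L.t.onSec v]) (L'.conn ψ' v')
  H_comm : ∀ ψ₁ ψ₂ ψ₃ ψ₁' ψ₂' ψ₃', Related φ F ψ₁ ψ₁' → Related φ F ψ₂ ψ₂' →
    Related φ F ψ₃ ψ₃' → Related φ G
      (L.H.onSec ![ψ₁, ψ₂, ψ₃] + extCovDeriv L.bracket L.conn B ![ψ₁, ψ₂, ψ₃] -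
        cubicB L.t B ψ₁ ψ₂ ψ₃)
      (L'.H.onSec ![ψ₁', ψ₂', ψ₃'])

/-- The pullback along the isomorphism `Φ` of a global function `a` on `E'[1] ⊕ V'[2]`, transported
to `E[1] ⊕ V[2]` by the splittings and evaluated at `x`. -/
def pullVal {φ : M ≃ₘ⟮𝓡 n, 𝓡 n'⟯ M'}
    {X : GradedSpace.{u, v} n M} {Q : HomologicalVF X}
    {X' : GradedSpace.{u', v'} n' M'} {Q' : HomologicalVF X'}
    {E : SmoothVB.{u, w₁} n M} {V : SmoothVB.{u, w₂} n M} (σ : Splitting X E V)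
    {E' : SmoothVB.{u', w₁'} n' M'} {V' : SmoothVB.{u', w₂'} n' M'} (σ' : Splitting X' E' V')
    (Φ : QIso φ Q Q') (a : (splitSpace E' V').A ⊤) (x : M) (l : List (E.fiber x)) (v : V.fiber x) : ℝ :=
  evalGr ((σ.equiv (preim φ ⊤) (Φ.pull ⊤ ((σ'.equiv ⊤).symm a))).1 ⟨x, trivial⟩) l v

/-- The isomorphism `Φ` of Q2-manifolds is the one given, in the splittings `σ`, `σ'`, by the
isomorphism `g = (F, G, B)` of Lie 2-algebroids:
`ξ̃^a = F^a_b ξ^b` and `b̃^D = G^D_C (b^C + ½ B^C_{ab} ξ^a ξ^b)`. -/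
structure Induces {φ : M ≃ₘ⟮𝓡 n, 𝓡 n'⟯ M'}
    {X : GradedSpace.{u, v} n M} {Q : HomologicalVF X}
    {X' : GradedSpace.{u', v'} n' M'} {Q' : HomologicalVF X'}
    {E : SmoothVB.{u, w₁} n M} {V : SmoothVB.{u, w₂} n M} (σ : Splitting X E V)
    {E' : SmoothVB.{u', w₁'} n' M'} {V' : SmoothVB.{u', w₂'} n' M'} (σ' : Splitting X' E' V')
    {L : LieTwoAlgebroid E V} {L' : LieTwoAlgebroid E' V'}
    (g : LieTwoIso φ L L') (Φ : QIso φ Q Q') : Prop where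
  on_dualE : ∀ (α : DualSec E') x (e : E.fiber x) (v : V.fiber x),
    pullVal σ σ' Φ (ofDualE E' V' α) x [e] v = α.form (φ x) (g.F x e)
  on_dualV_zero : ∀ (β : DualSec V') x (v : V.fiber x),
    pullVal σ σ' Φ (ofDualV E' V' β) x [] v = β.form (φ x) (g.G x v)
  on_dualV_two : ∀ (β : DualSec V') x (e₁ e₂ : E.fiber x) (v : V.fiber x),
    pullVal σ σ' Φ (ofDualV E' V' β) x [e₁, e₂] v = β.form (φ x) (g.G x (g.B.form x ![e₁, e₂]))

end Iso

end QTwo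

end

noncomputable section

namespace QTwo

open Module (Dual)

/-- Functions on the graded vector space `E[1] ⊕ V[2]`. -/
abbrev DualGrAlg (E : Type v) (V : Type v') [AddCommGroup E] [Module ℝ E] [AddCommGroup V]
    [Module ℝ V] := GrAlg (Dual ℝ E) (Dual ℝ V)

/-- The graded algebra with `r` generators of degree one and `s` generators of degree two. -/
abbrev FinGrAlg (r s : ℕ) := GrAlg (Fin r → ℝ) (Fin s → ℝ)

section GradedAlgebra

variable {W1 : Type v} {W2 : Type v'} [AddCommGroup W1] [Module ℝ W1] [AddCommGroup W2]
  [Module ℝ W2]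

instance : Module ℝ (ExteriorAlgebra ℝ W1) := inferInstance
instance : Module ℝ (SymmetricAlgebra ℝ W2) := inferInstance
instance : Algebra ℝ (SymmetricAlgebra ℝ W2) := inferInstance
instance : DistribMulAction ℝ (SymmetricAlgebra ℝ W2) := inferInstance
instance : IsScalarTower ℝ (SymmetricAlgebra ℝ W2) (SymmetricAlgebra ℝ W2) := inferInstance
instance : Ring (GrAlg W1 W2) := inferInstance
instance : Semiring (GrAlg W1 W2) := inferInstance
instance : Algebra ℝ (GrAlg W1 W2) := inferInstance
instance : AddCommMonoid (GrAlg W1 W2) := inferInstance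
instance : Module ℝ (GrAlg W1 W2) := inferInstance
instance : Mul (GrAlg W1 W2) := inferInstance
instance : Semigroup (GrAlg W1 W2) := inferInstance
instance : DistribMulAction ℝ (GrAlg W1 W2) := inferInstance
instance : AddCommGroup (GrAlg W1 W2) := inferInstance

lemma tmul_eq_mul (a : ExteriorAlgebra ℝ W1) (s : SymmetricAlgebra ℝ W2) :
    (a ⊗ₜ[ℝ] s : GrAlg W1 W2) = (a ⊗ₜ[ℝ] 1) * (1 ⊗ₜ[ℝ] s) := by
  simp [Algebra.TensorProduct.tmul_mul_tmul]

lemma ιOne_mul_tmul (w : W1) (a : ExteriorAlgebra ℝ W1) (s : SymmetricAlgebra ℝ W2) :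
    ιOne w * (a ⊗ₜ[ℝ] s : GrAlg W1 W2) = (ExteriorAlgebra.ι ℝ w * a) ⊗ₜ[ℝ] s := by
  simp [ιOne, Algebra.TensorProduct.tmul_mul_tmul]

lemma ιTwo_mul_tmul (w : W2) (a : ExteriorAlgebra ℝ W1) (s : SymmetricAlgebra ℝ W2) :
    ιTwo w * (a ⊗ₜ[ℝ] s : GrAlg W1 W2) = a ⊗ₜ[ℝ] (SymmetricAlgebra.ι ℝ W2 w * s) := by
  simp [ιTwo, Algebra.TensorProduct.tmul_mul_tmul]

lemma grAlg_induction {P : GrAlg W1 W2 → Prop} (one : P 1)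
    (add : ∀ a b, P a → P b → P (a + b)) (smul : ∀ (c : ℝ) a, P a → P (c • a))
    (mul_one : ∀ w a, P a → P (ιOne w * a)) (mul_two : ∀ w a, P a → P (ιTwo w * a))
    (a : GrAlg W1 W2) : P a := by
  let S : Subalgebra ℝ (GrAlg W1 W2) :=
    { carrier := {x | ∀ a, P a → P (x * a)}
      mul_mem' := fun hx hy a ha => by rw [mul_assoc]; exact hx _ (hy _ ha)
      add_mem' := fun hx hy a ha => by rw [add_mul]; exact add _ _ (hx _ ha) (hy _ ha)
      algebraMap_mem' := fun r a ha => by rw [← Algebra.smul_def]; exact smul r a ha }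
  have hS : ∀ s, (1 ⊗ₜ[ℝ] s : GrAlg W1 W2) ∈ S := fun s => by
    change s ∈ S.comap Algebra.TensorProduct.includeRight
    induction s using SymmetricAlgebra.induction with
    | algebraMap r => exact Subalgebra.algebraMap_mem _ r
    | ι x => exact mul_two x
    | mul x y hx hy => exact mul_mem hx hy
    | add x y hx hy => exact add_mem hx hy
  have hE : ∀ s, (s ⊗ₜ[ℝ] 1 : GrAlg W1 W2) ∈ S := fun s => by
    change s ∈ S.comap Algebra.TensorProduct.includeLeft
    induction s using ExteriorAlgebra.induction with
    | algebraMap r => exact Subalgebra.algebraMap_mem _ r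
    | ι x => exact mul_one x
    | mul x y hx hy => exact mul_mem hx hy
    | add x y hx hy => exact add_mem hx hy
  induction a using TensorProduct.induction_on with
  | zero => simpa using smul 0 1 one
  | tmul x y =>
    rw [tmul_eq_mul, ← _root_.mul_one (1 ⊗ₜ[ℝ] y)]
    exact hE _ _ (hS _ _ one)
  | add x y hx hy => exact add _ _ hx hy

lemma tmul_mem_grDeg {p q k : ℕ} (h : p + 2 * q = k) {a : ExteriorAlgebra ℝ W1}
    (ha : a ∈ ⋀[ℝ]^p W1) {s : SymmetricAlgebra ℝ W2}
    (hs : s ∈ LinearMap.range (SymmetricAlgebra.ι ℝ W2) ^ q) :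
    (a ⊗ₜ[ℝ] s : GrAlg W1 W2) ∈ grDeg W1 W2 k :=
  Submodule.mem_iSup_of_mem p (Submodule.mem_iSup_of_mem q
    (Submodule.mem_iSup_of_mem h (Submodule.apply_mem_map₂ _ ha hs)))

lemma grDeg_le {k : ℕ} {S : Submodule ℝ (GrAlg W1 W2)}
    (h : ∀ p q, p + 2 * q = k → ∀ a ∈ ⋀[ℝ]^p W1,
      ∀ s ∈ LinearMap.range (SymmetricAlgebra.ι ℝ W2) ^ q, (a ⊗ₜ[ℝ] s : GrAlg W1 W2) ∈ S) :
    grDeg W1 W2 k ≤ S :=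
  iSup_le fun p => iSup_le fun q => iSup_le fun hpq =>
    Submodule.map₂_le.2 fun a ha s hs => h p q hpq a ha s hs

lemma ιOne_mul_mem {k : ℕ} (w : W1) {a : GrAlg W1 W2} (ha : a ∈ grDeg W1 W2 k) :
    ιOne w * a ∈ grDeg W1 W2 (k + 1) := by
  refine (grDeg_le (S := (grDeg W1 W2 (k + 1)).comap (LinearMap.mulLeft ℝ (ιOne w : GrAlg W1 W2))) ?_) ha
  intro p q hpq a ha s hs
  change ιOne w * (a ⊗ₜ[ℝ] s) ∈ grDeg W1 W2 (k + 1)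
  rw [ιOne_mul_tmul]
  refine tmul_mem_grDeg (p := p + 1) (q := q) (by omega) ?_ hs
  change _ ∈ LinearMap.range (ExteriorAlgebra.ι ℝ) ^ (p + 1)
  rw [pow_succ']
  exact Submodule.mul_mem_mul ⟨w, rfl⟩ ha

lemma ιTwo_mul_mem {k : ℕ} (w : W2) {a : GrAlg W1 W2} (ha : a ∈ grDeg W1 W2 k) :
    ιTwo w * a ∈ grDeg W1 W2 (k + 2) := by
  refine (grDeg_le (S := (grDeg W1 W2 (k + 2)).comap (LinearMap.mulLeft ℝ (ιTwo w : GrAlg W1 W2))) ?_) ha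
  intro p q hpq a ha s hs
  change ιTwo w * (a ⊗ₜ[ℝ] s) ∈ grDeg W1 W2 (k + 2)
  rw [ιTwo_mul_tmul]
  refine tmul_mem_grDeg (p := p) (q := q + 1) (by omega) ha ?_
  rw [pow_succ']
  exact Submodule.mul_mem_mul ⟨w, rfl⟩ hs

lemma one_mem_grDeg_zero : (1 : GrAlg W1 W2) ∈ grDeg W1 W2 0 := by
  have := one_mem_grDeg (W₁ := W1) (W₂ := W2) 1
  rwa [map_one] at this

@[elab_as_elim]
lemma grDeg_induction {P : ℕ → GrAlg W1 W2 → Prop} (one : P 0 1)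
    (add : ∀ k a b, P k a → P k b → P k (a + b)) (smul : ∀ k (c : ℝ) a, P k a → P k (c • a))
    (zero : ∀ k, P k 0)
    (mul_one : ∀ k w a, a ∈ grDeg W1 W2 k → P k a → P (k + 1) (ιOne w * a))
    (mul_two : ∀ k w a, a ∈ grDeg W1 W2 k → P k a → P (k + 2) (ιTwo w * a))
    {k : ℕ} {a : GrAlg W1 W2} (ha : a ∈ grDeg W1 W2 k) : P k a := by
  have hS : ∀ q, ∀ s ∈ LinearMap.range (SymmetricAlgebra.ι ℝ W2) ^ q,
      P (2 * q) (1 ⊗ₜ[ℝ] s : GrAlg W1 W2) := by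
    intro q s hs
    induction hs using Submodule.pow_induction_on_left' with
    | algebraMap r =>
      rw [Algebra.algebraMap_eq_smul_one, TensorProduct.tmul_smul]
      exact smul _ _ _ one
    | add x y i hx hy h1 h2 => rw [TensorProduct.tmul_add]; exact add _ _ _ h1 h2
    | mem_mul m hm i x hx h =>
      obtain ⟨b, rfl⟩ := hm
      rw [← ιTwo_mul_tmul]
      exact mul_two _ _ _ (tmul_mem_grDeg (p := 0) (q := i) (Nat.zero_add _) (by simp) hx) h
  have hE : ∀ q, ∀ s ∈ LinearMap.range (SymmetricAlgebra.ι ℝ W2) ^ q, ∀ p, ∀ a ∈ ⋀[ℝ]^p W1,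
      P (p + 2 * q) (a ⊗ₜ[ℝ] s : GrAlg W1 W2) := by
    intro q s hs p a ha
    induction ha using Submodule.pow_induction_on_left' with
    | algebraMap r =>
      rw [Algebra.algebraMap_eq_smul_one, ← TensorProduct.smul_tmul', Nat.zero_add]
      exact smul _ _ _ (hS q s hs)
    | add x y i hx hy h1 h2 => rw [TensorProduct.add_tmul]; exact add _ _ _ h1 h2
    | mem_mul m hm i x hx h =>
      obtain ⟨b, rfl⟩ := hm
      rw [← ιOne_mul_tmul, Nat.succ_add]
      exact mul_one _ _ _ (tmul_mem_grDeg rfl hx hs) h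
  refine (grDeg_le (S := ⟨⟨⟨{a | P k a}, fun {a b} => add k a b⟩, zero k⟩,
    fun c a => smul k c a⟩) ?_) ha
  rintro p q rfl a ha s hs
  exact hE q s hs p a ha

lemma mul_mem_grDeg {i j : ℕ} {a b : GrAlg W1 W2} (ha : a ∈ grDeg W1 W2 i)
    (hb : b ∈ grDeg W1 W2 j) : a * b ∈ grDeg W1 W2 (i + j) := by
  refine grDeg_induction ?_ ?_ ?_ ?_ ?_ ?_ ha
  · simpa using hb
  · intro k a b h1 h2; rw [add_mul]; exact Submodule.add_mem _ h1 h2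
  · intro k c a h; rw [smul_mul_assoc]; exact Submodule.smul_mem _ _ h
  · simp
  · intro k w a _ h; rw [mul_assoc, Nat.add_right_comm]; exact ιOne_mul_mem _ h
  · intro k w a _ h; rw [mul_assoc, Nat.add_right_comm]; exact ιTwo_mul_mem _ h

lemma iSup_grDeg : ⨆ k, grDeg W1 W2 k = ⊤ := by
  refine Submodule.eq_top_iff'.2 fun a => ?_
  have key : ∀ (f : GrAlg W1 W2 →ₗ[ℝ] GrAlg W1 W2) (j : ℕ),
      (∀ k a, a ∈ grDeg W1 W2 k → f a ∈ grDeg W1 W2 (k + j)) →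
      ∀ a ∈ ⨆ k, grDeg W1 W2 k, f a ∈ ⨆ k, grDeg W1 W2 k := fun f j h a ha =>
    (iSup_le (a := (⨆ k, grDeg W1 W2 k).comap f) fun k a ha =>
      Submodule.mem_iSup_of_mem (k + j) (h k a ha)) ha
  induction a using grAlg_induction with
  | one => exact Submodule.mem_iSup_of_mem 0 one_mem_grDeg_zero
  | add a b h1 h2 => exact Submodule.add_mem _ h1 h2
  | smul c a h => exact Submodule.smul_mem _ _ h
  | mul_one w a h => exact key (LinearMap.mulLeft ℝ (ιOne w)) 1 (fun k a => ιOne_mul_mem w) a h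
  | mul_two w a h => exact key (LinearMap.mulLeft ℝ (ιTwo w)) 2 (fun k a => ιTwo_mul_mem w) a h

lemma ιOne_mul_self (w : W1) : (ιOne w * ιOne w : GrAlg W1 W2) = 0 := by
  simp [ιOne, Algebra.TensorProduct.tmul_mul_tmul]

lemma ιTwo_comm (w : W2) (a : GrAlg W1 W2) : ιTwo w * a = a * ιTwo w := by
  induction a using TensorProduct.induction_on with
  | zero => simp
  | tmul x y => simp [ιTwo, Algebra.TensorProduct.tmul_mul_tmul, mul_comm]
  | add x y hx hy => rw [mul_add, add_mul, hx, hy]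

/-- The inclusion of the degree one generators, as a linear map. -/
def ιOneL : W1 →ₗ[ℝ] GrAlg W1 W2 where
  toFun := ιOne
  map_add' a b := by simp [ιOne, TensorProduct.add_tmul]
  map_smul' c a := by simp [ιOne, TensorProduct.smul_tmul']

/-- The inclusion of the degree two generators, as a linear map. -/
def ιTwoL : W2 →ₗ[ℝ] GrAlg W1 W2 where
  toFun := ιTwo
  map_add' a b := by simp [ιTwo, TensorProduct.tmul_add]
  map_smul' c a := by simp [ιTwo, TensorProduct.tmul_smul]

lemma ιOne_add (a b : W1) : (ιOne (a + b) : GrAlg W1 W2) = ιOne a + ιOne b := map_add ιOneL a b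
lemma ιTwo_add (a b : W2) : (ιTwo (a + b) : GrAlg W1 W2) = ιTwo a + ιTwo b := map_add ιTwoL a b
lemma ιOne_smul (c : ℝ) (a : W1) : (ιOne (c • a) : GrAlg W1 W2) = c • ιOne a :=
  map_smul ιOneL c a
lemma ιTwo_smul (c : ℝ) (a : W2) : (ιTwo (c • a) : GrAlg W1 W2) = c • ιTwo a :=
  map_smul ιTwoL c a

section Lift

variable {A : Type w} [Ring A] [Algebra ℝ A]

/-- A linear map with central values, as a map to the centre. -/
def toCenter (g : W2 →ₗ[ℝ] A) (hg : ∀ b x, g b * x = x * g b) :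
    W2 →ₗ[ℝ] Subalgebra.center ℝ A where
  toFun b := ⟨g b, Subalgebra.mem_center_iff.2 fun x => (hg b x).symm⟩
  map_add' a b := Subtype.ext (map_add g a b)
  map_smul' c b := Subtype.ext (map_smul g c b)

lemma toCenter_commute (f : ExteriorAlgebra ℝ W1 →ₐ[ℝ] A) (g : W2 →ₗ[ℝ] A)
    (hg : ∀ b x, g b * x = x * g b) (x : ExteriorAlgebra ℝ W1) (y : SymmetricAlgebra ℝ W2) :
    Commute (f x) (((Subalgebra.center ℝ A).val.comp
      (SymmetricAlgebra.lift (toCenter g hg))) y) :=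
  Subalgebra.mem_center_iff.1 (SymmetricAlgebra.lift (toCenter g hg) y).2 _

/-- The universal property of the free graded-commutative algebra, for images of the degree two
generators which are central. -/
def grLift (f : W1 →ₗ[ℝ] A) (hf : ∀ a, f a * f a = 0) (g : W2 →ₗ[ℝ] A)
    (hg : ∀ b x, g b * x = x * g b) : GrAlg W1 W2 →ₐ[ℝ] A :=
  Algebra.TensorProduct.lift (ExteriorAlgebra.lift ℝ ⟨f, hf⟩)
    ((Subalgebra.center ℝ A).val.comp (SymmetricAlgebra.lift (toCenter g hg)))
    (toCenter_commute _ g hg)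

variable (f : W1 →ₗ[ℝ] A) (hf : ∀ a, f a * f a = 0) (g : W2 →ₗ[ℝ] A)
    (hg : ∀ b x, g b * x = x * g b)

@[simp] theorem grLift_ιOne (a : W1) : grLift f hf g hg (ιOne a) = f a := by
  rw [grLift, ιOne, Algebra.TensorProduct.lift_tmul, map_one, mul_one,
    ExteriorAlgebra.lift_ι_apply]

@[simp] theorem grLift_ιTwo (b : W2) : grLift f hf g hg (ιTwo b) = g b := by
  rw [grLift, ιTwo, Algebra.TensorProduct.lift_tmul, map_one, one_mul, AlgHom.comp_apply,
    SymmetricAlgebra.lift_ι_apply]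
  rfl

lemma grAlg_hom_ext {φ ψ : GrAlg W1 W2 →ₐ[ℝ] A} (h₁ : ∀ a, φ (ιOne a) = ψ (ιOne a))
    (h₂ : ∀ b, φ (ιTwo b) = ψ (ιTwo b)) : φ = ψ := by
  refine AlgHom.ext fun a => ?_
  induction a using grAlg_induction with
  | one => simp
  | add a b h1 h2 => rw [map_add, map_add, h1, h2]
  | smul c a h => rw [map_smul, map_smul, h]
  | mul_one w a h => rw [map_mul, map_mul, h, h₁]
  | mul_two w a h => rw [map_mul, map_mul, h, h₂]

end Lift

lemma monomial_ιTwo_comm (b : W2) (x : Polynomial (GrAlg W1 W2)) :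
    Polynomial.monomial 2 (ιTwo b) * x = x * Polynomial.monomial 2 (ιTwo b) := by
  induction x using Polynomial.induction_on' with
  | add p q hp hq => rw [mul_add, add_mul, hp, hq]
  | monomial n c =>
    rw [Polynomial.monomial_mul_monomial, Polynomial.monomial_mul_monomial, ιTwo_comm, add_comm]

/-- The homomorphism which multiplies elements of degree `k` by the `k`-th power of a formal
variable. -/
def grWeight : GrAlg W1 W2 →ₐ[ℝ] Polynomial (GrAlg W1 W2) :=
  grLift (A := Polynomial (GrAlg W1 W2))
    { toFun := fun a => Polynomial.monomial 1 (ιOne a)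
      map_add' := fun a b => by rw [ιOne_add, map_add]
      map_smul' := fun c a => by rw [ιOne_smul, ← Polynomial.smul_monomial]; rfl }
    (fun a => by
      change Polynomial.monomial 1 (ιOne a : GrAlg W1 W2) * Polynomial.monomial 1 (ιOne a) = 0
      rw [Polynomial.monomial_mul_monomial, ιOne_mul_self, map_zero])
    { toFun := fun a => Polynomial.monomial 2 (ιTwo a)
      map_add' := fun a b => by rw [ιTwo_add, map_add]
      map_smul' := fun c a => by rw [ιTwo_smul, ← Polynomial.smul_monomial]; rfl }
    monomial_ιTwo_comm

lemma grWeight_of_mem {k : ℕ} {a : GrAlg W1 W2} (ha : a ∈ grDeg W1 W2 k) :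
    grWeight a = Polynomial.monomial k a := by
  refine grDeg_induction ?_ ?_ ?_ ?_ ?_ ?_ ha
  · simp
  · intro k a b h1 h2; rw [map_add, map_add, h1, h2]
  · intro k c a h; rw [map_smul, h, Polynomial.smul_monomial]
  · simp
  · intro k w a _ h
    rw [map_mul, h, grWeight, grLift_ιOne]
    change Polynomial.monomial 1 (ιOne w) * _ = _
    rw [Polynomial.monomial_mul_monomial, add_comm]
  · intro k w a _ h
    rw [map_mul, h, grWeight, grLift_ιTwo]
    change Polynomial.monomial 2 (ιTwo w) * _ = _
    rw [Polynomial.monomial_mul_monomial, add_comm]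

lemma grDeg_sum_eq_zero {s : Finset ℕ} {a : ℕ → GrAlg W1 W2}
    (ha : ∀ k, a k ∈ grDeg W1 W2 k) (h : ∑ k ∈ s, a k = 0) : ∀ k ∈ s, a k = 0 := by
  intro k hk
  have := congrArg (fun x => (grWeight x).coeff k) h
  simp only [map_sum, Polynomial.finsetSum_coeff, map_zero, Polynomial.coeff_zero,
    grWeight_of_mem (ha _), Polynomial.coeff_monomial] at this
  simpa [hk] using this

lemma isInternal_of_sum {A : Type w} [AddCommGroup A] [Module ℝ A] (𝒜 : ℕ → Submodule ℝ A)
    (hsum : ∀ (s : Finset ℕ) (a : ℕ → A), (∀ k, a k ∈ 𝒜 k) → ∑ k ∈ s, a k = 0 → ∀ k ∈ s, a k = 0)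
    (htop : ⨆ k, 𝒜 k = ⊤) : DirectSum.IsInternal 𝒜 := by
  classical
  refine DirectSum.isInternal_submodule_of_iSupIndep_of_iSup_eq_top ?_ htop
  refine iSupIndep_of_dfinsupp_lsum_injective _ ?_
  rw [injective_iff_map_eq_zero]
  intro d hd
  rw [DFinsupp.lsum_apply_apply, DFinsupp.sumAddHom_apply] at hd
  ext k
  by_cases hk : k ∈ d.support
  · exact hsum d.support (fun k => (d k : A)) (fun k => (d k).2) hd k hk
  · simp [DFinsupp.notMem_support_iff.1 hk]

instance grDeg_finite [Module.Finite ℝ W1] [Module.Finite ℝ W2] (k : ℕ) :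
    Module.Finite ℝ (grDeg W1 W2 k) := by
  refine Module.Finite.iff_fg.2 ?_
  have hfg : ∀ p q, (Submodule.map₂
    (TensorProduct.mk ℝ (ExteriorAlgebra ℝ W1) (SymmetricAlgebra ℝ W2))
    (⋀[ℝ]^p W1) (LinearMap.range (SymmetricAlgebra.ι ℝ W2) ^ q)).FG := fun p q =>
    Submodule.FG.map₂ _ (Submodule.FG.pow (LinearMap.range_eq_map (ExteriorAlgebra.ι ℝ (M := W1)) ▸
      (Module.Finite.fg_top.map _)) p) (Submodule.FG.pow
      (LinearMap.range_eq_map (SymmetricAlgebra.ι ℝ W2) ▸ (Module.Finite.fg_top.map _)) q)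
  have : grDeg W1 W2 k = ⨆ i : Fin (k + 1) × Fin (k + 1), if (i.1 : ℕ) + 2 * i.2 = k then
      (Submodule.map₂ (TensorProduct.mk ℝ (ExteriorAlgebra ℝ W1) (SymmetricAlgebra ℝ W2))
        (⋀[ℝ]^(i.1 : ℕ) W1) (LinearMap.range (SymmetricAlgebra.ι ℝ W2) ^ (i.2 : ℕ))) else ⊥ := by
    apply le_antisymm
    · refine iSup_le fun p => iSup_le fun q => iSup_le fun h => ?_
      refine le_trans ?_ (le_iSup _ (⟨p, by omega⟩, ⟨q, by omega⟩))
      simp [h]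
    · refine iSup_le fun i => ?_
      split_ifs with h
      · exact le_iSup_of_le _ (le_iSup_of_le _ (le_iSup_of_le h le_rfl))
      · exact bot_le
  rw [this]
  refine Submodule.fg_iSup _ fun i => ?_
  split_ifs
  · exact hfg _ _
  · exact Submodule.fg_bot

end GradedAlgebra

section GradedDerivations

variable {W1 : Type v} {W2 : Type v'} [AddCommGroup W1] [Module ℝ W1] [AddCommGroup W2]
  [Module ℝ W2]

lemma ιOne_anticomm (w w' : W1) : (ιOne w * ιOne w' : GrAlg W1 W2) = (-1 : ℝ) • (ιOne w' * ιOne w) := by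
  have h := ιOne_mul_self (W2 := W2) (w + w')
  rw [ιOne_add, add_mul, mul_add, mul_add, ιOne_mul_self, ιOne_mul_self, zero_add, add_zero] at h
  have h2 : ιOne w * ιOne w' + (-1 : ℝ) • (ιOne w * ιOne w' + ιOne w' * ιOne w) =
      (-1 : ℝ) • (ιOne w' * ιOne w : GrAlg W1 W2) := by module
  rwa [h, smul_zero, add_zero] at h2

lemma ιOne_comm {k : ℕ} (w : W1) {a : GrAlg W1 W2} (ha : a ∈ grDeg W1 W2 k) :
    ιOne w * a = (-1 : ℝ) ^ k • (a * ιOne w) := by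
  refine grDeg_induction ?_ ?_ ?_ ?_ ?_ ?_ ha
  · simp
  · intro k a b h1 h2; rw [mul_add, add_mul, h1, h2, smul_add]
  · intro k c a h; rw [mul_smul_comm, h, smul_mul_assoc, smul_comm]
  · simp
  · intro k w' a _ h
    rw [← mul_assoc, ιOne_anticomm, smul_mul_assoc, mul_assoc, h, pow_succ', mul_smul_comm,
      mul_smul, mul_assoc]
  · intro k w' a _ h
    rw [← mul_assoc, ← ιTwo_comm, mul_assoc, h, pow_add, mul_smul_comm, mul_assoc]
    norm_num

/-- Contraction of the exterior factor with a linear form, an odd derivation of degree `-1`. -/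
def grContract (d : Dual ℝ W1) : GrAlg W1 W2 →ₗ[ℝ] GrAlg W1 W2 :=
  TensorProduct.map (CliffordAlgebra.contractLeft (Q := (0 : QuadraticForm ℝ W1)) d) LinearMap.id

lemma grContract_one (d : Dual ℝ W1) : grContract d (1 : GrAlg W1 W2) = 0 := by
  rw [grContract, Algebra.TensorProduct.one_def, TensorProduct.map_tmul]
  erw [CliffordAlgebra.contractLeft_one]
  rw [TensorProduct.zero_tmul]

lemma grContract_ιOne_mul (d : Dual ℝ W1) (w : W1) (a : GrAlg W1 W2) :
    grContract d (ιOne w * a) = d w • a + (-1 : ℝ) • (ιOne w * grContract d a) := by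
  induction a using TensorProduct.induction_on with
  | zero => simp
  | tmul x s =>
    rw [ιOne_mul_tmul, grContract, TensorProduct.map_tmul, TensorProduct.map_tmul, ιOne_mul_tmul,
      TensorProduct.smul_tmul', TensorProduct.smul_tmul', LinearMap.id_apply,
      ← TensorProduct.add_tmul]
    congr 1
    refine (CliffordAlgebra.contractLeft_ι_mul _ _ _).trans ?_
    rw [neg_one_smul, ← sub_eq_add_neg]
  | add x y hx hy => rw [mul_add, map_add, hx, hy, map_add, mul_add]; module

lemma grContract_ιTwo_mul (d : Dual ℝ W1) (w : W2) (a : GrAlg W1 W2) :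
    grContract d (ιTwo w * a) = ιTwo w * grContract d a := by
  induction a using TensorProduct.induction_on with
  | zero => simp
  | tmul x s =>
    rw [ιTwo_mul_tmul, grContract, TensorProduct.map_tmul, TensorProduct.map_tmul, ιTwo_mul_tmul]
    rfl
  | add x y hx hy => rw [mul_add, map_add, hx, hy, map_add, mul_add]

lemma grContract_ιOne (d : Dual ℝ W1) (w : W1) :
    grContract d (ιOne w : GrAlg W1 W2) = algebraMap ℝ _ (d w) := by
  rw [← mul_one (ιOne w), grContract_ιOne_mul, grContract_one, mul_zero, smul_zero, add_zero,
    Algebra.algebraMap_eq_smul_one]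

lemma grContract_ιTwo (d : Dual ℝ W1) (w : W2) :
    grContract d (ιTwo w : GrAlg W1 W2) = 0 := by
  rw [← mul_one (ιTwo w), grContract_ιTwo_mul, grContract_one, mul_zero]

lemma grContract_mul (d : Dual ℝ W1) {k : ℕ} {a : GrAlg W1 W2}
    (ha : a ∈ grDeg W1 W2 k) (b : GrAlg W1 W2) :
    grContract d (a * b) = grContract d a * b + (-1 : ℝ) ^ k • (a * grContract d b) := by
  refine grDeg_induction ?_ ?_ ?_ ?_ ?_ ?_ ha
  · simp [grContract_one]
  · intro k x y h1 h2; rw [add_mul, map_add, h1, h2, map_add, add_mul, add_mul, smul_add]; abel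
  · intro k c a h
    rw [smul_mul_assoc, map_smul, h, map_smul, smul_mul_assoc, smul_mul_assoc, smul_add,
      smul_comm c]
  · simp
  · intro k w a _ h
    rw [mul_assoc, grContract_ιOne_mul, h, grContract_ιOne_mul, add_mul, mul_add, smul_mul_assoc,
      smul_mul_assoc, mul_smul_comm, pow_succ, mul_assoc, mul_assoc]
    module
  · intro k w a _ h
    rw [mul_assoc, grContract_ιTwo_mul, h, grContract_ιTwo_mul, mul_add, mul_smul_comm, pow_add,
      mul_assoc, mul_assoc]
    norm_num

lemma grContract_mem (d : Dual ℝ W1) {k : ℕ} {a : GrAlg W1 W2}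
    (ha : a ∈ grDeg W1 W2 k) :
    grContract d a ∈ grDeg W1 W2 (k - 1) ∧ (k = 0 → grContract d a = 0) := by
  refine grDeg_induction ?_ ?_ ?_ ?_ ?_ ?_ ha
  · simp [grContract_one]
  · rintro k x y ⟨h1, h1'⟩ ⟨h2, h2'⟩
    rw [map_add]
    exact ⟨Submodule.add_mem _ h1 h2, fun h => by rw [h1' h, h2' h, add_zero]⟩
  · rintro k c a ⟨h, h'⟩
    rw [map_smul]
    exact ⟨Submodule.smul_mem _ _ h, fun hk => by rw [h' hk, smul_zero]⟩
  · simp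
  · rintro k w a hm ⟨h, h'⟩
    refine ⟨?_, fun hk => absurd hk (by omega)⟩
    rw [grContract_ιOne_mul]
    refine Submodule.add_mem _ (Submodule.smul_mem _ _ hm) (Submodule.smul_mem _ _ ?_)
    rcases k with _ | k
    · rw [h' rfl, mul_zero]; exact zero_mem _
    · exact ιOne_mul_mem w h
  · rintro k w a hm ⟨h, h'⟩
    refine ⟨?_, fun hk => absurd hk (by omega)⟩
    rw [grContract_ιTwo_mul]
    rcases k with _ | k
    · rw [h' rfl, mul_zero]; exact zero_mem _
    · exact ιTwo_mul_mem w h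

/-- The derivation of the symmetric algebra which extends a linear form. -/
def symDeriv (d : Dual ℝ W2) : SymmetricAlgebra ℝ W2 →ₗ[ℝ] SymmetricAlgebra ℝ W2 :=
  (TrivSqZeroExt.sndHom (SymmetricAlgebra ℝ W2) (SymmetricAlgebra ℝ W2)).restrictScalars ℝ ∘ₗ
    (SymmetricAlgebra.lift (A := TrivSqZeroExt (SymmetricAlgebra ℝ W2) (SymmetricAlgebra ℝ W2))
      { toFun := fun w => TrivSqZeroExt.inl (SymmetricAlgebra.ι ℝ W2 w) +
          TrivSqZeroExt.inr (d w • 1)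
        map_add' := fun x y => by ext <;> simp [add_smul]
        map_smul' := fun c x => by
          ext <;> simp [mul_smul] }).toLinearMap

lemma symDeriv_one (d : Dual ℝ W2) : symDeriv d 1 = 0 := by
  simp [symDeriv]

lemma symDeriv_ι_mul (d : Dual ℝ W2) (w : W2) (s : SymmetricAlgebra ℝ W2) :
    symDeriv d (SymmetricAlgebra.ι ℝ W2 w * s) =
      d w • s + SymmetricAlgebra.ι ℝ W2 w * symDeriv d s := by
  have key : ∀ F : SymmetricAlgebra ℝ W2 →ₐ[ℝ]
      TrivSqZeroExt (SymmetricAlgebra ℝ W2) (SymmetricAlgebra ℝ W2),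
      (∀ w, (F (SymmetricAlgebra.ι ℝ W2 w)).fst = SymmetricAlgebra.ι ℝ W2 w) →
      ∀ s, (F s).fst = s := by
    intro F hF s
    have : (TrivSqZeroExt.fstHom ℝ _ _).comp F = AlgHom.id ℝ _ :=
      SymmetricAlgebra.algHom_ext (LinearMap.ext hF)
    exact DFunLike.congr_fun this s
  simp only [symDeriv, LinearMap.comp_apply, AlgHom.toLinearMap_apply, map_mul]
  rw [SymmetricAlgebra.lift_ι_apply]
  simp only [LinearMap.coe_restrictScalars, TrivSqZeroExt.sndHom_apply, TrivSqZeroExt.snd_mul,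
    LinearMap.coe_mk, AddHom.coe_mk]
  rw [key _ (fun w => by rw [SymmetricAlgebra.lift_ι_apply]; simp) s]
  simp [add_comm, mul_comm]

/-- The derivation of the symmetric factor which extends a linear form, an even derivation of
degree `-2`. -/
def grDelta (d : Dual ℝ W2) : GrAlg W1 W2 →ₗ[ℝ] GrAlg W1 W2 :=
  TensorProduct.map LinearMap.id (symDeriv d)

lemma grDelta_one (d : Dual ℝ W2) : grDelta d (1 : GrAlg W1 W2) = 0 := by
  rw [grDelta, Algebra.TensorProduct.one_def, TensorProduct.map_tmul, symDeriv_one,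
    TensorProduct.tmul_zero]

lemma grDelta_ιOne_mul (d : Dual ℝ W2) (w : W1) (a : GrAlg W1 W2) :
    grDelta d (ιOne w * a) = ιOne w * grDelta d a := by
  induction a using TensorProduct.induction_on with
  | zero => simp
  | tmul x s =>
    rw [ιOne_mul_tmul, grDelta, TensorProduct.map_tmul, TensorProduct.map_tmul,
      LinearMap.id_apply, LinearMap.id_apply, ιOne_mul_tmul]
  | add x y hx hy => rw [mul_add, map_add, hx, hy, map_add, mul_add]

lemma grDelta_ιTwo_mul (d : Dual ℝ W2) (w : W2) (a : GrAlg W1 W2) :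
    grDelta d (ιTwo w * a) = d w • a + ιTwo w * grDelta d a := by
  induction a using TensorProduct.induction_on with
  | zero => simp
  | tmul x s =>
    rw [ιTwo_mul_tmul, grDelta, TensorProduct.map_tmul, TensorProduct.map_tmul,
      LinearMap.id_apply, ιTwo_mul_tmul, symDeriv_ι_mul, TensorProduct.tmul_add,
      TensorProduct.tmul_smul]
  | add x y hx hy => rw [mul_add, map_add, hx, hy, map_add, smul_add, mul_add]; abel

lemma exists_odd_derivation [Module.Finite ℝ W1] [Module.Finite ℝ W2]
    (d1 : W1 →ₗ[ℝ] GrAlg W1 W2) (h₁ : ∀ w, d1 w ∈ grDeg W1 W2 2)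
    (d2 : W2 →ₗ[ℝ] GrAlg W1 W2) (h₂ : ∀ w, d2 w ∈ grDeg W1 W2 3) :
    ∃ D : GrAlg W1 W2 →ₗ[ℝ] GrAlg W1 W2, D 1 = 0 ∧ (∀ w, D (ιOne w) = d1 w) ∧
      (∀ w, D (ιTwo w) = d2 w) ∧ (∀ k a b, a ∈ grDeg W1 W2 k →
        D (a * b) = D a * b + (-1 : ℝ) ^ k • (a * D b)) ∧
      (∀ k a, a ∈ grDeg W1 W2 k → D a ∈ grDeg W1 W2 (k + 1)) := by
  let b1 := Module.finBasis ℝ W1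
  let b2 := Module.finBasis ℝ W2
  let D : GrAlg W1 W2 →ₗ[ℝ] GrAlg W1 W2 :=
    ∑ i, LinearMap.mulLeft ℝ (d1 (b1 i)) ∘ₗ grContract (b1.coord i) +
    ∑ i, LinearMap.mulLeft ℝ (d2 (b2 i)) ∘ₗ grDelta (b2.coord i)
  have hD : ∀ a, D a = ∑ i, d1 (b1 i) * grContract (b1.coord i) a +
      ∑ i, d2 (b2 i) * grDelta (b2.coord i) a := fun a => by
    simp [D, LinearMap.sum_apply]
  have hs₁ : ∀ w, ∑ i, b1.coord i w • d1 (b1 i) = d1 w := fun w => by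
    conv_rhs => rw [← b1.sum_repr w, map_sum]
    simp
  have hs₂ : ∀ w, ∑ i, b2.coord i w • d2 (b2 i) = d2 w := fun w => by
    conv_rhs => rw [← b2.sum_repr w, map_sum]
    simp
  have hD0 : D 1 = 0 := by simp [hD, grContract_one, grDelta_one]
  have hD1 : ∀ w a, D (ιOne w * a) = d1 w * a + (-1 : ℝ) • (ιOne w * D a) := by
    intro w a
    have e1 : ∀ i, d1 (b1 i) * grContract (b1.coord i) (ιOne w * a) =
        (b1.coord i w • d1 (b1 i)) * a +
          (-1 : ℝ) • (ιOne w * (d1 (b1 i) * grContract (b1.coord i) a)) := by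
      intro i
      rw [grContract_ιOne_mul, mul_add, mul_smul_comm, smul_mul_assoc, ← mul_assoc (ιOne w),
        ιOne_comm w (h₁ _), smul_mul_assoc, mul_assoc, mul_smul_comm]
      module
    have e2 : ∀ i, d2 (b2 i) * grDelta (b2.coord i) (ιOne w * a) =
        (-1 : ℝ) • (ιOne w * (d2 (b2 i) * grDelta (b2.coord i) a)) := by
      intro i
      rw [grDelta_ιOne_mul, ← mul_assoc (ιOne w), ιOne_comm w (h₂ _), smul_mul_assoc, mul_assoc]
      module
    rw [hD, hD]
    simp only [e1, e2, Finset.sum_add_distrib, ← Finset.smul_sum, ← Finset.sum_mul, hs₁,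
      mul_add, Finset.mul_sum, smul_add, add_assoc]
  have hD2 : ∀ w a, D (ιTwo w * a) = d2 w * a + ιTwo w * D a := by
    intro w a
    have e1 : ∀ i, d1 (b1 i) * grContract (b1.coord i) (ιTwo w * a) =
        ιTwo w * (d1 (b1 i) * grContract (b1.coord i) a) := by
      intro i
      rw [grContract_ιTwo_mul, ← mul_assoc, ← mul_assoc, ιTwo_comm]
    have e2 : ∀ i, d2 (b2 i) * grDelta (b2.coord i) (ιTwo w * a) =
        (b2.coord i w • d2 (b2 i)) * a + ιTwo w * (d2 (b2 i) * grDelta (b2.coord i) a) := by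
      intro i
      rw [grDelta_ιTwo_mul, mul_add, mul_smul_comm, smul_mul_assoc, ← mul_assoc, ← mul_assoc,
        ιTwo_comm]
    rw [hD, hD]
    simp only [e1, e2, Finset.sum_add_distrib, ← Finset.sum_mul, hs₂, mul_add, Finset.mul_sum]
    abel
  refine ⟨D, hD0, fun w => ?_, fun w => ?_, fun k a b ha => ?_, fun k a ha => ?_⟩
  · simpa [hD0] using hD1 w 1
  · simpa [hD0] using hD2 w 1
  · refine grDeg_induction ?_ ?_ ?_ ?_ ?_ ?_ ha
    · simp [hD0]
    · intro k x y h1 h2; rw [add_mul, map_add, h1, h2, map_add, add_mul, add_mul, smul_add]; abel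
    · intro k c a h
      rw [smul_mul_assoc, map_smul, h, map_smul, smul_mul_assoc, smul_mul_assoc, smul_add,
        smul_comm c]
    · simp
    · intro k w a _ h
      rw [mul_assoc, hD1, h, hD1, add_mul, mul_add, mul_smul_comm, smul_mul_assoc, pow_succ,
        mul_assoc, mul_assoc, mul_assoc]
      module
    · intro k w a _ h
      rw [mul_assoc, hD2, h, hD2, add_mul, mul_add, mul_smul_comm, pow_add, mul_assoc, mul_assoc,
        mul_assoc]
      norm_num [add_assoc]
  · refine grDeg_induction ?_ ?_ ?_ ?_ ?_ ?_ ha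
    · simp [hD0]
    · intro k x y h1 h2; rw [map_add]; exact Submodule.add_mem _ h1 h2
    · intro k c a h; rw [map_smul]; exact Submodule.smul_mem _ _ h
    · simp
    · intro k w a hm h
      rw [hD1]
      refine Submodule.add_mem _ ?_ (Submodule.smul_mem _ _ (ιOne_mul_mem w h))
      rw [show k + 1 + 1 = 2 + k by omega]
      exact mul_mem_grDeg (h₁ w) hm
    · intro k w a hm h
      rw [hD2]
      refine Submodule.add_mem _ ?_ (ιTwo_mul_mem w h)
      rw [show k + 2 + 1 = 3 + k by omega]
      exact mul_mem_grDeg (h₂ w) hm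

end GradedDerivations

section Evaluation

variable {E : Type v} {V : Type v'} [AddCommGroup E] [Module ℝ E] [AddCommGroup V] [Module ℝ V]

lemma evalAt_tmul (v : V) (a : ExteriorAlgebra ℝ (Dual ℝ E))
    (s : SymmetricAlgebra ℝ (Dual ℝ V)) :
    evalAt v (a ⊗ₜ[ℝ] s) = SymmetricAlgebra.lift (Dual.eval ℝ V v) s • a := by
  simp [evalAt]

lemma evalAt_ιOne (v : V) (α : Dual ℝ E) :
    evalAt v (ιOne α : DualGrAlg E V) = ExteriorAlgebra.ι ℝ α := by
  rw [ιOne, evalAt_tmul, map_one, one_smul]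

lemma evalAt_ιTwo (v : V) (β : Dual ℝ V) :
    evalAt v (ιTwo β : DualGrAlg E V) = algebraMap ℝ _ (β v) := by
  rw [ιTwo, evalAt_tmul, SymmetricAlgebra.lift_ι_apply, Algebra.algebraMap_eq_smul_one]
  rfl

lemma evalAt_grContract (e : E) (v : V) (a : DualGrAlg E V) :
    evalAt v (grContract (Dual.eval ℝ E e) a) = contract e (evalAt v a) := by
  induction a using TensorProduct.induction_on with
  | zero => simp
  | tmul x s => rw [grContract, TensorProduct.map_tmul, evalAt_tmul, evalAt_tmul, map_smul]; rfl
  | add x y hx hy => rw [map_add, map_add, hx, hy, map_add, map_add]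

variable (a b : DualGrAlg E V) (e : E) (l : List E) (v : V)

lemma evalGr_cons :
    evalGr a (e :: l) v = evalGr (grContract (Dual.eval ℝ E e) a) l v := by
  rw [evalGr, List.foldl_cons, ← evalAt_grContract, evalGr]

lemma evalGr_add : evalGr (a + b) l v = evalGr a l v + evalGr b l v := by
  induction l generalizing a b with
  | nil => simp [evalGr]
  | cons e l ih => rw [evalGr_cons, map_add, ih, ← evalGr_cons, ← evalGr_cons]

lemma evalGr_smul (c : ℝ) : evalGr (c • a) l v = c * evalGr a l v := by
  induction l generalizing a with
  | nil => simp [evalGr]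
  | cons e l ih => rw [evalGr_cons, map_smul, ih, ← evalGr_cons]

/-- Evaluation on fixed arguments, as a linear map. -/
def evalGrL : DualGrAlg E V →ₗ[ℝ] ℝ where
  toFun a := evalGr a l v
  map_add' a b := evalGr_add a b l v
  map_smul' c a := evalGr_smul a l v c

@[simp] theorem evalGr_zero : evalGr (0 : DualGrAlg E V) l v = 0 :=
  map_zero (evalGrL l v)

lemma evalGr_sub : evalGr (a - b) l v = evalGr a l v - evalGr b l v := map_sub (evalGrL l v) a b

lemma evalGr_neg : evalGr (-a) l v = - evalGr a l v := map_neg (evalGrL l v) a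

lemma evalGr_sum {ι : Type*} (s : Finset ι) (f : ι → DualGrAlg E V) :
    evalGr (∑ i ∈ s, f i) l v = ∑ i ∈ s, evalGr (f i) l v := map_sum (evalGrL l v) f s

lemma evalGr_nil_mul : evalGr (a * b) [] v = evalGr a [] v * evalGr b [] v := by
  simp [evalGr]

@[simp] theorem evalGr_algebraMap_nil (c : ℝ) :
    evalGr (algebraMap ℝ (DualGrAlg E V) c) [] v = c := by
  simp only [evalGr, List.foldl_nil]
  rw [AlgHom.commutes, AlgHom.commutes]; rfl

@[simp] theorem evalGr_algebraMap_cons (c : ℝ) :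
    evalGr (algebraMap ℝ (DualGrAlg E V) c) (e :: l) v = 0 := by
  rw [evalGr_cons, Algebra.algebraMap_eq_smul_one, map_smul, grContract_one, smul_zero,
    evalGr_zero]

@[simp] theorem evalGr_ιOne_nil (α : Dual ℝ E) :
    evalGr (ιOne α : DualGrAlg E V) [] v = 0 := by
  rw [evalGr, List.foldl_nil, evalAt_ιOne, ExteriorAlgebra.algebraMapInv,
    ExteriorAlgebra.lift_ι_apply]
  rfl

@[simp] theorem evalGr_ιOne_one (α : Dual ℝ E) :
    evalGr (ιOne α : DualGrAlg E V) [e] v = α e := by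
  rw [evalGr_cons, grContract_ιOne, evalGr_algebraMap_nil]; rfl

@[simp] theorem evalGr_ιOne_two (α : Dual ℝ E) (e' : E) :
    evalGr (ιOne α : DualGrAlg E V) (e :: e' :: l) v = 0 := by
  rw [evalGr_cons, grContract_ιOne, evalGr_algebraMap_cons]

@[simp] theorem evalGr_ιTwo_nil (β : Dual ℝ V) :
    evalGr (ιTwo β : DualGrAlg E V) [] v = β v := by
  rw [evalGr, List.foldl_nil, evalAt_ιTwo, AlgHom.commutes]; rfl

@[simp] theorem evalGr_ιTwo_cons (β : Dual ℝ V) :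
    evalGr (ιTwo β : DualGrAlg E V) (e :: l) v = 0 := by
  rw [evalGr_cons, grContract_ιTwo, evalGr_zero]

/-- The values of a product of graded functions in terms of the values of the factors, the first
of which has degree `p`. -/
def mulEv {E : Type v} : List E → ℕ → (List E → ℝ) → (List E → ℝ) → ℝ
  | [], _, A, B => A [] * B []
  | e :: l, p, A, B => mulEv l (p - 1) (fun l => A (e :: l)) B +
      (-1) ^ p * mulEv l p A (fun l => B (e :: l))

variable {a} in
lemma evalGr_mul {p : ℕ} (ha : a ∈ grDeg _ _ p) :
    evalGr (a * b) l v = mulEv l p (fun l => evalGr a l v) (fun l => evalGr b l v) := by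
  induction l generalizing a b p with
  | nil => exact evalGr_nil_mul a b v
  | cons e l ih =>
    rw [evalGr_cons, grContract_mul _ ha, evalGr_add, evalGr_smul, mulEv,
      ih _ (grContract_mem _ ha).1, ih _ ha]
    simp only [evalGr_cons]

lemma evalGr_swap (e' : E) : evalGr a (e :: e' :: l) v = - evalGr a (e' :: e :: l) v := by
  rw [evalGr_cons, evalGr_cons, evalGr_cons, evalGr_cons, ← evalGr_neg]
  congr 1
  induction a using TensorProduct.induction_on with
  | zero => simp
  | tmul x s =>
    simp only [grContract, TensorProduct.map_tmul, ← TensorProduct.neg_tmul]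
    congr 1
    exact CliffordAlgebra.contractLeft_comm _ _ _
  | add x y hx hy => rw [map_add, map_add, hx, hy, map_add, map_add, neg_add]

lemma evalGr_cons_add (e' : E) :
    evalGr a ((e + e') :: l) v = evalGr a (e :: l) v + evalGr a (e' :: l) v := by
  rw [evalGr_cons, evalGr_cons, evalGr_cons, ← evalGr_add]
  congr 1
  simp only [grContract, map_add]
  rw [TensorProduct.map_add_left]; rfl

lemma evalGr_cons_smul (c : ℝ) :
    evalGr a ((c • e) :: l) v = c * evalGr a (e :: l) v := by
  rw [evalGr_cons, evalGr_cons, ← evalGr_smul]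
  congr 1
  simp only [grContract, map_smul]
  rw [TensorProduct.map_smul_left]; rfl

variable {a} in
lemma evalGr_eq_zero {k : ℕ} (ha : a ∈ grDeg _ _ k) (h : ∀ q, l.length + 2 * q ≠ k) :
    evalGr a l v = 0 := by
  induction l generalizing a k with
  | nil =>
    have h : ∀ q, 2 * q ≠ k := by simpa using h
    revert h
    refine grDeg_induction ?_ ?_ ?_ ?_ ?_ ?_ ha
    · intro h; exact absurd rfl (h 0)
    · intro k x y h1 h2 h; rw [evalGr_add, h1 h, h2 h, add_zero]
    · intro k c x h1 h; rw [evalGr_smul, h1 h, mul_zero]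
    · simp
    · intro k w x _ _ _; rw [evalGr_nil_mul, evalGr_ιOne_nil, zero_mul]
    · intro k w x _ h1 h
      rw [evalGr_nil_mul, h1 (fun q hq => h (q + 1) (by omega)), mul_zero]
  | cons e l ih =>
    rw [evalGr_cons]
    rcases k with _ | k
    · rw [(grContract_mem _ ha).2 rfl, evalGr_zero]
    · refine ih (grContract_mem _ ha).1 fun q hq => h q ?_
      rw [List.length_cons]; omega

end Evaluation

section Separation

variable {E : Type v} {V : Type v'} [AddCommGroup E] [Module ℝ E] [AddCommGroup V] [Module ℝ V]

lemma exists_generators {W1 : Type v} {W2 : Type v'} [AddCommGroup W1] [Module ℝ W1]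
    [AddCommGroup W2] [Module ℝ W2] {k : ℕ} {a : GrAlg W1 W2} (ha : a ∈ grDeg W1 W2 k) :
    (k = 0 → ∃ c : ℝ, a = algebraMap ℝ _ c) ∧ (k = 1 → ∃ w, a = ιOne w) := by
  constructor <;> rintro rfl
  · refine (grDeg_le (S := LinearMap.range (Algebra.linearMap ℝ _)) ?_ ha).imp fun _ => Eq.symm
    intro p q h x hx s hs
    obtain ⟨rfl, rfl⟩ : p = 0 ∧ q = 0 := by omega
    obtain ⟨c, rfl⟩ := Submodule.mem_one.1 (by simpa using hx)
    obtain ⟨d, rfl⟩ := Submodule.mem_one.1 (by simpa using hs)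
    exact ⟨c * d, by
      rw [Algebra.linearMap_apply, Algebra.algebraMap_eq_smul_one, Algebra.algebraMap_eq_smul_one,
        Algebra.algebraMap_eq_smul_one, TensorProduct.smul_tmul_smul]; rfl⟩
  · refine (grDeg_le (S := LinearMap.range ιOneL) ?_ ha).imp fun _ => Eq.symm
    intro p q h x hx s hs
    obtain ⟨rfl, rfl⟩ : p = 1 ∧ q = 0 := by omega
    obtain ⟨c, rfl⟩ : ∃ c, ExteriorAlgebra.ι ℝ c = x := by simpa using hx
    obtain ⟨d, rfl⟩ := Submodule.mem_one.1 (by simpa using hs)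
    exact ⟨d • c, by
      rw [map_smul, Algebra.algebraMap_eq_smul_one, TensorProduct.tmul_smul]; rfl⟩

lemma grDelta_mem {W1 : Type v} {W2 : Type v'} [AddCommGroup W1] [Module ℝ W1] [AddCommGroup W2]
    [Module ℝ W2] (d : Dual ℝ W2) {k : ℕ} {a : GrAlg W1 W2} (ha : a ∈ grDeg W1 W2 k) :
    grDelta d a ∈ grDeg W1 W2 (k - 2) ∧ (k < 2 → grDelta d a = 0) := by
  refine grDeg_induction ?_ ?_ ?_ ?_ ?_ ?_ ha
  · simp [grDelta_one]
  · rintro k x y ⟨h1, h1'⟩ ⟨h2, h2'⟩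
    rw [map_add]
    exact ⟨add_mem h1 h2, fun h => by rw [h1' h, h2' h, add_zero]⟩
  · rintro k c a ⟨h, h'⟩
    rw [map_smul]
    exact ⟨Submodule.smul_mem _ _ h, fun hk => by rw [h' hk, smul_zero]⟩
  · simp
  · rintro k w a hm ⟨h, h'⟩
    rw [grDelta_ιOne_mul]
    refine ⟨?_, fun hk => by rw [h' (by omega), mul_zero]⟩
    rcases lt_or_ge k 2 with hk | hk
    · rw [h' hk, mul_zero]; exact zero_mem _
    · rw [show k + 1 - 2 = k - 2 + 1 by omega]; exact ιOne_mul_mem w h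
  · rintro k w a hm ⟨h, h'⟩
    refine ⟨?_, fun hk => absurd hk (by omega)⟩
    rw [grDelta_ιTwo_mul]
    refine add_mem (Submodule.smul_mem _ _ hm) ?_
    rcases lt_or_ge k 2 with hk | hk
    · rw [h' hk, mul_zero]; exact zero_mem _
    · rw [show k + 2 - 2 = k - 2 + 2 by omega]; exact ιTwo_mul_mem w h

/-- The Euler identity. -/
lemma sum_mul_contract_add_sum_mul_delta {ι κ : Type*} [Fintype ι] [Fintype κ] (e : ι → E)
    (ξ : ι → Dual ℝ E) (hξ : ∀ α : Dual ℝ E, ∑ i, α (e i) • ξ i = α) (g : κ → V)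
    (η : κ → Dual ℝ V) (hη : ∀ β : Dual ℝ V, ∑ i, β (g i) • η i = β) {k : ℕ}
    {a : DualGrAlg E V} (ha : a ∈ grDeg _ _ k) :
    ∑ i, ιOne (ξ i) * grContract (Dual.eval ℝ E (e i)) a +
      (2 : ℝ) • ∑ i, ιTwo (η i) * grDelta (Dual.eval ℝ V (g i)) a = (k : ℝ) • a := by
  refine grDeg_induction ?_ ?_ ?_ ?_ ?_ ?_ ha
  · simp [grContract_one, grDelta_one]
  · intro k x y h1 h2
    rw [smul_add, ← h1, ← h2]
    simp only [map_add, mul_add, Finset.sum_add_distrib, smul_add]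
    abel
  · intro k c x h
    rw [smul_comm, ← h]
    simp only [map_smul, mul_smul_comm, ← Finset.smul_sum, smul_add, smul_comm c (2 : ℝ)]
  · simp
  · intro k w x _ h
    have e1 : ∀ i, ιOne (ξ i) * grContract (Dual.eval ℝ E (e i)) (ιOne w * x) =
        ιOneL (w (e i) • ξ i) * x + ιOne w * (ιOne (ξ i) * grContract (Dual.eval ℝ E (e i)) x) := by
      intro i
      rw [grContract_ιOne_mul, map_smul, mul_add, mul_smul_comm, mul_smul_comm, ← mul_assoc,
        ιOne_anticomm, smul_mul_assoc, smul_smul, mul_assoc, smul_mul_assoc]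
      norm_num
      rfl
    simp only [e1, grDelta_ιOne_mul, ← mul_assoc, ιTwo_comm _ (ιOne w), Finset.sum_add_distrib]
    simp only [mul_assoc, ← Finset.mul_sum, ← Finset.sum_mul, ← map_sum, hξ]
    rw [add_assoc, ← mul_smul_comm, ← mul_add, h, mul_smul_comm]
    push_cast
    rw [add_smul, one_smul, add_comm]
    rfl
  · intro k w x _ h
    have e1 : ∀ i, ιTwo (η i) * grDelta (Dual.eval ℝ V (g i)) (ιTwo w * x) =
        ιTwoL (w (g i) • η i) * x + ιTwo w * (ιTwo (η i) * grDelta (Dual.eval ℝ V (g i)) x) := by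
      intro i
      rw [grDelta_ιTwo_mul, map_smul, mul_add, mul_smul_comm, ← mul_assoc, ← mul_assoc,
        ιTwo_comm w, smul_mul_assoc]
      rfl
    simp only [e1, grContract_ιTwo_mul, ← mul_assoc, ← ιTwo_comm w, Finset.sum_add_distrib]
    simp only [mul_assoc, ← Finset.mul_sum, ← Finset.sum_mul, ← map_sum, hη]
    change _ + (2 : ℝ) • (ιTwo w * x + _) = _
    have := congrArg (ιTwo w * ·) h
    simp only [mul_add, mul_smul_comm] at this
    rw [smul_add, add_left_comm, this]
    push_cast
    rw [add_smul, add_comm]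

lemma dual_sum_coord [Module.Finite ℝ E] (α : Dual ℝ E) :
    ∑ i, α (Module.finBasis ℝ E i) • (Module.finBasis ℝ E).coord i = α := by
  refine (Module.finBasis ℝ E).ext fun j => ?_
  simp

lemma evalGr_grDelta (a : DualGrAlg E V) (g : V) (l : List E) (v : V) :
    HasDerivAt (fun t : ℝ => evalGr a l (v + t • g))
      (evalGr (grDelta (Dual.eval ℝ V g) a) l v) 0 := by
  induction l generalizing a with
  | nil =>
    induction a using grAlg_induction with
    | one =>
      rw [grDelta_one, evalGr_zero, ← map_one (algebraMap ℝ _)]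
      simpa only [evalGr_algebraMap_nil] using hasDerivAt_const (0 : ℝ) (1 : ℝ)
    | add a b h1 h2 => simp only [evalGr_add, map_add]; exact h1.add h2
    | smul c a h => simpa only [evalGr_smul, map_smul] using h.const_mul c
    | mul_one w a h =>
      simpa only [grDelta_ιOne_mul, evalGr_nil_mul, evalGr_ιOne_nil, zero_mul] using
        hasDerivAt_const (0 : ℝ) (0 : ℝ)
    | mul_two w a h =>
      have hw : HasDerivAt (fun t : ℝ => w (v + t • g)) (w g) 0 := by
        simpa using ((hasDerivAt_id (0 : ℝ)).mul_const (w g)).const_add (w v)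
      have := hw.mul h
      simp only [grDelta_ιTwo_mul, evalGr_nil_mul, evalGr_add, evalGr_smul, evalGr_ιTwo_nil]
      rwa [zero_smul, add_zero] at this
  | cons e l ih =>
    have hc : grContract (Dual.eval ℝ E e) (grDelta (Dual.eval ℝ V g) a) =
        grDelta (Dual.eval ℝ V g) (grContract (Dual.eval ℝ E e) a) := by
      induction a using TensorProduct.induction_on with
      | zero => simp
      | tmul x s => rfl
      | add x y hx hy => simp only [map_add, hx, hy]
    simp only [evalGr_cons, hc]
    exact ih _

/-- An element of `Λ E^* ⊗ S V^*` is determined by its values. -/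
lemma evalGr_ext [Module.Finite ℝ E] [Module.Finite ℝ V] {a b : DualGrAlg E V}
    (h : ∀ l v, evalGr a l v = evalGr b l v) : a = b := by
  have h1 : ∀ a : ℕ → DualGrAlg E V, (∀ k, a k ∈ grDeg _ _ k) →
      (∀ l v, evalGr (∑ k ∈ Finset.range 1, a k) l v = 0) → ∑ k ∈ Finset.range 1, a k = 0 := by
    intro a ha h
    rw [Finset.sum_range_one] at h ⊢
    obtain ⟨c, hc⟩ := (exists_generators (ha 0)).1 rfl
    have := h [] 0
    rw [hc, evalGr_algebraMap_nil] at this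
    rw [hc, this, map_zero]
  have main : ∀ (N : ℕ) (a : ℕ → DualGrAlg E V), (∀ k, a k ∈ grDeg _ _ k) →
      (∀ l v, evalGr (∑ k ∈ Finset.range N, a k) l v = 0) → ∑ k ∈ Finset.range N, a k = 0 := by
    intro N
    induction N using Nat.twoStepInduction with
    | zero => exact fun a _ _ => Finset.sum_range_zero _
    | one => exact h1
    | more N ih ih' =>
      intro a ha h
      have hc : ∀ e, grContract (Dual.eval ℝ E e) (∑ k ∈ Finset.range (N + 2), a k) = 0 := by
        intro e
        have h0 := fun l => h (e :: l)
        simp only [evalGr_cons] at h0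
        rw [map_sum, Finset.sum_range_succ', (grContract_mem _ (ha 0)).2 rfl, add_zero] at h0 ⊢
        exact ih' _ (fun k => (grContract_mem _ (ha (k + 1))).1) h0
      have hd : ∀ g, grDelta (Dual.eval ℝ V g) (∑ k ∈ Finset.range (N + 2), a k) = 0 := by
        intro g
        have h0 : ∀ l v, evalGr (grDelta (Dual.eval ℝ V g) (∑ k ∈ Finset.range (N + 2), a k)) l v =
            0 := fun l v => (evalGr_grDelta _ g l v).unique (by
          simpa only [h] using hasDerivAt_const (0 : ℝ) (0 : ℝ))
        rw [map_sum, Finset.sum_range_succ', Finset.sum_range_succ',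
          (grDelta_mem _ (ha 0)).2 two_pos, (grDelta_mem _ (ha (0 + 1))).2 one_lt_two, add_zero,
          add_zero] at h0 ⊢
        exact ih _ (fun k => (grDelta_mem _ (ha (k + 2))).1) h0
      have hE : ∑ k ∈ Finset.range (N + 2), (k : ℝ) • a k = 0 := by
        simp_rw [← fun k => sum_mul_contract_add_sum_mul_delta _ _ dual_sum_coord _ _
          dual_sum_coord (ha k)]
        rw [Finset.sum_add_distrib, ← Finset.smul_sum, Finset.sum_comm, Finset.sum_comm (γ := ℕ)]
        simp only [← Finset.mul_sum, ← map_sum, hc, hd, mul_zero, Finset.sum_const_zero, smul_zero,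
          add_zero]
      have hk := grDeg_sum_eq_zero (fun k => Submodule.smul_mem _ _ (ha k)) hE
      have hs : ∑ k ∈ Finset.range (N + 2), a k = ∑ k ∈ Finset.range 1, a k := by
        rw [Finset.sum_range_succ', Finset.sum_range_one, add_eq_right]
        exact Finset.sum_eq_zero fun k h => (smul_eq_zero.1
          (hk (k + 1) (by simpa using h))).resolve_left (by positivity)
      rw [hs] at h ⊢
      exact h1 a ha h
  rw [← sub_eq_zero]
  have h0 : ∀ l v, evalGr (a - b) l v = 0 := fun l v => by rw [evalGr_sub, h, sub_self]
  have hm : a - b ∈ ⨆ k, grDeg (Dual ℝ E) (Dual ℝ V) k := by rw [iSup_grDeg]; trivial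
  obtain ⟨f, hf, e⟩ := (Submodule.mem_iSup_iff_exists_finsupp _ _).1 hm
  obtain ⟨N, hN⟩ := f.support.exists_nat_subset_range
  rw [f.sum_of_support_subset hN _ fun _ _ => rfl] at e
  rw [← e] at h0 ⊢
  exact main N f hf h0

variable {a : DualGrAlg E V}

lemma evalGr_const {k : ℕ} (ha : a ∈ grDeg _ _ k) (l : List E) (hl : l.length = k) (v v' : V) :
    evalGr a l v = evalGr a l v' := by
  induction l generalizing a k with
  | nil =>
    obtain ⟨c, rfl⟩ := (exists_generators ha).1 hl.symm
    rw [evalGr_algebraMap_nil, evalGr_algebraMap_nil]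
  | cons e l ih =>
    rw [evalGr_cons, evalGr_cons]
    rw [List.length_cons] at hl
    exact ih (grContract_mem _ ha).1 (by omega)

lemma evalGr_linear {k : ℕ} (ha : a ∈ grDeg _ _ k) (l : List E) (hl : l.length + 2 = k) :
    ∃ f : Dual ℝ V, ∀ v, evalGr a l v = f v := by
  induction l generalizing a k with
  | nil =>
    refine grDeg_induction (P := fun k a => k = 2 →
      ∃ f : Dual ℝ V, ∀ v, evalGr a [] v = f v) ?_ ?_ ?_ ?_ ?_ ?_ ha hl.symm
    · exact fun h => absurd h (by omega)
    · intro k x y h1 h2 h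
      obtain ⟨f, hf⟩ := h1 h
      obtain ⟨g, hg⟩ := h2 h
      exact ⟨f + g, fun v => by rw [evalGr_add, hf, hg]; rfl⟩
    · intro k c x h1 h
      obtain ⟨f, hf⟩ := h1 h
      exact ⟨c • f, fun v => by rw [evalGr_smul, hf]; rfl⟩
    · exact fun k h => ⟨0, fun v => evalGr_zero _ _⟩
    · exact fun k w x _ _ _ => ⟨0, fun v => by
        rw [evalGr_nil_mul, evalGr_ιOne_nil, zero_mul]; rfl⟩
    · intro k w x hx _ h
      obtain ⟨c, rfl⟩ := (exists_generators hx).1 (by omega)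
      exact ⟨c • w, fun v => by
        rw [evalGr_nil_mul, evalGr_ιTwo_nil, evalGr_algebraMap_nil, mul_comm]; rfl⟩
  | cons e l ih =>
    simp only [evalGr_cons]
    rw [List.length_cons] at hl
    exact ih (grContract_mem _ ha).1 (by omega)

end Separation

open Filter Topology

variable {n : ℕ} {M : Type u} [TopologicalSpace M] [ChartedSpace (EuclideanSpace ℝ (Fin n)) M]
  [IsManifold (𝓡 n) ∞ M] [T2Space M]
  {n' : ℕ} {M' : Type u'} [TopologicalSpace M'] [ChartedSpace (EuclideanSpace ℝ (Fin n')) M']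
  [IsManifold (𝓡 n') ∞ M'] [T2Space M']
  {E : SmoothVB.{u, w₁} n M} {V : SmoothVB.{u, w₂} n M}
  {E' : SmoothVB.{u', w₁'} n' M'} {V' : SmoothVB.{u', w₂'} n' M'}
  {X : GradedSpace.{u, v} n M} {φ : M ≃ₘ⟮𝓡 n, 𝓡 n'⟯ M'}

set_option linter.unusedSectionVars false

notation:max "𝒪[" E "," V "]" => splitSpace E V

/-! ### Linear structure on sections of the dual bundle -/

instance (x : M) : Module.Finite ℝ (E.fiber x) :=
  Module.Finite.equiv ((trivializationAt (EuclideanSpace ℝ (Fin E.rank)) E.fiber x).linearEquivAt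
    ℝ x (mem_baseSet_trivializationAt _ _ x)).symm

@[simp] theorem smulSec_apply (f : GlobalFun n M) (ψ : Sec E) (x : M) :
    smulSec f ψ x = f x • ψ x := rfl

instance : Add (DualSec E) :=
  ⟨fun α β => ⟨fun x => α.form x + β.form x, fun ψ => (α.smooth ψ).add (β.smooth ψ)⟩⟩

instance : Zero (DualSec E) := ⟨⟨fun _ => 0, fun _ => contMDiff_const⟩⟩

instance : SMul (GlobalFun n M) (DualSec E) :=
  ⟨fun f α => ⟨fun x => f x • α.form x, fun ψ => f.contMDiff.mul (α.smooth ψ)⟩⟩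

@[simp] theorem DualSec.add_form (α β : DualSec E) (x : M) :
    (α + β).form x = α.form x + β.form x := rfl

@[simp] theorem DualSec.zero_form (x : M) : (0 : DualSec E).form x = 0 := rfl

@[simp] theorem DualSec.smul_form (f : GlobalFun n M) (α : DualSec E) (x : M) :
    (f • α).form x = f x • α.form x := rfl

instance : AddCommMonoid (DualSec E) where
  add_assoc a b c := by ext; simp [add_assoc]
  zero_add a := by ext; simp
  add_zero a := by ext; simp
  add_comm a b := by ext; simp [add_comm]
  nsmul := nsmulRec

@[simp] theorem DualSec.sum_form {ι : Type*} (s : Finset ι) (α : ι → DualSec E) (x : M) :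
    (∑ i ∈ s, α i).form x = ∑ i ∈ s, (α i).form x := by
  classical
  induction s using Finset.induction_on with
  | empty => simp
  | insert i s hi h => rw [Finset.sum_insert hi, Finset.sum_insert hi, DualSec.add_form, h]

@[simp] theorem Sec.sum_apply {ι : Type*} (s : Finset ι) (ψ : ι → Sec E) (x : M) :
    (∑ i ∈ s, ψ i) x = ∑ i ∈ s, ψ i x := by
  classical
  induction s using Finset.induction_on with
  | empty => simp
  | insert i s hi h =>
    rw [Finset.sum_insert hi, Finset.sum_insert hi, ContMDiffSection.coe_add, Pi.add_apply, h]

/-! ### Bump functions and frames -/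

lemma exists_bump (W : Opens M) {x : M} (hx : x ∈ W) :
    ∃ χ : GlobalFun n M, tsupport χ ⊆ W ∧ ∀ᶠ y in 𝓝 x, χ y = 1 := by
  obtain ⟨f, -, hf⟩ := (SmoothBumpFunction.nhds_basis_tsupport (I := 𝓡 n) x).mem_iff.1
    (W.isOpen.mem_nhds hx)
  exact ⟨⟨f, f.contMDiff⟩, hf, f.eventuallyEq_one⟩

lemma cutoff_smooth {W : Opens M} {χ : GlobalFun n M} (hχ : tsupport χ ⊆ W) {f : M → ℝ}
    (hf : ∀ x ∈ W, ContMDiffAt (𝓡 n) 𝓘(ℝ, ℝ) ∞ f x) :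
    ContMDiff (𝓡 n) 𝓘(ℝ, ℝ) ∞ (fun x => χ x * f x) := by
  intro x
  by_cases hx : x ∈ tsupport χ
  · exact (χ.contMDiff x).mul (hf x (hχ hx))
  · refine (contMDiffAt_const (c := (0 : ℝ))).congr_of_eventuallyEq ?_
    filter_upwards [notMem_tsupport_iff_eventuallyEq.1 hx] with y hy
    rw [hy, Pi.zero_apply, zero_mul]

/-- Global sections of `E` and of `E^*` which restrict to dual frames over `W`. -/
structure Frame (E : SmoothVB.{u, w} n M) (W : Opens M) where
  e : Fin E.rank → Sec E
  ξ : Fin E.rank → DualSec E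
  dual : ∀ y ∈ W, ∀ a b, (ξ a).form y (e b y) = if a = b then 1 else 0
  sum : ∀ y ∈ W, ∀ v, ∑ a, (ξ a).form y v • e a y = v

/-- A frame over `W` restricts to smaller open sets. -/
def Frame.restrict {W : Opens M} (F : Frame E W) {W' : Opens M} (h : W' ≤ W) : Frame E W' :=
  ⟨F.e, F.ξ, fun y hy => F.dual y (h hy), fun y hy => F.sum y (h hy)⟩

lemma exists_frame_trivializationAt (E : SmoothVB.{u, w} n M) (x : M) :
    ∃ W : Opens M, x ∈ W ∧ ∃ F : Frame E W, ∀ y ∈ W,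
      y ∈ (trivializationAt (EuclideanSpace ℝ (Fin E.rank)) E.fiber x).baseSet ∧
      ∀ v, ∑ a, v a • F.e a y =
        (trivializationAt (EuclideanSpace ℝ (Fin E.rank)) E.fiber x).symm y v := by
  let t := trivializationAt (EuclideanSpace ℝ (Fin E.rank)) E.fiber x
  let b := (EuclideanSpace.basisFun (Fin E.rank) ℝ).toBasis
  have hone : ContMDiffVectorBundle 1 (EuclideanSpace ℝ (Fin E.rank)) E.fiber (𝓡 n) :=
    ContMDiffVectorBundle.of_le (n := ∞) (by exact_mod_cast le_top)
  let U : Opens M := ⟨t.baseSet, t.open_baseSet⟩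
  obtain ⟨χ, hχ, h1⟩ := exists_bump (n := n) U (mem_baseSet_trivializationAt _ _ x)
  have hz : ∀ y, y ∉ t.baseSet → χ y = 0 := fun y hy =>
    image_eq_zero_of_notMem_tsupport fun h => hy (hχ h)
  let e : Fin E.rank → Sec E := fun a => ⟨fun y => χ y • t.localFrame b a y, by
    exact ContMDiffOn.smul_section_of_tsupport (n := ∞) (ψ := χ) (s := t.localFrame b a)
      χ.contMDiff.contMDiffOn U.isOpen hχ
      (t.contMDiffOn_localFrame_baseSet (I := 𝓡 n) ∞ b a)⟩
  let ξ : Fin E.rank → DualSec E := fun a =>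
    ⟨fun y => χ y • t.localFrameCoeff (𝓡 n) b a y, fun ψ =>
      cutoff_smooth hχ fun y hy => contMDiffAt_localFrameCoeff b hy (ψ.contMDiff y) a⟩
  obtain ⟨W, hW, hWo, hxW⟩ := eventually_nhds_iff.1 h1
  have hWU : ∀ y ∈ W, y ∈ t.baseSet := fun y hy => by
    by_contra h; have := hW y hy; rw [hz y h] at this; exact zero_ne_one this
  refine ⟨⟨W, hWo⟩, hxW, ⟨e, ξ, fun y hy a c => ?_, fun y hy v => ?_⟩, fun y hy =>
    ⟨hWU y hy, fun v => ?_⟩⟩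
  · have hyU := hWU y hy
    change (χ y • t.localFrameCoeff (𝓡 n) b a y) (χ y • t.localFrame b c y) = _
    rw [hW y hy, one_smul, one_smul,
      t.localFrameCoeff_apply_of_mem_baseSet b hyU (t.localFrame b c) a,
      t.localFrame_apply_of_mem_baseSet b hyU, Module.Basis.repr_self, Finsupp.single_apply]
    simp only [eq_comm]
  · have hyU := hWU y hy
    change ∑ a, (χ y • t.localFrameCoeff (𝓡 n) b a y) v • (χ y • t.localFrame b a y) = _
    have h2 : ∀ a, t.localFrameCoeff (𝓡 n) b a y v = (t.basisAt b hyU).repr v a := by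
      intro a
      classical
      have := t.localFrameCoeff_apply_of_mem_baseSet (I := 𝓡 n) b hyU
        (fun z => if h : y = z then h ▸ v else 0) a
      simpa using this
    simp only [hW y hy, one_smul, h2, t.localFrame_apply_of_mem_baseSet b hyU]
    exact (t.basisAt b hyU).sum_repr v
  · have hyU := hWU y hy
    change ∑ a, v a • (χ y • t.localFrame b a y) = _
    simp only [hW y hy, one_smul, t.localFrame_apply_of_mem_baseSet b hyU]
    have := congrArg (t.symm y) (b.sum_repr v)
    rw [← this, ← t.coe_symmₗ (R := ℝ) hyU, map_sum]
    refine Finset.sum_congr rfl fun a _ => ?_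
    rw [map_smul, t.symmₗ_apply (R := ℝ) hyU]
    rfl

lemma exists_frame (E : SmoothVB.{u, w} n M) (x : M) :
    ∃ W : Opens M, x ∈ W ∧ Nonempty (Frame E W) :=
  let ⟨W, hx, F, _⟩ := exists_frame_trivializationAt E x
  ⟨W, hx, ⟨F⟩⟩

lemma exists_sec (x : M) (v : E.fiber x) : ∃ ψ : Sec E, ψ x = v := by
  obtain ⟨W, hx, ⟨F⟩⟩ := exists_frame E x
  refine ⟨∑ a, (F.ξ a).form x v • F.e a, ?_⟩
  rw [Sec.sum_apply]
  exact F.sum x hx v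

lemma forall_sec {x : M} {p : E.fiber x → Prop} : (∀ e, p e) ↔ ∀ ψ : Sec E, p (ψ x) :=
  ⟨fun h ψ => h _, fun h e => by obtain ⟨ψ, rfl⟩ := exists_sec x e; exact h ψ⟩

lemma dual_ext_sec {x : M} {α β : Dual ℝ (E.fiber x)}
    (h : ∀ ψ : Sec E, α (ψ x) = β (ψ x)) : α = β := LinearMap.ext (forall_sec.2 h)

lemma vec_ext_dual {x : M} {v v' : E.fiber x}
    (h : ∀ α : DualSec E, α.form x v = α.form x v') : v = v' := by
  obtain ⟨W, hx, ⟨F⟩⟩ := exists_frame E x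
  rw [← F.sum x hx v, ← F.sum x hx v']
  simp only [h]

lemma sec_ext_dual {s s' : Sec E} (h : ∀ (α : DualSec E) x, α.form x (s x) = α.form x (s' x)) :
    s = s' := by
  ext x
  exact vec_ext_dual fun α => h α x

lemma Frame.dual_sum {W : Opens M} (F : Frame E W) {y : M} (hy : y ∈ W)
    (α : Dual ℝ (E.fiber y)) : ∑ a, α (F.e a y) • (F.ξ a).form y = α := by
  ext v
  conv_rhs => rw [← F.sum y hy v, map_sum]
  simp [LinearMap.sum_apply, mul_comm]

lemma sec_contMDiffAt {s : ∀ x, E.fiber x} {x : M}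
    (h : ∀ α : DualSec E, ContMDiffAt (𝓡 n) 𝓘(ℝ, ℝ) ∞ (fun y => α.form y (s y)) x) :
    ContMDiffAt (𝓡 n) ((𝓡 n).prod 𝓘(ℝ, EuclideanSpace ℝ (Fin E.rank))) ∞
      (fun y => TotalSpace.mk' (EuclideanSpace ℝ (Fin E.rank)) y (s y)) x := by
  obtain ⟨W, hx, ⟨F⟩⟩ := exists_frame E x
  have h1 := ContMDiffAt.sum_section (I := 𝓡 n) (n := ∞) (F := EuclideanSpace ℝ (Fin E.rank))
    (V := E.fiber) (x₀ := x) (s := Finset.univ)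
    (t := fun a : Fin E.rank => (fun y => (F.ξ a).form y (s y)) • (fun y => F.e a y))
    fun a _ => ContMDiffAt.smul_section (h (F.ξ a)) ((F.e a).contMDiff x)
  refine h1.congr_of_eventuallyEq ?_
  filter_upwards [W.isOpen.mem_nhds hx] with y hy
  congr 1
  exact (F.sum y hy (s y)).symm

/-- A family of vectors which pairs smoothly with all sections of the dual bundle. -/
def Sec.ofDual (s : ∀ x, E.fiber x)
    (h : ∀ α : DualSec E, ContMDiff (𝓡 n) 𝓘(ℝ, ℝ) ∞ (fun y => α.form y (s y))) : Sec E :=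
  ⟨s, fun x => sec_contMDiffAt fun α => h α x⟩

lemma exists_dualSec (W : Opens M) {x : M} (hx : x ∈ W) (α : ∀ y, Dual ℝ (E.fiber y))
    (hα : ∀ ψ : Sec E, ∀ y ∈ W, ContMDiffAt (𝓡 n) 𝓘(ℝ, ℝ) ∞ (fun y => α y (ψ y)) y) :
    ∃ β : DualSec E, ∀ᶠ y in 𝓝 x, β.form y = α y := by
  obtain ⟨χ, hχ, h1⟩ := exists_bump (n := n) W hx
  refine ⟨⟨fun y => χ y • α y, fun ψ => cutoff_smooth hχ fun y hy => hα ψ y hy⟩, ?_⟩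
  filter_upwards [h1] with y hy
  simp only [hy, one_smul]

lemma exists_globalFun (W : Opens M) {x : M} (hx : x ∈ W) (f : M → ℝ)
    (hf : ∀ y ∈ W, ContMDiffAt (𝓡 n) 𝓘(ℝ, ℝ) ∞ f y) :
    ∃ g : GlobalFun n M, ∀ᶠ y in 𝓝 x, g y = f y := by
  obtain ⟨χ, hχ, h1⟩ := exists_bump (n := n) W hx
  refine ⟨⟨fun y => χ y * f y, cutoff_smooth hχ hf⟩, ?_⟩
  filter_upwards [h1] with y hy
  change χ y * f y = f y
  rw [hy, one_mul]

lemma exists_bump_eq {x : M} {P : M → Prop} (h : ∀ᶠ y in 𝓝 x, P y) :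
    ∃ χ : GlobalFun n M, (∀ᶠ y in 𝓝 x, χ y = 1) ∧ ∀ y, P y ∨ χ y = 0 := by
  obtain ⟨W, hW, hWo, hx⟩ := eventually_nhds_iff.1 h
  obtain ⟨χ, hχ, h1⟩ := exists_bump (n := n) ⟨W, hWo⟩ hx
  refine ⟨χ, h1, fun y => ?_⟩
  by_cases hy : y ∈ W
  · exact Or.inl (hW y hy)
  · exact Or.inr (image_eq_zero_of_notMem_tsupport fun h => hy (hχ h))

section Tensorial

variable {N : Type*} [AddCommGroup N] [Module ℝ N] {x : M} {W : Opens M} (F : Frame E W)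
  (hx : x ∈ W)
include hx

lemma Frame.tensorial_dual {c : DualSec E → N} (hadd : ∀ α β, c (α + β) = c α + c β)
    (hsmul : ∀ (f : GlobalFun n M) α, c (f • α) = f x • c α) (α : DualSec E) :
    c α = ∑ a, α.form x (F.e a x) • c (F.ξ a) := by
  obtain ⟨χ, hχ, h1⟩ := exists_bump (n := n) W hx
  have hg : χ • α = ∑ a, (χ * ⟨fun y => α.form y (F.e a y), α.smooth (F.e a)⟩) • F.ξ a := by
    ext y : 2
    rw [DualSec.sum_form]
    change χ y • α.form y = ∑ a, (χ y * α.form y (F.e a y)) • (F.ξ a).form y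
    simp only [mul_smul, ← Finset.smul_sum]
    by_cases hy : y ∈ W
    · rw [F.dual_sum hy]
    · rw [image_eq_zero_of_notMem_tsupport fun h => hy (hχ h), zero_smul, zero_smul]
  have h2 := hsmul χ α
  rw [hg, h1.self_of_nhds, one_smul] at h2
  rw [← h2]
  refine (map_sum (AddMonoidHom.mk' c hadd) _ _).trans (Finset.sum_congr rfl fun a _ => ?_)
  refine (hsmul _ _).trans ?_
  change (χ x * _) • _ = _
  rw [h1.self_of_nhds, one_mul]
  rfl

lemma Frame.tensorial_sec {c : Sec E → N} (hadd : ∀ ψ ψ', c (ψ + ψ') = c ψ + c ψ')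
    (hsmul : ∀ (f : GlobalFun n M) ψ, c (smulSec f ψ) = f x • c ψ) (ψ : Sec E) :
    c ψ = ∑ a, (F.ξ a).form x (ψ x) • c (F.e a) := by
  obtain ⟨χ, hχ, h1⟩ := exists_bump (n := n) W hx
  have hg : smulSec χ ψ =
      ∑ a, smulSec (χ * ⟨fun y => (F.ξ a).form y (ψ y), (F.ξ a).smooth ψ⟩) (F.e a) := by
    ext y : 2
    rw [Sec.sum_apply]
    change χ y • ψ y = ∑ a, (χ y * (F.ξ a).form y (ψ y)) • F.e a y
    simp only [mul_smul, ← Finset.smul_sum]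
    by_cases hy : y ∈ W
    · rw [F.sum y hy]
    · rw [image_eq_zero_of_notMem_tsupport fun h => hy (hχ h), zero_smul, zero_smul]
  have h2 := hsmul χ ψ
  rw [hg, h1.self_of_nhds, one_smul] at h2
  rw [← h2]
  refine (map_sum (AddMonoidHom.mk' c hadd) _ _).trans (Finset.sum_congr rfl fun a _ => ?_)
  refine (hsmul _ _).trans ?_
  change (χ x * _) • _ = _
  rw [h1.self_of_nhds, one_mul]
  rfl

end Tensorial

lemma exists_linear_of_tensorial {N : Type*} [AddCommGroup N] [Module ℝ N] (x : M)
    (c : DualSec E → N) (hadd : ∀ α β, c (α + β) = c α + c β)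
    (hsmul : ∀ (f : GlobalFun n M) α, c (f • α) = f x • c α) :
    ∃ C : Dual ℝ (E.fiber x) →ₗ[ℝ] N, ∀ α, C (α.form x) = c α := by
  obtain ⟨W, hx, ⟨F⟩⟩ := exists_frame E x
  refine ⟨∑ a, (Dual.eval ℝ _ (F.e a x)).smulRight (c (F.ξ a)), fun α => ?_⟩
  rw [F.tensorial_dual hx hadd hsmul, LinearMap.sum_apply]
  rfl

lemma exists_vec_of_tensorial (x : M) (c : DualSec E → ℝ)
    (hadd : ∀ α β, c (α + β) = c α + c β)
    (hsmul : ∀ (f : GlobalFun n M) α, c (f • α) = f x * c α) :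
    ∃ v : E.fiber x, ∀ α, c α = α.form x v := by
  obtain ⟨W, hx, ⟨F⟩⟩ := exists_frame E x
  refine ⟨∑ a, c (F.ξ a) • F.e a x, fun α => ?_⟩
  rw [F.tensorial_dual hx hadd hsmul]
  simp [mul_comm]

lemma exists_dual_of_tensorial (x : M) (c : Sec E → ℝ)
    (hadd : ∀ ψ ψ', c (ψ + ψ') = c ψ + c ψ')
    (hsmul : ∀ (f : GlobalFun n M) ψ, c (smulSec f ψ) = f x * c ψ) :
    ∃ α : Dual ℝ (E.fiber x), ∀ ψ, c ψ = α (ψ x) := by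
  obtain ⟨W, hx, ⟨F⟩⟩ := exists_frame E x
  refine ⟨∑ a, c (F.e a) • (F.ξ a).form x, fun ψ => ?_⟩
  rw [F.tensorial_sec hx hadd hsmul]
  simp [LinearMap.sum_apply, mul_comm]

lemma exists_sec_of_tensorial (c : DualSec E → M → ℝ)
    (hc : ∀ α, ContMDiff (𝓡 n) 𝓘(ℝ, ℝ) ∞ (c α))
    (hadd : ∀ α β x, c (α + β) x = c α x + c β x)
    (hsmul : ∀ (f : GlobalFun n M) α x, c (f • α) x = f x * c α x) :
    ∃ s : Sec E, ∀ α x, c α x = α.form x (s x) := by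
  choose s hs using fun x => exists_vec_of_tensorial x (fun α => c α x)
    (fun α β => hadd α β x) (fun f α => hsmul f α x)
  refine ⟨Sec.ofDual s fun α => ?_, fun α x => hs x α⟩
  simpa only [← hs] using hc α

section Maps

variable {W1 : Type v} {W2 : Type v'} [AddCommGroup W1] [Module ℝ W1] [AddCommGroup W2]
  [Module ℝ W2] {W1' : Type w} {W2' : Type w'} [AddCommGroup W1'] [Module ℝ W1'] [AddCommGroup W2']
  [Module ℝ W2']

lemma grDeg_two_comm {b : GrAlg W1 W2} (hb : b ∈ grDeg W1 W2 2) (a : GrAlg W1 W2) :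
    b * a = a * b := by
  induction a using grAlg_induction with
  | one => simp
  | add x y hx hy => rw [mul_add, add_mul, hx, hy]
  | smul c x hx => rw [mul_smul_comm, hx, smul_mul_assoc]
  | mul_one w x hx =>
    rw [mul_assoc, ← hx, ← mul_assoc, ← mul_assoc, ιOne_comm w hb]
    norm_num
  | mul_two w x hx => rw [mul_assoc, ← hx, ← mul_assoc, ← mul_assoc, ιTwo_comm]

lemma ιOneL_comp_sq (f : W1 →ₗ[ℝ] W1') (a : W1) :
    ((ιOneL : W1' →ₗ[ℝ] GrAlg W1' W2') ∘ₗ f) a * ((ιOneL : W1' →ₗ[ℝ] GrAlg W1' W2') ∘ₗ f) a = 0 :=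
  ιOne_mul_self (f a)

lemma two_comm (g : W2 →ₗ[ℝ] GrAlg W1' W2') (hg : ∀ b, g b ∈ grDeg W1' W2' 2) (b : W2)
    (x : GrAlg W1' W2') : g b * x = x * g b := grDeg_two_comm (hg b) x

/-- The homomorphism with given linear values on the generators of degree one and given values of
degree two on the generators of degree two. -/
def grGen (f : W1 →ₗ[ℝ] W1') (g : W2 →ₗ[ℝ] GrAlg W1' W2') (hg : ∀ b, g b ∈ grDeg W1' W2' 2) :
    GrAlg W1 W2 →ₐ[ℝ] GrAlg W1' W2' :=
  grLift (ιOneL ∘ₗ f) (ιOneL_comp_sq f) g (two_comm g hg)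

variable (f : W1 →ₗ[ℝ] W1') (g : W2 →ₗ[ℝ] GrAlg W1' W2') (hg : ∀ b, g b ∈ grDeg W1' W2' 2)

@[simp] theorem grGen_ιOne (a : W1) : grGen f g hg (ιOne a) = ιOne (f a) := by
  rw [grGen, grLift_ιOne]; rfl

@[simp] theorem grGen_ιTwo (b : W2) : grGen f g hg (ιTwo b) = g b := by
  rw [grGen, grLift_ιTwo]

lemma map_mem_grDeg {Φ : GrAlg W1 W2 →ₐ[ℝ] GrAlg W1' W2'}
    (h₁ : ∀ a, Φ (ιOne a) ∈ grDeg W1' W2' 1) (h₂ : ∀ b, Φ (ιTwo b) ∈ grDeg W1' W2' 2) {k : ℕ}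
    {a : GrAlg W1 W2} (ha : a ∈ grDeg W1 W2 k) : Φ a ∈ grDeg W1' W2' k := by
  refine grDeg_induction (P := fun k a => Φ a ∈ grDeg W1' W2' k) ?_ ?_ ?_ ?_ ?_ ?_ ha
  · rw [map_one]; exact one_mem_grDeg_zero
  · intro k x y hx hy; rw [map_add]; exact Submodule.add_mem _ hx hy
  · intro k c x hx; rw [map_smul]; exact Submodule.smul_mem _ _ hx
  · intro k; rw [map_zero]; exact zero_mem _
  · intro k w x _ hx; rw [map_mul, add_comm]; exact mul_mem_grDeg (h₁ w) hx
  · intro k w x _ hx; rw [map_mul, add_comm]; exact mul_mem_grDeg (h₂ w) hx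

lemma grGen_mem {k : ℕ} {a : GrAlg W1 W2} (ha : a ∈ grDeg W1 W2 k) :
    grGen f g hg a ∈ grDeg W1' W2' k :=
  map_mem_grDeg (fun a => by rw [grGen_ιOne]; exact ιOne_mem_grDeg _)
    (fun b => by rw [grGen_ιTwo]; exact hg b) ha

/-- Functoriality of the free graded-commutative algebra. -/
def grMap (f : W1 →ₗ[ℝ] W1') (g : W2 →ₗ[ℝ] W2') : GrAlg W1 W2 →ₐ[ℝ] GrAlg W1' W2' :=
  grGen f (ιTwoL ∘ₗ g) fun b => ιTwo_mem_grDeg (g b)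

@[simp] theorem grMap_ιOne (f : W1 →ₗ[ℝ] W1') (g : W2 →ₗ[ℝ] W2') (a : W1) :
    grMap f g (ιOne a) = ιOne (f a) := grGen_ιOne _ _ _ a

@[simp] theorem grMap_ιTwo (f : W1 →ₗ[ℝ] W1') (g : W2 →ₗ[ℝ] W2') (b : W2) :
    grMap f g (ιTwo b) = ιTwo (g b) := grGen_ιTwo _ _ _ b

lemma grMap_mem (f : W1 →ₗ[ℝ] W1') (g : W2 →ₗ[ℝ] W2') {k : ℕ} {a : GrAlg W1 W2}
    (ha : a ∈ grDeg W1 W2 k) : grMap f g a ∈ grDeg W1' W2' k := grGen_mem _ _ _ ha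

instance grDeg_free (k : ℕ) : Module.Free ℝ (grDeg W1 W2 k) :=
  @Module.Free.of_divisionRing ℝ (grDeg W1 W2 k) _ (Submodule.addCommGroup _) _

end Maps

section Coordinates

/-- Evaluation of smooth functions at a point. -/
def evalFun {U : Opens M} (y : U) : SmoothFun n U →ₐ[ℝ] ℝ where
  toFun f := f y
  map_one' := rfl
  map_mul' _ _ := rfl
  map_zero' := rfl
  map_add' _ _ := rfl
  commutes' _ := rfl

@[simp] theorem evalFun_apply {U : Opens M} (y : U) (f : SmoothFun n U) : evalFun y f = f y := rfl

variable {r s : ℕ}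

/-- The value of an element of the coordinate algebra at a point. -/
def coordVal {U : Opens M} (y : U) : CoordAlg n r s U →ₐ[ℝ] FinGrAlg r s :=
  (Algebra.TensorProduct.lid ℝ _).toAlgHom.comp
    (Algebra.TensorProduct.map (evalFun y) (AlgHom.id ℝ _))

@[simp] theorem coordVal_tmul {U : Opens M} (y : U) (f : SmoothFun n U)
    (g : FinGrAlg r s) :
    coordVal y (f ⊗ₜ[ℝ] g : CoordAlg n r s U) = f y • g := by
  simp [coordVal]

lemma coordVal_res {U W : Opens M} (h : W ≤ U) (y : W) (τ : CoordAlg n r s U) :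
    coordVal y (resCoord r s h τ) = coordVal ⟨y.1, h y.2⟩ τ := by
  induction τ using TensorProduct.induction_on with
  | zero => simp
  | tmul f g =>
    simp only [resCoord, Algebra.TensorProduct.map_tmul, coordVal_tmul]
    rfl
  | add a b ha hb => rw [map_add, map_add, ha, hb, map_add]

lemma coordVal_injective {U : Opens M} {τ τ' : CoordAlg n r s U}
    (h : ∀ y, coordVal y τ = coordVal y τ') : τ = τ' := by
  rw [← sub_eq_zero]
  have h0 : ∀ y, coordVal y (τ - τ') = 0 := fun y => by rw [map_sub, h, sub_self]
  generalize τ - τ' = c at h0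
  let bs := Module.Free.chooseBasis ℝ (FinGrAlg r s)
  obtain ⟨f, rfl⟩ := TensorProduct.eq_repr_basis_right bs c
  refine Finset.sum_eq_zero fun i hi => ?_
  have : f i = 0 := by
    ext y
    have hv := congrArg (fun z => bs.repr z i) (h0 y)
    simp only [Finsupp.sum, map_sum, coordVal_tmul, map_smul, Module.Basis.repr_self, map_zero,
      Finsupp.coe_finsetSum, Finset.sum_apply, Finsupp.smul_apply, Finsupp.single_apply,
      Finsupp.coe_zero, Pi.zero_apply, smul_ite, smul_zero] at hv
    simpa [Finset.sum_ite_eq', Finsupp.mem_support_iff.1 hi] using hv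
  simp [this]

lemma coordVal_smooth {U : Opens M} (τ : CoordAlg n r s U)
    (φ : FinGrAlg r s →ₗ[ℝ] ℝ) :
    ContMDiff (𝓡 n) 𝓘(ℝ, ℝ) ∞ (fun y : U => φ (coordVal y τ)) := by
  induction τ using TensorProduct.induction_on with
  | zero => simpa using contMDiff_const
  | tmul f g =>
    simp only [coordVal_tmul, map_smul, smul_eq_mul]
    exact f.contMDiff.mul contMDiff_const
  | add a b ha hb => exact (ha.add hb).congr fun y => by simp

lemma coordVal_mem {U : Opens M} {k : ℕ} {τ : CoordAlg n r s U} (hτ : τ ∈ coordDeg n r s U k)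
    (y : U) : coordVal y τ ∈ grDeg (Fin r → ℝ) (Fin s → ℝ) k := by
  have : coordDeg n r s U k ≤ (grDeg (Fin r → ℝ) (Fin s → ℝ) k).comap
      (coordVal (r := r) (s := s) y).toLinearMap :=
    Submodule.map₂_le.2 fun f _ g hg => by
      rw [Submodule.mem_comap, AlgHom.toLinearMap_apply, TensorProduct.mk_apply, coordVal_tmul]
      exact Submodule.smul_mem _ _ hg
  exact this hτ

lemma exists_grDeg_basis (k : ℕ) : ∃ (ι : Type) (_ : Fintype ι)
    (φ : ι → FinGrAlg r s →ₗ[ℝ] ℝ) (b : ι → FinGrAlg r s),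
      (∀ i, b i ∈ grDeg (Fin r → ℝ) (Fin s → ℝ) k) ∧
        ∀ a ∈ grDeg (Fin r → ℝ) (Fin s → ℝ) k, ∑ i, φ i a • b i = a := by
  let B := Module.finBasis ℝ (grDeg (Fin r → ℝ) (Fin s → ℝ) k)
  choose φ hφ using fun i => LinearMap.exists_extend (B.coord i)
  refine ⟨_, inferInstance, φ, fun i => ((B i).1 : GrAlg _ _), fun i => (B i).2, fun a ha => ?_⟩
  have h1 := congrArg Subtype.val (B.sum_repr ⟨a, ha⟩)
  rw [AddSubmonoidClass.coe_finsetSum] at h1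
  refine Eq.trans (Finset.sum_congr rfl fun i _ => ?_) h1
  exact congrArg (fun c : ℝ => c • ((B i).1 : GrAlg _ _)) (DFunLike.congr_fun (hφ i) ⟨a, ha⟩)

lemma exists_coord_mem {U : Opens M} {k : ℕ} (f : U → FinGrAlg r s)
    (hk : ∀ y, f y ∈ grDeg (Fin r → ℝ) (Fin s → ℝ) k)
    (hf : ∀ φ : FinGrAlg r s →ₗ[ℝ] ℝ,
      ContMDiff (𝓡 n) 𝓘(ℝ, ℝ) ∞ (fun y : U => φ (f y))) :
    ∃ τ ∈ coordDeg n r s U k, ∀ y, coordVal y τ = f y := by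
  obtain ⟨ι, _, φ, b, hb, h⟩ := exists_grDeg_basis (r := r) (s := s) k
  refine ⟨∑ i, (⟨fun y => φ i (f y), hf (φ i)⟩ : SmoothFun n U) ⊗ₜ[ℝ] b i,
    Submodule.sum_mem _ fun i _ => Submodule.apply_mem_map₂ _ trivial (hb i), fun y => ?_⟩
  rw [map_sum, ← h (f y) (hk y)]
  exact Finset.sum_congr rfl fun i _ => coordVal_tmul _ _ _

lemma mem_coordDeg_iff {U : Opens M} {k : ℕ} {τ : CoordAlg n r s U} :
    τ ∈ coordDeg n r s U k ↔ ∀ y, coordVal y τ ∈ grDeg (Fin r → ℝ) (Fin s → ℝ) k := by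
  refine ⟨fun h y => coordVal_mem h y, fun h => ?_⟩
  obtain ⟨τ', hτ', he⟩ := exists_coord_mem (n := n) (fun y => coordVal y τ) h
    fun φ => coordVal_smooth τ φ
  rwa [← coordVal_injective he]

end Coordinates

section SplitSheaf

/-- The value of a function on `E[1] ⊕ V[2]` at a point, as a homomorphism. -/
def valHom {U : Opens M} (x : U) : 𝒪[E,V].A U →ₐ[ℝ] FibAlg E V x.1 where
  toFun a := a.1 x
  map_one' := rfl
  map_mul' _ _ := rfl
  map_zero' := rfl
  map_add' _ _ := rfl
  commutes' _ := rfl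

lemma split_ext {U : Opens M} {a b : 𝒪[E,V].A U} (h : ∀ x, valHom x a = valHom x b) :
    a = b := Subtype.ext (funext h)

lemma valHom_res {U W : Opens M} (h : W ≤ U) (a : 𝒪[E,V].A U) (x : W) :
    valHom x (𝒪[E,V].res h a) = valHom ⟨x.1, h x.2⟩ a := rfl

lemma mem_splitDeg {U : Opens M} {k : ℕ} {a : 𝒪[E,V].A U} :
    a ∈ 𝒪[E,V].deg U k ↔ ∀ x, valHom x a ∈ grDeg _ _ k := Iff.rfl

@[simp] theorem splitVal_add (a b : 𝒪[E,V].A ⊤) (x : M) :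
    splitVal (a + b) x = splitVal a x + splitVal b x := rfl
@[simp] theorem splitVal_mul (a b : 𝒪[E,V].A ⊤) (x : M) :
    splitVal (a * b) x = splitVal a x * splitVal b x := rfl
@[simp] theorem splitVal_smul (c : ℝ) (a : 𝒪[E,V].A ⊤) (x : M) :
    splitVal (c • a) x = c • splitVal a x := rfl
@[simp] theorem splitVal_one (x : M) : splitVal (1 : 𝒪[E,V].A ⊤) x = 1 := rfl
@[simp] theorem splitVal_zero (x : M) : splitVal (0 : 𝒪[E,V].A ⊤) x = 0 := rfl
@[simp] theorem splitVal_ofFun (f : GlobalFun n M) (x : M) :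
    splitVal (ofFun E V f) x = algebraMap ℝ (FibAlg E V x) (f x) := rfl
@[simp] theorem splitVal_ofDualE (α : DualSec E) (x : M) :
    splitVal (ofDualE E V α) x = ιOne (α.form x) := rfl
@[simp] theorem splitVal_ofDualV (β : DualSec V) (x : M) :
    splitVal (ofDualV E V β) x = ιTwo (β.form x) := rfl

@[simp] theorem splitVal_sum {ι : Type*} (s : Finset ι) (a : ι → 𝒪[E,V].A ⊤) (x : M) :
    splitVal (∑ i ∈ s, a i) x = ∑ i ∈ s, splitVal (a i) x :=
  map_sum (valHom (⟨x, trivial⟩ : (⊤ : Opens M))) a s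

lemma splitVal_ext {a b : 𝒪[E,V].A ⊤} (h : ∀ x, splitVal a x = splitVal b x) :
    a = b := split_ext fun x => h x.1

lemma ofFun_mem (f : GlobalFun n M) : ofFun E V f ∈ 𝒪[E,V].deg ⊤ 0 :=
  fun x => one_mem_grDeg (f x.1)

lemma ofDualE_mem (α : DualSec E) : ofDualE E V α ∈ 𝒪[E,V].deg ⊤ 1 :=
  fun x => ιOne_mem_grDeg (α.form x.1)

lemma ofDualV_mem (β : DualSec V) : ofDualV E V β ∈ 𝒪[E,V].deg ⊤ 2 :=
  fun x => ιTwo_mem_grDeg (β.form x.1)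

variable (E V) in
/-- The global smooth functions and sections of `E^*` and `V^*`. -/
def globalGens : Set (𝒪[E,V].A ⊤) :=
  Set.range (ofFun E V) ∪ Set.range (ofDualE E V) ∪ Set.range (ofDualV E V)

/-- Smoothness at a point: near the point, the section is a polynomial expression in global
generators. -/
def SmoothAt (f : ∀ y, FibAlg E V y) (x : M) : Prop :=
  ∃ a ∈ Algebra.adjoin ℝ (globalGens E V), ∀ᶠ y in 𝓝 x, f y = splitVal a y

variable {f g : ∀ y, FibAlg E V y} {x : M}

lemma SmoothAt.add (hf : SmoothAt f x) (hg : SmoothAt g x) : SmoothAt (fun y => f y + g y) x := by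
  obtain ⟨a, ha, hfa⟩ := hf
  obtain ⟨b, hb, hgb⟩ := hg
  exact ⟨a + b, add_mem ha hb, by filter_upwards [hfa, hgb] with y h1 h2; rw [h1, h2, splitVal_add]⟩

lemma SmoothAt.mul (hf : SmoothAt f x) (hg : SmoothAt g x) : SmoothAt (fun y => f y * g y) x := by
  obtain ⟨a, ha, hfa⟩ := hf
  obtain ⟨b, hb, hgb⟩ := hg
  exact ⟨a * b, mul_mem ha hb, by filter_upwards [hfa, hgb] with y h1 h2; rw [h1, h2, splitVal_mul]⟩

lemma SmoothAt.smul (c : ℝ) (hf : SmoothAt f x) : SmoothAt (fun y => c • f y) x := by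
  obtain ⟨a, ha, hfa⟩ := hf
  exact ⟨c • a, Subalgebra.smul_mem _ ha c, by
    filter_upwards [hfa] with y h1; rw [h1, splitVal_smul]⟩

lemma SmoothAt.congr (hf : SmoothAt f x) (h : ∀ᶠ y in 𝓝 x, g y = f y) : SmoothAt g x := by
  obtain ⟨a, ha, hfa⟩ := hf
  exact ⟨a, ha, by filter_upwards [hfa, h] with y h1 h2; rw [h2, h1]⟩

lemma smoothAt_adjoin {a : 𝒪[E,V].A ⊤} (ha : a ∈ Algebra.adjoin ℝ (globalGens E V)) :
    SmoothAt (splitVal a) x := ⟨a, ha, Eventually.of_forall fun _ => rfl⟩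

lemma smoothAt_ofFun (f : GlobalFun n M) :
    SmoothAt (fun y => algebraMap ℝ (FibAlg E V y) (f y)) x :=
  smoothAt_adjoin (Algebra.subset_adjoin (Or.inl (Or.inl ⟨f, rfl⟩)))

lemma smoothAt_ofDualE (α : DualSec E) : SmoothAt (V := V) (fun y => ιOne (α.form y)) x :=
  smoothAt_adjoin (Algebra.subset_adjoin (Or.inl (Or.inr ⟨α, rfl⟩)))

lemma smoothAt_ofDualV (β : DualSec V) : SmoothAt (E := E) (fun y => ιTwo (β.form y)) x :=
  smoothAt_adjoin (Algebra.subset_adjoin (Or.inr ⟨β, rfl⟩))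

lemma smoothAt_zero : SmoothAt (fun y => (0 : FibAlg E V y)) x :=
  ⟨0, zero_mem _, Eventually.of_forall fun _ => rfl⟩

lemma smoothAt_const (c : ℝ) : SmoothAt (fun y => algebraMap ℝ (FibAlg E V y) c) x :=
  smoothAt_adjoin (a := algebraMap ℝ _ c) (Subalgebra.algebraMap_mem _ c)

lemma SmoothAt.sum {ι : Type*} (s : Finset ι) {f : ι → ∀ y, FibAlg E V y}
    (h : ∀ i ∈ s, SmoothAt (f i) x) : SmoothAt (fun y => ∑ i ∈ s, f i y) x := by
  classical
  induction s using Finset.induction_on with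
  | empty => simpa using smoothAt_zero
  | insert i s hi ih =>
    simp only [Finset.sum_insert hi]
    exact (h i (Finset.mem_insert_self i s)).add (ih fun j hj => h j (Finset.mem_insert_of_mem hj))

lemma SmoothAt.fun_smul {W : Opens M} (hx : x ∈ W) {c : M → ℝ}
    (hc : ∀ y ∈ W, ContMDiffAt (𝓡 n) 𝓘(ℝ, ℝ) ∞ c y) (hf : SmoothAt f x) :
    SmoothAt (fun y => c y • f y) x := by
  obtain ⟨g, hg⟩ := exists_globalFun W hx c hc
  refine ((smoothAt_ofFun g).mul hf).congr ?_
  filter_upwards [hg] with y hy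
  rw [hy, Algebra.algebraMap_eq_smul_one, smul_mul_assoc, one_mul]

open scoped Classical in
/-- Extension by zero. -/
def extZero {U : Opens M} (f : ∀ x : U, FibAlg E V x.1) (x : M) : FibAlg E V x :=
  if h : x ∈ U then f ⟨x, h⟩ else 0

lemma extZero_of_mem {U : Opens M} (f : ∀ x : U, FibAlg E V x.1) {x : M} (h : x ∈ U) :
    extZero f x = f ⟨x, h⟩ := dif_pos h

lemma contMDiffAt_of_opens {W : Opens M} {c : W → ℝ} (hc : ContMDiff (𝓡 n) 𝓘(ℝ, ℝ) ∞ c)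
    {c' : M → ℝ} (h : ∀ y : W, c' y = c y) : ∀ y ∈ W, ContMDiffAt (𝓡 n) 𝓘(ℝ, ℝ) ∞ c' y := by
  intro y hy
  have := (contMDiffAt_subtype_iff (n := ∞) (I := 𝓡 n) (I' := 𝓘(ℝ, ℝ)) (U := W) (f := c')
    (x := ⟨y, hy⟩)).1
  refine this ?_
  have h2 : (fun x : W => c' x) = c := funext h
  rw [h2]
  exact hc _

lemma isSmoothSplit_iff {U : Opens M} {f : ∀ x : U, FibAlg E V x.1} :
    IsSmoothSplit E V U f ↔ ∀ x : U, SmoothAt (extZero f) x.1 := by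
  constructor
  · intro hf x
    obtain ⟨W, hW, hx, hm⟩ := hf x
    have key : ∀ g ∈ Algebra.adjoin ℝ (splitGens E V W), SmoothAt (extZero g) x.1 := by
      intro g hg
      induction hg using Algebra.adjoin_induction with
      | mem g hg =>
        rcases hg with (⟨c, rfl⟩ | ⟨α, hα, rfl⟩) | ⟨β, hβ, rfl⟩
        · classical
          obtain ⟨c', hc'⟩ := exists_globalFun W hx (fun y => if h : y ∈ W then c ⟨y, h⟩ else 0)
            (contMDiffAt_of_opens c.contMDiff fun y => dif_pos y.2)
          refine (smoothAt_ofFun c').congr ?_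
          filter_upwards [hc', W.isOpen.mem_nhds hx] with y hy hyW
          rw [hy, extZero_of_mem _ hyW, dif_pos (show y ∈ W from hyW)]
        · classical
          obtain ⟨c', hc'⟩ := exists_dualSec W hx
            (fun y => if h : y ∈ W then α ⟨y, h⟩ else 0)
            fun ψ => contMDiffAt_of_opens (hα ψ) fun y => by rw [dif_pos y.2]
          refine (smoothAt_ofDualE c').congr ?_
          filter_upwards [hc', W.isOpen.mem_nhds hx] with y hy hyW
          rw [hy, extZero_of_mem _ hyW, dif_pos (show y ∈ W from hyW)]
        · classical
          obtain ⟨c', hc'⟩ := exists_dualSec W hx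
            (fun y => if h : y ∈ W then β ⟨y, h⟩ else 0)
            fun ψ => contMDiffAt_of_opens (hβ ψ) fun y => by rw [dif_pos y.2]
          refine (smoothAt_ofDualV c').congr ?_
          filter_upwards [hc', W.isOpen.mem_nhds hx] with y hy hyW
          rw [hy, extZero_of_mem _ hyW, dif_pos (show y ∈ W from hyW)]
      | algebraMap c =>
        refine (smoothAt_const c).congr ?_
        filter_upwards [W.isOpen.mem_nhds hx] with y hyW
        rw [extZero_of_mem _ hyW]; rfl
      | add a b _ _ ha hb =>
        refine (ha.add hb).congr ?_
        filter_upwards [W.isOpen.mem_nhds hx] with y hyW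
        simp only [extZero_of_mem _ (show y ∈ W from hyW), Pi.add_apply]
      | mul a b _ _ ha hb =>
        refine (ha.mul hb).congr ?_
        filter_upwards [W.isOpen.mem_nhds hx] with y hyW
        simp only [extZero_of_mem _ (show y ∈ W from hyW), Pi.mul_apply]
    refine (key _ hm).congr ?_
    filter_upwards [W.isOpen.mem_nhds hx] with y hyW
    rw [extZero_of_mem _ (show y ∈ W from hyW), extZero_of_mem _ (hW hyW)]
  · intro hf x
    obtain ⟨a, ha, hfa⟩ := hf x
    obtain ⟨W, hW, hWo, hx⟩ := eventually_nhds_iff.1 hfa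
    refine ⟨⟨W, hWo⟩ ⊓ U, inf_le_right, ⟨hx, x.2⟩, ?_⟩
    have h1 : a.1 ∈ Algebra.adjoin ℝ (splitGens E V ⊤) := by
      have : Algebra.adjoin ℝ (globalGens E V) ≤
          (Algebra.adjoin ℝ (splitGens E V ⊤)).comap (splitAlg E V ⊤).val := by
        refine Algebra.adjoin_le ?_
        rintro _ ((⟨c, rfl⟩ | ⟨α, rfl⟩) | ⟨β, rfl⟩)
        · exact Algebra.subset_adjoin (Or.inl (Or.inl
            ⟨⟨fun x => c x, c.contMDiff.comp contMDiff_subtype_val⟩, rfl⟩))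
        · exact Algebra.subset_adjoin (Or.inl (Or.inr
            ⟨fun x => α.form x, fun ψ => (α.smooth ψ).comp contMDiff_subtype_val, rfl⟩))
        · exact Algebra.subset_adjoin (Or.inr
            ⟨fun x => β.form x, fun v => (β.smooth v).comp contMDiff_subtype_val, rfl⟩)
      exact this ha
    have h2 := resPi_adjoin E V (le_top : (⟨W, hWo⟩ ⊓ U : Opens M) ≤ ⊤) h1
    convert h2 using 1
    funext y
    have := hW y.1 y.2.1
    rw [extZero_of_mem _ y.2.2] at this
    exact this

lemma SmoothAt.isSmoothSplit {U : Opens M} (hf : ∀ x ∈ U, SmoothAt f x) :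
    IsSmoothSplit E V U fun x => f x.1 := by
  refine isSmoothSplit_iff.2 fun x => (hf x.1 x.2).congr ?_
  filter_upwards [U.isOpen.mem_nhds x.2] with y hy
  rw [extZero_of_mem _ hy]

/-- A smooth section of homogeneous elements, as a function on `E[1] ⊕ V[2]`. -/
def ofHom (U : Opens M) (k : ℕ) (f : ∀ x : U, FibAlg E V x.1) (hf : IsSmoothSplit E V U f)
    (hk : ∀ x, f x ∈ grDeg _ _ k) : 𝒪[E,V].A U :=
  ⟨f, Algebra.subset_adjoin ⟨hf, k, hk⟩⟩

@[simp] theorem valHom_ofHom {U : Opens M} {k : ℕ} {f : ∀ x : U, FibAlg E V x.1}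
    (hf : IsSmoothSplit E V U f) (hk : ∀ x, f x ∈ grDeg _ _ k) (x : U) :
    valHom x (ofHom U k f hf hk) = f x := rfl

lemma smooth_of_mem {U : Opens M} {f : ∀ x : U, FibAlg E V x.1} (hf : f ∈ splitAlg E V U) :
    IsSmoothSplit E V U f := by
  rw [isSmoothSplit_iff]
  intro x
  induction hf using Algebra.adjoin_induction with
  | mem g hg => exact isSmoothSplit_iff.1 hg.1 x
  | algebraMap c =>
    refine (smoothAt_const c).congr ?_
    filter_upwards [U.isOpen.mem_nhds x.2] with y hyW
    rw [extZero_of_mem _ hyW]; rfl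
  | add a b _ _ ha hb =>
    refine (ha.add hb).congr ?_
    filter_upwards [U.isOpen.mem_nhds x.2] with y hyW
    simp only [extZero_of_mem _ (show y ∈ U from hyW), Pi.add_apply]
  | mul a b _ _ ha hb =>
    refine (ha.mul hb).congr ?_
    filter_upwards [U.isOpen.mem_nhds x.2] with y hyW
    simp only [extZero_of_mem _ (show y ∈ U from hyW), Pi.mul_apply]

lemma smoothAt_val {U : Opens M} (a : 𝒪[E,V].A U) (x : U) :
    SmoothAt (extZero a.1) x.1 := isSmoothSplit_iff.1 (smooth_of_mem a.2) x

lemma smoothAt_splitVal (a : 𝒪[E,V].A ⊤) (x : M) : SmoothAt (splitVal a) x := by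
  refine (smoothAt_val a ⟨x, trivial⟩).congr (Eventually.of_forall fun y => ?_)
  rw [extZero_of_mem _ (show y ∈ (⊤ : Opens M) from trivial)]; rfl

lemma exists_global {U : Opens M} (a : 𝒪[E,V].A U) (x : U) :
    ∃ b ∈ Algebra.adjoin ℝ (globalGens E V), ∀ᶠ y in 𝓝 x.1, ∀ h : y ∈ U,
      valHom ⟨y, h⟩ a = splitVal b y := by
  obtain ⟨b, hb, h⟩ := smoothAt_val a x
  refine ⟨b, hb, ?_⟩
  filter_upwards [h] with y hy hyU
  rw [← hy, extZero_of_mem _ hyU]; rfl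

lemma adjoin_global_induction {P : 𝒪[E,V].A ⊤ → Prop} (one : P 1)
    (add : ∀ a b, P a → P b → P (a + b)) (smul : ∀ (c : ℝ) a, P a → P (c • a))
    (mul_fun : ∀ f a, P a → P (ofFun E V f * a))
    (mul_one : ∀ α a, P a → P (ofDualE E V α * a))
    (mul_two : ∀ β a, P a → P (ofDualV E V β * a)) {a : 𝒪[E,V].A ⊤}
    (ha : a ∈ Algebra.adjoin ℝ (globalGens E V)) : P a := by
  have hm : ∀ m ∈ Submonoid.closure (globalGens E V), P m := by
    intro m hm
    induction hm using Submonoid.closure_induction_left with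
    | one => exact one
    | mul_left g hg m _ h =>
      rcases hg with (⟨f, rfl⟩ | ⟨α, rfl⟩) | ⟨β, rfl⟩
      exacts [mul_fun f m h, mul_one α m h, mul_two β m h]
  have ha' : a ∈ Submodule.span ℝ (Submonoid.closure (globalGens E V) : Set _) := by
    rw [← Algebra.adjoin_eq_span]; exact ha
  clear ha
  induction ha' using Submodule.span_induction with
  | mem m h => exact hm m h
  | zero => simpa using smul 0 1 one
  | add a b _ _ h1 h2 => exact add a b h1 h2
  | smul c a _ h => exact smul c a h

instance split_gradedMonoid (U : Opens M) : SetLike.GradedMonoid (𝒪[E,V].deg U) where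
  one_mem := fun _ => one_mem_grDeg_zero
  mul_mem := fun _ _ _ _ ha hb x => mul_mem_grDeg (ha x) (hb x)

lemma iSup_splitDeg (U : Opens M) : ⨆ k, 𝒪[E,V].deg U k = ⊤ := by
  rw [Submodule.iSup_eq_toSubmodule_range]
  refine eq_top_iff.2 fun a _ => ?_
  have key : ∀ f (hf : f ∈ splitAlg E V U), (⟨f, hf⟩ : 𝒪[E,V].A U) ∈
      (DirectSum.coeAlgHom (𝒪[E,V].deg U)).range := by
    intro f hf
    induction hf using Algebra.adjoin_induction with
    | mem g hg =>
      obtain ⟨hs, k, hk⟩ := hg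
      exact ⟨DirectSum.of (fun k => 𝒪[E,V].deg U k) k
        ⟨⟨g, Algebra.subset_adjoin ⟨hs, k, hk⟩⟩, hk⟩, DirectSum.coeAlgHom_of _ _ _⟩
    | algebraMap c => exact (DirectSum.coeAlgHom (𝒪[E,V].deg U)).range.algebraMap_mem c
    | add a b _ _ ha hb => exact add_mem ha hb
    | mul a b _ _ ha hb => exact mul_mem ha hb
  exact key a.1 a.2

lemma split_internal (U : Opens M) : DirectSum.IsInternal (𝒪[E,V].deg U) := by
  refine isInternal_of_sum _ (fun s a ha h k hk => ?_) (iSup_splitDeg U)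
  refine split_ext fun x => ?_
  have := congrArg (valHom x) h
  rw [map_sum, map_zero] at this
  rw [map_zero]
  exact grDeg_sum_eq_zero (fun k => ha k x) this k hk

lemma homogeneous_induction {U : Opens M} {P : 𝒪[E,V].A U → Prop}
    (hom : ∀ k, ∀ a ∈ 𝒪[E,V].deg U k, P a) (add : ∀ a b, P a → P b → P (a + b))
    (a : 𝒪[E,V].A U) : P a := by
  have ha : a ∈ ⨆ k, 𝒪[E,V].deg U k := by rw [iSup_splitDeg]; trivial
  induction ha using Submodule.iSup_induction' with
  | mem k a ha => exact hom k a ha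
  | zero => exact hom 0 0 (zero_mem _)
  | add a b _ _ h1 h2 => exact add a b h1 h2

end SplitSheaf

lemma grMap_grMap_of_id {W1 : Type v} {W2 : Type v'} [AddCommGroup W1] [Module ℝ W1]
    [AddCommGroup W2] [Module ℝ W2] {W1' : Type w} {W2' : Type w'} [AddCommGroup W1']
    [Module ℝ W1'] [AddCommGroup W2'] [Module ℝ W2'] {f : W1 →ₗ[ℝ] W1'} {g : W2 →ₗ[ℝ] W2'}
    {f' : W1' →ₗ[ℝ] W1} {g' : W2' →ₗ[ℝ] W2} (hf : f' ∘ₗ f = LinearMap.id)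
    (hg : g' ∘ₗ g = LinearMap.id) (a : GrAlg W1 W2) : grMap f' g' (grMap f g a) = a := by
  have : (grMap f' g').comp (grMap f g) = AlgHom.id ℝ (GrAlg W1 W2) :=
    grAlg_hom_ext
      (fun w => by
        rw [AlgHom.comp_apply, grMap_ιOne, grMap_ιOne, AlgHom.id_apply]
        exact congrArg ιOne (LinearMap.congr_fun hf w))
      (fun w => by
        rw [AlgHom.comp_apply, grMap_ιTwo, grMap_ιTwo, AlgHom.id_apply]
        exact congrArg ιTwo (LinearMap.congr_fun hg w))
  exact DFunLike.congr_fun this a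

/-- Restriction of a global smooth function. -/
def resGlobal (f : GlobalFun n M) (U : Opens M) : SmoothFun n U :=
  ⟨fun x => f x, f.contMDiff.comp contMDiff_subtype_val⟩

@[simp] theorem resGlobal_apply (f : GlobalFun n M) {U : Opens M} (x : U) :
    resGlobal f U x = f x := rfl

variable (E V) in
/-- A smooth trivialization over `U` of the bundle of algebras `Λ E^* ⊗ S V^*`. -/
structure LocalIso (r s : ℕ) (U : Opens M) where
  toFib : ∀ y, FinGrAlg r s →ₐ[ℝ] FibAlg E V y
  ofFib : ∀ y, FibAlg E V y →ₐ[ℝ] FinGrAlg r s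
  left : ∀ y ∈ U, ∀ a, ofFib y (toFib y a) = a
  right : ∀ y ∈ U, ∀ b, toFib y (ofFib y b) = b
  toFib_mem : ∀ y k a, a ∈ grDeg (Fin r → ℝ) (Fin s → ℝ) k → toFib y a ∈ grDeg _ _ k
  ofFib_mem : ∀ y k b, b ∈ grDeg _ _ k → ofFib y b ∈ grDeg (Fin r → ℝ) (Fin s → ℝ) k
  smooth_one : ∀ y ∈ U, ∀ w, SmoothAt (fun y => toFib y (ιOne w)) y
  smooth_two : ∀ y ∈ U, ∀ w, SmoothAt (fun y => toFib y (ιTwo w)) y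
  inv_smooth_one : ∀ (α : DualSec E) (φ : FinGrAlg r s →ₗ[ℝ] ℝ), ∀ y ∈ U,
    ContMDiffAt (𝓡 n) 𝓘(ℝ, ℝ) ∞ (fun y => φ (ofFib y (ιOne (α.form y)))) y
  inv_smooth_two : ∀ (β : DualSec V) (φ : FinGrAlg r s →ₗ[ℝ] ℝ), ∀ y ∈ U,
    ContMDiffAt (𝓡 n) 𝓘(ℝ, ℝ) ∞ (fun y => φ (ofFib y (ιTwo (β.form y)))) y

namespace LocalIso

variable {r s : ℕ} {U : Opens M} (T : LocalIso E V r s U)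
include T

lemma smoothAt_toFib (a : FinGrAlg r s) {y : M} (hy : y ∈ U) :
    SmoothAt (fun y => T.toFib y a) y := by
  induction a using grAlg_induction with
  | one => simpa only [map_one] using smoothAt_const (E := E) (V := V) (x := y) 1
  | add a b ha hb => simpa using ha.add hb
  | smul c a ha => simpa using ha.smul c
  | mul_one w a ha => simpa using (T.smooth_one y hy w).mul ha
  | mul_two w a ha => simpa using (T.smooth_two y hy w).mul ha

lemma mem_splitAlg {W : Opens M} (h : W ≤ U) (τ : CoordAlg n r s W) :
    (fun y : W => T.toFib y.1 (coordVal y τ)) ∈ splitAlg E V W := by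
  induction τ using TensorProduct.induction_on with
  | zero => simp only [map_zero]; exact zero_mem (splitAlg E V W)
  | add a b ha hb => simp only [map_add]; exact add_mem ha hb
  | tmul f g =>
    have hg : g ∈ ⨆ k, grDeg (Fin r → ℝ) (Fin s → ℝ) k := by rw [iSup_grDeg]; trivial
    induction hg using Submodule.iSup_induction' with
    | zero => simp only [TensorProduct.tmul_zero, map_zero]; exact zero_mem (splitAlg E V W)
    | add a b _ _ ha hb =>
      simp only [TensorProduct.tmul_add, map_add]; exact add_mem ha hb
    | mem k g hg =>
      classical
      refine Algebra.subset_adjoin ⟨isSmoothSplit_iff.2 fun y => ?_, k, fun y => ?_⟩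
      · refine (SmoothAt.fun_smul y.2 (contMDiffAt_of_opens (c' := fun y => if h : y ∈ W then
          f ⟨y, h⟩ else 0) f.contMDiff fun y => dif_pos y.2)
          (T.smoothAt_toFib g (h y.2))).congr ?_
        filter_upwards [W.isOpen.mem_nhds y.2] with z hz
        rw [extZero_of_mem _ hz, dif_pos (show z ∈ W from hz), coordVal_tmul, map_smul]
      · change T.toFib y.1 (coordVal y (f ⊗ₜ[ℝ] g)) ∈ _
        rw [coordVal_tmul, map_smul]
        exact Submodule.smul_mem _ _ (T.toFib_mem _ _ _ hg)

/-- The homomorphism from the coordinate algebra. -/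
def hom {W : Opens M} (h : W ≤ U) : CoordAlg n r s W →ₐ[ℝ] 𝒪[E,V].A W :=
  AlgHom.codRestrict (AlgHom.pi fun y : W => (T.toFib y.1).comp (coordVal y))
    (splitAlg E V W) (T.mem_splitAlg h)

lemma valHom_hom {W : Opens M} (h : W ≤ U) (τ : CoordAlg n r s W) (y : W) :
    valHom y (T.hom h τ) = T.toFib y.1 (coordVal y τ) := rfl

lemma exists_coord_adjoin {b : 𝒪[E,V].A ⊤}
    (hb : b ∈ Algebra.adjoin ℝ (globalGens E V)) :
    ∃ τ : CoordAlg n r s U, ∀ y : U, T.ofFib y.1 (splitVal b y.1) = coordVal y τ := by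
  induction hb using Algebra.adjoin_induction with
  | mem g hg =>
    rcases hg with (⟨c, rfl⟩ | ⟨α, rfl⟩) | ⟨β, rfl⟩
    · refine ⟨resGlobal c U ⊗ₜ[ℝ] 1, fun y => ?_⟩
      rw [splitVal_ofFun, AlgHom.commutes, coordVal_tmul, Algebra.algebraMap_eq_smul_one,
        resGlobal_apply]
    · obtain ⟨τ, -, h⟩ := exists_coord_mem (n := n) (U := U) (k := 1)
        (fun y => T.ofFib y.1 (ιOne (α.form y.1)))
        (fun y => T.ofFib_mem _ _ _ (ιOne_mem_grDeg _))
        (fun φ y => (T.inv_smooth_one α φ y.1 y.2).comp y contMDiff_subtype_val.contMDiffAt)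
      exact ⟨τ, fun y => (h y).symm⟩
    · obtain ⟨τ, -, h⟩ := exists_coord_mem (n := n) (U := U) (k := 2)
        (fun y => T.ofFib y.1 (ιTwo (β.form y.1)))
        (fun y => T.ofFib_mem _ _ _ (ιTwo_mem_grDeg _))
        (fun φ y => (T.inv_smooth_two β φ y.1 y.2).comp y contMDiff_subtype_val.contMDiffAt)
      exact ⟨τ, fun y => (h y).symm⟩
  | algebraMap c =>
    refine ⟨resGlobal ⟨fun _ => c, contMDiff_const⟩ U ⊗ₜ[ℝ] 1, fun y => ?_⟩
    have : splitVal (algebraMap ℝ (𝒪[E,V].A ⊤) c) y.1 = algebraMap ℝ _ c := rfl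
    rw [this, AlgHom.commutes, coordVal_tmul, Algebra.algebraMap_eq_smul_one]
    rfl
  | add a b _ _ ha hb =>
    obtain ⟨τ, hτ⟩ := ha
    obtain ⟨σ, hσ⟩ := hb
    exact ⟨τ + σ, fun y => by rw [splitVal_add, map_add, map_add, hτ, hσ]⟩
  | mul a b _ _ ha hb =>
    obtain ⟨τ, hτ⟩ := ha
    obtain ⟨σ, hσ⟩ := hb
    exact ⟨τ * σ, fun y => by rw [splitVal_mul, map_mul, map_mul, hτ, hσ]⟩

lemma exists_coord {W : Opens M} (h : W ≤ U) (a : 𝒪[E,V].A W) :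
    ∃ τ : CoordAlg n r s W, ∀ y : W, T.ofFib y.1 (valHom y a) = coordVal y τ := by
  induction a using homogeneous_induction with
  | add a b ha hb =>
    obtain ⟨τ, hτ⟩ := ha
    obtain ⟨σ, hσ⟩ := hb
    exact ⟨τ + σ, fun y => by rw [map_add, map_add, map_add, hτ, hσ]⟩
  | hom k a ha =>
    obtain ⟨τ, -, hτ⟩ := exists_coord_mem (n := n) (U := W) (k := k)
      (fun y => T.ofFib y.1 (valHom y a)) (fun y => T.ofFib_mem _ _ _ (ha y)) fun φ y => by
        obtain ⟨b, hb, hab⟩ := exists_global a y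
        obtain ⟨τ, hτ⟩ := T.exists_coord_adjoin hb
        refine (coordVal_smooth (resCoord r s h τ) φ y).congr_of_eventuallyEq ?_
        filter_upwards [(continuous_subtype_val.tendsto y).eventually hab] with z hz
        rw [coordVal_res, ← hτ, hz z.2]
    exact ⟨τ, fun y => (hτ y).symm⟩

lemma hom_bijective {W : Opens M} (h : W ≤ U) : Function.Bijective (T.hom h) := by
  refine ⟨fun τ σ hτσ => coordVal_injective fun y => ?_, fun a => ?_⟩
  · rw [← T.left y.1 (h y.2) (coordVal y τ), ← T.left y.1 (h y.2) (coordVal y σ), ← T.valHom_hom h,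
      ← T.valHom_hom h, hτσ]
  · obtain ⟨τ, hτ⟩ := T.exists_coord h a
    refine ⟨τ, split_ext fun y => ?_⟩
    rw [T.valHom_hom, ← hτ, T.right y.1 (h y.2)]

/-- The coordinate system given by a trivialization. -/
def coordinates : 𝒪[E,V].Coordinates r s U where
  equiv W h := AlgEquiv.ofBijective (T.hom h) (T.hom_bijective h)
  natural W W' h h' a := split_ext fun y => by
    change T.toFib y.1 (coordVal ⟨y.1, h' y.2⟩ a) = T.toFib y.1 (coordVal y (resCoord r s h' a))
    rw [coordVal_res]
  map_deg W h k a := by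
    rw [mem_coordDeg_iff, mem_splitDeg]
    refine forall_congr' fun y => ⟨fun ha => T.toFib_mem _ _ _ ha, fun ha => ?_⟩
    rw [← T.left y.1 (h y.2) (coordVal y a)]
    exact T.ofFib_mem _ _ _ ha
  map_base W h f := split_ext fun y => by
    change T.toFib y.1 (coordVal y (f ⊗ₜ[ℝ] 1)) = algebraMap ℝ _ (f y)
    rw [coordVal_tmul, map_smul, map_one, Algebra.algebraMap_eq_smul_one]

omit T in
/-- The trivialization given by frames of `E` and `V`. -/
def ofFrames (F : Frame E U) (G : Frame V U) : LocalIso E V E.rank V.rank U where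
  toFib y := grMap (Fintype.linearCombination ℝ fun a => (F.ξ a).form y)
    (Fintype.linearCombination ℝ fun a => (G.ξ a).form y)
  ofFib y := grMap (LinearMap.pi fun a => Dual.eval ℝ _ (F.e a y))
    (LinearMap.pi fun a => Dual.eval ℝ _ (G.e a y))
  left y hy a := by
    refine grMap_grMap_of_id (LinearMap.ext fun w => ?_) (LinearMap.ext fun w => ?_) a
    · ext b
      simp [Fintype.linearCombination_apply, F.dual y hy]
    · ext b
      simp [Fintype.linearCombination_apply, G.dual y hy]
  right y hy a :=
    grMap_grMap_of_id (LinearMap.ext fun w => F.dual_sum hy w)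
      (LinearMap.ext fun w => G.dual_sum hy w) a
  toFib_mem y k a ha := grMap_mem _ _ ha
  ofFib_mem y k a ha := grMap_mem _ _ ha
  smooth_one y hy w := by
    refine (SmoothAt.sum Finset.univ fun a _ => (smoothAt_ofDualE (F.ξ a)).smul (w a)).congr
      (Eventually.of_forall fun y => ?_)
    rw [grMap_ιOne, Fintype.linearCombination_apply]
    exact (map_sum ιOneL _ _).trans (Finset.sum_congr rfl fun a _ => ιOne_smul _ _)
  smooth_two y hy w := by
    refine (SmoothAt.sum Finset.univ fun a _ => (smoothAt_ofDualV (G.ξ a)).smul (w a)).congr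
      (Eventually.of_forall fun y => ?_)
    rw [grMap_ιTwo, Fintype.linearCombination_apply]
    exact (map_sum ιTwoL _ _).trans (Finset.sum_congr rfl fun a _ => ιTwo_smul _ _)
  inv_smooth_one α φ y hy := by
    have : ∀ z, φ (grMap (LinearMap.pi fun a => Dual.eval ℝ _ (F.e a z))
        (LinearMap.pi fun a => Dual.eval ℝ _ (G.e a z)) (ιOne (α.form z))) =
        ∑ a, α.form z (F.e a z) * φ (ιOne (fun j => if a = j then 1 else 0)) := fun z => by
      rw [grMap_ιOne]
      exact LinearMap.pi_apply_eq_sum_univ (φ ∘ₗ ιOneL) _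
    simp only [this]
    exact contMDiffAt_finsetSum fun a _ => (α.smooth (F.e a) y).mul contMDiffAt_const
  inv_smooth_two β φ y hy := by
    have : ∀ z, φ (grMap (LinearMap.pi fun a => Dual.eval ℝ _ (F.e a z))
        (LinearMap.pi fun a => Dual.eval ℝ _ (G.e a z)) (ιTwo (β.form z))) =
        ∑ a, β.form z (G.e a z) * φ (ιTwo (fun j => if a = j then 1 else 0)) := fun z => by
      rw [grMap_ιTwo]
      exact LinearMap.pi_apply_eq_sum_univ (φ ∘ₗ ιTwoL) _
    simp only [this]
    exact contMDiffAt_finsetSum fun a _ => (β.smooth (G.e a) y).mul contMDiffAt_const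

end LocalIso

lemma split_glue {ι : Type*} (U : ι → Opens M) (k : ℕ) (a : ∀ i, 𝒪[E,V].A (U i))
    (ha : ∀ i, a i ∈ 𝒪[E,V].deg (U i) k)
    (h : ∀ i j, 𝒪[E,V].res (inf_le_left : U i ⊓ U j ≤ U i) (a i) =
      𝒪[E,V].res (inf_le_right : U i ⊓ U j ≤ U j) (a j)) :
    ∃! b : 𝒪[E,V].A (iSup U), b ∈ 𝒪[E,V].deg (iSup U) k ∧
      ∀ i, 𝒪[E,V].res (le_iSup U i) b = a i := by
  choose i hi using fun x : (iSup U : Opens M) => Opens.mem_iSup.1 x.2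
  have hind : ∀ (x : (iSup U : Opens M)) j (hj : x.1 ∈ U j),
      valHom ⟨x.1, hi x⟩ (a (i x)) = valHom ⟨x.1, hj⟩ (a j) := fun x j hj =>
    congrArg (valHom (⟨x.1, hi x, hj⟩ : (U (i x) ⊓ U j : Opens M))) (h (i x) j)
  have hf : IsSmoothSplit E V (iSup U) fun x => valHom ⟨x.1, hi x⟩ (a (i x)) :=
    isSmoothSplit_iff.2 fun x => by
      refine (smoothAt_val (a (i x)) ⟨x.1, hi x⟩).congr ?_
      filter_upwards [(U (i x)).isOpen.mem_nhds (hi x)] with y hy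
      rw [extZero_of_mem _ (Opens.mem_iSup.2 ⟨i x, hy⟩), extZero_of_mem _ hy]
      exact hind ⟨y, Opens.mem_iSup.2 ⟨i x, hy⟩⟩ (i x) hy
  have hk : ∀ x, valHom ⟨x.1, hi x⟩ (a (i x)) ∈ grDeg _ _ k := fun x => ha (i x) ⟨x.1, hi x⟩
  refine ⟨ofHom _ k _ hf hk, ⟨hk, fun j => split_ext fun x => ?_⟩, ?_⟩
  · rw [valHom_res, valHom_ofHom]
    exact hind ⟨x.1, _⟩ j x.2
  · intro b hb
    refine split_ext fun x => ?_
    rw [valHom_ofHom, ← hb.2 (i x), valHom_res]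

lemma splitSpace_isNTwoManifold : 𝒪[E,V].IsNTwoManifold E.rank V.rank where
  res_id _ _ := rfl
  res_comp _ _ _ _ _ _ := rfl
  res_deg U W h k a ha x := ha ⟨x.1, h x.2⟩
  res_base _ _ _ _ := rfl
  gradedMonoid U := split_gradedMonoid U
  internal U := split_internal U
  glue ι U k a ha h := split_glue U k a ha h
  locallyTrivial x := by
    obtain ⟨U, hU, ⟨F⟩⟩ := exists_frame E x
    obtain ⟨W, hW, ⟨G⟩⟩ := exists_frame V x
    exact ⟨U ⊓ W, ⟨hU, hW⟩, ⟨(LocalIso.ofFrames (F.restrict inf_le_left)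
      (G.restrict inf_le_right)).coordinates⟩⟩

section TangentVectors

open MeasureTheory

lemma exists_smooth_quotients {n : ℕ} {F : EuclideanSpace ℝ (Fin n) → ℝ} (hF : ContDiff ℝ ∞ F)
    (u0 : EuclideanSpace ℝ (Fin n)) :
    ∃ g : Fin n → EuclideanSpace ℝ (Fin n) → ℝ, (∀ i, ContDiff ℝ ∞ (g i)) ∧
      ∀ u, F u = F u0 + ∑ i, (u i - u0 i) * g i u := by
  obtain ⟨η, hη1, -, hηc, -, -⟩ : ∃ η : ContDiffBump (0 : ℝ), η.rIn = 1 ∧ True ∧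
      HasCompactSupport η ∧ True ∧ True :=
    ⟨⟨1, 2, one_pos, one_lt_two⟩, rfl, trivial, ContDiffBump.hasCompactSupport _, trivial, trivial⟩
  have hdF : ContDiff ℝ ∞ (fderiv ℝ F) := hF.fderiv_right (by norm_num)
  let h : Fin n → EuclideanSpace ℝ (Fin n) → ℝ → ℝ := fun i u t =>
    η t * fderiv ℝ F (u0 + (-t) • (u - u0)) (EuclideanSpace.single i 1)
  have hh : ∀ i, ContDiff ℝ ∞ (fun p : EuclideanSpace ℝ (Fin n) × ℝ => h i p.1 p.2) := by
    intro i
    refine (η.contDiff.comp contDiff_snd).mul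
      (ContDiff.clm_apply (hdF.comp ?_) contDiff_const)
    fun_prop
  let f : ℝ → ℝ := Set.indicator (Set.Icc 0 1) fun _ => 1
  have hf : LocallyIntegrable f volume :=
    (integrable_indicator_iff measurableSet_Icc |>.2
      (by simp [integrableOn_const_iff])).locallyIntegrable
  let g : Fin n → EuclideanSpace ℝ (Fin n) → ℝ := fun i u =>
    ∫ t in (0 : ℝ)..1, fderiv ℝ F (u0 + t • (u - u0)) (EuclideanSpace.single i 1)
  refine ⟨g, fun i => ?_, fun u => ?_⟩
  · have := contDiffOn_convolution_right_with_param_comp (μ := volume) (n := ⊤) (𝕜 := ℝ)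
      (ContinuousLinearMap.mul ℝ ℝ) (s := Set.univ) (v := fun _ : EuclideanSpace ℝ (Fin n) => (0 : ℝ))
      (f := f) (g := h i) (k := tsupport η) contDiffOn_const isOpen_univ hηc
      (fun p x _ hx => by
        change η x * _ = 0
        rw [image_eq_zero_of_notMem_tsupport hx, zero_mul]) hf (hh i).contDiffOn
    rw [contDiffOn_univ] at this
    convert this using 1
    funext u
    change (∫ t in (0 : ℝ)..1, _) = ∫ t, f t * (η (0 - t) * _)
    rw [intervalIntegral.integral_of_le zero_le_one, ← integral_Icc_eq_integral_Ioc,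
      ← integral_indicator measurableSet_Icc]
    refine integral_congr_ae (Eventually.of_forall fun t => ?_)
    by_cases ht : t ∈ Set.Icc (0 : ℝ) 1
    · have : η (0 - t) = 1 := η.one_of_mem_closedBall (by
        rw [hη1, mem_closedBall_zero_iff, zero_sub, norm_neg, Real.norm_of_nonneg ht.1]
        exact ht.2)
      change _ = f t * (η (0 - t) * _)
      rw [this]
      simp [f, ht]
    · simp [f, ht]
  · have hder : ∀ t ∈ Set.uIcc (0 : ℝ) 1, HasDerivAt (fun t : ℝ => F (u0 + t • (u - u0)))
        (fderiv ℝ F (u0 + t • (u - u0)) (u - u0)) t := by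
      intro t _
      have h1 : HasDerivAt (fun t : ℝ => u0 + t • (u - u0)) (u - u0) t := by
        simpa using ((hasDerivAt_id t).smul_const (u - u0)).const_add u0
      exact ((hF.differentiable (by simp)) _).hasFDerivAt.comp_hasDerivAt t h1
    have hc : ∀ w, Continuous fun t : ℝ => fderiv ℝ F (u0 + t • (u - u0)) w := fun w =>
      (hdF.continuous.comp (by fun_prop)).clm_apply continuous_const
    have h2 := intervalIntegral.integral_eq_sub_of_hasDerivAt hder
      ((hc (u - u0)).intervalIntegrable 0 1)
    have h3 : ∀ t : ℝ, fderiv ℝ F (u0 + t • (u - u0)) (u - u0) = ∑ i, (u i - u0 i) *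
        fderiv ℝ F (u0 + t • (u - u0)) (EuclideanSpace.single i 1) := by
      intro t
      have h4 : u - u0 = ∑ i, (u i - u0 i) • EuclideanSpace.single i (1 : ℝ) := by
        ext j
        simp [Pi.single_apply]
      refine (congrArg (fderiv ℝ F (u0 + t • (u - u0))) h4).trans ?_
      rw [map_sum]
      simp
    simp only [h3] at h2
    rw [intervalIntegral.integral_finsetSum
      (fun i _ => ((hc _).const_mul _ |>.intervalIntegrable 0 1))] at h2
    simp only [intervalIntegral.integral_const_mul] at h2
    simp only [one_smul, zero_smul, add_zero, add_sub_cancel] at h2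
    change F u = F u0 + ∑ i, (u i - u0 i) * ∫ t in (0 : ℝ)..1, _
    rw [h2]; ring

lemma contMDiffAt_euclidean {m : ℕ} {f : M → EuclideanSpace ℝ (Fin m)} {x : M}
    (h : ∀ i, ContMDiffAt (𝓡 n) 𝓘(ℝ, ℝ) ∞ (fun y => f y i) x) :
    ContMDiffAt (𝓡 n) 𝓘(ℝ, EuclideanSpace ℝ (Fin m)) ∞ f x :=
  (EuclideanSpace.equiv (Fin m) ℝ).symm.contDiff.contMDiff.contMDiffAt.comp x
    (contMDiffAt_pi_space.2 h)

lemma dirDeriv_add {f g : M → ℝ} {x : M} (hf : MDifferentiableAt (𝓡 n) 𝓘(ℝ, ℝ) f x)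
    (hg : MDifferentiableAt (𝓡 n) 𝓘(ℝ, ℝ) g x) (X : TangentSpace (𝓡 n) x) :
    dirDeriv (fun y => f y + g y) x X = dirDeriv f x X + dirDeriv g x X := by
  have := mfderiv_add hf hg
  exact DFunLike.congr_fun this X

lemma dirDeriv_mul {f g : M → ℝ} {x : M} (hf : MDifferentiableAt (𝓡 n) 𝓘(ℝ, ℝ) f x)
    (hg : MDifferentiableAt (𝓡 n) 𝓘(ℝ, ℝ) g x) (X : TangentSpace (𝓡 n) x) :
    dirDeriv (fun y => f y * g y) x X = f x * dirDeriv g x X + g x * dirDeriv f x X := by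
  have := (hf.hasMFDerivAt.mul hg.hasMFDerivAt).mfderiv
  exact (DFunLike.congr_fun this X)

lemma dirDeriv_congr {f g : M → ℝ} {x : M} (h : ∀ᶠ y in 𝓝 x, f y = g y)
    (X : TangentSpace (𝓡 n) x) : dirDeriv f x X = dirDeriv g x X := by
  unfold dirDeriv
  rw [Filter.EventuallyEq.mfderiv_eq h]
  rfl

lemma dirDeriv_const (c : ℝ) (x : M) (X : TangentSpace (𝓡 n) x) :
    dirDeriv (fun _ => c) x X = 0 := by
  unfold dirDeriv
  rw [mfderiv_const]; rfl

/-- The constant functions. -/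
def constFun (c : ℝ) : GlobalFun n M := ⟨fun _ => c, contMDiff_const⟩

@[simp] theorem constFun_apply (c : ℝ) (x : M) : (constFun c : GlobalFun n M) x = c := rfl

lemma GlobalFun.sum_apply {ι : Type*} (s : Finset ι) (f : ι → GlobalFun n M) (x : M) :
    (∑ i ∈ s, f i) x = ∑ i ∈ s, f i x := by
  have h := map_sum (ContMDiffMap.coeFnAlgHom (𝕜 := ℝ) (I := 𝓡 n) (N := M) (A := ℝ) (n := ∞)) f s
  have h1 := congrFun h x
  rw [Finset.sum_apply] at h1
  exact h1

lemma GlobalFun.mdiff (f : GlobalFun n M) (x : M) : MDifferentiableAt (𝓡 n) 𝓘(ℝ, ℝ) f x :=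
  f.contMDiff.mdifferentiableAt (by simp)

lemma exists_coordinates (x : M) : ∃ κ : Fin n → GlobalFun n M,
    ∀ᶠ y in 𝓝 x, y ∈ (chartAt (EuclideanSpace ℝ (Fin n)) x).source ∧
      ∀ i, κ i y = extChartAt (𝓡 n) x y i := by
  have h : ∀ i, ∃ κ : GlobalFun n M, ∀ᶠ y in 𝓝 x, κ y = extChartAt (𝓡 n) x y i := fun i =>
    exists_globalFun ⟨(chartAt (EuclideanSpace ℝ (Fin n)) x).source,
      (chartAt (EuclideanSpace ℝ (Fin n)) x).open_source⟩ (mem_chart_source _ x) _ fun y hy => by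
        have h1 : ContMDiffAt (𝓡 n) 𝓘(ℝ, EuclideanSpace ℝ (Fin n)) ∞ (extChartAt (𝓡 n) x) y :=
          contMDiffAt_extChartAt' hy
        exact (EuclideanSpace.proj i : EuclideanSpace ℝ (Fin n) →L[ℝ] ℝ).contMDiff.contMDiffAt.comp y h1
  choose κ hκ using h
  refine ⟨κ, ?_⟩
  filter_upwards [eventually_all.2 hκ, (chartAt (EuclideanSpace ℝ (Fin n)) x).open_source.mem_nhds
    (mem_chart_source _ x)] with y h1 h2
  exact ⟨h2, h1⟩

lemma dirDeriv_coordinate {x y : M} (hy : y ∈ (chartAt (EuclideanSpace ℝ (Fin n)) x).source)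
    {f : M → ℝ} (i : Fin n) (hf : ∀ᶠ z in 𝓝 y, f z = extChartAt (𝓡 n) x z i)
    (X : TangentSpace (𝓡 n) y) :
    dirDeriv f y X = (EuclideanSpace.proj i : EuclideanSpace ℝ (Fin n) →L[ℝ] ℝ)
      (mfderiv (𝓡 n) 𝓘(ℝ, EuclideanSpace ℝ (Fin n)) (extChartAt (𝓡 n) x) y X) := by
  rw [dirDeriv_congr hf]
  have h1 := (mdifferentiableAt_extChartAt (I := 𝓡 n) hy).hasMFDerivAt
  have h2 := (EuclideanSpace.proj i : EuclideanSpace ℝ (Fin n) →L[ℝ] ℝ).hasMFDerivAt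
    (x := extChartAt (𝓡 n) x y)
  have h3 := (h2.comp y h1).mfderiv
  exact DFunLike.congr_fun h3 X

lemma tangent_ext {x : M} {X Y : TangentSpace (𝓡 n) x}
    (h : ∀ f : GlobalFun n M, dirDeriv f x X = dirDeriv f x Y) : X = Y := by
  obtain ⟨κ, hκ⟩ := exists_coordinates (n := n) x
  refine (isInvertible_mfderiv_extChartAt (I := 𝓡 n) (mem_extChartAt_source x)).injective ?_
  refine PiLp.ext fun i => ?_
  have h1 : ∀ᶠ z in 𝓝 x, κ i z = extChartAt (𝓡 n) x z i := hκ.mono fun y hy => hy.2 i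
  have h2 := h (κ i)
  rw [dirDeriv_coordinate (mem_chart_source _ x) i h1,
    dirDeriv_coordinate (mem_chart_source _ x) i h1] at h2
  exact h2

lemma exists_tangent_of_derivation (x : M) (δ : GlobalFun n M →ₗ[ℝ] ℝ)
    (hδ : ∀ f g, δ (f * g) = δ f * g x + f x * δ g) :
    ∃ X : TangentSpace (𝓡 n) x, ∀ f : GlobalFun n M, δ f = dirDeriv f x X := by
  obtain ⟨κ, hκ⟩ := exists_coordinates (n := n) x
  have h1 : ∀ i, ∀ᶠ z in 𝓝 x, κ i z = extChartAt (𝓡 n) x z i := fun i =>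
    hκ.mono fun y hy => hy.2 i
  have key : ∀ f : GlobalFun n M, ∃ c : Fin n → ℝ, ∀ D : GlobalFun n M →ₗ[ℝ] ℝ,
      (∀ f g, D (f * g) = D f * g x + f x * D g) → D f = ∑ i, D (κ i) * c i := by
    intro f
    let e := extChartAt (𝓡 n) x
    obtain ⟨F, hF⟩ := exists_globalFun (M := EuclideanSpace ℝ (Fin n)) (n := n)
      ⟨e.target, isOpen_extChartAt_target x⟩ (mem_extChartAt_target (I := 𝓡 n) x) (f ∘ e.symm)
      fun u hu => (f.contMDiff _).comp u ((contMDiffOn_extChartAt_symm (I := 𝓡 n) x).contMDiffAt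
        ((isOpen_extChartAt_target (I := 𝓡 n) x).mem_nhds hu))
    obtain ⟨g, hg, hFg⟩ := exists_smooth_quotients F.contMDiff.contDiff (e x)
    let K : M → EuclideanSpace ℝ (Fin n) := fun y => WithLp.toLp 2 fun i => κ i y
    have hK : ContMDiff (𝓡 n) 𝓘(ℝ, EuclideanSpace ℝ (Fin n)) ∞ K := by
      exact fun y => contMDiffAt_euclidean fun i => (κ i).contMDiff y
    let G : Fin n → GlobalFun n M := fun i => ⟨fun y => g i (K y), (hg i).contMDiff.comp hK⟩
    refine ⟨fun i => g i (e x), fun D hD => ?_⟩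
    have hD1 : ∀ c : ℝ, D (constFun c) = 0 := by
      intro c
      have h2 := hD 1 1
      have h3 : D 1 = 0 := by
        rw [mul_one] at h2
        have : D 1 = D 1 * 1 + 1 * D 1 := h2
        linarith
      have h4 : constFun c = c • (1 : GlobalFun n M) := by
        ext y; exact (mul_one c).symm
      rw [h4, map_smul, h3, smul_zero]
    have hloc : ∀ a b : GlobalFun n M, (∀ᶠ y in 𝓝 x, a y = b y) → D a = D b := by
      intro a b hab
      obtain ⟨χ, hχ1, hχ⟩ := exists_bump_eq (n := n) hab
      have h2 : χ * a = χ * b := by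
        ext y
        change χ y * a y = χ y * b y
        rcases hχ y with hy | hy
        · rw [hy]
        · rw [hy, zero_mul, zero_mul]
      have h3 := hD χ a
      rw [h2, hD χ b, hχ1.self_of_nhds, hab.self_of_nhds] at h3
      linarith
    have hsum : D f = D (constFun (F (e x)) +
        ∑ i, (κ i - constFun (e x i)) * G i) := by
      refine hloc _ _ ?_
      have hKx : ∀ᶠ y in 𝓝 x, F (e y) = f (e.symm (e y)) :=
        (continuousAt_extChartAt x).eventually hF
      filter_upwards [hκ, hKx] with y hy hy2
      have hKy : K y = e y := PiLp.ext fun i => hy.2 i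
      change _ = F (e x) + (∑ i, (κ i - constFun (e x i)) * G i : GlobalFun n M) y
      have h5 : (∑ i, (κ i - constFun (e x i)) * G i : GlobalFun n M) y =
          ∑ i, (κ i y - e x i) * g i (K y) := by
        exact GlobalFun.sum_apply _ _ y
      rw [h5]
      have h6 := hFg (e y)
      rw [hy2, e.left_inv (by rw [extChartAt_source]; exact hy.1)] at h6
      rw [h6, hKy]
      refine congrArg₂ (· + ·) rfl (Finset.sum_congr rfl fun i _ => ?_)
      rw [hy.2 i]
    rw [hsum, map_add, hD1, zero_add, map_sum]
    refine Finset.sum_congr rfl fun i _ => ?_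
    rw [hD, map_sub, hD1, sub_zero]
    have h7 : (κ i - constFun (e x i) : GlobalFun n M) x = 0 := by
      change κ i x - e x i = 0
      rw [(h1 i).self_of_nhds, sub_self]
    have h8 : G i x = g i (e x) := by
      have : K x = e x := PiLp.ext fun i => (h1 i).self_of_nhds
      change g i (K x) = _
      rw [this]
    rw [h7, h8, zero_mul, add_zero]
  have hinv := isInvertible_mfderiv_extChartAt (I := 𝓡 n) (mem_extChartAt_source (I := 𝓡 n) x)
  obtain ⟨X, hX⟩ := hinv.surjective (WithLp.toLp 2 fun i => δ (κ i) : EuclideanSpace ℝ (Fin n))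
  refine ⟨X, fun f => ?_⟩
  obtain ⟨c, hc⟩ := key f
  let D : GlobalFun n M →ₗ[ℝ] ℝ :=
    { toFun := fun f => dirDeriv f x X
      map_add' := fun f g => dirDeriv_add (f.mdiff x) (g.mdiff x) X
      map_smul' := fun a f => by
        have := dirDeriv_mul (mdifferentiableAt_const (c := a)) (f.mdiff x) X
        rw [dirDeriv_const, mul_zero, add_zero] at this
        exact this }
  rw [hc δ hδ]
  refine Eq.trans ?_ (hc D fun f g => ?_).symm
  · refine Finset.sum_congr rfl fun i _ => ?_
    change _ = dirDeriv (κ i) x X * c i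
    rw [dirDeriv_coordinate (mem_chart_source _ x) i (h1 i), hX]
    rfl
  · refine (dirDeriv_mul (f.mdiff x) (g.mdiff x) X).trans ?_
    change _ = dirDeriv f x X * g x + f x * dirDeriv g x X
    ring

lemma smooth_of_dirDeriv {X : ∀ x : M, TangentSpace (𝓡 n) x}
    (h : ∀ f : GlobalFun n M, ContMDiff (𝓡 n) 𝓘(ℝ, ℝ) ∞ (fun x => dirDeriv f x (X x))) :
    ContMDiff (𝓡 n) (𝓡 n).tangent ∞ (fun x => (⟨x, X x⟩ : TangentBundle (𝓡 n) M)) := by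
  intro x
  obtain ⟨κ, hκ⟩ := exists_coordinates (n := n) x
  refine (Bundle.contMDiffAt_section _).2 (contMDiffAt_euclidean fun i => ?_)
  refine ((h (κ i)) x).congr_of_eventuallyEq ?_
  filter_upwards [eventually_eventually_nhds.2 hκ] with y hy
  have hys := hy.self_of_nhds.1
  rw [dirDeriv_coordinate hys i (hy.mono fun z hz => hz.2 i)]
  let t := trivializationAt (EuclideanSpace ℝ (Fin n)) (TangentSpace (𝓡 n) (M := M)) x
  have h1 : (t ⟨y, X y⟩).2 = t.continuousLinearMapAt ℝ y (X y) := by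
    rw [Trivialization.continuousLinearMapAt_apply, Trivialization.linearMapAt_apply, if_pos (show y ∈ t.baseSet from hys)]
  have h2 := DFunLike.congr_fun (TangentBundle.continuousLinearMapAt_trivializationAt
    (I := 𝓡 n) hys) (X y)
  exact congrArg (fun w : EuclideanSpace ℝ (Fin n) => w i) (h1.trans h2)

end TangentVectors

section Elements

variable {E : Type v} {V : Type v'} [AddCommGroup E] [Module ℝ E] [AddCommGroup V] [Module ℝ V]
  {W : Type w} [AddCommGroup W] [Module ℝ W]

/-- Alternating bilinear maps, as functions. -/
structure Alt2 (τ : E → E → W) : Prop where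
  add : ∀ a a' b, τ (a + a') b = τ a b + τ a' b
  smul : ∀ (c : ℝ) a b, τ (c • a) b = c • τ a b
  swap : ∀ a b, τ a b = - τ b a

/-- Alternating trilinear maps, as functions. -/
structure Alt3 (τ : E → E → E → W) : Prop where
  add : ∀ a a' b c, τ (a + a') b c = τ a b c + τ a' b c
  smul : ∀ (r : ℝ) a b c, τ (r • a) b c = r • τ a b c
  swap : ∀ a b c, τ a b c = - τ b a c
  swap' : ∀ a b c, τ a b c = - τ a c b

lemma self_eq_neg_self {w : W} (h : w = -w) : w = 0 := by
  have h1 : (2 : ℝ) • w = 0 := by rw [two_smul]; nth_rewrite 1 [h]; exact neg_add_cancel w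
  exact (smul_eq_zero.1 h1).resolve_left two_ne_zero

lemma Alt2.add' {τ : E → E → W} (h : Alt2 τ) (a b b' : E) : τ a (b + b') = τ a b + τ a b' := by
  rw [h.swap, h.add, h.swap b, h.swap b']; abel

lemma Alt2.smul' {τ : E → E → W} (h : Alt2 τ) (c : ℝ) (a b : E) : τ a (c • b) = c • τ a b := by
  rw [h.swap, h.smul, h.swap b, smul_neg, neg_neg]

lemma Alt2.self {τ : E → E → W} (h : Alt2 τ) (a : E) : τ a a = 0 := self_eq_neg_self (h.swap a a)

lemma Alt3.add₂ {τ : E → E → E → W} (h : Alt3 τ) (a b b' c : E) :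
    τ a (b + b') c = τ a b c + τ a b' c := by
  rw [h.swap, h.add, h.swap b, h.swap b']; abel

lemma Alt3.smul₂ {τ : E → E → E → W} (h : Alt3 τ) (r : ℝ) (a b c : E) :
    τ a (r • b) c = r • τ a b c := by
  rw [h.swap, h.smul, h.swap b, smul_neg, neg_neg]

lemma Alt3.add₃ {τ : E → E → E → W} (h : Alt3 τ) (a b c c' : E) :
    τ a b (c + c') = τ a b c + τ a b c' := by
  rw [h.swap', h.add₂, h.swap' a c, h.swap' a c']; abel

lemma Alt3.smul₃ {τ : E → E → E → W} (h : Alt3 τ) (r : ℝ) (a b c : E) :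
    τ a b (r • c) = r • τ a b c := by
  rw [h.swap', h.smul₂, h.swap' a c, smul_neg, neg_neg]

/-- Bundling of an alternating bilinear map. -/
def Alt2.map {τ : E → E → W} (h : Alt2 τ) : E [⋀^Fin 2]→ₗ[ℝ] W where
  toFun v := τ (v 0) (v 1)
  map_update_add' := by
    intro inst v i a b
    rw [Subsingleton.elim inst (instDecidableEqFin 2)]
    fin_cases i <;> simp [h.add, h.add']
  map_update_smul' := by
    intro inst v i c a
    rw [Subsingleton.elim inst (instDecidableEqFin 2)]
    fin_cases i <;> simp [h.smul, h.smul']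
  map_eq_zero_of_eq' v i j hij hne := by
    fin_cases i <;> fin_cases j <;> simp_all [h.self]

/-- Bundling of an alternating trilinear map. -/
def Alt3.map {τ : E → E → E → W} (h : Alt3 τ) : E [⋀^Fin 3]→ₗ[ℝ] W where
  toFun v := τ (v 0) (v 1) (v 2)
  map_update_add' := by
    intro inst v i a b
    obtain rfl : inst = instDecidableEqFin 3 := Subsingleton.elim _ _
    fin_cases i
    · simp [h.add]
    · simp [h.add₂]
    · simp [h.add₃]
  map_update_smul' := by
    intro inst v i c a
    obtain rfl : inst = instDecidableEqFin 3 := Subsingleton.elim _ _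
    fin_cases i
    · simp [h.smul]
    · simp [h.smul₂]
    · simp [h.smul₃]
  map_eq_zero_of_eq' v i j hij hne := by
    have h1 : ∀ a c, τ a a c = 0 := fun a c => self_eq_neg_self (h.swap a a c)
    have h2 : ∀ a c, τ c a a = 0 := fun a c => self_eq_neg_self (h.swap' c a a)
    have h3 : ∀ a c, τ a c a = 0 := fun a c => by rw [h.swap', h1, neg_zero]
    fin_cases i <;> fin_cases j <;> simp_all

@[simp] theorem Alt2.map_apply {τ : E → E → W} (h : Alt2 τ) (a b : E) : h.map ![a, b] = τ a b := rfl
@[simp] theorem Alt3.map_apply {τ : E → E → E → W} (h : Alt3 τ) (a b c : E) :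
    h.map ![a, b, c] = τ a b c := rfl

lemma alt2_of_map (B : E [⋀^Fin 2]→ₗ[ℝ] W) : Alt2 fun a b => B ![a, b] where
  add a a' b := by
    have := B.map_update_add ![a, b] 0 a a'
    have h : ∀ c, Function.update ![a, b] 0 c = ![c, b] := fun c => by
      ext i; fin_cases i <;> rfl
    rwa [h, h, h] at this
  smul c a b := by
    have := B.map_update_smul ![a, b] 0 c a
    have h : ∀ c, Function.update ![a, b] 0 c = ![c, b] := fun c => by
      ext i; fin_cases i <;> rfl
    rwa [h, h] at this
  swap a b := by
    have := B.map_swap ![a, b] (i := 0) (j := 1) (by decide)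
    rw [eq_neg_iff_add_eq_zero, ← neg_eq_iff_add_eq_zero, ← this]
    congr 1; ext i; fin_cases i <;> simp

lemma alt3_of_map (B : E [⋀^Fin 3]→ₗ[ℝ] W) : Alt3 fun a b c => B ![a, b, c] where
  add a a' b c := by
    have := B.map_update_add ![a, b, c] 0 a a'
    have h : ∀ d, Function.update ![a, b, c] 0 d = ![d, b, c] := fun c => by
      ext i; fin_cases i <;> rfl
    rwa [h, h, h] at this
  smul r a b c := by
    have := B.map_update_smul ![a, b, c] 0 r a
    have h : ∀ d, Function.update ![a, b, c] 0 d = ![d, b, c] := fun c => by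
      ext i; fin_cases i <;> rfl
    rwa [h, h] at this
  swap a b c := by
    have := B.map_swap ![a, b, c] (i := 0) (j := 1) (by decide)
    rw [eq_neg_iff_add_eq_zero, ← neg_eq_iff_add_eq_zero, ← this]
    congr 1; ext i; fin_cases i <;> simp [Equiv.swap_apply_def]
  swap' a b c := by
    have := B.map_swap ![a, b, c] (i := 1) (j := 2) (by decide)
    rw [eq_neg_iff_add_eq_zero, ← neg_eq_iff_add_eq_zero, ← this]
    congr 1; ext i; fin_cases i <;> simp [Equiv.swap_apply_def]

section Expansion

variable {ι : Type*} [Fintype ι] {e : ι → E} {ξ : ι → Dual ℝ E}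
  (he : ∀ v, ∑ i, ξ i v • e i = v) {κ : Type*} [Fintype κ] {g : κ → V} {η : κ → Dual ℝ V}
  (hg : ∀ v, ∑ i, η i v • g i = v)
include he

lemma linear_expand {f : E → W} (hadd : ∀ a b, f (a + b) = f a + f b)
    (hsmul : ∀ (c : ℝ) a, f (c • a) = c • f a) (v : E) : f v = ∑ i, ξ i v • f (e i) := by
  let F : E →ₗ[ℝ] W := ⟨⟨f, hadd⟩, hsmul⟩
  have h := congrArg F (he v)
  rw [map_sum] at h
  simp only [map_smul] at h
  exact h.symm

lemma Alt2.expand {τ : E → E → W} (h : Alt2 τ) (a b : E) :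
    τ a b = ∑ i, ∑ j, (ξ i a * ξ j b) • τ (e i) (e j) := by
  rw [linear_expand he (f := fun a => τ a b) (fun a a' => h.add a a' b) (fun c a => h.smul c a b) a]
  refine Finset.sum_congr rfl fun i _ => ?_
  rw [linear_expand he (f := fun b => τ (e i) b) (fun a a' => h.add' _ a a')
    (fun c a => h.smul' c _ a) b, Finset.smul_sum]
  simp only [smul_smul]

lemma Alt3.expand {τ : E → E → E → W} (h : Alt3 τ) (a b c : E) :
    τ a b c = ∑ i, ∑ j, ∑ k, (ξ i a * ξ j b * ξ k c) • τ (e i) (e j) (e k) := by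
  rw [linear_expand he (f := fun a => τ a b c) (fun a a' => h.add a a' b c)
    (fun r a => h.smul r a b c) a]
  refine Finset.sum_congr rfl fun i _ => ?_
  rw [linear_expand he (f := fun b => τ (e i) b c) (fun a a' => h.add₂ _ a a' _)
    (fun r a => h.smul₂ r _ a _) b, Finset.smul_sum]
  refine Finset.sum_congr rfl fun j _ => ?_
  rw [linear_expand he (f := fun c => τ (e i) (e j) c) (fun a a' => h.add₃ _ _ a a')
    (fun r a => h.smul₃ r _ _ a) c, Finset.smul_sum, Finset.smul_sum]
  simp only [smul_smul, mul_assoc]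

end Expansion

section Evaluation

variable (α α' α'' : Dual ℝ E) (β : Dual ℝ V) (e1 e2 e3 : E) (v : V)

lemma evalGr_two_mul :
    evalGr (ιOne α * ιOne α' : DualGrAlg E V) [e1, e2] v = α e1 * α' e2 - α e2 * α' e1 := by
  simp only [evalGr_mul _ _ _ (ιOne_mem_grDeg α), mulEv, evalGr_ιOne_nil, evalGr_ιOne_one,
    evalGr_ιOne_two]
  ring

lemma evalGr_two_mul_nil : evalGr (ιOne α * ιOne α' : DualGrAlg E V) [] v = 0 := by
  rw [evalGr_nil_mul, evalGr_ιOne_nil, zero_mul]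

lemma evalGr_three_mul :
    evalGr (ιOne α * (ιOne α' * ιOne α'') : DualGrAlg E V) [e1, e2, e3] v =
      α e1 * (α' e2 * α'' e3 - α' e3 * α'' e2) - α e2 * (α' e1 * α'' e3 - α' e3 * α'' e1) +
      α e3 * (α' e1 * α'' e2 - α' e2 * α'' e1) := by
  simp only [evalGr_mul _ _ _ (ιOne_mem_grDeg α), mulEv, evalGr_ιOne_nil, evalGr_ιOne_one,
    evalGr_ιOne_two, evalGr_two_mul]
  ring

lemma evalGr_three_mul_one :
    evalGr (ιOne α * (ιOne α' * ιOne α'') : DualGrAlg E V) [e1] v = 0 := by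
  simp only [evalGr_mul _ _ _ (ιOne_mem_grDeg α), mulEv, evalGr_ιOne_nil, evalGr_ιOne_one,
    evalGr_two_mul_nil]
  ring

lemma evalGr_mixed_mul :
    evalGr (ιOne α * ιTwo β : DualGrAlg E V) [e1] v = α e1 * β v := by
  simp only [evalGr_mul _ _ _ (ιOne_mem_grDeg α), mulEv, evalGr_ιOne_nil, evalGr_ιOne_one,
    evalGr_ιTwo_nil, evalGr_ιTwo_cons]
  ring

lemma evalGr_mixed_mul_three :
    evalGr (ιOne α * ιTwo β : DualGrAlg E V) [e1, e2, e3] v = 0 := by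
  simp only [evalGr_mul _ _ _ (ιOne_mem_grDeg α), mulEv, evalGr_ιOne_nil, evalGr_ιOne_one,
    evalGr_ιOne_two, evalGr_ιTwo_nil, evalGr_ιTwo_cons]
  ring

end Evaluation

section Ext

variable [Module.Finite ℝ E] [Module.Finite ℝ V] {a b : DualGrAlg E V}

lemma evalGr_eq_evalGr {k : ℕ} (ha : a ∈ grDeg _ _ k) (hb : b ∈ grDeg _ _ k) {l : List E}
    (h : ∀ q, l.length + 2 * q ≠ k) (v : V) : evalGr a l v = evalGr b l v := by
  rw [evalGr_eq_zero _ _ ha h, evalGr_eq_zero _ _ hb h]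

lemma ext_one (ha : a ∈ grDeg _ _ 1) (hb : b ∈ grDeg _ _ 1)
    (h : ∀ e, evalGr a [e] 0 = evalGr b [e] 0) : a = b := by
  refine evalGr_ext fun l v => ?_
  match l with
  | [e] => rw [evalGr_const ha [e] rfl v 0, evalGr_const hb [e] rfl v 0, h]
  | [] => exact evalGr_eq_evalGr ha hb (fun q => by simp) v
  | _ :: _ :: _ => exact evalGr_eq_evalGr ha hb (fun q => by simp; omega) v

lemma ext_two (ha : a ∈ grDeg _ _ 2) (hb : b ∈ grDeg _ _ 2)
    (h : ∀ e e', evalGr a [e, e'] 0 = evalGr b [e, e'] 0)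
    (h' : ∀ v, evalGr a [] v = evalGr b [] v) : a = b := by
  refine evalGr_ext fun l v => ?_
  match l with
  | [e, e'] => rw [evalGr_const ha _ rfl v 0, evalGr_const hb _ rfl v 0, h]
  | [] => exact h' v
  | [_] => exact evalGr_eq_evalGr ha hb (fun q => by simp; omega) v
  | _ :: _ :: _ :: _ => exact evalGr_eq_evalGr ha hb (fun q => by simp; omega) v

lemma ext_three (ha : a ∈ grDeg _ _ 3) (hb : b ∈ grDeg _ _ 3)
    (h : ∀ e1 e2 e3, evalGr a [e1, e2, e3] 0 = evalGr b [e1, e2, e3] 0)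
    (h' : ∀ e v, evalGr a [e] v = evalGr b [e] v) : a = b := by
  refine evalGr_ext fun l v => ?_
  match l with
  | [e1, e2, e3] => rw [evalGr_const ha _ rfl v 0, evalGr_const hb _ rfl v 0, h]
  | [e] => exact h' e v
  | [] => exact evalGr_eq_evalGr ha hb (fun q => by simp; omega) v
  | [_, _] => exact evalGr_eq_evalGr ha hb (fun q => by simp; omega) v
  | _ :: _ :: _ :: _ :: _ => exact evalGr_eq_evalGr ha hb (fun q => by simp; omega) v

lemma ext_four (ha : a ∈ grDeg _ _ 4)
    (h : ∀ e1 e2 e3 e4, evalGr a [e1, e2, e3, e4] 0 = 0)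
    (h' : ∀ e e' v, evalGr a [e, e'] v = 0) (h'' : ∀ v, evalGr a [] v = 0) : a = 0 := by
  refine evalGr_ext fun l v => ?_
  rw [evalGr_zero]
  match l with
  | [e1, e2, e3, e4] => rw [evalGr_const ha _ rfl v 0, h]
  | [e, e'] => exact h' e e' v
  | [] => exact h'' v
  | [_] => exact evalGr_eq_zero _ _ ha fun q => by simp; omega
  | [_, _, _] => exact evalGr_eq_zero _ _ ha fun q => by simp; omega
  | _ :: _ :: _ :: _ :: _ :: _ => exact evalGr_eq_zero _ _ ha fun q => by simp; omega

end Ext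

section Values

variable {a : DualGrAlg E V}

lemma alt2_evalGr (a : DualGrAlg E V) (v : V) : Alt2 fun e e' => evalGr a [e, e'] v where
  add _ _ _ := evalGr_cons_add _ _ _ _ _
  smul _ _ _ := evalGr_cons_smul _ _ _ _ _
  swap _ _ := evalGr_swap _ _ _ _ _

lemma alt3_evalGr (a : DualGrAlg E V) (v : V) :
    Alt3 fun e1 e2 e3 => evalGr a [e1, e2, e3] v where
  add _ _ _ _ := evalGr_cons_add _ _ _ _ _
  smul _ _ _ _ := evalGr_cons_smul _ _ _ _ _
  swap _ _ _ := evalGr_swap _ _ _ _ _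
  swap' _ _ _ := by
    rw [evalGr_cons, evalGr_cons a]
    exact evalGr_swap _ _ _ _ _

variable {ι κ : Type*} [Fintype ι] [Fintype κ] (e : ι → E) (ξ : ι → Dual ℝ E)
  (g : κ → V) (η : κ → Dual ℝ V)

/-- The element of degree one with given values on a basis. -/
def oneElem (τ : E → ℝ) : DualGrAlg E V := ∑ i, τ (e i) • ιOne (ξ i)

/-- The element of degree two with given values on a basis. -/
def twoElem (τ : E → E → ℝ) (μ : V → ℝ) : DualGrAlg E V :=
  ∑ i, ∑ j, (2⁻¹ * τ (e i) (e j)) • (ιOne (ξ i) * ιOne (ξ j)) + ∑ k, μ (g k) • ιTwo (η k)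

/-- The element of degree three with given values on a basis. -/
def threeElem (τ : E → E → E → ℝ) (μ : E → V → ℝ) : DualGrAlg E V :=
  ∑ i, ∑ j, ∑ k, (6⁻¹ * τ (e i) (e j) (e k)) • (ιOne (ξ i) * (ιOne (ξ j) * ιOne (ξ k))) +
    ∑ i, ∑ k, μ (e i) (g k) • (ιOne (ξ i) * ιTwo (η k))

lemma twoElem_mem (τ : E → E → ℝ) (μ : V → ℝ) : twoElem e ξ g η τ μ ∈ grDeg _ _ 2 :=
  Submodule.add_mem _ (Submodule.sum_mem _ fun _ _ => Submodule.sum_mem _ fun _ _ =>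
    Submodule.smul_mem _ _ (ιOne_mul_mem _ (ιOne_mem_grDeg _)))
    (Submodule.sum_mem _ fun _ _ => Submodule.smul_mem _ _ (ιTwo_mem_grDeg _))

lemma threeElem_mem (τ : E → E → E → ℝ) (μ : E → V → ℝ) :
    threeElem e ξ g η τ μ ∈ grDeg _ _ 3 :=
  Submodule.add_mem _ (Submodule.sum_mem _ fun _ _ => Submodule.sum_mem _ fun _ _ =>
    Submodule.sum_mem _ fun _ _ => Submodule.smul_mem _ _
      (ιOne_mul_mem _ (ιOne_mul_mem _ (ιOne_mem_grDeg _))))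
    (Submodule.sum_mem _ fun _ _ => Submodule.sum_mem _ fun _ _ => Submodule.smul_mem _ _
      (ιOne_mul_mem _ (ιTwo_mem_grDeg _)))

variable {e ξ g η} (he : ∀ v, ∑ i, ξ i v • e i = v) (hg : ∀ v, ∑ i, η i v • g i = v)
include he

lemma evalGr_twoElem {τ : E → E → ℝ} (hτ : Alt2 τ) (μ : V → ℝ) (d1 d2 : E) (v : V) :
    evalGr (twoElem e ξ g η τ μ) [d1, d2] v = τ d1 d2 := by
  have h1 := hτ.expand he d1 d2
  have h2 := hτ.expand he d2 d1
  rw [hτ.swap] at h2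
  rw [twoElem, evalGr_add]
  simp only [evalGr_sum, evalGr_smul, evalGr_two_mul, evalGr_ιTwo_cons, mul_zero,
    Finset.sum_const_zero, add_zero]
  have h3 : τ d1 d2 = 2⁻¹ * (τ d1 d2 - -τ d1 d2) := by ring
  rw [h3, h2, h1, ← Finset.sum_sub_distrib, Finset.mul_sum]
  refine Finset.sum_congr rfl fun i _ => ?_
  rw [← Finset.sum_sub_distrib, Finset.mul_sum]
  refine Finset.sum_congr rfl fun j _ => ?_
  simp only [smul_eq_mul]
  ring

lemma evalGr_threeElem {τ : E → E → E → ℝ} (hτ : Alt3 τ) (μ : E → V → ℝ) (d1 d2 d3 : E)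
    (v : V) : evalGr (threeElem e ξ g η τ μ) [d1, d2, d3] v = τ d1 d2 d3 := by
  have h1 : τ d1 d2 d3 = 6⁻¹ * (τ d1 d2 d3 - τ d1 d3 d2 - τ d2 d1 d3 + τ d3 d1 d2 + τ d2 d3 d1
      - τ d3 d2 d1) := by
    rw [hτ.swap' d1 d3, hτ.swap d2 d1, hτ.swap' d2 d3, hτ.swap d3 d2, hτ.swap' d2 d3,
      hτ.swap d2 d1, hτ.swap d3 d1, hτ.swap' d1 d3]
    ring
  rw [threeElem, evalGr_add]
  simp only [evalGr_sum, evalGr_smul, evalGr_three_mul, evalGr_mixed_mul_three, mul_zero,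
    Finset.sum_const_zero, add_zero]
  rw [h1, hτ.expand he d1 d2 d3, hτ.expand he d1 d3 d2, hτ.expand he d2 d1 d3,
    hτ.expand he d3 d1 d2, hτ.expand he d2 d3 d1, hτ.expand he d3 d2 d1]
  simp only [← Finset.sum_sub_distrib, ← Finset.sum_add_distrib, Finset.mul_sum, smul_eq_mul]
  refine Finset.sum_congr rfl fun i _ => Finset.sum_congr rfl fun j _ =>
    Finset.sum_congr rfl fun k _ => ?_
  ring

omit he
include hg

lemma evalGr_twoElem_nil (τ : E → E → ℝ) {μ : V → ℝ} (hadd : ∀ a b, μ (a + b) = μ a + μ b)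
    (hsmul : ∀ (c : ℝ) a, μ (c • a) = c • μ a) (v : V) :
    evalGr (twoElem e ξ g η τ μ) [] v = μ v := by
  rw [linear_expand hg hadd hsmul v, twoElem, evalGr_add]
  simp only [evalGr_sum, evalGr_smul, evalGr_two_mul_nil, evalGr_ιTwo_nil, mul_zero,
    Finset.sum_const_zero, zero_add]
  simp only [smul_eq_mul, mul_comm]

include he

lemma evalGr_threeElem_one (τ : E → E → E → ℝ) {μ : E → V → ℝ}
    (hadd : ∀ a b v, μ (a + b) v = μ a v + μ b v) (hsmul : ∀ (c : ℝ) a v, μ (c • a) v = c • μ a v)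
    (hadd' : ∀ a v w, μ a (v + w) = μ a v + μ a w) (hsmul' : ∀ (c : ℝ) a v, μ a (c • v) = c • μ a v)
    (d : E) (v : V) : evalGr (threeElem e ξ g η τ μ) [d] v = μ d v := by
  rw [linear_expand he (f := fun d => μ d v) (fun a b => hadd a b v) (fun c a => hsmul c a v) d,
    threeElem, evalGr_add]
  simp only [evalGr_sum, evalGr_smul, evalGr_three_mul_one, evalGr_mixed_mul, mul_zero,
    Finset.sum_const_zero, zero_add]
  refine Finset.sum_congr rfl fun i _ => ?_
  rw [linear_expand hg (hadd' (e i)) (fun c => hsmul' c (e i)) v, Finset.smul_sum]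
  simp only [smul_eq_mul]
  refine Finset.sum_congr rfl fun j _ => ?_
  ring

end Values

end Elements

section Evaluation

variable {f : ∀ y, FibAlg E V y} {x : M}

lemma mulEv_contMDiffAt {A B : ∀ y, List (E.fiber y) → ℝ}
    (hA : ∀ l : List (Sec E),
      ContMDiffAt (𝓡 n) 𝓘(ℝ, ℝ) ∞ (fun y => A y (l.map fun ψ => ψ y)) x)
    (hB : ∀ l : List (Sec E),
      ContMDiffAt (𝓡 n) 𝓘(ℝ, ℝ) ∞ (fun y => B y (l.map fun ψ => ψ y)) x)
    (p : ℕ) (l : List (Sec E)) :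
    ContMDiffAt (𝓡 n) 𝓘(ℝ, ℝ) ∞
      (fun y => mulEv (l.map fun ψ => ψ y) p (A y) (B y)) x := by
  induction l generalizing p A B with
  | nil => exact (hA []).mul (hB [])
  | cons ψ l ih =>
    exact (ih (A := fun y l => A y (ψ y :: l)) (fun l => hA (ψ :: l)) hB (p - 1)).add
      (contMDiffAt_const.mul (ih (B := fun y l => B y (ψ y :: l)) hA (fun l => hB (ψ :: l)) p))

lemma SmoothAt.evalGr (hf : SmoothAt f x) (l : List (Sec E)) (v : Sec V) :
    ContMDiffAt (𝓡 n) 𝓘(ℝ, ℝ) ∞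
      (fun y => QTwo.evalGr (f y) (l.map fun ψ => ψ y) (v y)) x := by
  obtain ⟨a, ha, hfa⟩ := hf
  suffices key : ∀ l : List (Sec E), ContMDiffAt (𝓡 n) 𝓘(ℝ, ℝ) ∞
      (fun y => QTwo.evalGr (splitVal a y) (l.map fun ψ => ψ y) (v y)) x by
    refine (key l).congr_of_eventuallyEq ?_
    filter_upwards [hfa] with y hy
    rw [hy]
  refine adjoin_global_induction (P := fun a => ∀ l : List (Sec E), ContMDiffAt (𝓡 n) 𝓘(ℝ, ℝ) ∞
      (fun y => QTwo.evalGr (splitVal a y) (l.map fun ψ => ψ y) (v y)) x) ?_ ?_ ?_ ?_ ?_ ?_ ha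
  · intro l
    have h1 : ∀ y, splitVal (1 : 𝒪[E,V].A ⊤) y = algebraMap ℝ _ 1 := fun y =>
      (map_one _).symm
    simp only [h1]
    cases l with
    | nil => simpa only [List.map_nil, evalGr_algebraMap_nil] using contMDiffAt_const
    | cons e l => simpa only [List.map_cons, evalGr_algebraMap_cons] using contMDiffAt_const
  · intro a b ha hb l
    simp only [splitVal_add, evalGr_add]
    exact (ha l).add (hb l)
  · intro c a ha l
    simp only [splitVal_smul, evalGr_smul]
    exact contMDiffAt_const.mul (ha l)
  · intro g a ha l
    have h1 : ∀ y, splitVal (ofFun E V g * a) y = g y • splitVal a y := fun y => by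
      rw [splitVal_mul, splitVal_ofFun, Algebra.algebraMap_eq_smul_one, smul_mul_assoc, one_mul]
    simp only [h1, evalGr_smul]
    exact (g.contMDiff x).mul (ha l)
  · intro α a ha l
    simp only [splitVal_mul, splitVal_ofDualE, evalGr_mul _ _ _ (ιOne_mem_grDeg _)]
    refine mulEv_contMDiffAt (A := fun y l => QTwo.evalGr (ιOne (α.form y)) l (v y))
      (fun l => ?_) ha 1 l
    match l with
    | [] => simpa using contMDiffAt_const
    | [ψ] => simpa using α.smooth ψ x
    | _ :: _ :: _ => simpa using contMDiffAt_const
  · intro β a ha l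
    simp only [splitVal_mul, splitVal_ofDualV, evalGr_mul _ _ _ (ιTwo_mem_grDeg _)]
    refine mulEv_contMDiffAt (A := fun y l => QTwo.evalGr (ιTwo (β.form y)) l (v y))
      (fun l => ?_) ha 2 l
    match l with
    | [] => simpa using β.smooth v x
    | _ :: _ => simpa using contMDiffAt_const

/-- The values of a function on sections. -/
def evalSec (a : 𝒪[E,V].A ⊤) (l : List (Sec E)) (v : Sec V) : GlobalFun n M :=
  ⟨fun y => evalGr (splitVal a y) (l.map fun ψ => ψ y) (v y),
    fun y => (smoothAt_splitVal a y).evalGr l v⟩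

lemma evalSec_apply (a : 𝒪[E,V].A ⊤) (l : List (Sec E)) (v : Sec V) (y : M) :
    evalSec a l v y = evalGr (splitVal a y) (l.map fun ψ => ψ y) (v y) := rfl

/-- Bundling of a smooth function. -/
def mkFun (f : M → ℝ) (hf : ContMDiff (𝓡 n) 𝓘(ℝ, ℝ) ∞ f) : GlobalFun n M := ⟨f, hf⟩

/-- Pairing of a section with a section of the dual. -/
def pair (α : DualSec E) (ψ : Sec E) : GlobalFun n M := ⟨fun y => α.form y (ψ y), α.smooth ψ⟩

@[simp] theorem pair_apply (α : DualSec E) (ψ : Sec E) (y : M) : pair α ψ y = α.form y (ψ y) := rfl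

section FrameExpressions

variable {W : Opens M} (F : Frame E W) (G : Frame V W)

lemma Frame.coe_sum {W : Opens M} (F : Frame E W) {y : M} (hy : y ∈ W) (v : E.fiber y) :
    ∑ a, (F.ξ a).form y v • F.e a y = v := F.sum y hy v

/-- The function of degree two with given coefficients in a frame. -/
def twoGlobal (f : Fin E.rank → Fin E.rank → GlobalFun n M) (g : Fin V.rank → GlobalFun n M) :
    𝒪[E,V].A ⊤ :=
  ∑ i, ∑ j, ofDualE E V (f i j • F.ξ i) * ofDualE E V (F.ξ j) + ∑ k, ofDualV E V (g k • G.ξ k)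

/-- The function of degree three with given coefficients in a frame. -/
def threeGlobal (f : Fin E.rank → Fin E.rank → Fin E.rank → GlobalFun n M)
    (g : Fin E.rank → Fin V.rank → GlobalFun n M) : 𝒪[E,V].A ⊤ :=
  ∑ i, ∑ j, ∑ k, ofDualE E V (f i j k • F.ξ i) * (ofDualE E V (F.ξ j) * ofDualE E V (F.ξ k)) +
    ∑ i, ∑ k, ofDualE E V (g i k • F.ξ i) * ofDualV E V (G.ξ k)

lemma splitVal_twoGlobal {f : Fin E.rank → Fin E.rank → GlobalFun n M}
    {g : Fin V.rank → GlobalFun n M} (y : M) {τ : E.fiber y → E.fiber y → ℝ} {μ : V.fiber y → ℝ}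
    (hf : ∀ i j, f i j y = 2⁻¹ * τ (F.e i y) (F.e j y)) (hg : ∀ k, g k y = μ (G.e k y)) :
    splitVal (twoGlobal F G f g) y = twoElem (fun i => F.e i y) (fun i => (F.ξ i).form y)
      (fun i => G.e i y) (fun i => (G.ξ i).form y) τ μ := by
  simp only [twoGlobal, twoElem, splitVal_add, splitVal_sum, splitVal_mul, splitVal_ofDualE,
    splitVal_ofDualV, DualSec.smul_form, ιOne_smul, ιTwo_smul, smul_mul_assoc, hf, hg]

lemma splitVal_threeGlobal {f : Fin E.rank → Fin E.rank → Fin E.rank → GlobalFun n M}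
    {g : Fin E.rank → Fin V.rank → GlobalFun n M} (y : M)
    {τ : E.fiber y → E.fiber y → E.fiber y → ℝ} {μ : E.fiber y → V.fiber y → ℝ}
    (hf : ∀ i j k, f i j k y = 6⁻¹ * τ (F.e i y) (F.e j y) (F.e k y))
    (hg : ∀ i k, g i k y = μ (F.e i y) (G.e k y)) :
    splitVal (threeGlobal F G f g) y = threeElem (fun i => F.e i y) (fun i => (F.ξ i).form y)
      (fun i => G.e i y) (fun i => (G.ξ i).form y) τ μ := by
  simp only [threeGlobal, threeElem, splitVal_add, splitVal_sum, splitVal_mul, splitVal_ofDualE,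
    splitVal_ofDualV, DualSec.smul_form, ιOne_smul, smul_mul_assoc, hf, hg]

end FrameExpressions

lemma exists_two_frames (E : SmoothVB.{u, w} n M) (V : SmoothVB.{u, w₂} n M) (x : M) :
    ∃ W : Opens M, x ∈ W ∧ Nonempty (Frame E W) ∧ Nonempty (Frame V W) := by
  obtain ⟨W, hx, ⟨F⟩⟩ := exists_frame E x
  obtain ⟨W', hx', ⟨G⟩⟩ := exists_frame V x
  exact ⟨W ⊓ W', ⟨hx, hx'⟩, ⟨F.restrict inf_le_left⟩, ⟨G.restrict inf_le_right⟩⟩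

lemma exists_deg_two (τ : ∀ y, E.fiber y → E.fiber y → ℝ) (hτ : ∀ y, Alt2 (τ y))
    (hs : ∀ ψ ψ' : Sec E, ContMDiff (𝓡 n) 𝓘(ℝ, ℝ) ∞ fun y => τ y (ψ y) (ψ' y)) (μ : DualSec V) :
    ∃ a ∈ 𝒪[E,V].deg ⊤ 2, (∀ y e e' v, evalGr (splitVal a y) [e, e'] v = τ y e e') ∧
      ∀ y v, evalGr (splitVal a y) [] v = μ.form y v := by
  have h : ∀ y, ∃ b ∈ grDeg (Dual ℝ (E.fiber y)) (Dual ℝ (V.fiber y)) 2,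
      (∀ e e' v, evalGr b [e, e'] v = τ y e e') ∧ ∀ v, evalGr b [] v = μ.form y v := by
    intro y
    obtain ⟨W, hy, ⟨F⟩, ⟨G⟩⟩ := exists_two_frames E V y
    exact ⟨_, twoElem_mem _ _ _ _ _ _, fun e e' v => evalGr_twoElem (F.coe_sum hy) (hτ y) _ e e' v,
      fun v => evalGr_twoElem_nil (G.coe_sum hy) _ (map_add _) (map_smul (μ.form y)) v⟩
  choose b hb h1 h2 using h
  refine ⟨ofHom ⊤ 2 (fun y => b y.1) (SmoothAt.isSmoothSplit fun x _ => ?_) fun y => hb y.1,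
    fun y => hb y.1, h1, h2⟩
  obtain ⟨W, hx, ⟨F⟩, ⟨G⟩⟩ := exists_two_frames E V x
  refine (smoothAt_splitVal (twoGlobal F G
    (fun i j => mkFun (fun y => 2⁻¹ * τ y (F.e i y) (F.e j y)) (contMDiff_const.mul (hs _ _)))
    (fun k => pair μ (G.e k))) x).congr ?_
  filter_upwards [W.isOpen.mem_nhds hx] with y hy
  rw [splitVal_twoGlobal F G y (τ := τ y) (μ := μ.form y) (fun _ _ => rfl) fun _ => rfl]
  refine ext_two (hb y) (twoElem_mem _ _ _ _ _ _) (fun e e' => ?_) fun v => ?_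
  · rw [h1, evalGr_twoElem (F.coe_sum hy) (hτ y)]
  · rw [h2, evalGr_twoElem_nil (G.coe_sum hy) _ (map_add _) (map_smul (μ.form y))]

lemma exists_deg_three (τ : ∀ y, E.fiber y → E.fiber y → E.fiber y → ℝ) (hτ : ∀ y, Alt3 (τ y))
    (hs : ∀ ψ1 ψ2 ψ3 : Sec E, ContMDiff (𝓡 n) 𝓘(ℝ, ℝ) ∞ fun y => τ y (ψ1 y) (ψ2 y) (ψ3 y))
    (μ : ∀ y, E.fiber y →ₗ[ℝ] V.fiber y →ₗ[ℝ] ℝ)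
    (hs' : ∀ (ψ : Sec E) (v : Sec V), ContMDiff (𝓡 n) 𝓘(ℝ, ℝ) ∞ fun y => μ y (ψ y) (v y)) :
    ∃ a ∈ 𝒪[E,V].deg ⊤ 3,
      (∀ y e1 e2 e3 v, evalGr (splitVal a y) [e1, e2, e3] v = τ y e1 e2 e3) ∧
      ∀ y e v, evalGr (splitVal a y) [e] v = μ y e v := by
  have key : ∀ (W : Opens M) (F : Frame E W) (G : Frame V W), ∀ y ∈ W, ∀ e v,
      evalGr (threeElem (fun i => F.e i y) (fun i => (F.ξ i).form y) (fun i => G.e i y)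
        (fun i => (G.ξ i).form y) (τ y) (fun e v => μ y e v)) [e] v = μ y e v :=
    fun W F G y hy e v => evalGr_threeElem_one (F.coe_sum hy) (G.coe_sum hy) _
      (fun a b v => by rw [map_add]; rfl) (fun c a v => by rw [map_smul]; rfl)
      (fun a v w => map_add _ _ _) (fun c a v => map_smul _ _ _) e v
  have h : ∀ y, ∃ b ∈ grDeg (Dual ℝ (E.fiber y)) (Dual ℝ (V.fiber y)) 3,
      (∀ e1 e2 e3 v, evalGr b [e1, e2, e3] v = τ y e1 e2 e3) ∧
      ∀ e v, evalGr b [e] v = μ y e v := by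
    intro y
    obtain ⟨W, hy, ⟨F⟩, ⟨G⟩⟩ := exists_two_frames E V y
    exact ⟨_, threeElem_mem _ _ _ _ _ _, fun e1 e2 e3 v =>
      evalGr_threeElem (F.coe_sum hy) (hτ y) _ e1 e2 e3 v, key W F G y hy⟩
  choose b hb h1 h2 using h
  refine ⟨ofHom ⊤ 3 (fun y => b y.1) (SmoothAt.isSmoothSplit fun x _ => ?_) fun y => hb y.1,
    fun y => hb y.1, h1, h2⟩
  obtain ⟨W, hx, ⟨F⟩, ⟨G⟩⟩ := exists_two_frames E V x
  refine (smoothAt_splitVal (threeGlobal F G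
    (fun i j k => mkFun (fun y => 6⁻¹ * τ y (F.e i y) (F.e j y) (F.e k y))
      (contMDiff_const.mul (hs _ _ _)))
    (fun i k => mkFun (fun y => μ y (F.e i y) (G.e k y)) (hs' _ _))) x).congr ?_
  filter_upwards [W.isOpen.mem_nhds hx] with y hy
  rw [splitVal_threeGlobal F G y (τ := τ y) (μ := fun e v => μ y e v)
    (fun _ _ _ => rfl) fun _ _ => rfl]
  refine ext_three (hb y) (threeElem_mem _ _ _ _ _ _) (fun e1 e2 e3 => ?_) fun e v => ?_
  · rw [h1, evalGr_threeElem (F.coe_sum hy) (hτ y)]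
  · rw [h2, key W F G y hy]

lemma exists_ofDualE {a : 𝒪[E,V].A ⊤} (ha : a ∈ 𝒪[E,V].deg ⊤ 1) :
    ∃ α : DualSec E, a = ofDualE E V α := by
  let α : DualSec E := ⟨fun y =>
    { toFun := fun e => evalGr (splitVal a y) [e] 0
      map_add' := fun _ _ => evalGr_cons_add _ _ _ _ _
      map_smul' := fun _ _ => evalGr_cons_smul _ _ _ _ _ }, fun ψ => (evalSec a [ψ] 0).contMDiff⟩
  refine ⟨α, splitVal_ext fun y => ext_one (ha ⟨y, trivial⟩) (ιOne_mem_grDeg _) fun e => ?_⟩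
  rw [splitVal_ofDualE, evalGr_ιOne_one]
  rfl

section Induction

variable {P : 𝒪[E,V].A ⊤ → Prop} (add : ∀ a b, P a → P b → P (a + b))
include add

lemma closed_sum (zero : P 0) {ι : Type*} (s : Finset ι) {a : ι → 𝒪[E,V].A ⊤}
    (h : ∀ i, P (a i)) : P (∑ i ∈ s, a i) := by
  classical
  induction s using Finset.induction_on with
  | empty => simpa using zero
  | insert i s hi ih => rw [Finset.sum_insert hi]; exact add _ _ (h i) ih

variable (loc : ∀ a b, (∀ᶠ y in 𝓝 x, splitVal a y = splitVal b y) → P a → P b)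
include loc

@[elab_as_elim] theorem deg_two_induction (one : ∀ α α', P (ofDualE E V α * ofDualE E V α'))
    (two : ∀ β, P (ofDualV E V β)) {a : 𝒪[E,V].A ⊤}
    (ha : a ∈ 𝒪[E,V].deg ⊤ 2) : P a := by
  have zero : P 0 := by
    have h := one 0 0
    have h0 : ofDualE E V 0 * ofDualE E V 0 = 0 := splitVal_ext fun y => by
      rw [splitVal_mul, splitVal_ofDualE, DualSec.zero_form, ιOne_mul_self, splitVal_zero]
    rwa [h0] at h
  obtain ⟨W, hx, ⟨F⟩, ⟨G⟩⟩ := exists_two_frames E V x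
  refine loc (twoGlobal F G
    (fun i j => constFun 2⁻¹ * evalSec a [F.e i, F.e j] 0) (fun k => evalSec a [] (G.e k))) a ?_
    (add _ _ (closed_sum add zero _ fun i => closed_sum add zero _ fun j => one _ _)
      (closed_sum add zero _ fun k => two _))
  filter_upwards [W.isOpen.mem_nhds hx] with y hy
  rw [splitVal_twoGlobal F G y (τ := fun e e' => evalGr (splitVal a y) [e, e'] 0)
    (μ := fun v => evalGr (splitVal a y) [] v) (fun _ _ => rfl) fun _ => rfl]
  obtain ⟨μ, hμ⟩ := evalGr_linear (ha ⟨y, trivial⟩) [] rfl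
  refine ext_two (twoElem_mem _ _ _ _ _ _) (ha ⟨y, trivial⟩) (fun e e' => ?_) fun v => ?_
  · rw [evalGr_twoElem (F.coe_sum hy) (alt2_evalGr _ _)]
  · rw [evalGr_twoElem_nil (G.coe_sum hy) _ (fun v w => ?_) (fun c v => ?_)]
    · exact (hμ (v + w)).trans ((map_add μ v w).trans (by rw [← hμ, ← hμ]; rfl))
    · exact (hμ (c • v)).trans ((map_smul μ c v).trans (by rw [← hμ]; rfl))

@[elab_as_elim] theorem deg_three_induction
    (mul : ∀ α, ∀ η ∈ 𝒪[E,V].deg ⊤ 2, P (ofDualE E V α * η)) {a : 𝒪[E,V].A ⊤}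
    (ha : a ∈ 𝒪[E,V].deg ⊤ 3) : P a := by
  have zero : P 0 := by
    have h := mul 0 0 (zero_mem _)
    rwa [mul_zero] at h
  obtain ⟨W, hx, ⟨F⟩, ⟨G⟩⟩ := exists_two_frames E V x
  refine loc (threeGlobal F G
    (fun i j k => constFun 6⁻¹ * evalSec a [F.e i, F.e j, F.e k] 0)
    (fun i k => evalSec a [F.e i] (G.e k))) a ?_
    (add _ _ (closed_sum add zero _ fun i => closed_sum add zero _ fun j =>
      closed_sum add zero _ fun k => mul _ _ fun y => ιOne_mul_mem _ (ιOne_mem_grDeg _))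
      (closed_sum add zero _ fun i => closed_sum add zero _ fun k => mul _ _ (ofDualV_mem _)))
  filter_upwards [W.isOpen.mem_nhds hx] with y hy
  rw [splitVal_threeGlobal F G y (τ := fun e1 e2 e3 => evalGr (splitVal a y) [e1, e2, e3] 0)
    (μ := fun e v => evalGr (splitVal a y) [e] v) (fun _ _ _ => rfl) fun _ _ => rfl]
  refine ext_three (threeElem_mem _ _ _ _ _ _) (ha ⟨y, trivial⟩) (fun e1 e2 e3 => ?_) fun e v => ?_
  · rw [evalGr_threeElem (F.coe_sum hy) (alt3_evalGr _ _)]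
  · rw [evalGr_threeElem_one (F.coe_sum hy) (G.coe_sum hy) _
      (fun a b v => evalGr_cons_add _ _ _ _ _) (fun c a v => evalGr_cons_smul _ _ _ _ _)
      (fun e v w => ?_) (fun c e v => ?_)]
    · obtain ⟨μ, hμ⟩ := evalGr_linear (ha ⟨y, trivial⟩) [e] rfl
      exact (hμ (v + w)).trans ((map_add μ v w).trans (by rw [← hμ, ← hμ]; rfl))
    · obtain ⟨μ, hμ⟩ := evalGr_linear (ha ⟨y, trivial⟩) [e] rfl
      exact (hμ (c • v)).trans ((map_smul μ c v).trans (by rw [← hμ]; rfl))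

end Induction

end Evaluation

lemma ofFun_smul_val (f : GlobalFun n M) (a : 𝒪[E,V].A ⊤) (x : M) :
    splitVal (ofFun E V f * a) x = f x • splitVal a x := by
  rw [splitVal_mul, splitVal_ofFun, Algebra.algebraMap_eq_smul_one, smul_mul_assoc, one_mul]

lemma ofDualE_smul (f : GlobalFun n M) (α : DualSec E) :
    ofDualE E V (f • α) = ofFun E V f * ofDualE E V α := splitVal_ext fun y => by
  rw [ofFun_smul_val, splitVal_ofDualE, splitVal_ofDualE, DualSec.smul_form, ιOne_smul]

lemma ofDualV_smul (f : GlobalFun n M) (β : DualSec V) :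
    ofDualV E V (f • β) = ofFun E V f * ofDualV E V β := splitVal_ext fun y => by
  rw [ofFun_smul_val, splitVal_ofDualV, splitVal_ofDualV, DualSec.smul_form, ιTwo_smul]

lemma ofDualE_add (α β : DualSec E) :
    ofDualE E V (α + β) = ofDualE E V α + ofDualE E V β := splitVal_ext fun y => by
  rw [splitVal_add, splitVal_ofDualE, splitVal_ofDualE, splitVal_ofDualE, DualSec.add_form,
    ιOne_add]

lemma ofDualV_add (α β : DualSec V) :
    ofDualV E V (α + β) = ofDualV E V α + ofDualV E V β := splitVal_ext fun y => by
  rw [splitVal_add, splitVal_ofDualV, splitVal_ofDualV, splitVal_ofDualV, DualSec.add_form,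
    ιTwo_add]

lemma ofFun_mul (f g : GlobalFun n M) :
    ofFun E V (f * g) = ofFun E V f * ofFun E V g := splitVal_ext fun y =>
  map_mul (algebraMap ℝ (FibAlg E V y)) (f y) (g y)

lemma ofFun_add (f g : GlobalFun n M) :
    ofFun E V (f + g) = ofFun E V f + ofFun E V g := splitVal_ext fun y =>
  map_add (algebraMap ℝ (FibAlg E V y)) (f y) (g y)

lemma ofFun_smul (c : ℝ) (f : GlobalFun n M) :
    ofFun E V (c • f) = c • ofFun E V f := splitVal_ext fun y => by
  rw [splitVal_smul, splitVal_ofFun, splitVal_ofFun, Algebra.algebraMap_eq_smul_one,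
    Algebra.algebraMap_eq_smul_one, smul_smul]
  rfl

variable (E V) in
/-- A derivation of degree one at a point. -/
structure PointDer (x : M) where
  app : 𝒪[E,V].A ⊤ →ₗ[ℝ] FibAlg E V x
  degree : ∀ k, ∀ a ∈ 𝒪[E,V].deg ⊤ k, app a ∈ grDeg _ _ (k + 1)
  leibniz : ∀ k, ∀ a ∈ 𝒪[E,V].deg ⊤ k, ∀ b,
    app (a * b) = app a * splitVal b x + (-1 : ℝ) ^ k • (splitVal a x * app b)

lemma PointDer.ofFun_mul {x : M} (D : PointDer E V x) (f : GlobalFun n M)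
    (a : 𝒪[E,V].A ⊤) :
    D.app (ofFun E V f * a) = D.app (ofFun E V f) * splitVal a x + f x • D.app a := by
  rw [D.leibniz 0 _ (ofFun_mem f), pow_zero, one_smul, splitVal_ofFun,
    Algebra.algebraMap_eq_smul_one, smul_mul_assoc, one_mul]

lemma exists_cutoff {x : M} {a b : 𝒪[E,V].A ⊤}
    (h : ∀ᶠ y in 𝓝 x, splitVal a y = splitVal b y) :
    ∃ χ : GlobalFun n M, χ x = 1 ∧ ofFun E V χ * a = ofFun E V χ * b := by
  obtain ⟨χ, h1, hχ⟩ := exists_bump_eq (n := n) h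
  refine ⟨χ, h1.self_of_nhds, splitVal_ext fun y => ?_⟩
  rw [ofFun_smul_val, ofFun_smul_val]
  rcases hχ y with hy | hy
  · rw [hy]
  · rw [hy, zero_smul, zero_smul]

lemma PointDer.local {x : M} (D : PointDer E V x) {a b : 𝒪[E,V].A ⊤}
    (h : ∀ᶠ y in 𝓝 x, splitVal a y = splitVal b y) : D.app a = D.app b := by
  obtain ⟨χ, h1, h2⟩ := exists_cutoff h
  have h3 := D.ofFun_mul χ a
  rw [h2, D.ofFun_mul, h1, h.self_of_nhds, one_smul, one_smul] at h3
  exact (add_left_cancel h3).symm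

lemma exists_homogeneous {x : M} {a : 𝒪[E,V].A ⊤} {k : ℕ}
    (h : ∀ᶠ y in 𝓝 x, splitVal a y ∈ grDeg _ _ k) :
    ∃ b ∈ 𝒪[E,V].deg ⊤ k, ∀ᶠ y in 𝓝 x, splitVal a y = splitVal b y := by
  obtain ⟨χ, hχ1, hχ⟩ := exists_bump_eq (n := n) h
  refine ⟨ofFun E V χ * a, fun y => ?_, ?_⟩
  · change splitVal (ofFun E V χ * a) y.1 ∈ _
    rw [ofFun_smul_val]
    rcases hχ y.1 with hy | hy
    · exact Submodule.smul_mem _ _ hy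
    · rw [hy, zero_smul]; exact zero_mem _
  · filter_upwards [hχ1] with y hy
    rw [ofFun_smul_val, hy, one_smul]

lemma PointDer.degree_local {x : M} (D : PointDer E V x) {a : 𝒪[E,V].A ⊤} {k : ℕ}
    (h : ∀ᶠ y in 𝓝 x, splitVal a y ∈ grDeg _ _ k) : D.app a ∈ grDeg _ _ (k + 1) := by
  obtain ⟨b, hb, e⟩ := exists_homogeneous h
  rw [D.local e]
  exact D.degree k b hb

lemma PointDer.app_one {x : M} (D : PointDer E V x) : D.app 1 = 0 := by
  have h := D.leibniz 0 1 (fun _ => one_mem_grDeg_zero) 1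
  rw [mul_one, splitVal_one, pow_zero, one_smul, mul_one, one_mul] at h
  exact left_eq_add.1 h

variable (E V) in
/-- Prescribed values of a derivation of degree one on generators. -/
structure GenDer where
  q₀ : GlobalFun n M →ₗ[ℝ] 𝒪[E,V].A ⊤
  q₁ : DualSec E → 𝒪[E,V].A ⊤
  q₂ : DualSec V → 𝒪[E,V].A ⊤
  deg₀ : ∀ f, q₀ f ∈ 𝒪[E,V].deg ⊤ 1
  deg₁ : ∀ α, q₁ α ∈ 𝒪[E,V].deg ⊤ 2
  deg₂ : ∀ β, q₂ β ∈ 𝒪[E,V].deg ⊤ 3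
  mul₀ : ∀ f g, q₀ (f * g) = ofFun E V f * q₀ g + ofFun E V g * q₀ f
  add₁ : ∀ α α', q₁ (α + α') = q₁ α + q₁ α'
  add₂ : ∀ β β', q₂ (β + β') = q₂ β + q₂ β'
  smul₁ : ∀ f α, q₁ (f • α) = q₀ f * ofDualE E V α + ofFun E V f * q₁ α
  smul₂ : ∀ f β, q₂ (f • β) = q₀ f * ofDualV E V β + ofFun E V f * q₂ β

lemma GenDer.local (q : GenDer E V) {x : M} {f g : GlobalFun n M}
    (h : ∀ᶠ y in 𝓝 x, f y = g y) : splitVal (q.q₀ f) x = splitVal (q.q₀ g) x := by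
  obtain ⟨χ, h1, hχ⟩ := exists_bump_eq (n := n) h
  have h2 : χ * f = χ * g := by
    ext y
    change χ y * f y = χ y * g y
    rcases hχ y with hy | hy
    · rw [hy]
    · rw [hy, zero_mul, zero_mul]
  have h3 := congrArg (fun a => splitVal a x) (q.mul₀ χ f)
  simp only [splitVal_add, ofFun_smul_val] at h3
  rw [h2, q.mul₀, splitVal_add, ofFun_smul_val, ofFun_smul_val, h1.self_of_nhds, h.self_of_nhds,
    one_smul, one_smul] at h3
  exact (add_right_cancel h3).symm

open scoped Classical in
/-- Cutting off a smooth function. -/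
def cut {W : Opens M} (χ : GlobalFun n M) (hχ : tsupport χ ⊆ W) :
    SmoothFun n W →ₗ[ℝ] GlobalFun n M where
  toFun f := mkFun (fun y => χ y * if h : y ∈ W then f ⟨y, h⟩ else 0)
    (cutoff_smooth hχ (contMDiffAt_of_opens f.contMDiff fun y => dif_pos y.2))
  map_add' f g := by
    ext y
    change χ y * _ = χ y * _ + χ y * _
    by_cases h : y ∈ W
    · simp only [dif_pos h, ← mul_add]; rfl
    · simp only [dif_neg h, mul_zero, add_zero]
  map_smul' c f := by
    ext y
    change χ y * _ = c * (χ y * _)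
    by_cases h : y ∈ W
    · simp only [dif_pos h, mul_left_comm c]; rfl
    · simp only [dif_neg h, mul_zero]

lemma cut_apply {W : Opens M} {χ : GlobalFun n M} (hχ : tsupport χ ⊆ W) (f : SmoothFun n W)
    {y : M} (h : y ∈ W) : cut χ hχ f y = χ y * f ⟨y, h⟩ := by
  classical
  change χ y * _ = _
  rw [dif_pos h]

lemma one_mul_deg {W1 : Type v} {W2 : Type v'} [AddCommGroup W1] [Module ℝ W1] [AddCommGroup W2]
    [Module ℝ W2] {k : ℕ} {a b : GrAlg W1 W2} (ha : a ∈ grDeg W1 W2 k)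
    (hb : b ∈ grDeg W1 W2 1) : b * a = (-1 : ℝ) ^ k • (a * b) := by
  obtain ⟨w, rfl⟩ := (exists_generators hb).2 rfl
  exact ιOne_comm w ha

section CoordinateDerivation

variable {r s : ℕ} {W : Opens M} {x : M} (hx : x ∈ W) (d : SmoothFun n W →ₗ[ℝ] FibAlg E V x)
  (T : FinGrAlg r s →ₐ[ℝ] FibAlg E V x)

/-- The extension of a derivation of the smooth functions to the coordinate algebra, which is zero
on the generators. -/
def coordDer : CoordAlg n r s W →ₗ[ℝ] FibAlg E V x :=
  TensorProduct.lift ((LinearMap.mul ℝ (FibAlg E V x)).compl₁₂ d T.toLinearMap)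

@[simp] theorem coordDer_tmul (f : SmoothFun n W) (g : FinGrAlg r s) :
    coordDer d T (f ⊗ₜ[ℝ] g) = d f * T g := by
  rw [coordDer, TensorProduct.lift.tmul]; rfl

lemma coordDer_mem (hd : ∀ f, d f ∈ grDeg _ _ 1)
    (hT : ∀ k, ∀ g ∈ grDeg (Fin r → ℝ) (Fin s → ℝ) k, T g ∈ grDeg _ _ k) {k : ℕ}
    {τ : CoordAlg n r s W} (hτ : τ ∈ coordDeg n r s W k) : coordDer d T τ ∈ grDeg _ _ (k + 1) := by
  have : coordDeg n r s W k ≤ (grDeg (Dual ℝ (E.fiber x)) (Dual ℝ (V.fiber x))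
      (k + 1)).comap (coordDer d T) :=
    Submodule.map₂_le.2 fun f _ g hg => by
      refine Submodule.mem_comap.2 ?_
      rw [TensorProduct.mk_apply, coordDer_tmul, add_comm]
      exact mul_mem_grDeg (hd f) (hT k g hg)
  exact this hτ

lemma coordDer_leibniz (hd : ∀ f, d f ∈ grDeg _ _ 1)
    (hmul : ∀ f g, d (f * g) = f ⟨x, hx⟩ • d g + g ⟨x, hx⟩ • d f)
    (hT : ∀ k, ∀ g ∈ grDeg (Fin r → ℝ) (Fin s → ℝ) k, T g ∈ grDeg _ _ k) {k : ℕ}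
    {τ : CoordAlg n r s W} (hτ : τ ∈ coordDeg n r s W k) (τ' : CoordAlg n r s W) :
    coordDer d T (τ * τ') = coordDer d T τ * T (coordVal ⟨x, hx⟩ τ') +
      (-1 : ℝ) ^ k • (T (coordVal ⟨x, hx⟩ τ) * coordDer d T τ') := by
  have hz0 : ∀ a : CoordAlg n r s W, 0 * a = 0 :=
    fun a => LinearMap.map_zero₂ Algebra.TensorProduct.mul a
  have hz1 : ∀ a b c : CoordAlg n r s W, (a + b) * c = a * c + b * c :=
    fun a b c => LinearMap.map_add₂ Algebra.TensorProduct.mul a b c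
  have hz2 : ∀ a : CoordAlg n r s W, a * 0 = 0 := fun a => map_zero (Algebra.TensorProduct.mul a)
  have hz3 : ∀ a b c : CoordAlg n r s W, a * (b + c) = a * b + a * c :=
    fun a b c => map_add (Algebra.TensorProduct.mul a) b c
  rw [coordDeg, Submodule.map₂_eq_span_image2] at hτ
  induction hτ using Submodule.span_induction with
  | zero => rw [hz0]; simp
  | add a b _ _ ha hb =>
    rw [hz1]
    simp only [map_add, ha, hb, smul_add, add_mul]
    abel
  | smul c a _ ha =>
    simp only [smul_mul_assoc, map_smul, ha, smul_add]
    rw [smul_comm c]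
  | mem τ h =>
    obtain ⟨f, -, g, hg, rfl⟩ := h
    change coordDer d T (f ⊗ₜ[ℝ] g * τ') = coordDer d T (f ⊗ₜ[ℝ] g) * _ +
      (-1 : ℝ) ^ k • (T (coordVal ⟨x, hx⟩ (f ⊗ₜ[ℝ] g)) * _)
    induction τ' using TensorProduct.induction_on with
    | zero => rw [hz2]; simp
    | add a b ha hb =>
      rw [hz3]
      simp only [map_add, ha, hb, smul_add, mul_add]
      abel
    | tmul f' g' =>
      have h1 : d f' * T g = (-1 : ℝ) ^ k • (T g * d f') := one_mul_deg (hT k g hg) (hd f')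
      rw [Algebra.TensorProduct.tmul_mul_tmul]
      simp only [coordDer_tmul, coordVal_tmul, hmul, map_smul, map_mul, add_mul, smul_mul_assoc,
        mul_smul_comm, ← mul_assoc, h1]
      rw [smul_comm ((-1 : ℝ) ^ k), add_comm]

end CoordinateDerivation

lemma exists_dual_at (x : M) (α : Dual ℝ (E.fiber x)) :
    ∃ α' : DualSec E, α'.form x = α := by
  obtain ⟨W, hx, ⟨F⟩⟩ := exists_frame E x
  refine ⟨∑ a, (constFun (α (F.e a x)) : GlobalFun n M) • F.ξ a, ?_⟩
  rw [DualSec.sum_form]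
  exact F.dual_sum hx α

lemma GenDer.exists_pointDer (q : GenDer E V) (x : M) : ∃ D : PointDer E V x,
    (∀ f, D.app (ofFun E V f) = splitVal (q.q₀ f) x) ∧
    (∀ α, D.app (ofDualE E V α) = splitVal (q.q₁ α) x) ∧
    ∀ β, D.app (ofDualV E V β) = splitVal (q.q₂ β) x := by
  obtain ⟨W, hx, ⟨F⟩, ⟨G⟩⟩ := exists_two_frames E V x
  obtain ⟨χ, hχ, hχ1⟩ := exists_bump (n := n) W hx
  let T := LocalIso.ofFrames F G
  let C := T.coordinates
  let κ : 𝒪[E,V].A ⊤ →ₐ[ℝ] CoordAlg n E.rank V.rank W :=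
    ((C.equiv W le_rfl).symm : 𝒪[E,V].A W →ₐ[ℝ] CoordAlg n E.rank V.rank W).comp
      (𝒪[E,V].res le_top)
  have hκ1 : ∀ a, C.equiv W le_rfl (κ a) = 𝒪[E,V].res le_top a := fun a =>
    (C.equiv W le_rfl).apply_symm_apply _
  have hκ : ∀ a, T.toFib x (coordVal ⟨x, hx⟩ (κ a)) = splitVal a x := fun a =>
    congrArg (valHom (⟨x, hx⟩ : W)) (hκ1 a)
  have hκdeg : ∀ k, ∀ a ∈ 𝒪[E,V].deg ⊤ k, κ a ∈ coordDeg n E.rank V.rank W k := by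
    intro k a ha
    rw [C.map_deg W le_rfl, hκ1]
    exact fun y => ha ⟨y.1, trivial⟩
  have hκu : ∀ τ a, (∀ y : W, T.toFib y.1 (coordVal y τ) = splitVal a y.1) → κ a = τ := by
    intro τ a h
    exact (C.equiv W le_rfl).symm_apply_eq.2 (split_ext fun y => (h y).symm)
  let val : 𝒪[E,V].A ⊤ →ₗ[ℝ] FibAlg E V x :=
    (valHom (⟨x, trivial⟩ : (⊤ : Opens M))).toLinearMap
  let d : SmoothFun n W →ₗ[ℝ] FibAlg E V x := val ∘ₗ q.q₀ ∘ₗ cut χ hχ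
  have hd : ∀ f, d f ∈ grDeg _ _ 1 := fun f => q.deg₀ _ ⟨x, trivial⟩
  have hcut : ∀ f : SmoothFun n W, cut χ hχ f x = f ⟨x, hx⟩ := fun f => by
    rw [cut_apply hχ f hx, hχ1.self_of_nhds, one_mul]
  have hdmul : ∀ f g, d (f * g) = f ⟨x, hx⟩ • d g + g ⟨x, hx⟩ • d f := by
    intro f g
    have h1 : splitVal (q.q₀ (cut χ hχ (f * g))) x =
        splitVal (q.q₀ (cut χ hχ f * cut χ hχ g)) x := q.local <| by
      filter_upwards [hχ1, W.isOpen.mem_nhds hx] with y hy hyW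
      change _ = cut χ hχ f y * cut χ hχ g y
      rw [cut_apply hχ _ hyW, cut_apply hχ _ hyW, cut_apply hχ _ hyW, hy, one_mul, one_mul,
        one_mul]
      rfl
    change splitVal (q.q₀ (cut χ hχ (f * g))) x = _
    rw [h1, q.mul₀, splitVal_add, ofFun_smul_val, ofFun_smul_val, hcut, hcut]
    rfl
  let D₀ : PointDer E V x :=
    { app := coordDer d (T.toFib x) ∘ₗ κ.toLinearMap
      degree := fun k a ha => coordDer_mem d _ hd (T.toFib_mem x) (hκdeg k a ha)
      leibniz := fun k a ha b => by
        change coordDer d (T.toFib x) (κ (a * b)) = _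
        rw [map_mul, coordDer_leibniz hx d _ hd hdmul (T.toFib_mem x) (hκdeg k a ha), hκ, hκ]
        rfl }
  have h₀ : ∀ f, D₀.app (ofFun E V f) = splitVal (q.q₀ f) x := by
    intro f
    have h1 : κ (ofFun E V f) = resGlobal f W ⊗ₜ[ℝ] 1 := hκu _ _ fun y => by
      rw [coordVal_tmul, map_smul, map_one, splitVal_ofFun, Algebra.algebraMap_eq_smul_one,
        resGlobal_apply]
    change coordDer d (T.toFib x) (κ (ofFun E V f)) = _
    rw [h1, coordDer_tmul, map_one, mul_one]
    refine q.local ?_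
    filter_upwards [hχ1, W.isOpen.mem_nhds hx] with y hy hyW
    rw [cut_apply hχ _ hyW, hy, one_mul, resGlobal_apply]
  obtain ⟨d1, hd₁⟩ := exists_linear_of_tensorial x
    (fun α => splitVal (q.q₁ α) x + (-1 : ℝ) • D₀.app (ofDualE E V α))
    (fun α α' => by rw [ofDualE_add, map_add, q.add₁, splitVal_add]; module) (fun f α => by
      rw [ofDualE_smul, D₀.ofFun_mul, h₀, q.smul₁, splitVal_add, ofFun_smul_val, splitVal_mul]
      module)
  obtain ⟨d2, hd₂⟩ := exists_linear_of_tensorial x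
    (fun α => splitVal (q.q₂ α) x + (-1 : ℝ) • D₀.app (ofDualV E V α))
    (fun α α' => by rw [ofDualV_add, map_add, q.add₂, splitVal_add]; module) (fun f α => by
      rw [ofDualV_smul, D₀.ofFun_mul, h₀, q.smul₂, splitVal_add, ofFun_smul_val, splitVal_mul]
      module)
  obtain ⟨A, hA0, hA1, hA2, hAl, hAd⟩ := exists_odd_derivation d1
    (fun w => by
      obtain ⟨α, rfl⟩ := exists_dual_at x w
      rw [hd₁]
      exact add_mem (q.deg₁ α ⟨x, trivial⟩) (Submodule.smul_mem _ _ (D₀.degree _ _ (ofDualE_mem α))))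
    d2 (fun w => by
      obtain ⟨α, rfl⟩ := exists_dual_at x w
      rw [hd₂]
      exact add_mem (q.deg₂ α ⟨x, trivial⟩) (Submodule.smul_mem _ _ (D₀.degree _ _ (ofDualV_mem α))))
  refine ⟨{ app := D₀.app + A ∘ₗ val
            degree := fun k a ha => add_mem (D₀.degree k a ha) (hAd k _ (ha ⟨x, trivial⟩))
            leibniz := fun k a ha b => ?_ }, fun f => ?_, fun α => ?_, fun β => ?_⟩
  · change D₀.app (a * b) + A (splitVal a x * splitVal b x) =
      (D₀.app a + A (splitVal a x)) * splitVal b x + (-1 : ℝ) ^ k •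
        (splitVal a x * (D₀.app b + A (splitVal b x)))
    rw [D₀.leibniz k a ha, hAl k (splitVal a x) _ (ha ⟨x, trivial⟩), add_mul, mul_add, smul_add]
    abel
  · change D₀.app (ofFun E V f) + A (splitVal (ofFun E V f) x) = _
    rw [h₀, splitVal_ofFun, Algebra.algebraMap_eq_smul_one, map_smul, hA0, smul_zero, add_zero]
  · change D₀.app (ofDualE E V α) + A (splitVal (ofDualE E V α) x) = _
    rw [splitVal_ofDualE, hA1, hd₁]
    module
  · change D₀.app (ofDualV E V β) + A (splitVal (ofDualV E V β) x) = _
    rw [splitVal_ofDualV, hA2, hd₂]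
    module

variable (E V) in
/-- A derivation of degree one of the structure sheaf of `E[1] ⊕ V[2]`. -/
structure OddDer where
  app : ∀ U, 𝒪[E,V].A U →ₗ[ℝ] 𝒪[E,V].A U
  natural : ∀ (U W : Opens M) (h : W ≤ U) (a : 𝒪[E,V].A U),
    𝒪[E,V].res h (app U a) = app W (𝒪[E,V].res h a)
  degree : ∀ U k (a : 𝒪[E,V].A U), a ∈ 𝒪[E,V].deg U k →
    app U a ∈ 𝒪[E,V].deg U (k + 1)
  leibniz : ∀ U k (a b : 𝒪[E,V].A U), a ∈ 𝒪[E,V].deg U k →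
    app U (a * b) = app U a * b + (-1 : ℝ) ^ k • (a * app U b)

/-- A polynomial in global generators which agrees with a given function near a point. -/
def germ {U : Opens M} (a : 𝒪[E,V].A U) (x : U) : 𝒪[E,V].A ⊤ :=
  (exists_global a x).choose

lemma germ_mem {U : Opens M} (a : 𝒪[E,V].A U) (x : U) :
    germ a x ∈ Algebra.adjoin ℝ (globalGens E V) := (exists_global a x).choose_spec.1

lemma germ_eq {U : Opens M} (a : 𝒪[E,V].A U) (x : U) :
    ∀ᶠ y in 𝓝 x.1, ∀ h : y ∈ U, valHom ⟨y, h⟩ a = splitVal (germ a x) y :=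
  (exists_global a x).choose_spec.2

section Family

variable (D : ∀ x, PointDer E V x)

lemma PointDer.germ {U : Opens M} (a : 𝒪[E,V].A U) (x : U)
    {b : 𝒪[E,V].A ⊤}
    (hb : ∀ᶠ y in 𝓝 x.1, ∀ h : y ∈ U, valHom ⟨y, h⟩ a = splitVal b y) :
    (D x.1).app (QTwo.germ a x) = (D x.1).app b := (D x.1).local <| by
  filter_upwards [germ_eq a x, hb, U.isOpen.mem_nhds x.2] with y h1 h2 hy
  rw [← h1 hy, h2 hy]

lemma PointDer.germ_add {U : Opens M} (a b : 𝒪[E,V].A U) (x : U) :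
    (D x.1).app (QTwo.germ (a + b) x) =
      (D x.1).app (QTwo.germ a x) + (D x.1).app (QTwo.germ b x) := by
  rw [← map_add]
  refine PointDer.germ D _ x ?_
  filter_upwards [germ_eq a x, germ_eq b x] with y h1 h2 hy
  rw [map_add, h1 hy, h2 hy, splitVal_add]

variable (hD : ∀ b ∈ Algebra.adjoin ℝ (globalGens E V), ∃ c : 𝒪[E,V].A ⊤,
  ∀ y, (D y).app b = splitVal c y)
include hD

lemma PointDer.mem_splitAlg {U : Opens M} (a : 𝒪[E,V].A U) :
    (fun x : U => (D x.1).app (QTwo.germ a x)) ∈ splitAlg E V U := by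
  induction a using homogeneous_induction with
  | hom k a ha =>
    refine Algebra.subset_adjoin ⟨isSmoothSplit_iff.2 fun x => ?_, k + 1, fun x => ?_⟩
    · obtain ⟨c, hc⟩ := hD _ (germ_mem a x)
      refine (smoothAt_splitVal c x.1).congr ?_
      filter_upwards [eventually_eventually_nhds.2 (germ_eq a x), U.isOpen.mem_nhds x.2]
        with y hy hyU
      rw [extZero_of_mem _ hyU, ← hc]
      exact PointDer.germ D a ⟨y, hyU⟩ hy
    · refine (D x.1).degree_local ?_
      filter_upwards [germ_eq a x, U.isOpen.mem_nhds x.2] with y hy hyU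
      rw [← hy hyU]
      exact ha ⟨y, hyU⟩
  | add a b ha hb =>
    rw [funext (PointDer.germ_add D a b)]
    exact add_mem ha hb

/-- The derivation given by a smooth family of derivations at points. -/
def OddDer.ofPoint : OddDer E V where
  app U :=
    { toFun := fun a => ⟨fun x => (D x.1).app (germ a x), PointDer.mem_splitAlg D hD a⟩
      map_add' := fun a b => split_ext (PointDer.germ_add D a b)
      map_smul' := fun c a => split_ext fun x => by
        change (D x.1).app (germ (c • a) x) = c • (D x.1).app (germ a x)
        rw [← map_smul]
        refine PointDer.germ D _ x ?_
        filter_upwards [germ_eq a x] with y h1 hy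
        rw [map_smul, h1 hy, splitVal_smul] }
  natural U W h a := split_ext fun x => by
    change (D x.1).app (germ a ⟨x.1, h x.2⟩) = (D x.1).app (germ _ x)
    refine (PointDer.germ D _ x ?_).symm
    filter_upwards [germ_eq a ⟨x.1, h x.2⟩] with y h1 hy
    rw [valHom_res, h1 (h hy)]
  degree U k a ha x := (D x.1).degree_local <| by
    filter_upwards [germ_eq a x, U.isOpen.mem_nhds x.2] with y hy hyU
    rw [← hy hyU]
    exact ha ⟨y, hyU⟩
  leibniz U k a b ha := split_ext fun x => by
    have hk : ∀ᶠ y in 𝓝 x.1, splitVal (germ a x) y ∈ grDeg _ _ k := by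
      filter_upwards [germ_eq a x, U.isOpen.mem_nhds x.2] with y hy hyU
      rw [← hy hyU]
      exact ha ⟨y, hyU⟩
    obtain ⟨c, hdeg, hc⟩ := exists_homogeneous hk
    have ha' : ∀ᶠ y in 𝓝 x.1, ∀ h : y ∈ U, valHom ⟨y, h⟩ a = splitVal c y := by
      filter_upwards [germ_eq a x, hc] with y h1 h2 hy
      rw [h1 hy, h2]
    have h3 := (D x.1).leibniz k _ hdeg (germ b x)
    change (D x.1).app (germ (a * b) x) = (D x.1).app (germ a x) * valHom x b +
      (-1 : ℝ) ^ k • (valHom x a * (D x.1).app (germ b x))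
    rw [PointDer.germ D a x ha', ha'.self_of_nhds x.2, (germ_eq b x).self_of_nhds x.2, ← h3]
    refine PointDer.germ D _ x ?_
    filter_upwards [ha', germ_eq b x] with y h1 h2 hy
    rw [map_mul, h1 hy, h2 hy]
    rfl

lemma OddDer.ofPoint_val (a : 𝒪[E,V].A ⊤) (x : M) :
    splitVal ((OddDer.ofPoint D hD).app ⊤ a) x = (D x).app a :=
  PointDer.germ D a ⟨x, trivial⟩ (Eventually.of_forall fun _ _ => rfl)

end Family

lemma GenDer.exists_oddDer (q : GenDer E V) : ∃ D : OddDer E V,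
    (∀ f, D.app ⊤ (ofFun E V f) = q.q₀ f) ∧ (∀ α, D.app ⊤ (ofDualE E V α) = q.q₁ α) ∧
    ∀ β, D.app ⊤ (ofDualV E V β) = q.q₂ β := by
  choose D h0 h1 h2 using q.exists_pointDer
  have hD : ∀ b ∈ Algebra.adjoin ℝ (globalGens E V), ∃ c : 𝒪[E,V].A ⊤,
      ∀ y, (D y).app b = splitVal c y := by
    intro b hb
    refine adjoin_global_induction (P := fun b => ∃ c : 𝒪[E,V].A ⊤,
      ∀ y, (D y).app b = splitVal c y) ?_ ?_ ?_ ?_ ?_ ?_ hb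
    · exact ⟨0, fun y => by rw [(D y).app_one, splitVal_zero]⟩
    · rintro a b ⟨c, hc⟩ ⟨c', hc'⟩
      exact ⟨c + c', fun y => by rw [map_add, hc, hc', splitVal_add]⟩
    · rintro r a ⟨c, hc⟩
      exact ⟨r • c, fun y => by rw [map_smul, hc, splitVal_smul]⟩
    · rintro f a ⟨c, hc⟩
      exact ⟨q.q₀ f * a + ofFun E V f * c, fun y => by
        rw [(D y).ofFun_mul, h0, hc, splitVal_add, splitVal_mul, ofFun_smul_val]⟩
    · rintro α a ⟨c, hc⟩
      exact ⟨q.q₁ α * a + (-1 : ℝ) ^ 1 • (ofDualE E V α * c), fun y => by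
        rw [(D y).leibniz 1 _ (ofDualE_mem α), h1, hc, splitVal_add, splitVal_mul, splitVal_smul,
          splitVal_mul]⟩
    · rintro β a ⟨c, hc⟩
      exact ⟨q.q₂ β * a + (-1 : ℝ) ^ 2 • (ofDualV E V β * c), fun y => by
        rw [(D y).leibniz 2 _ (ofDualV_mem β), h2, hc, splitVal_add, splitVal_mul, splitVal_smul,
          splitVal_mul]⟩
  exact ⟨OddDer.ofPoint D hD,
    fun f => splitVal_ext fun y => by rw [OddDer.ofPoint_val, h0],
    fun α => splitVal_ext fun y => by rw [OddDer.ofPoint_val, h1],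
    fun β => splitVal_ext fun y => by rw [OddDer.ofPoint_val, h2]⟩

section LieDerivative

lemma dirDeriv_smooth (f : GlobalFun n M) {X : ∀ x : M, TangentSpace (𝓡 n) x}
    (hX : ContMDiff (𝓡 n) (𝓡 n).tangent ∞ (fun x => (⟨x, X x⟩ : TangentBundle (𝓡 n) M))) :
    ContMDiff (𝓡 n) 𝓘(ℝ, ℝ) ∞ (fun x => dirDeriv f x (X x)) := by
  have h1 : ContMDiff (𝓡 n) 𝓘(ℝ, ℝ).tangent ∞
      (fun x => tangentMap (𝓡 n) 𝓘(ℝ, ℝ) f ⟨x, X x⟩) :=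
    (f.contMDiff.contMDiff_tangentMap (m := ∞) (by simp)).comp hX
  intro x
  have h2 := (contMDiffAt_totalSpace.1 (h1 x)).2
  refine h2.congr_of_eventuallyEq (Eventually.of_forall fun y => ?_)
  exact congrArg Prod.snd (trivializationAt_model_space_apply (I := 𝓘(ℝ, ℝ))
    (tangentMap (𝓡 n) 𝓘(ℝ, ℝ) f ⟨y, X y⟩) (f x)).symm

/-- The derivative of a function along the image of a section under the anchor. -/
def Anchor.lie (ρ : Anchor E) (ψ : Sec E) (f : GlobalFun n M) : GlobalFun n M :=
  mkFun (fun y => dirDeriv f y (ρ.map y (ψ y))) (dirDeriv_smooth f (ρ.smooth ψ))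

variable (ρ : Anchor E) (ψ : Sec E) (f g : GlobalFun n M) (x : M)

lemma Anchor.lie_apply : ρ.lie ψ f x = dirDeriv f x (ρ.map x (ψ x)) := rfl

lemma GlobalFun.add_apply : (f + g) x = f x + g x := rfl
lemma GlobalFun.mul_apply : (f * g) x = f x * g x := rfl
lemma GlobalFun.ops : (∀ (f g : GlobalFun n M) x, (f + g) x = f x + g x ∧
    (f - g) x = f x - g x ∧ (f * g) x = f x * g x) ∧ ∀ x, (0 : GlobalFun n M) x = 0 :=
  ⟨fun _ _ _ => ⟨rfl, rfl, rfl⟩, fun _ => rfl⟩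

lemma Anchor.lie_add : ρ.lie ψ (f + g) x = ρ.lie ψ f x + ρ.lie ψ g x :=
  dirDeriv_add (f.mdiff x) (g.mdiff x) _

lemma Anchor.lie_mul : ρ.lie ψ (f * g) x = f x * ρ.lie ψ g x + g x * ρ.lie ψ f x :=
  dirDeriv_mul (f.mdiff x) (g.mdiff x) _

lemma Anchor.lie_smul (c : ℝ) : ρ.lie ψ (c • f) x = c * ρ.lie ψ f x := by
  have h := ρ.lie_mul ψ (constFun c) f x
  have h1 : ρ.lie ψ (constFun c) x = 0 := dirDeriv_const c x _
  rw [h1, mul_zero, add_zero, constFun_apply] at h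
  exact h

lemma Anchor.lie_sub : ρ.lie ψ (f - g) x = ρ.lie ψ f x - ρ.lie ψ g x := by
  have h : f = (f - g) + g := (sub_add_cancel f g).symm
  have h1 : ρ.lie ψ f x = ρ.lie ψ ((f - g) + g) x := by rw [← h]
  rw [h1, ρ.lie_add]; ring

lemma Anchor.lie_ops : ρ.lie ψ (f + g) x = ρ.lie ψ f x + ρ.lie ψ g x ∧
    ρ.lie ψ (f - g) x = ρ.lie ψ f x - ρ.lie ψ g x ∧
    ρ.lie ψ (f * g) x = f x * ρ.lie ψ g x + g x * ρ.lie ψ f x :=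
  ⟨ρ.lie_add ψ f g x, ρ.lie_sub ψ f g x, ρ.lie_mul ψ f g x⟩

lemma Anchor.lie_congr {f g : GlobalFun n M} {x : M} (h : ∀ᶠ y in 𝓝 x, f y = g y) :
    ρ.lie ψ f x = ρ.lie ψ g x := dirDeriv_congr h _

variable (E V) in
/-- The data of a Lie 2-algebroid without the quadratic conditions. -/
structure PreLie where
  anchor : Anchor E
  t : BundleMap V E
  bracket : Sec E → Sec E → Sec E
  conn : Sec E → Sec V → Sec V
  H : EForm 3 E V
  bracket_add : ∀ ψ1 ψ2 ψ3, bracket ψ1 (ψ2 + ψ3) = bracket ψ1 ψ2 + bracket ψ1 ψ3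
  bracket_skew : ∀ ψ1 ψ2, bracket ψ1 ψ2 = - bracket ψ2 ψ1
  bracket_leibniz : ∀ ψ1 (f : GlobalFun n M) ψ2 x, bracket ψ1 (smulSec f ψ2) x =
    dirDeriv f x (anchor.map x (ψ1 x)) • ψ2 x + f x • bracket ψ1 ψ2 x
  conn_add_left : ∀ ψ1 ψ2 v, conn (ψ1 + ψ2) v = conn ψ1 v + conn ψ2 v
  conn_smul_left : ∀ (f : GlobalFun n M) ψ v, conn (smulSec f ψ) v = smulSec f (conn ψ v)
  conn_add_right : ∀ ψ v1 v2, conn ψ (v1 + v2) = conn ψ v1 + conn ψ v2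
  conn_leibniz : ∀ ψ (f : GlobalFun n M) v x, conn ψ (smulSec f v) x =
    dirDeriv f x (anchor.map x (ψ x)) • v x + f x • conn ψ v x

/-- Forgetting the quadratic conditions. -/
def LieTwoAlgebroid.toPre (L : LieTwoAlgebroid E V) : PreLie E V where
  anchor := L.anchor
  t := L.t
  bracket := L.bracket
  conn := L.conn
  H := L.H
  bracket_add := L.bracket_add
  bracket_skew := L.bracket_skew
  bracket_leibniz := L.bracket_leibniz
  conn_add_left := L.conn_add_left
  conn_smul_left := L.conn_smul_left
  conn_add_right := L.conn_add_right
  conn_leibniz := L.conn_leibniz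

/-- The values of a derivation on generators are given by `P`. -/
structure OddDer.HasData (D : OddDer E V) (P : PreLie E V) : Prop where
  on_fun : ∀ f ψ v, evalSec (D.app ⊤ (ofFun E V f)) [ψ] v = P.anchor.lie ψ f
  on_dualE_two : ∀ α ψ1 ψ2 v, evalSec (D.app ⊤ (ofDualE E V α)) [ψ1, ψ2] v =
    P.anchor.lie ψ1 (pair α ψ2) - P.anchor.lie ψ2 (pair α ψ1) - pair α (P.bracket ψ1 ψ2)
  on_dualE_zero : ∀ α v, evalSec (D.app ⊤ (ofDualE E V α)) [] v = pair α (P.t.onSec v)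
  on_dualV_one : ∀ β ψ v, evalSec (D.app ⊤ (ofDualV E V β)) [ψ] v =
    P.anchor.lie ψ (pair β v) - pair β (P.conn ψ v)
  on_dualV_three : ∀ β ψ1 ψ2 ψ3 v, evalSec (D.app ⊤ (ofDualV E V β)) [ψ1, ψ2, ψ3] v =
    pair β (P.H.onSec ![ψ1, ψ2, ψ3])

lemma OddDer.ofFun_mul (D : OddDer E V) (f : GlobalFun n M) (a : 𝒪[E,V].A ⊤) :
    D.app ⊤ (ofFun E V f * a) = D.app ⊤ (ofFun E V f) * a + ofFun E V f * D.app ⊤ a := by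
  rw [D.leibniz ⊤ 0 _ _ (ofFun_mem f), pow_zero, one_smul]

/-- The derivation at a point given by a derivation. -/
def OddDer.at (D : OddDer E V) (x : M) : PointDer E V x where
  app := (valHom (⟨x, trivial⟩ : (⊤ : Opens M))).toLinearMap ∘ₗ D.app ⊤
  degree k a ha := D.degree ⊤ k a ha ⟨x, trivial⟩
  leibniz k a ha b := congrArg (valHom (⟨x, trivial⟩ : (⊤ : Opens M))) (D.leibniz ⊤ k a b ha)

lemma OddDer.local (D : OddDer E V) {a b : 𝒪[E,V].A ⊤} {x : M}
    (h : ∀ᶠ y in 𝓝 x, splitVal a y = splitVal b y) :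
    splitVal (D.app ⊤ a) x = splitVal (D.app ⊤ b) x := (D.at x).local h

lemma OddDer.app_one (D : OddDer E V) : D.app ⊤ 1 = 0 :=
  splitVal_ext fun x => (D.at x).app_one

lemma OddDer.ext_global {D D' : OddDer E V} (h : D.app ⊤ = D'.app ⊤) : D.app = D'.app := by
  have key : ∀ (D : OddDer E V) U (a : 𝒪[E,V].A U) (x : U),
      valHom x (D.app U a) = splitVal (D.app ⊤ (germ a x)) x := by
    intro D U a x
    obtain ⟨W, hW, hWo, hx⟩ := eventually_nhds_iff.1 (germ_eq a x)
    let W' : Opens M := ⟨W, hWo⟩ ⊓ U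
    have h1 : 𝒪[E,V].res (inf_le_right : W' ≤ U) a =
        𝒪[E,V].res (le_top : W' ≤ ⊤) (germ a x) := split_ext fun y => hW y.1 y.2.1 y.2.2
    have h2 := congrArg (valHom (⟨x, hx, x.2⟩ : W')) (D.natural U W' inf_le_right a)
    rw [h1, ← D.natural] at h2
    exact h2
  funext U
  refine LinearMap.ext fun a => split_ext fun x => ?_
  rw [key, key, h]

lemma OddDer.ext_gens {D D' : OddDer E V}
    (h0 : ∀ f, D.app ⊤ (ofFun E V f) = D'.app ⊤ (ofFun E V f))
    (h1 : ∀ α, D.app ⊤ (ofDualE E V α) = D'.app ⊤ (ofDualE E V α))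
    (h2 : ∀ β, D.app ⊤ (ofDualV E V β) = D'.app ⊤ (ofDualV E V β)) : D.app = D'.app := by
  refine OddDer.ext_global (LinearMap.ext fun a => splitVal_ext fun x => ?_)
  have key : ∀ b ∈ Algebra.adjoin ℝ (globalGens E V), D.app ⊤ b = D'.app ⊤ b := by
    intro b hb
    refine adjoin_global_induction (P := fun b => D.app ⊤ b = D'.app ⊤ b) ?_ ?_ ?_ ?_ ?_ ?_ hb
    · rw [D.app_one, D'.app_one]
    · intro a b ha hb; rw [map_add, map_add, ha, hb]
    · intro c a ha; rw [map_smul, map_smul, ha]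
    · intro f a ha; rw [D.ofFun_mul, D'.ofFun_mul, ha, h0]
    · intro α a ha
      rw [D.leibniz ⊤ 1 _ _ (ofDualE_mem α), D'.leibniz ⊤ 1 _ _ (ofDualE_mem α), ha, h1]
    · intro β a ha
      rw [D.leibniz ⊤ 2 _ _ (ofDualV_mem β), D'.leibniz ⊤ 2 _ _ (ofDualV_mem β), ha, h2]
  have h3 : ∀ᶠ y in 𝓝 x, splitVal a y = splitVal (germ a ⟨x, trivial⟩) y := by
    filter_upwards [germ_eq a ⟨x, trivial⟩] with y hy using hy trivial
  rw [D.local h3, D'.local h3, key _ (germ_mem _ _)]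

lemma OddDer.sq_leibniz (D : OddDer E V) {k : ℕ} {a : 𝒪[E,V].A ⊤}
    (ha : a ∈ 𝒪[E,V].deg ⊤ k) (b : 𝒪[E,V].A ⊤) :
    D.app ⊤ (D.app ⊤ (a * b)) = D.app ⊤ (D.app ⊤ a) * b + a * D.app ⊤ (D.app ⊤ b) := by
  rw [D.leibniz ⊤ k a b ha, map_add, map_smul, D.leibniz ⊤ (k + 1) _ _ (D.degree ⊤ k a ha),
    D.leibniz ⊤ k a _ ha]
  refine splitVal_ext fun x => ?_
  simp only [splitVal_add, splitVal_mul, splitVal_smul, smul_add, smul_smul, pow_succ]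
  rw [show (-1 : ℝ) ^ k * (-1) ^ k = 1 by rw [← mul_pow]; simp]
  module

lemma OddDer.square_zero (D : OddDer E V) (h0 : ∀ f, D.app ⊤ (D.app ⊤ (ofFun E V f)) = 0)
    (h1 : ∀ α, D.app ⊤ (D.app ⊤ (ofDualE E V α)) = 0)
    (h2 : ∀ β, D.app ⊤ (D.app ⊤ (ofDualV E V β)) = 0) (U : Opens M) (a : 𝒪[E,V].A U) :
    D.app U (D.app U a) = 0 := by
  have key : ∀ b ∈ Algebra.adjoin ℝ (globalGens E V), D.app ⊤ (D.app ⊤ b) = 0 := by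
    intro b hb
    refine adjoin_global_induction (P := fun b => D.app ⊤ (D.app ⊤ b) = 0) ?_ ?_ ?_ ?_ ?_ ?_ hb
    · rw [D.app_one, map_zero]
    · intro a b ha hb; rw [map_add, map_add, ha, hb, add_zero]
    · intro c a ha; rw [map_smul, map_smul, ha, smul_zero]
    · intro f a ha; rw [D.sq_leibniz (ofFun_mem f), ha, h0, zero_mul, mul_zero, add_zero]
    · intro f a ha; rw [D.sq_leibniz (ofDualE_mem f), ha, h1, zero_mul, mul_zero, add_zero]
    · intro f a ha; rw [D.sq_leibniz (ofDualV_mem f), ha, h2, zero_mul, mul_zero, add_zero]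
  refine split_ext fun x => ?_
  obtain ⟨W, hW, hWo, hx⟩ := eventually_nhds_iff.1 (germ_eq a x)
  let W' : Opens M := ⟨W, hWo⟩ ⊓ U
  have h1 : 𝒪[E,V].res (inf_le_right : W' ≤ U) a =
      𝒪[E,V].res (le_top : W' ≤ ⊤) (germ a x) := split_ext fun y => hW y.1 y.2.1 y.2.2
  have h2 : 𝒪[E,V].res (inf_le_right : W' ≤ U) (D.app U (D.app U a)) = 0 := by
    rw [D.natural, D.natural, h1, ← D.natural, ← D.natural, key _ (germ_mem _ _), map_zero]
  have h3 := congrArg (valHom (⟨x, hx, x.2⟩ : W')) h2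
  rw [map_zero] at h3
  rw [map_zero]
  exact h3

end LieDerivative

lemma mulEv_map {A' B' : Type*} (f : A' → B') (A B : List B' → ℝ) (p : ℕ) (l : List A') :
    mulEv (l.map f) p A B = mulEv l p (fun l => A (l.map f)) (fun l => B (l.map f)) := by
  induction l generalizing p A B with
  | nil => rfl
  | cons e l ih =>
    rw [List.map_cons, mulEv, mulEv, ih, ih]
    rfl

section EvalSec

variable (a b : 𝒪[E,V].A ⊤) (l : List (Sec E)) (ψ ψ' : Sec E) (v : Sec V) (x : M)
  (α : DualSec E) (β : DualSec V) (f : GlobalFun n M)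

lemma evalSec_add : evalSec (a + b) l v = evalSec a l v + evalSec b l v := by
  ext y; exact evalGr_add _ _ _ _

lemma evalSec_smul (c : ℝ) : evalSec (c • a) l v x = c * evalSec a l v x := evalGr_smul _ _ _ _

lemma evalSec_zero : evalSec (0 : 𝒪[E,V].A ⊤) l v = 0 := by
  ext y; exact evalGr_zero _ _

variable {a} in
lemma evalSec_mul {p : ℕ} (ha : a ∈ 𝒪[E,V].deg ⊤ p) : evalSec (a * b) l v x =
    mulEv l p (fun l => evalSec a l v x) (fun l => evalSec b l v x) := by
  have h := evalGr_mul (a := splitVal a x) (splitVal b x) (l.map fun ψ => ψ x) (v x)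
    (ha ⟨x, trivial⟩)
  rw [mulEv_map] at h
  rw [evalSec_apply, splitVal_mul, h]
  rfl

lemma evalSec_ofFun_mul : evalSec (ofFun E V f * a) l v = f * evalSec a l v := by
  ext y
  change evalGr (splitVal (ofFun E V f * a) y) _ _ = f y * _
  rw [ofFun_smul_val, evalGr_smul]
  rfl

lemma evalSec_ofDualE_nil : evalSec (ofDualE E V α) [] v = 0 := by
  ext y; exact evalGr_ιOne_nil _ _
lemma evalSec_ofDualE_one : evalSec (ofDualE E V α) [ψ] v = pair α ψ := by
  ext y; exact evalGr_ιOne_one _ _ _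
lemma evalSec_ofDualE_two : evalSec (ofDualE E V α) (ψ :: ψ' :: l) v = 0 := by
  ext y; exact evalGr_ιOne_two _ _ _ _ _
lemma evalSec_ofDualV_nil : evalSec (ofDualV E V β) [] v = pair β v := by
  ext y; exact evalGr_ιTwo_nil _ _
lemma evalSec_ofDualV_cons : evalSec (ofDualV E V β) (ψ :: l) v = 0 := by
  ext y; exact evalGr_ιTwo_cons _ _ _ _

lemma evalSec_oneE_two : evalSec (ofDualE E V α * a) [ψ, ψ'] v =
    pair α ψ * evalSec a [ψ'] v - pair α ψ' * evalSec a [ψ] v := by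
  ext y
  rw [evalSec_mul _ _ _ _ (ofDualE_mem α)]
  simp only [mulEv, evalSec_ofDualE_nil, evalSec_ofDualE_one, evalSec_ofDualE_two, GlobalFun.ops]
  ring

lemma evalSec_oneE_nil : evalSec (ofDualE E V α * a) [] v = 0 := by
  ext y
  rw [evalSec_mul _ _ _ _ (ofDualE_mem α)]
  simp only [mulEv, evalSec_ofDualE_nil, GlobalFun.ops]
  ring

lemma evalSec_oneE_one : evalSec (ofDualE E V α * a) [ψ] v = pair α ψ * evalSec a [] v := by
  ext y
  rw [evalSec_mul _ _ _ _ (ofDualE_mem α)]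
  simp only [mulEv, evalSec_ofDualE_nil, evalSec_ofDualE_one, GlobalFun.ops]
  ring

lemma evalSec_oneE_three (ψ1 ψ2 ψ3 : Sec E) : evalSec (ofDualE E V α * a) [ψ1, ψ2, ψ3] v =
    pair α ψ1 * evalSec a [ψ2, ψ3] v - pair α ψ2 * evalSec a [ψ1, ψ3] v +
      pair α ψ3 * evalSec a [ψ1, ψ2] v := by
  ext y
  rw [evalSec_mul _ _ _ _ (ofDualE_mem α)]
  simp only [mulEv, evalSec_ofDualE_nil, evalSec_ofDualE_one, evalSec_ofDualE_two, GlobalFun.ops]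
  ring

variable {a b x} in
lemma evalSec_congr (h : ∀ᶠ y in 𝓝 x, splitVal a y = splitVal b y) :
    ∀ᶠ y in 𝓝 x, evalSec a l v y = evalSec b l v y := by
  filter_upwards [h] with y hy
  rw [evalSec_apply, hy, evalSec_apply]

variable {a} in
lemma evalSec_eq_zero {k : ℕ} (ha : a ∈ 𝒪[E,V].deg ⊤ k)
    (h : ∀ q, l.length + 2 * q ≠ k) : evalSec a l v = 0 := by
  ext y
  refine evalGr_eq_zero _ _ (ha ⟨y, trivial⟩) ?_
  rwa [List.length_map]

end EvalSec

lemma evalSec_two {a : 𝒪[E,V].A ⊤} (ha : a ∈ 𝒪[E,V].deg ⊤ 2) :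
    (∀ ψ v, evalSec a [ψ] v = 0) ∧ ∀ ψ1 ψ2 ψ3 l v, evalSec a (ψ1 :: ψ2 :: ψ3 :: l) v = 0 :=
  ⟨fun _ _ => evalSec_eq_zero _ _ ha (by intro q; simp; omega),
    fun _ _ _ _ _ => evalSec_eq_zero _ _ ha (by intro q; simp; omega)⟩

lemma OddDer.evalSec_congr (D : OddDer E V) (ρ : Anchor E) {a b : 𝒪[E,V].A ⊤} {x : M}
    (h : ∀ᶠ y in 𝓝 x, splitVal a y = splitVal b y) :
    (∀ l v, evalSec (D.app ⊤ a) l v x = evalSec (D.app ⊤ b) l v x) ∧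
    (∀ ψ l v, ρ.lie ψ (evalSec a l v) x = ρ.lie ψ (evalSec b l v) x) ∧
    ∀ l v, evalSec a l v x = evalSec b l v x :=
  ⟨fun l v => by rw [evalSec_apply, D.local h, evalSec_apply],
    fun ψ l v => ρ.lie_congr ψ (QTwo.evalSec_congr l v h),
    fun l v => (QTwo.evalSec_congr l v h).self_of_nhds⟩

lemma OddDer.evalSec_mul (D : OddDer E V) (α : DualSec E) (a : 𝒪[E,V].A ⊤)
    (l : List (Sec E)) (v : Sec V) (x : M) : evalSec (D.app ⊤ (ofDualE E V α * a)) l v x =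
      mulEv l 2 (fun l => evalSec (D.app ⊤ (ofDualE E V α)) l v x) (fun l => evalSec a l v x) +
      (-1) ^ 1 * mulEv l 1 (fun l => evalSec (ofDualE E V α) l v x)
        (fun l => evalSec (D.app ⊤ a) l v x) := by
  rw [D.leibniz ⊤ 1 _ _ (ofDualE_mem α), evalSec_add, GlobalFun.add_apply, evalSec_smul,
    QTwo.evalSec_mul _ _ _ _ (show _ ∈ 𝒪[E,V].deg ⊤ 2 from D.degree ⊤ 1 _ (ofDualE_mem α)),
    QTwo.evalSec_mul _ _ _ _ (ofDualE_mem α)]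

namespace OddDer.HasData

variable {D : OddDer E V} {P : PreLie E V} (h : D.HasData P) {τ : 𝒪[E,V].A ⊤}
  (ψ1 ψ2 ψ3 ψ4 ψ : Sec E) (v : Sec V) (x : M)
include h

lemma two_three (hτ : τ ∈ 𝒪[E,V].deg ⊤ 2) :
    evalSec (D.app ⊤ τ) [ψ1, ψ2, ψ3] v x =
      P.anchor.lie ψ1 (evalSec τ [ψ2, ψ3] v) x - P.anchor.lie ψ2 (evalSec τ [ψ1, ψ3] v) x +
      P.anchor.lie ψ3 (evalSec τ [ψ1, ψ2] v) x - evalSec τ [P.bracket ψ1 ψ2, ψ3] v x +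
      evalSec τ [P.bracket ψ1 ψ3, ψ2] v x - evalSec τ [P.bracket ψ2 ψ3, ψ1] v x +
      evalSec τ [] (P.H.onSec ![ψ1, ψ2, ψ3]) x := by
  refine deg_two_induction (x := x) ?_ ?_ ?_ ?_ hτ
  · intro a b ha hb
    simp only [map_add, evalSec_add, Anchor.lie_ops, GlobalFun.ops, ha, hb]
    ring
  · exact fun a b hab ha => by simpa only [D.evalSec_congr P.anchor hab] using ha
  · intro α α'
    rw [D.evalSec_mul]
    simp only [mulEv, evalSec_oneE_two, evalSec_oneE_nil, evalSec_ofDualE_nil, evalSec_ofDualE_one,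
      evalSec_ofDualE_two, h.on_dualE_two, Anchor.lie_ops, GlobalFun.ops]
    ring
  · intro β
    simp only [h.on_dualV_three, evalSec_ofDualV_cons, evalSec_ofDualV_nil]
    have h0 : ∀ ψ, P.anchor.lie ψ 0 x = 0 := fun ψ => dirDeriv_const 0 x _
    simp only [h0, GlobalFun.ops]
    ring

lemma two_one (hτ : τ ∈ 𝒪[E,V].deg ⊤ 2) :
    evalSec (D.app ⊤ τ) [ψ] v x = P.anchor.lie ψ (evalSec τ [] v) x -
      evalSec τ [] (P.conn ψ v) x + evalSec τ [P.t.onSec v, ψ] v x := by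
  refine deg_two_induction (x := x) ?_ ?_ ?_ ?_ hτ
  · intro a b ha hb
    simp only [map_add, evalSec_add, Anchor.lie_ops, GlobalFun.ops, ha, hb]
    ring
  · exact fun a b hab ha => by simpa only [D.evalSec_congr P.anchor hab] using ha
  · intro α α'
    have h0 : ∀ ψ, P.anchor.lie ψ 0 x = 0 := fun ψ => dirDeriv_const 0 x _
    rw [D.evalSec_mul]
    simp only [mulEv, evalSec_oneE_two, evalSec_oneE_nil, evalSec_ofDualE_nil, evalSec_ofDualE_one,
      h.on_dualE_zero, GlobalFun.ops, h0]
    ring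
  · intro β
    simp only [h.on_dualV_one, evalSec_ofDualV_cons, evalSec_ofDualV_nil, GlobalFun.ops]
    ring

lemma three_four (hτ : τ ∈ 𝒪[E,V].deg ⊤ 3) :
    evalSec (D.app ⊤ τ) [ψ1, ψ2, ψ3, ψ4] v x =
      P.anchor.lie ψ1 (evalSec τ [ψ2, ψ3, ψ4] v) x - P.anchor.lie ψ2 (evalSec τ [ψ1, ψ3, ψ4] v) x +
      P.anchor.lie ψ3 (evalSec τ [ψ1, ψ2, ψ4] v) x - P.anchor.lie ψ4 (evalSec τ [ψ1, ψ2, ψ3] v) x -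
      evalSec τ [P.bracket ψ1 ψ2, ψ3, ψ4] v x + evalSec τ [P.bracket ψ1 ψ3, ψ2, ψ4] v x -
      evalSec τ [P.bracket ψ1 ψ4, ψ2, ψ3] v x - evalSec τ [P.bracket ψ2 ψ3, ψ1, ψ4] v x +
      evalSec τ [P.bracket ψ2 ψ4, ψ1, ψ3] v x - evalSec τ [P.bracket ψ3 ψ4, ψ1, ψ2] v x -
      evalSec τ [ψ1] (P.H.onSec ![ψ2, ψ3, ψ4]) x + evalSec τ [ψ2] (P.H.onSec ![ψ1, ψ3, ψ4]) x -
      evalSec τ [ψ3] (P.H.onSec ![ψ1, ψ2, ψ4]) x + evalSec τ [ψ4] (P.H.onSec ![ψ1, ψ2, ψ3]) x := by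
  refine deg_three_induction (x := x) ?_ ?_ ?_ hτ
  · intro a b ha hb
    simp only [map_add, evalSec_add, Anchor.lie_ops, GlobalFun.ops, ha, hb]
    ring
  · exact fun a b hab ha => by simpa only [D.evalSec_congr P.anchor hab] using ha
  · intro α η hη
    rw [D.evalSec_mul]
    simp only [mulEv, evalSec_oneE_three, evalSec_oneE_one, evalSec_ofDualE_nil,
      evalSec_ofDualE_one, evalSec_ofDualE_two, h.on_dualE_two, evalSec_two hη, evalSec_two (D.degree ⊤ 1 _ (ofDualE_mem α)),
      h.two_three _ _ _ _ _ hη, Anchor.lie_ops, GlobalFun.ops]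
    ring

lemma three_two (hτ : τ ∈ 𝒪[E,V].deg ⊤ 3) :
    evalSec (D.app ⊤ τ) [ψ1, ψ2] v x =
      P.anchor.lie ψ1 (evalSec τ [ψ2] v) x - P.anchor.lie ψ2 (evalSec τ [ψ1] v) x -
      evalSec τ [P.bracket ψ1 ψ2] v x - evalSec τ [ψ2] (P.conn ψ1 v) x +
      evalSec τ [ψ1] (P.conn ψ2 v) x + evalSec τ [P.t.onSec v, ψ1, ψ2] v x := by
  refine deg_three_induction (x := x) ?_ ?_ ?_ hτ
  · intro a b ha hb
    simp only [map_add, evalSec_add, Anchor.lie_ops, GlobalFun.ops, ha, hb]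
    ring
  · exact fun a b hab ha => by simpa only [D.evalSec_congr P.anchor hab] using ha
  · intro α η hη
    rw [D.evalSec_mul]
    simp only [mulEv, evalSec_oneE_three, evalSec_oneE_one, evalSec_ofDualE_nil,
      evalSec_ofDualE_one, evalSec_ofDualE_two, h.on_dualE_two, h.on_dualE_zero, evalSec_two hη, evalSec_two (D.degree ⊤ 1 _ (ofDualE_mem α)),
      h.two_one _ _ _ hη, Anchor.lie_ops, GlobalFun.ops]
    ring

lemma three_zero (hτ : τ ∈ 𝒪[E,V].deg ⊤ 3) :
    evalSec (D.app ⊤ τ) [] v x = evalSec τ [P.t.onSec v] v x := by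
  refine deg_three_induction (x := x) ?_ ?_ ?_ hτ
  · intro a b ha hb
    simp only [map_add, evalSec_add, GlobalFun.ops, ha, hb]
  · exact fun a b hab ha => by simpa only [D.evalSec_congr P.anchor hab] using ha
  · intro α η hη
    rw [D.evalSec_mul]
    simp only [mulEv, h.on_dualE_zero, evalSec_oneE_one, evalSec_ofDualE_nil, GlobalFun.ops]
    ring

end OddDer.HasData

lemma extCovDeriv_two (br : Sec E → Sec E → Sec E) (conn : Sec E → Sec V → Sec V)
    (η : EForm 2 E V) (ψ1 ψ2 ψ3 : Sec E) : extCovDeriv br conn η ![ψ1, ψ2, ψ3] =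
      conn ψ1 (η.onSec ![ψ2, ψ3]) - conn ψ2 (η.onSec ![ψ1, ψ3]) + conn ψ3 (η.onSec ![ψ1, ψ2]) -
      η.onSec ![br ψ1 ψ2, ψ3] + η.onSec ![br ψ1 ψ3, ψ2] - η.onSec ![br ψ2 ψ3, ψ1] := by
  have h1 : (fun k => ![ψ1, ψ2, ψ3] (Fin.succAbove 0 k)) = ![ψ2, ψ3] := by
    funext k; fin_cases k <;> rfl
  have h2 : (fun k => ![ψ1, ψ2, ψ3] (Fin.succAbove 1 k)) = ![ψ1, ψ3] := by
    funext k; fin_cases k <;> rfl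
  have h3 : (fun k => ![ψ1, ψ2, ψ3] (Fin.succAbove 2 k)) = ![ψ1, ψ2] := by
    funext k; fin_cases k <;> rfl
  have e : ∀ (ψ : Sec E) (j : Fin 3) (i : Fin 2),
      (Fin.cons ψ fun k => ![ψ1, ψ2, ψ3] (j.succAbove (i.succAbove k)) : Fin 2 → Sec E) =
      ![ψ, ![ψ1, ψ2, ψ3] (j.succAbove (i.succAbove 0))] := fun ψ j i => by
    funext k; fin_cases k <;> rfl
  change (∑ i : Fin 3, (-1 : ℝ) ^ (i : ℕ) • conn (![ψ1, ψ2, ψ3] i)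
      (η.onSec fun k => ![ψ1, ψ2, ψ3] (Fin.succAbove i k))) +
    (∑ j : Fin 3, ∑ i : Fin 2, if i.castSucc < j then (-1 : ℝ) ^ ((i : ℕ) + (j : ℕ)) •
      η.onSec (Fin.cons (br (![ψ1, ψ2, ψ3] i.castSucc) (![ψ1, ψ2, ψ3] j))
        fun k => ![ψ1, ψ2, ψ3] (j.succAbove (i.succAbove k))) else 0) = _
  rw [Fin.sum_univ_three, Fin.sum_univ_three]
  simp only [Fin.sum_univ_two, h1, h2, h3, e]
  simp [Fin.succAbove, Fin.lt_def, pow_succ]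
  abel

lemma extCovDeriv_three (br : Sec E → Sec E → Sec E) (conn : Sec E → Sec V → Sec V)
    (η : EForm 3 E V) (ψ1 ψ2 ψ3 ψ4 : Sec E) : extCovDeriv br conn η ![ψ1, ψ2, ψ3, ψ4] =
      conn ψ1 (η.onSec ![ψ2, ψ3, ψ4]) - conn ψ2 (η.onSec ![ψ1, ψ3, ψ4]) +
      conn ψ3 (η.onSec ![ψ1, ψ2, ψ4]) - conn ψ4 (η.onSec ![ψ1, ψ2, ψ3]) -
      η.onSec ![br ψ1 ψ2, ψ3, ψ4] + η.onSec ![br ψ1 ψ3, ψ2, ψ4] - η.onSec ![br ψ1 ψ4, ψ2, ψ3] -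
      η.onSec ![br ψ2 ψ3, ψ1, ψ4] + η.onSec ![br ψ2 ψ4, ψ1, ψ3] - η.onSec ![br ψ3 ψ4, ψ1, ψ2] := by
  have h : ∀ i : Fin 4, (fun k => ![ψ1, ψ2, ψ3, ψ4] (Fin.succAbove i k)) =
      ![![ψ1, ψ2, ψ3, ψ4] (i.succAbove 0), ![ψ1, ψ2, ψ3, ψ4] (i.succAbove 1),
        ![ψ1, ψ2, ψ3, ψ4] (i.succAbove 2)] := fun i => by
    funext k; fin_cases k <;> rfl
  have e : ∀ (ψ : Sec E) (j : Fin 4) (i : Fin 3),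
      (Fin.cons ψ fun k => ![ψ1, ψ2, ψ3, ψ4] (j.succAbove (i.succAbove k)) : Fin 3 → Sec E) =
      ![ψ, ![ψ1, ψ2, ψ3, ψ4] (j.succAbove (i.succAbove 0)),
        ![ψ1, ψ2, ψ3, ψ4] (j.succAbove (i.succAbove 1))] := fun ψ j i => by
    funext k; fin_cases k <;> rfl
  change (∑ i : Fin 4, (-1 : ℝ) ^ (i : ℕ) • conn (![ψ1, ψ2, ψ3, ψ4] i)
      (η.onSec fun k => ![ψ1, ψ2, ψ3, ψ4] (Fin.succAbove i k))) +
    (∑ j : Fin 4, ∑ i : Fin 3, if i.castSucc < j then (-1 : ℝ) ^ ((i : ℕ) + (j : ℕ)) •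
      η.onSec (Fin.cons (br (![ψ1, ψ2, ψ3, ψ4] i.castSucc) (![ψ1, ψ2, ψ3, ψ4] j))
        fun k => ![ψ1, ψ2, ψ3, ψ4] (j.succAbove (i.succAbove k))) else 0) = _
  rw [Fin.sum_univ_four, Fin.sum_univ_four]
  simp only [Fin.sum_univ_three, h, e]
  simp [Fin.succAbove, Fin.lt_def, pow_succ]
  abel

lemma LieTwoAlgebroid.lie_bracket (L : LieTwoAlgebroid E V) (ψ1 ψ2 : Sec E) (f : GlobalFun n M)
    (x : M) : L.anchor.lie ψ1 (L.anchor.lie ψ2 f) x - L.anchor.lie ψ2 (L.anchor.lie ψ1 f) x =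
      L.anchor.lie (L.bracket ψ1 ψ2) f x := by
  have key : ∀ ψ3 : Sec E, (L.anchor.lie ψ1 (L.anchor.lie ψ2 f) x -
      L.anchor.lie ψ2 (L.anchor.lie ψ1 f) x - L.anchor.lie (L.bracket ψ1 ψ2) f x) • ψ3 x = 0 := by
    intro ψ3
    have lb : ∀ (ψ : Sec E) (f : GlobalFun n M) (ψ' : Sec E), L.bracket ψ (smulSec f ψ') =
        smulSec (L.anchor.lie ψ f) ψ' + smulSec f (L.bracket ψ ψ') := fun ψ f ψ' => by
      ext y; exact L.bracket_leibniz ψ f ψ' y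
    have hsk : ∀ ψ ψ' y, L.bracket ψ ψ' y = - L.bracket ψ' ψ y := fun ψ ψ' y => by
      rw [L.bracket_skew]; rfl
    have hneg : ∀ ψ ψ' y, L.bracket ψ (-ψ') y = - L.bracket ψ ψ' y := fun ψ ψ' y => by
      have h := L.bracket_add ψ ψ' (-ψ')
      have h0 := L.bracket_add ψ 0 0
      rw [add_zero, left_eq_add] at h0
      rw [add_neg_cancel, h0] at h
      have := congrArg (fun s : Sec E => s y) h
      exact (neg_eq_of_add_eq_zero_right this.symm).symm
    have hj := congrArg (fun s : Sec E => s x) (L.jacobiator ψ1 ψ2 ψ3)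
    have hjf := congrArg (fun s : Sec E => s x) (L.jacobiator ψ1 ψ2 (smulSec f ψ3))
    have ht : L.t.onSec (L.H.onSec ![ψ1, ψ2, smulSec f ψ3]) x =
        f x • L.t.onSec (L.H.onSec ![ψ1, ψ2, ψ3]) x := by
      change L.t.map x (L.H.form x _) = f x • L.t.map x (L.H.form x _)
      rw [← map_smul]
      congr 1
      have h3 := (alt3_of_map (L.H.form x)).smul₃ (f x) (ψ1 x) (ψ2 x) (ψ3 x)
      refine Eq.trans (congrArg _ ?_) (h3.trans (congrArg _ (congrArg _ ?_)))
      · funext k; fin_cases k <;> rfl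
      · funext k; fin_cases k <;> rfl
    rw [ht, ← hj] at hjf
    rw [L.bracket_skew (smulSec f ψ3) ψ1, L.bracket_skew ψ3 ψ1,
      L.bracket_skew (smulSec f ψ3) (L.bracket ψ1 ψ2), L.bracket_skew ψ3 (L.bracket ψ1 ψ2)] at hjf
    simp only [ContMDiffSection.coe_add, Pi.add_apply, ContMDiffSection.coe_neg, Pi.neg_apply,
      hneg, lb, L.bracket_add, smulSec_apply] at hjf
    rw [← sub_eq_zero] at hjf
    refine Eq.trans ?_ hjf
    module
  by_cases h : ∃ e : E.fiber x, e ≠ 0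
  · obtain ⟨e, he⟩ := h
    obtain ⟨ψ3, h3⟩ := exists_sec x e
    have := key ψ3
    rw [h3, smul_eq_zero, or_iff_left he] at this
    linarith
  · push Not at h
    have z : ∀ ψ g, L.anchor.lie ψ g x = 0 := fun ψ g => by
      rw [Anchor.lie_apply, h (ψ x), map_zero]
      exact map_zero _
    rw [z, z, z, sub_zero]

lemma pair_add (α : DualSec E) (ψ ψ' : Sec E) (x : M) :
    pair α (ψ + ψ') x = pair α ψ x + pair α ψ' x := map_add (α.form x) _ _
lemma pair_sub (α : DualSec E) (ψ ψ' : Sec E) (x : M) :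
    pair α (ψ - ψ') x = pair α ψ x - pair α ψ' x := map_sub (α.form x) _ _
lemma pair_neg (α : DualSec E) (ψ : Sec E) (x : M) :
    pair α (-ψ) x = - pair α ψ x := map_neg (α.form x) _

namespace OddDer.HasData

variable {D : OddDer E V} {P : PreLie E V} (h : D.HasData P) 
  (ψ1 ψ2 ψ3 ψ4 ψ : Sec E) (v : Sec V) (x : M) (f : GlobalFun n M) (α : DualSec E) (β : DualSec V)
include h

lemma exists_fun : ∃ α : DualSec E, D.app ⊤ (ofFun E V f) = ofDualE E V α ∧
    ∀ ψ, pair α ψ = P.anchor.lie ψ f := by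
  obtain ⟨α, hα⟩ := exists_ofDualE (D.degree ⊤ 0 _ (ofFun_mem f))
  exact ⟨α, hα, fun ψ => by rw [← h.on_fun f ψ 0, hα, evalSec_ofDualE_one]⟩

lemma sq_fun_two : evalSec (D.app ⊤ (D.app ⊤ (ofFun E V f))) [ψ1, ψ2] v x =
    P.anchor.lie ψ1 (P.anchor.lie ψ2 f) x - P.anchor.lie ψ2 (P.anchor.lie ψ1 f) x -
      P.anchor.lie (P.bracket ψ1 ψ2) f x := by
  obtain ⟨α, hα, h1⟩ := h.exists_fun f
  rw [hα, h.on_dualE_two, h1, h1, h1]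
  rfl

lemma sq_fun_zero : evalSec (D.app ⊤ (D.app ⊤ (ofFun E V f))) [] v x =
    P.anchor.lie (P.t.onSec v) f x := by
  obtain ⟨α, hα, h1⟩ := h.exists_fun f
  rw [hα, h.on_dualE_zero, h1]

lemma sq_dualE_three : evalSec (D.app ⊤ (D.app ⊤ (ofDualE E V α))) [ψ1, ψ2, ψ3] v x =
    evalSec (D.app ⊤ (D.app ⊤ (ofFun E V (pair α ψ3)))) [ψ1, ψ2] v x -
    evalSec (D.app ⊤ (D.app ⊤ (ofFun E V (pair α ψ2)))) [ψ1, ψ3] v x +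
    evalSec (D.app ⊤ (D.app ⊤ (ofFun E V (pair α ψ1)))) [ψ2, ψ3] v x +
    pair α (P.t.onSec (P.H.onSec ![ψ1, ψ2, ψ3]) - (P.bracket ψ1 (P.bracket ψ2 ψ3) +
      P.bracket ψ2 (P.bracket ψ3 ψ1) + P.bracket ψ3 (P.bracket ψ1 ψ2))) x := by
  rw [h.two_three _ _ _ _ _ (D.degree ⊤ 1 _ (ofDualE_mem α)), P.bracket_skew ψ3 ψ1]
  have hn : P.bracket ψ2 (-P.bracket ψ1 ψ3) = P.bracket (P.bracket ψ1 ψ3) ψ2 := by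
    have h := P.bracket_add ψ2 (P.bracket ψ1 ψ3) (-P.bracket ψ1 ψ3)
    have h0 := P.bracket_add ψ2 0 0
    rw [add_zero, left_eq_add] at h0
    rw [add_neg_cancel, h0, P.bracket_skew ψ2] at h
    exact eq_of_sub_eq_zero (by rw [h]; abel)
  rw [hn, P.bracket_skew ψ1 (P.bracket ψ2 ψ3), P.bracket_skew ψ3 (P.bracket ψ1 ψ2)]
  simp only [h.sq_fun_two, h.on_dualE_two, h.on_dualE_zero, pair_sub, pair_add, pair_neg,
    Anchor.lie_ops, GlobalFun.ops]
  ring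

lemma sq_dualE_one : evalSec (D.app ⊤ (D.app ⊤ (ofDualE E V α))) [ψ] v x =
    evalSec (D.app ⊤ (D.app ⊤ (ofFun E V (pair α ψ)))) [] v x +
    pair α (P.bracket ψ (P.t.onSec v) - P.t.onSec (P.conn ψ v)) x := by
  rw [h.two_one _ _ _ (D.degree ⊤ 1 _ (ofDualE_mem α)), P.bracket_skew ψ]
  simp only [h.sq_fun_zero, h.on_dualE_two, h.on_dualE_zero, pair_sub, pair_neg, GlobalFun.ops]
  ring

lemma sq_dualV_zero : evalSec (D.app ⊤ (D.app ⊤ (ofDualV E V β))) [] v x =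
    evalSec (D.app ⊤ (D.app ⊤ (ofFun E V (pair β v)))) [] v x -
      pair β (P.conn (P.t.onSec v) v) x := by
  rw [h.three_zero _ _ (D.degree ⊤ 2 _ (ofDualV_mem β)), h.on_dualV_one, h.sq_fun_zero]
  rfl

lemma sq_dualV_two : evalSec (D.app ⊤ (D.app ⊤ (ofDualV E V β))) [ψ1, ψ2] v x =
    evalSec (D.app ⊤ (D.app ⊤ (ofFun E V (pair β v)))) [ψ1, ψ2] v x +
    pair β (P.H.onSec ![ψ1, ψ2, P.t.onSec v] - (P.conn ψ1 (P.conn ψ2 v) - P.conn ψ2 (P.conn ψ1 v) -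
      P.conn (P.bracket ψ1 ψ2) v)) x := by
  have hH : P.H.onSec ![P.t.onSec v, ψ1, ψ2] = P.H.onSec ![ψ1, ψ2, P.t.onSec v] := by
    ext y
    have h3 := alt3_of_map (P.H.form y)
    have e := (h3.swap (P.t.onSec v y) (ψ1 y) (ψ2 y)).trans (congrArg Neg.neg
      (h3.swap' (ψ1 y) (P.t.onSec v y) (ψ2 y)))
    rw [neg_neg] at e
    refine Eq.trans (congrArg _ ?_) (e.trans (congrArg _ ?_))
    · funext k; fin_cases k <;> rfl
    · funext k; fin_cases k <;> rfl
  rw [h.three_two _ _ _ _ (D.degree ⊤ 2 _ (ofDualV_mem β))]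
  simp only [h.sq_fun_two, h.on_dualV_one, h.on_dualV_three, pair_sub, hH, GlobalFun.ops,
    Anchor.lie_ops]
  ring

lemma sq_dualV_four : evalSec (D.app ⊤ (D.app ⊤ (ofDualV E V β))) [ψ1, ψ2, ψ3, ψ4] v x =
    pair β (extCovDeriv P.bracket P.conn P.H ![ψ1, ψ2, ψ3, ψ4]) x := by
  rw [h.three_four _ _ _ _ _ _ (D.degree ⊤ 2 _ (ofDualV_mem β)), extCovDeriv_three]
  simp only [h.on_dualV_one, h.on_dualV_three, pair_sub, pair_add, GlobalFun.ops]
  ring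

end OddDer.HasData

lemma PreLie.conn_t_skew_of_self (P : PreLie E V)
    (h : ∀ v, P.conn (P.t.onSec v) v = 0) (v1 v2 : Sec V) :
    P.conn (P.t.onSec v1) v2 = - P.conn (P.t.onSec v2) v1 := by
  have h1 := h (v1 + v2)
  have ht : P.t.onSec (v1 + v2) = P.t.onSec v1 + P.t.onSec v2 := by
    ext y; exact map_add (P.t.map y) _ _
  rw [ht, P.conn_add_left, P.conn_add_right, P.conn_add_right, h, h, zero_add, add_zero] at h1
  exact eq_neg_of_add_eq_zero_left h1

lemma exists_bilin_of_tensorial (x : M) (c : Sec E → Sec V → ℝ)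
    (hadd : ∀ ψ ψ' v, c (ψ + ψ') v = c ψ v + c ψ' v)
    (hsmul : ∀ (f : GlobalFun n M) ψ v, c (smulSec f ψ) v = f x * c ψ v)
    (hadd' : ∀ ψ v v', c ψ (v + v') = c ψ v + c ψ v')
    (hsmul' : ∀ (f : GlobalFun n M) ψ v, c ψ (smulSec f v) = f x * c ψ v) :
    ∃ μ : E.fiber x →ₗ[ℝ] V.fiber x →ₗ[ℝ] ℝ, ∀ ψ v, c ψ v = μ (ψ x) (v x) := by
  choose A hA using fun v => exists_dual_of_tensorial x (fun ψ => c ψ v)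
    (fun ψ ψ' => hadd ψ ψ' v) (fun f ψ => hsmul f ψ v)
  choose B hB using fun ψ => exists_dual_of_tensorial x (c ψ) (hadd' ψ) (fun f v => hsmul' f ψ v)
  choose s hs using fun e => exists_sec (E := E) x e
  choose s' hs' using fun w => exists_sec (E := V) x w
  have h1 : ∀ e w, A (s' w) e = B (s e) w := fun e w => by
    have := (hA (s' w) (s e)).symm.trans (hB (s e) (s' w))
    rwa [hs, hs'] at this
  refine ⟨LinearMap.mk₂ ℝ (fun e w => A (s' w) e) (fun _ _ _ => map_add _ _ _)
    (fun _ _ _ => map_smul _ _ _) (fun e w w' => ?_) (fun r e w => ?_), fun ψ v => ?_⟩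
  · simp only [h1, map_add]
  · simp only [h1, map_smul]
  · rw [LinearMap.mk₂_apply, ← hA, hB, hB, hs']

lemma mul_mem_deg {U : Opens M} {a b : 𝒪[E,V].A U} {k l : ℕ}
    (ha : a ∈ 𝒪[E,V].deg U k) (hb : b ∈ 𝒪[E,V].deg U l) :
    a * b ∈ 𝒪[E,V].deg U (k + l) := SetLike.GradedMul.mul_mem ha hb

lemma ofFun_mul_mem (f : GlobalFun n M) {a : 𝒪[E,V].A ⊤} {k : ℕ}
    (ha : a ∈ 𝒪[E,V].deg ⊤ k) : ofFun E V f * a ∈ 𝒪[E,V].deg ⊤ k := by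
  have := mul_mem_deg (ofFun_mem f) ha
  rwa [zero_add] at this

lemma ofDualE_mul_mem (α : DualSec E) {a : 𝒪[E,V].A ⊤} {k : ℕ}
    (ha : a ∈ 𝒪[E,V].deg ⊤ k) : ofDualE E V α * a ∈ 𝒪[E,V].deg ⊤ (k + 1) := by
  have := mul_mem_deg (ofDualE_mem α) ha
  rwa [add_comm] at this

lemma deg_add_mem {U : Opens M} {a b : 𝒪[E,V].A U} {k : ℕ}
    (ha : a ∈ 𝒪[E,V].deg U k) (hb : b ∈ 𝒪[E,V].deg U k) :
    a + b ∈ 𝒪[E,V].deg U k := Submodule.add_mem _ ha hb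

section Ext

variable {a b : 𝒪[E,V].A ⊤}

lemma global_ext_one (ha : a ∈ 𝒪[E,V].deg ⊤ 1) (hb : b ∈ 𝒪[E,V].deg ⊤ 1)
    (h : ∀ ψ x, evalSec a [ψ] 0 x = evalSec b [ψ] 0 x) : a = b := splitVal_ext fun x =>
  ext_one (ha ⟨x, trivial⟩) (hb ⟨x, trivial⟩) (forall_sec.2 fun ψ => h ψ x)

lemma global_ext_two (ha : a ∈ 𝒪[E,V].deg ⊤ 2) (hb : b ∈ 𝒪[E,V].deg ⊤ 2)
    (h : ∀ ψ ψ' x, evalSec a [ψ, ψ'] 0 x = evalSec b [ψ, ψ'] 0 x)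
    (h' : ∀ v x, evalSec a [] v x = evalSec b [] v x) : a = b := splitVal_ext fun x =>
  ext_two (ha ⟨x, trivial⟩) (hb ⟨x, trivial⟩) (forall_sec.2 fun ψ => forall_sec.2 fun ψ' => h ψ ψ' x)
    (forall_sec.2 fun v => h' v x)

lemma global_ext_three (ha : a ∈ 𝒪[E,V].deg ⊤ 3) (hb : b ∈ 𝒪[E,V].deg ⊤ 3)
    (h : ∀ ψ1 ψ2 ψ3 x, evalSec a [ψ1, ψ2, ψ3] 0 x = evalSec b [ψ1, ψ2, ψ3] 0 x)
    (h' : ∀ ψ v x, evalSec a [ψ] v x = evalSec b [ψ] v x) : a = b := splitVal_ext fun x =>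
  ext_three (ha ⟨x, trivial⟩) (hb ⟨x, trivial⟩) (forall_sec.2 fun ψ1 => forall_sec.2 fun ψ2 =>
    forall_sec.2 fun ψ3 => h ψ1 ψ2 ψ3 x) (forall_sec.2 fun ψ => forall_sec.2 fun v => h' ψ v x)

lemma global_ext_four (ha : a ∈ 𝒪[E,V].deg ⊤ 4)
    (h : ∀ ψ1 ψ2 ψ3 ψ4 x, evalSec a [ψ1, ψ2, ψ3, ψ4] 0 x = 0)
    (h' : ∀ ψ ψ' v x, evalSec a [ψ, ψ'] v x = 0) (h'' : ∀ v x, evalSec a [] v x = 0) : a = 0 :=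
  splitVal_ext fun x => (ext_four (ha ⟨x, trivial⟩)
    (forall_sec.2 fun ψ1 => forall_sec.2 fun ψ2 => forall_sec.2 fun ψ3 => forall_sec.2 fun ψ4 =>
      h ψ1 ψ2 ψ3 ψ4 x)
    (forall_sec.2 fun ψ => forall_sec.2 fun ψ' => forall_sec.2 fun v => h' ψ ψ' v x)
    (forall_sec.2 fun v => h'' v x)).trans
      (map_zero (valHom (E := E) (V := V) (⟨x, trivial⟩ : (⊤ : Opens M)))).symm

end Ext

/-- The differential of a function, pulled back by the anchor. -/
def Anchor.dual (ρ : Anchor E) (f : GlobalFun n M) : DualSec E where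
  form x := (mfderiv (𝓡 n) 𝓘(ℝ, ℝ) f x).toLinearMap ∘ₗ ρ.map x
  smooth ψ := dirDeriv_smooth f (ρ.smooth ψ)

lemma Anchor.pair_dual (ρ : Anchor E) (f : GlobalFun n M) (ψ : Sec E) :
    pair (ρ.dual f) ψ = ρ.lie ψ f := rfl

lemma dualSec_ext {α α' : DualSec E} (h : ∀ ψ x, pair α ψ x = pair α' ψ x) : α = α' := by
  ext x : 2
  exact dual_ext_sec fun ψ => h ψ x

lemma pair_smul (f : GlobalFun n M) (α : DualSec E) (ψ : Sec E) :
    pair (f • α) ψ = f * pair α ψ := rfl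
lemma pair_smulSec (f : GlobalFun n M) (α : DualSec E) (ψ : Sec E) :
    pair α (smulSec f ψ) = f * pair α ψ := by
  ext y; exact map_smul (α.form y) _ _
lemma add_pair (α α' : DualSec E) (ψ : Sec E) :
    pair (α + α') ψ = pair α ψ + pair α' ψ := rfl

lemma pair_add_sec (α : DualSec E) (ψ ψ' : Sec E) :
    pair α (ψ + ψ') = pair α ψ + pair α ψ' := by
  ext y; exact map_add (α.form y) _ _

lemma Anchor.lie_left (ρ : Anchor E) (f : GlobalFun n M) (x : M) :
    (∀ ψ ψ', ρ.lie (ψ + ψ') f x = ρ.lie ψ f x + ρ.lie ψ' f x) ∧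
    ∀ g ψ, ρ.lie (smulSec g ψ) f x = g x * ρ.lie ψ f x :=
  ⟨fun _ _ => pair_add (ρ.dual f) _ _ x, fun _ _ => map_smul ((ρ.dual f).form x) _ _⟩

namespace PreLie

variable (P : PreLie E V)

/-- The Cartan differential of a one-form. -/
def dE (α : DualSec E) (ψ1 ψ2 : Sec E) : GlobalFun n M :=
  P.anchor.lie ψ1 (pair α ψ2) - P.anchor.lie ψ2 (pair α ψ1) - pair α (P.bracket ψ1 ψ2)

lemma dE_swap (α : DualSec E) (ψ1 ψ2 : Sec E) (x : M) :
    P.dE α ψ1 ψ2 x = - P.dE α ψ2 ψ1 x := by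
  simp only [dE, GlobalFun.ops, P.bracket_skew ψ1 ψ2, pair_neg]
  ring

lemma dE_add_right (α : DualSec E) (ψ1 ψ2 ψ3 : Sec E) (x : M) :
    P.dE α ψ1 (ψ2 + ψ3) x = P.dE α ψ1 ψ2 x + P.dE α ψ1 ψ3 x := by
  simp only [dE, GlobalFun.ops, P.bracket_add, pair_add_sec, Anchor.lie_ops, Anchor.lie_left]
  ring

lemma pair_bracket_smul (α : DualSec E) (ψ1 ψ2 : Sec E) (f : GlobalFun n M) (x : M) :
    pair α (P.bracket ψ1 (smulSec f ψ2)) x =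
      P.anchor.lie ψ1 f x * pair α ψ2 x + f x * pair α (P.bracket ψ1 ψ2) x := by
  rw [pair_apply, P.bracket_leibniz, map_add, map_smul, map_smul]
  rfl

lemma dE_smul_right (α : DualSec E) (ψ1 ψ2 : Sec E) (f : GlobalFun n M) (x : M) :
    P.dE α ψ1 (smulSec f ψ2) x = f x * P.dE α ψ1 ψ2 x := by
  simp only [dE, GlobalFun.ops, pair_bracket_smul, pair_smulSec, Anchor.lie_ops, Anchor.lie_left]
  ring

lemma exists_dE (α : DualSec E) : ∃ a ∈ 𝒪[E,V].deg ⊤ 2,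
    (∀ ψ ψ' v, evalSec a [ψ, ψ'] v = P.dE α ψ ψ') ∧
    ∀ v, evalSec a [] v = pair α (P.t.onSec v) := by
  have hl : ∀ ψ1 ψ2 ψ3 x, P.dE α (ψ1 + ψ2) ψ3 x = P.dE α ψ1 ψ3 x + P.dE α ψ2 ψ3 x := by
    intro ψ1 ψ2 ψ3 x
    rw [dE_swap, dE_add_right, dE_swap, P.dE_swap α ψ2]; ring
  have hls : ∀ (f : GlobalFun n M) ψ1 ψ2 x, P.dE α (smulSec f ψ1) ψ2 x = f x * P.dE α ψ1 ψ2 x := by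
    intro f ψ1 ψ2 x
    rw [dE_swap, dE_smul_right, dE_swap, P.dE_swap α ψ1]; ring
  choose μ hμ using fun x => exists_bilin_of_tensorial x (fun ψ ψ' => P.dE α ψ ψ' x)
    (fun ψ ψ' v => hl ψ ψ' v x) (fun f ψ v => hls f ψ v x)
    (fun ψ v v' => P.dE_add_right α ψ v v' x) (fun f ψ v => P.dE_smul_right α ψ v f x)
  obtain ⟨a, ha, h1, h2⟩ := exists_deg_two (E := E) (V := V) (fun y e e' => μ y e e')
    (fun y => ⟨fun a a' b => by rw [map_add]; rfl, fun c a b => by rw [map_smul]; rfl,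
      fun a b => by
        obtain ⟨ψ, rfl⟩ := exists_sec y a
        obtain ⟨ψ', rfl⟩ := exists_sec y b
        rw [← hμ, ← hμ, dE_swap]⟩)
    (fun ψ ψ' => by simpa only [← hμ] using (P.dE α ψ ψ').contMDiff)
    { form := fun x => α.form x ∘ₗ P.t.map x
      smooth := fun v => α.smooth (P.t.onSec v) }
  refine ⟨a, ha, fun ψ ψ' v => ?_, fun v => ?_⟩
  · ext y
    exact (h1 y _ _ _).trans (hμ y ψ ψ').symm
  · ext y
    exact h2 y _

/-- The covariant derivative of a section of the dual. -/
def dV (β : DualSec V) (ψ : Sec E) (v : Sec V) : GlobalFun n M :=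
  P.anchor.lie ψ (pair β v) - pair β (P.conn ψ v)

lemma dV_smul_right (β : DualSec V) (ψ : Sec E) (v : Sec V) (f : GlobalFun n M) (x : M) :
    P.dV β ψ (smulSec f v) x = f x * P.dV β ψ v x := by
  have h : pair β (P.conn ψ (smulSec f v)) x =
      P.anchor.lie ψ f x * pair β v x + f x * pair β (P.conn ψ v) x := by
    rw [pair_apply, P.conn_leibniz, map_add, map_smul, map_smul]
    rfl
  simp only [dV, GlobalFun.ops, h, pair_smulSec, Anchor.lie_ops]
  ring

lemma exists_dV (β : DualSec V) : ∃ a ∈ 𝒪[E,V].deg ⊤ 3,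
    (∀ ψ1 ψ2 ψ3 v, evalSec a [ψ1, ψ2, ψ3] v = pair β (P.H.onSec ![ψ1, ψ2, ψ3])) ∧
    ∀ ψ v, evalSec a [ψ] v = P.dV β ψ v := by
  choose μ hμ using fun x => exists_bilin_of_tensorial x (fun ψ v => P.dV β ψ v x)
    (fun ψ ψ' v => by
      simp only [dV, GlobalFun.ops, P.conn_add_left, pair_add, Anchor.lie_left]; ring)
    (fun f ψ v => by
      simp only [dV, GlobalFun.ops, P.conn_smul_left, pair_smulSec, Anchor.lie_left]; ring)
    (fun ψ v v' => by
      simp only [dV, GlobalFun.ops, P.conn_add_right, pair_add_sec, Anchor.lie_ops]; ring)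
    (fun f ψ v => P.dV_smul_right β ψ v f x)
  have h3 : ∀ y (a b c : Sec E), (fun i => ![a, b, c] i y) = ![a y, b y, c y] := by
    intro y a b c
    funext k; fin_cases k <;> rfl
  have hH := fun y => alt3_of_map (P.H.form y)
  obtain ⟨a, ha, h1, h2⟩ := exists_deg_three (E := E) (V := V)
    (fun y e1 e2 e3 => β.form y (P.H.form y ![e1, e2, e3]))
    (fun y => ⟨fun a a' b c => by rw [(hH y).add, map_add],
      fun r a b c => by rw [(hH y).smul, map_smul],
      fun a b c => by rw [(hH y).swap, map_neg],
      fun a b c => by rw [(hH y).swap', map_neg]⟩)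
    (fun ψ1 ψ2 ψ3 => by
      have := β.smooth (P.H.onSec ![ψ1, ψ2, ψ3])
      simp only [← h3]
      exact this) μ
    (fun ψ v => by simpa only [← hμ] using (P.dV β ψ v).contMDiff)
  refine ⟨a, ha, fun ψ1 ψ2 ψ3 v => ?_, fun ψ v => ?_⟩
  · ext y
    refine (h1 y _ _ _ _).trans ?_
    rw [← h3]
    rfl
  · ext y
    exact (h2 y _ _).trans (hμ y ψ v).symm

lemma exists_oddDer : ∃ D : OddDer E V, D.HasData P := by
  choose q₁ d1 q₁e q₁o using P.exists_dE
  choose q₂ d2 q₂e q₂o using P.exists_dV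
  have hadd : ∀ f g, P.anchor.dual (f + g) = P.anchor.dual f + P.anchor.dual g := fun f g =>
    dualSec_ext fun ψ x => P.anchor.lie_add ψ f g x
  let q : GenDer E V :=
    { q₀ :=
      { toFun := fun f => ofDualE E V (P.anchor.dual f)
        map_add' := fun f g => by rw [← ofDualE_add, hadd]
        map_smul' := fun c f => by
          have : P.anchor.dual (c • f) = constFun c • P.anchor.dual f := dualSec_ext fun ψ x =>
            (P.anchor.lie_smul ψ f x c).trans (by
              rw [pair_smul, GlobalFun.mul_apply, constFun_apply, Anchor.pair_dual])
          rw [this, ofDualE_smul]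
          refine splitVal_ext fun x => ?_
          rw [ofFun_smul_val, constFun_apply]
          rfl }
      q₁ := q₁
      q₂ := q₂
      deg₀ := fun f => ofDualE_mem _
      deg₁ := d1
      deg₂ := d2
      mul₀ := fun f g => by
        have : P.anchor.dual (f * g) = f • P.anchor.dual g + g • P.anchor.dual f :=
          dualSec_ext fun ψ x => P.anchor.lie_mul ψ f g x
        change ofDualE E V _ = _ * ofDualE E V _ + _ * ofDualE E V _
        rw [this, ofDualE_add, ofDualE_smul, ofDualE_smul]
      add₁ := fun α α' => by
        refine global_ext_two (d1 _) (Submodule.add_mem _ (d1 _) (d1 _)) (fun ψ ψ' x => ?_)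
          fun v x => ?_
        · rw [evalSec_add, q₁e, q₁e, q₁e]
          simp only [dE, GlobalFun.ops, Anchor.lie_ops, add_pair]
          ring
        · rw [evalSec_add, q₁o, q₁o, q₁o]
          rfl
      add₂ := fun β β' => by
        refine global_ext_three (d2 _) (Submodule.add_mem _ (d2 _) (d2 _)) (fun ψ ψ' ψ'' x => ?_)
          fun ψ v x => ?_
        · rw [evalSec_add, q₂e, q₂e, q₂e]
          rfl
        · rw [evalSec_add, q₂o, q₂o, q₂o]
          simp only [dV, GlobalFun.ops, Anchor.lie_ops, add_pair]
          ring
      smul₁ := fun f α => by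
        change _ = ofDualE E V _ * _ + _
        refine global_ext_two (d1 _) (deg_add_mem (ofDualE_mul_mem _ (ofDualE_mem α))
          (ofFun_mul_mem f (d1 α)))
          (fun ψ ψ' x => ?_) fun v x => ?_
        · rw [evalSec_add, evalSec_oneE_two, evalSec_ofFun_mul, q₁e, q₁e, evalSec_ofDualE_one,
            evalSec_ofDualE_one, Anchor.pair_dual, Anchor.pair_dual]
          simp only [dE, GlobalFun.ops, Anchor.lie_ops, pair_smul]
          ring
        · rw [evalSec_add, evalSec_oneE_nil, evalSec_ofFun_mul, q₁o, q₁o, zero_add]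
          rfl
      smul₂ := fun f β => by
        change _ = ofDualE E V _ * _ + _
        refine global_ext_three (d2 _) (deg_add_mem (ofDualE_mul_mem _ (ofDualV_mem β))
          (ofFun_mul_mem f (d2 β)))
          (fun ψ ψ' ψ'' x => ?_) fun ψ v x => ?_
        · rw [evalSec_add, evalSec_oneE_three, evalSec_ofFun_mul, q₂e, q₂e]
          simp only [evalSec_ofDualV_cons, pair_smul, GlobalFun.ops]
          ring
        · rw [evalSec_add, evalSec_oneE_one, evalSec_ofFun_mul, q₂o, q₂o, evalSec_ofDualV_nil,
            Anchor.pair_dual]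
          simp only [dV, GlobalFun.ops, Anchor.lie_ops, pair_smul]
          ring }
  obtain ⟨D, h0, h1, h2⟩ := q.exists_oddDer
  refine ⟨D, ⟨fun f ψ v => ?_, fun α ψ1 ψ2 v => ?_, fun α v => ?_, fun β ψ v => ?_,
    fun β ψ1 ψ2 ψ3 v => ?_⟩⟩
  · rw [h0]; exact evalSec_ofDualE_one _ _ _
  · rw [h1]; exact q₁e α ψ1 ψ2 v
  · rw [h1]; exact q₁o α v
  · rw [h2]; exact q₂o β ψ v
  · rw [h2]; exact q₂e β ψ1 ψ2 ψ3 v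

end PreLie

lemma pair_zero (α : DualSec E) (x : M) : pair α 0 x = 0 := map_zero (α.form x)

lemma LieTwoAlgebroid.square_zero (L : LieTwoAlgebroid E V) {D : OddDer E V}
    (h : D.HasData L.toPre) (U : Opens M) (a : 𝒪[E,V].A U) : D.app U (D.app U a) = 0 := by
  have hf : ∀ f, D.app ⊤ (D.app ⊤ (ofFun E V f)) = 0 := fun f => by
    refine global_ext_two (D.degree ⊤ 1 _ (D.degree ⊤ 0 _ (ofFun_mem f))) (Submodule.zero_mem _)
      (fun ψ ψ' x => ?_) fun v x => ?_
    · rw [h.sq_fun_two, evalSec_zero]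
      exact sub_eq_zero.2 (L.lie_bracket ψ ψ' f x)
    · rw [h.sq_fun_zero, evalSec_zero, Anchor.lie_apply]
      refine (congrArg (dirDeriv f x) (L.anchor_t x (v x))).trans (map_zero _)
  have z : ∀ f l v x, evalSec (D.app ⊤ (D.app ⊤ (ofFun E V f))) l v x = 0 := fun f l v x => by
    rw [hf, evalSec_zero]; rfl
  refine D.square_zero hf (fun α => ?_) (fun β => ?_) U a
  · refine global_ext_three (D.degree ⊤ 2 _ (D.degree ⊤ 1 _ (ofDualE_mem α))) (Submodule.zero_mem _)
      (fun ψ1 ψ2 ψ3 x => ?_) fun ψ v x => ?_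
    · rw [h.sq_dualE_three, z, z, z, evalSec_zero]
      have := sub_eq_zero.2 (L.jacobiator ψ1 ψ2 ψ3).symm
      refine Eq.trans ?_ (pair_zero α x)
      rw [sub_zero, add_zero, zero_add]
      exact congrArg (fun s => pair α s x) this
    · rw [h.sq_dualE_one, z, evalSec_zero, zero_add]
      exact (congrArg (fun s => pair α s x) (sub_eq_zero.2 (L.t_conn ψ v).symm)).trans
        (pair_zero α x)
  · refine global_ext_four (D.degree ⊤ 3 _ (D.degree ⊤ 2 _ (ofDualV_mem β)))
      (fun ψ1 ψ2 ψ3 ψ4 x => ?_) (fun ψ ψ' v x => ?_) fun v x => ?_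
    · rw [h.sq_dualV_four]
      exact (congrArg (fun s => pair β s x) (L.closed ![ψ1, ψ2, ψ3, ψ4])).trans (pair_zero β x)
    · rw [h.sq_dualV_two, z, zero_add]
      exact (congrArg (fun s => pair β s x) (sub_eq_zero.2 (L.curvature ψ ψ' v).symm)).trans
        (pair_zero β x)
    · rw [h.sq_dualV_zero, z, zero_sub, neg_eq_zero]
      have h1 : L.conn (L.t.onSec v) v = 0 := by
        ext y : 2
        exact self_eq_neg_self (congrArg (fun s : Sec V => s y) (L.conn_t_skew v v))
      exact (congrArg (fun s => pair β s x) h1).trans (pair_zero β x)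

namespace OddDer

variable (D : OddDer E V)

lemma exists_anchor : ∃ ρ : Anchor E, ∀ f, D.app ⊤ (ofFun E V f) = ofDualE E V (ρ.dual f) := by
  choose δ hδ using fun f => exists_ofDualE (D.degree ⊤ 0 _ (ofFun_mem f))
  have hδ' : ∀ f ψ, evalSec (D.app ⊤ (ofFun E V f)) [ψ] 0 = pair (δ f) ψ := fun f ψ => by
    rw [hδ, evalSec_ofDualE_one]
  have hp : ∀ f x e, (δ f).form x e = evalGr (splitVal (D.app ⊤ (ofFun E V f)) x) [e] 0 := by
    intro f x e
    obtain ⟨ψ, rfl⟩ := exists_sec x e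
    exact (congrArg (fun g : GlobalFun n M => g x) (hδ' f ψ)).symm
  have hX : ∀ x (e : E.fiber x), ∃ X : TangentSpace (𝓡 n) x, ∀ f : GlobalFun n M,
      (δ f).form x e = dirDeriv f x X := fun x e => by
    refine exists_tangent_of_derivation x
      { toFun := fun f => (δ f).form x e
        map_add' := fun f g => by rw [hp, hp, hp, ofFun_add, map_add, splitVal_add, evalGr_add]
        map_smul' := fun c f => by
          rw [hp, hp, ofFun_smul, map_smul, splitVal_smul, evalGr_smul]; rfl } (fun f g => ?_)
    change (δ (f * g)).form x e = (δ f).form x e * _ + _ * (δ g).form x e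
    have h : δ (f * g) = f • δ g + g • δ f := by
      refine dualSec_ext fun ψ y => ?_
      rw [← hδ', QTwo.ofFun_mul, D.ofFun_mul, hδ, hδ, evalSec_add, evalSec_ofFun_mul,
        evalSec_oneE_one, evalSec_ofDualE_one, add_pair, pair_smul, pair_smul]
      have h2 : evalSec (ofFun E V g) [] 0 = g := by
        ext z; exact evalGr_algebraMap_nil _ _
      rw [h2, mul_comm g, add_comm]
    rw [h, DualSec.add_form, DualSec.smul_form, DualSec.smul_form]
    simp only [LinearMap.add_apply, LinearMap.smul_apply, smul_eq_mul]
    ring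
  choose X hX using hX
  refine ⟨⟨fun x => ⟨⟨X x, fun e e' => ?_⟩, fun c e => ?_⟩, fun ψ => ?_⟩, fun f => ?_⟩
  · refine tangent_ext fun f => ?_
    rw [← hX, map_add, hX, hX]
    exact (map_add (mfderiv (𝓡 n) 𝓘(ℝ, ℝ) f x) _ _).symm
  · refine tangent_ext fun f => ?_
    rw [← hX, map_smul, hX]
    exact (map_smul (mfderiv (𝓡 n) 𝓘(ℝ, ℝ) f x) _ _).symm
  · refine smooth_of_dirDeriv fun f => ?_
    change ContMDiff _ _ _ (fun x => dirDeriv f x (X x (ψ x)))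
    simpa only [← hX] using (δ f).smooth ψ
  · rw [hδ]
    congr 1
    exact dualSec_ext fun ψ x => hX x (ψ x) f

lemma app_smul_dualE {ρ : Anchor E} (hρ : ∀ f, D.app ⊤ (ofFun E V f) = ofDualE E V (ρ.dual f))
    (f : GlobalFun n M) (α : DualSec E) : D.app ⊤ (ofDualE E V (f • α)) =
      ofDualE E V (ρ.dual f) * ofDualE E V α + ofFun E V f * D.app ⊤ (ofDualE E V α) := by
  rw [ofDualE_smul, D.ofFun_mul, hρ]

lemma app_smul_dualV {ρ : Anchor E} (hρ : ∀ f, D.app ⊤ (ofFun E V f) = ofDualE E V (ρ.dual f))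
    (f : GlobalFun n M) (β : DualSec V) : D.app ⊤ (ofDualV E V (f • β)) =
      ofDualE E V (ρ.dual f) * ofDualV E V β + ofFun E V f * D.app ⊤ (ofDualV E V β) := by
  rw [ofDualV_smul, D.ofFun_mul, hρ]

set_option maxHeartbeats 1000000 in
lemma exists_preLie : ∃ P : PreLie E V, D.HasData P := by
  obtain ⟨ρ, hρ⟩ := D.exists_anchor
  have dE : ∀ α, D.app ⊤ (ofDualE E V α) ∈ 𝒪[E,V].deg ⊤ 2 := fun α =>
    D.degree ⊤ 1 _ (ofDualE_mem α)
  have dV : ∀ β, D.app ⊤ (ofDualV E V β) ∈ 𝒪[E,V].deg ⊤ 3 := fun β =>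
    D.degree ⊤ 2 _ (ofDualV_mem β)
  have ht : ∀ x (w : V.fiber x), ∃ e : E.fiber x, ∀ α : DualSec E,
      evalGr (splitVal (D.app ⊤ (ofDualE E V α)) x) [] w = α.form x e := fun x =>
    forall_sec.2 fun v => by
      refine exists_vec_of_tensorial x (fun α => evalSec (D.app ⊤ (ofDualE E V α)) [] v x)
        (fun α α' => ?_) fun f α => ?_
      · rw [ofDualE_add, map_add, evalSec_add]; rfl
      · rw [D.app_smul_dualE hρ, evalSec_add, evalSec_oneE_nil, evalSec_ofFun_mul, zero_add]; rfl
  choose t ht using ht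
  have tlin : ∀ x (α : DualSec E), ∃ f : Dual ℝ (V.fiber x), ∀ w, α.form x (t x w) = f w :=
    fun x α => by
      obtain ⟨f, hf⟩ := evalGr_linear (dE α ⟨x, trivial⟩) [] rfl
      exact ⟨f, fun w => by rw [← ht]; exact hf w⟩
  let T : BundleMap V E :=
    { map := fun x =>
      { toFun := t x
        map_add' := fun w w' => vec_ext_dual fun α => by
          obtain ⟨f, hf⟩ := tlin x α
          rw [map_add, hf, hf, hf, map_add]
        map_smul' := fun c w => vec_ext_dual fun α => by
          obtain ⟨f, hf⟩ := tlin x α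
          rw [RingHom.id_apply, map_smul, hf, hf, map_smul] }
      smooth := fun v x => sec_contMDiffAt fun α =>
        ((evalSec (D.app ⊤ (ofDualE E V α)) [] v).contMDiff x).congr_of_eventuallyEq
          (.of_forall fun y => (ht y _ α).symm) }
  have hb : ∀ ψ1 ψ2, ∃ b : Sec E, ∀ α x, (ρ.lie ψ1 (pair α ψ2) - ρ.lie ψ2 (pair α ψ1) -
      evalSec (D.app ⊤ (ofDualE E V α)) [ψ1, ψ2] 0) x = α.form x (b x) := fun ψ1 ψ2 => by
    refine exists_sec_of_tensorial _ (fun α => ContMDiffMap.contMDiff _) (fun α α' x => ?_)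
      fun f α x => ?_
    · simp only [ofDualE_add, map_add, evalSec_add, GlobalFun.ops, add_pair, Anchor.lie_ops]
      ring
    · simp only [D.app_smul_dualE hρ, evalSec_add, evalSec_oneE_two, evalSec_ofFun_mul,
        evalSec_ofDualE_one, Anchor.pair_dual, GlobalFun.ops, pair_smul, Anchor.lie_ops]
      ring
  choose br hbr using hb
  replace hbr : ∀ ψ1 ψ2 α x, α.form x (br ψ1 ψ2 x) = ρ.lie ψ1 (pair α ψ2) x -
      ρ.lie ψ2 (pair α ψ1) x - evalGr (splitVal (D.app ⊤ (ofDualE E V α)) x) [ψ1 x, ψ2 x] 0 :=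
    fun ψ1 ψ2 α x => (hbr ψ1 ψ2 α x).symm
  have hc : ∀ ψ v, ∃ b : Sec V, ∀ β x, (ρ.lie ψ (pair β v) -
      evalSec (D.app ⊤ (ofDualV E V β)) [ψ] v) x = β.form x (b x) := fun ψ v => by
    refine exists_sec_of_tensorial _ (fun α => ContMDiffMap.contMDiff _) (fun α α' x => ?_)
      fun f α x => ?_
    · simp only [ofDualV_add, map_add, evalSec_add, GlobalFun.ops, add_pair, Anchor.lie_ops]
      ring
    · simp only [D.app_smul_dualV hρ, evalSec_add, evalSec_oneE_one, evalSec_ofFun_mul,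
        evalSec_ofDualV_nil, Anchor.pair_dual, GlobalFun.ops, pair_smul, Anchor.lie_ops]
      ring
  choose cn hcn using hc
  replace hcn : ∀ ψ v β x, β.form x (cn ψ v x) = ρ.lie ψ (pair β v) x -
      evalGr (splitVal (D.app ⊤ (ofDualV E V β)) x) [ψ x] (v x) := fun ψ v β x => (hcn ψ v β x).symm
  have hh : ∀ x (e1 e2 e3 : E.fiber x), ∃ h : V.fiber x, ∀ β : DualSec V,
      evalGr (splitVal (D.app ⊤ (ofDualV E V β)) x) [e1, e2, e3] 0 = β.form x h := fun x =>
    forall_sec.2 fun ψ1 => forall_sec.2 fun ψ2 => forall_sec.2 fun ψ3 => by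
      refine exists_vec_of_tensorial x
        (fun β => evalSec (D.app ⊤ (ofDualV E V β)) [ψ1, ψ2, ψ3] 0 x) (fun α α' => ?_) fun f α => ?_
      · rw [ofDualV_add, map_add, evalSec_add]; rfl
      · simp only [D.app_smul_dualV hρ, evalSec_add, evalSec_oneE_three, evalSec_ofFun_mul,
          evalSec_ofDualV_cons, GlobalFun.ops]
        ring
  choose h hh using hh
  have hA : ∀ x, Alt3 (h x) := fun x => by
    have hA := fun β => alt3_evalGr (splitVal (D.app ⊤ (ofDualV E V β)) x) 0
    refine ⟨fun a a' b c => vec_ext_dual fun β => ?_, fun r a b c => vec_ext_dual fun β => ?_,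
      fun a b c => vec_ext_dual fun β => ?_, fun a b c => vec_ext_dual fun β => ?_⟩
    · rw [map_add, ← hh, ← hh, ← hh, (hA β).add]
    · rw [map_smul, ← hh, ← hh, (hA β).smul]
    · rw [map_neg, ← hh, ← hh, (hA β).swap]
    · rw [map_neg, ← hh, ← hh, (hA β).swap']
  let H : EForm 3 E V :=
    { form := fun x => (hA x).map
      smooth := fun ψ x => sec_contMDiffAt fun β =>
        ((evalSec (D.app ⊤ (ofDualV E V β)) [ψ 0, ψ 1, ψ 2] 0).contMDiff x).congr_of_eventuallyEq
          (.of_forall fun y => (hh y _ _ _ β).symm) }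
  have vlin : ∀ β x (e : E.fiber x),
      (∀ w w', evalGr (splitVal (D.app ⊤ (ofDualV E V β)) x) [e] (w + w') =
        evalGr (splitVal (D.app ⊤ (ofDualV E V β)) x) [e] w +
        evalGr (splitVal (D.app ⊤ (ofDualV E V β)) x) [e] w') ∧
      ∀ (c : ℝ) w, evalGr (splitVal (D.app ⊤ (ofDualV E V β)) x) [e] (c • w) =
        c * evalGr (splitVal (D.app ⊤ (ofDualV E V β)) x) [e] w := fun β x e => by
    obtain ⟨f, hf⟩ := evalGr_linear (dV β ⟨x, trivial⟩) [e] rfl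
    exact ⟨fun w w' => (hf _).trans ((map_add f w w').trans (by rw [← hf, ← hf]; rfl)),
      fun c w => (hf _).trans ((map_smul f c w).trans (by rw [← hf]; rfl))⟩
  have a2 : ∀ α x, Alt2 fun e e' => evalGr (splitVal (D.app ⊤ (ofDualE E V α)) x) [e, e'] 0 :=
    fun α x => alt2_evalGr _ _
  refine ⟨⟨ρ, T, br, cn, H, ?_, ?_, ?_, ?_, ?_, ?_, ?_⟩, ⟨fun f ψ v => ?_, fun α ψ1 ψ2 v => ?_,
      fun α v => ?_, fun β ψ v => ?_, fun β ψ1 ψ2 ψ3 v => ?_⟩⟩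
  · refine fun ψ1 ψ2 ψ3 => sec_ext_dual fun α x => ?_
    simp only [ContMDiffSection.coe_add, Pi.add_apply, map_add, hbr, pair_add_sec, Anchor.lie_ops,
      Anchor.lie_left, (a2 α x).add']
    ring
  · refine fun ψ1 ψ2 => sec_ext_dual fun α x => ?_
    simp only [ContMDiffSection.coe_neg, Pi.neg_apply, map_neg, hbr]
    rw [(a2 α x).swap (ψ1 x) (ψ2 x)]
    ring
  · refine fun ψ1 f ψ2 x => vec_ext_dual fun α => ?_
    simp only [hbr, map_add, map_smul, smul_eq_mul, pair_smulSec, Anchor.lie_ops, Anchor.lie_left,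
      smulSec_apply, (a2 α x).smul', pair_apply,
      ← Anchor.lie_apply]
    ring
  · refine fun ψ1 ψ2 v => sec_ext_dual fun β x => ?_
    simp only [ContMDiffSection.coe_add, Pi.add_apply, map_add, hcn, Anchor.lie_left,
      evalGr_cons_add]
    ring
  · refine fun f ψ v => sec_ext_dual fun β x => ?_
    simp only [smulSec_apply, map_smul, smul_eq_mul, hcn, Anchor.lie_left, evalGr_cons_smul]
    ring
  · refine fun ψ v v' => sec_ext_dual fun β x => ?_
    simp only [ContMDiffSection.coe_add, Pi.add_apply, map_add, hcn, pair_add_sec, Anchor.lie_ops,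
      vlin]
    ring
  · refine fun ψ g v x => vec_ext_dual fun β => ?_
    simp only [hcn, map_add, map_smul, smul_eq_mul, pair_smulSec, Anchor.lie_ops, smulSec_apply,
      vlin, pair_apply, ← Anchor.lie_apply]
    ring
  · rw [hρ, evalSec_ofDualE_one, Anchor.pair_dual]
  · ext x
    rw [show evalSec (D.app ⊤ (ofDualE E V α)) [ψ1, ψ2] v x = evalGr (splitVal (D.app ⊤
      (ofDualE E V α)) x) [ψ1 x, ψ2 x] 0 from evalGr_const (dE α ⟨x, trivial⟩) _ rfl _ _]
    simp only [GlobalFun.ops, pair_apply, hbr]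
    ring
  · ext x
    exact ht x (v x) α
  · ext x
    simp only [GlobalFun.ops, pair_apply, hcn, evalSec_apply, List.map]
    ring
  · ext x
    exact (evalGr_const (dV β ⟨x, trivial⟩) _ rfl _ _).trans (hh x _ _ _ β)

lemma _root_.QTwo.sec_eq_zero {s : Sec E} (h : ∀ α x, pair α s x = 0) : s = 0 :=
  sec_ext_dual fun α x => (h α x).trans (map_zero (α.form x)).symm

lemma _root_.QTwo.sec_ext_pair {s s' : Sec E} (h : ∀ α, pair α s = pair α s') : s = s' :=
  sec_ext_dual fun α x => congrArg (fun g : GlobalFun n M => g x) (h α)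

lemma HasData.exists_lie {P : PreLie E V} {D : OddDer E V} (h : D.HasData P)
    (hD : ∀ a, D.app ⊤ (D.app ⊤ a) = 0) : ∃ L : LieTwoAlgebroid E V, D.HasData L.toPre := by
  have z : ∀ a l v x, evalSec (D.app ⊤ (D.app ⊤ a)) l v x = 0 := fun a l v x => by
    rw [hD, evalSec_zero]; rfl
  refine ⟨⟨P.anchor, P.t, P.bracket, P.conn, P.H, fun x v => ?_, P.bracket_add, P.bracket_skew,
    P.bracket_leibniz, P.conn_add_left, P.conn_smul_left, P.conn_add_right, P.conn_leibniz,
    fun ψ v => ?_, P.conn_t_skew_of_self fun v => ?_, fun ψ1 ψ2 ψ3 => ?_, fun ψ1 ψ2 v => ?_,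
    fun ψ => ?_⟩, h⟩
  · refine tangent_ext fun f => ?_
    obtain ⟨v, rfl⟩ := exists_sec x v
    refine (h.sq_fun_zero v x f).symm.trans ((z _ _ _ _).trans ?_)
    exact (map_zero (mfderiv (𝓡 n) 𝓘(ℝ, ℝ) f x)).symm
  · refine (sub_eq_zero.1 (sec_eq_zero fun α x => ?_)).symm
    have := h.sq_dualE_one ψ v x α
    rwa [z, z, zero_add, eq_comm] at this
  · refine sec_eq_zero fun β x => ?_
    have := h.sq_dualV_zero v x β
    rwa [z, z, zero_sub, eq_comm, neg_eq_zero] at this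
  · refine (sub_eq_zero.1 (sec_eq_zero fun α x => ?_)).symm
    have := h.sq_dualE_three ψ1 ψ2 ψ3 0 x α
    rwa [z, z, z, z, sub_zero, add_zero, zero_add, eq_comm] at this
  · refine (sub_eq_zero.1 (sec_eq_zero fun β x => ?_)).symm
    have := h.sq_dualV_two ψ1 ψ2 v x β
    rwa [z, z, zero_add, eq_comm] at this
  · refine sec_eq_zero fun β x => ?_
    have := h.sq_dualV_four (ψ 0) (ψ 1) (ψ 2) (ψ 3) 0 x β
    rw [z, eq_comm] at this
    have h4 : ψ = ![ψ 0, ψ 1, ψ 2, ψ 3] := by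
      funext k; fin_cases k <;> rfl
    rw [h4]
    exact this

lemma HasData.lie_unique {L L' : LieTwoAlgebroid E V} {D : OddDer E V} (h : D.HasData L.toPre)
    (h' : D.HasData L'.toPre) : L = L' := by
  have hρ : L.anchor = L'.anchor := by
    ext x e : 3
    obtain ⟨ψ, rfl⟩ := exists_sec x e
    refine tangent_ext fun f => ?_
    exact congrArg (fun g : GlobalFun n M => g x) ((h.on_fun f ψ 0).symm.trans (h'.on_fun f ψ 0))
  have ht : L.t = L'.t := by
    ext x v : 3
    obtain ⟨v, rfl⟩ := exists_sec x v
    have : L.t.onSec v = L'.t.onSec v := sec_ext_pair fun α =>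
      (h.on_dualE_zero α v).symm.trans (h'.on_dualE_zero α v)
    exact congrArg (fun s : Sec E => s x) this
  refine LieTwoAlgebroid.ext hρ ht ?_ ?_ ?_
  · funext ψ1 ψ2
    refine sec_ext_pair fun α => ?_
    have h1 := h.on_dualE_two α ψ1 ψ2 0
    have h2 := h'.on_dualE_two α ψ1 ψ2 0
    rw [h1] at h2
    change L.anchor.lie _ _ - L.anchor.lie _ _ - _ = L'.anchor.lie _ _ - L'.anchor.lie _ _ - _ at h2
    rw [hρ] at h2
    exact sub_right_injective h2
  · funext ψ v
    refine sec_ext_pair fun β => ?_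
    have h1 := h.on_dualV_one β ψ v
    have h2 := h'.on_dualV_one β ψ v
    rw [h1] at h2
    change L.anchor.lie _ _ - _ = L'.anchor.lie _ _ - _ at h2
    rw [hρ] at h2
    exact sub_right_injective h2
  · ext x : 2
    refine AlternatingMap.ext fun e => ?_
    choose ψ hψ using fun i => exists_sec x (e i)
    have : L.H.onSec ![ψ 0, ψ 1, ψ 2] = L'.H.onSec ![ψ 0, ψ 1, ψ 2] := sec_ext_pair fun β =>
      (h.on_dualV_three β _ _ _ 0).symm.trans (h'.on_dualV_three β _ _ _ 0)
    have h3 : ψ = ![ψ 0, ψ 1, ψ 2] := by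
      funext k; fin_cases k <;> rfl
    rw [← h3] at this
    have h4 : e = fun i => ψ i x := funext fun i => (hψ i).symm
    rw [h4]
    exact congrArg (fun s : Sec V => s x) this

lemma HasData.oddDer_unique {P : PreLie E V} {D D' : OddDer E V} (h : D.HasData P)
    (h' : D'.HasData P) : D.app = D'.app := by
  refine OddDer.ext_gens (fun f => ?_) (fun α => ?_) fun β => ?_
  · exact global_ext_one (D.degree ⊤ 0 _ (ofFun_mem f)) (D'.degree ⊤ 0 _ (ofFun_mem f)) fun ψ x => by
      rw [h.on_fun, h'.on_fun]
  · exact global_ext_two (D.degree ⊤ 1 _ (ofDualE_mem α)) (D'.degree ⊤ 1 _ (ofDualE_mem α))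
      (fun ψ ψ' x => by rw [h.on_dualE_two, h'.on_dualE_two]) fun v x => by
        rw [h.on_dualE_zero, h'.on_dualE_zero]
  · exact global_ext_three (D.degree ⊤ 2 _ (ofDualV_mem β)) (D'.degree ⊤ 2 _ (ofDualV_mem β))
      (fun ψ ψ' ψ'' x => by rw [h.on_dualV_three, h'.on_dualV_three]) fun ψ v x => by
        rw [h.on_dualV_one, h'.on_dualV_one]

end OddDer

/-- The vector field on `E[1] ⊕ V[2]` which corresponds to a homological vector field. -/
def Splitting.push (σ : Splitting X E V) (Q : HomologicalVF X) : OddDer E V where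
  app U := (σ.equiv U).toLinearMap ∘ₗ Q.app U ∘ₗ (σ.equiv U).symm.toLinearMap
  natural U W h a := by
    change 𝒪[E,V].res h (σ.equiv U (Q.app U ((σ.equiv U).symm a))) =
      σ.equiv W (Q.app W ((σ.equiv W).symm (𝒪[E,V].res h a)))
    rw [σ.natural, Q.natural]
    congr 2
    rw [AlgEquiv.eq_symm_apply, ← σ.natural, AlgEquiv.apply_symm_apply]
  degree U k a ha := by
    refine (σ.map_deg U (k + 1) _).1 (Q.degree U k _ ((σ.map_deg U k _).2 ?_))
    change σ.equiv U ((σ.equiv U).symm a) ∈ _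
    rwa [AlgEquiv.apply_symm_apply]
  leibniz U k a b ha := by
    change σ.equiv U (Q.app U ((σ.equiv U).symm (a * b))) =
      σ.equiv U (Q.app U ((σ.equiv U).symm a)) * b +
        (-1 : ℝ) ^ k • (a * σ.equiv U (Q.app U ((σ.equiv U).symm b)))
    have h : (σ.equiv U).symm a ∈ X.deg U k := (σ.map_deg U k _).2 (by
      rwa [AlgEquiv.apply_symm_apply])
    rw [map_mul, Q.leibniz U k _ _ h, map_add, map_smul, map_mul, map_mul,
      AlgEquiv.apply_symm_apply, AlgEquiv.apply_symm_apply]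

lemma Splitting.push_app (σ : Splitting X E V) (Q : HomologicalVF X) (U : Opens M)
    (a : 𝒪[E,V].A U) :
    (σ.push Q).app U a = σ.equiv U (Q.app U ((σ.equiv U).symm a)) := rfl

lemma Splitting.push_square (σ : Splitting X E V) (Q : HomologicalVF X) (U : Opens M)
    (a : 𝒪[E,V].A U) : (σ.push Q).app U ((σ.push Q).app U a) = 0 := by
  rw [push_app, push_app, AlgEquiv.symm_apply_apply, Q.square, map_zero]

lemma Splitting.push_injective (σ : Splitting X E V) {Q Q' : HomologicalVF X}
    (h : (σ.push Q).app = (σ.push Q').app) : Q = Q' := by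
  refine HomologicalVF.ext (funext fun U => LinearMap.ext fun a => (σ.equiv U).injective ?_)
  have := congrArg (fun D => D U (σ.equiv U a)) h
  change σ.equiv U (Q.app U ((σ.equiv U).symm (σ.equiv U a))) =
    σ.equiv U (Q'.app U ((σ.equiv U).symm (σ.equiv U a))) at this
  rwa [AlgEquiv.symm_apply_apply] at this

lemma Splitting.symm_natural (σ : Splitting X E V) {U W : Opens M} (h : W ≤ U)
    (a : 𝒪[E,V].A U) :
    X.res h ((σ.equiv U).symm a) = (σ.equiv W).symm (𝒪[E,V].res h a) := by
  rw [AlgEquiv.eq_symm_apply, ← σ.natural, AlgEquiv.apply_symm_apply]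

/-- The homological vector field on `X` which corresponds to one on `E[1] ⊕ V[2]`. -/
def Splitting.pull (σ : Splitting X E V) (D : OddDer E V)
    (hD : ∀ U a, D.app U (D.app U a) = 0) : HomologicalVF X where
  app U := (σ.equiv U).symm.toLinearMap ∘ₗ D.app U ∘ₗ (σ.equiv U).toLinearMap
  natural U W h a := by
    change X.res h ((σ.equiv U).symm (D.app U (σ.equiv U a))) =
      (σ.equiv W).symm (D.app W (σ.equiv W (X.res h a)))
    rw [σ.symm_natural, D.natural, σ.natural]
  degree U k a ha := by
    refine (σ.map_deg U (k + 1) _).2 ?_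
    change σ.equiv U ((σ.equiv U).symm (D.app U (σ.equiv U a))) ∈ _
    rw [AlgEquiv.apply_symm_apply]
    exact D.degree U k _ ((σ.map_deg U k _).1 ha)
  leibniz U k a b ha := by
    change (σ.equiv U).symm (D.app U (σ.equiv U (a * b))) =
      (σ.equiv U).symm (D.app U (σ.equiv U a)) * b +
        (-1 : ℝ) ^ k • (a * (σ.equiv U).symm (D.app U (σ.equiv U b)))
    rw [map_mul, D.leibniz U k _ _ ((σ.map_deg U k _).1 ha), map_add, map_smul, map_mul, map_mul,
      AlgEquiv.symm_apply_apply, AlgEquiv.symm_apply_apply]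
  square U a := by
    change (σ.equiv U).symm (D.app U (σ.equiv U ((σ.equiv U).symm (D.app U (σ.equiv U a))))) = 0
    rw [AlgEquiv.apply_symm_apply, hD, map_zero]

lemma Splitting.push_pull (σ : Splitting X E V) (D : OddDer E V)
    (hD : ∀ U a, D.app U (D.app U a) = 0) : (σ.push (σ.pull D hD)).app = D.app := by
  refine funext fun U => LinearMap.ext fun a => ?_
  change σ.equiv U ((σ.equiv U).symm (D.app U (σ.equiv U ((σ.equiv U).symm a)))) = _
  rw [AlgEquiv.apply_symm_apply, AlgEquiv.apply_symm_apply]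

lemma OddDer.HasData.of_app_eq {D D' : OddDer E V} {P : PreLie E V} (h : D.HasData P)
    (e : D'.app = D.app) : D'.HasData P := by
  refine ⟨?_, ?_, ?_, ?_, ?_⟩ <;> rw [e]
  exacts [h.on_fun, h.on_dualE_two, h.on_dualE_zero, h.on_dualV_one, h.on_dualV_three]

lemma isData_iff {σ : Splitting X E V} {Q : HomologicalVF X} {L : LieTwoAlgebroid E V} :
    IsData σ Q L ↔ (σ.push Q).HasData L.toPre := by
  have ap : ∀ {f g : GlobalFun n M} (_ : f = g) (x : M), f x = g x := fun h x => by rw [h]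
  refine ⟨fun h => ⟨fun f ψ v => ?_, fun α ψ1 ψ2 v => ?_, fun α v => ?_, fun β ψ v => ?_,
    fun β ψ1 ψ2 ψ3 v => ?_⟩, fun h => ⟨fun f x e v => ?_, fun α ψ1 ψ2 x v => ?_, fun α x v => ?_,
    fun β ψ v x => ?_, fun β x e1 e2 e3 v => ?_⟩⟩
  · ext x; exact h.on_fun f x (ψ x) (v x)
  · ext x; exact h.on_dualE_two α ψ1 ψ2 x (v x)
  · ext x; exact h.on_dualE_zero α x (v x)
  · ext x; exact h.on_dualV_one β ψ v x
  · ext x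
    refine (h.on_dualV_three β x (ψ1 x) (ψ2 x) (ψ3 x) (v x)).trans (congrArg (β.form x) ?_)
    refine congrArg (L.H.form x) ?_
    funext k; fin_cases k <;> rfl
  · obtain ⟨ψ, rfl⟩ := exists_sec x e
    obtain ⟨v, rfl⟩ := exists_sec x v
    exact ap (h.on_fun f ψ v) x
  · obtain ⟨v, rfl⟩ := exists_sec x v
    exact ap (h.on_dualE_two α ψ1 ψ2 v) x
  · obtain ⟨v, rfl⟩ := exists_sec x v
    exact ap (h.on_dualE_zero α v) x
  · exact ap (h.on_dualV_one β ψ v) x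
  · obtain ⟨ψ1, rfl⟩ := exists_sec x e1
    obtain ⟨ψ2, rfl⟩ := exists_sec x e2
    obtain ⟨ψ3, rfl⟩ := exists_sec x e3
    obtain ⟨v, rfl⟩ := exists_sec x v
    refine (ap (h.on_dualV_three β ψ1 ψ2 ψ3 v) x).trans (congrArg (β.form x) ?_)
    refine congrArg (L.H.form x) ?_
    funext k; fin_cases k <;> rfl

lemma existsUnique_lie (σ : Splitting X E V) (Q : HomologicalVF X) :
    ∃! L : LieTwoAlgebroid E V, IsData σ Q L := by
  obtain ⟨P, hP⟩ := (σ.push Q).exists_preLie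
  obtain ⟨L, hL⟩ := hP.exists_lie (σ.push_square Q ⊤)
  exact ⟨L, isData_iff.2 hL, fun L' h' => (isData_iff.1 h').lie_unique hL⟩

lemma existsUnique_vf (σ : Splitting X E V) (L : LieTwoAlgebroid E V) :
    ∃! Q : HomologicalVF X, IsData σ Q L := by
  obtain ⟨D, hD⟩ := L.toPre.exists_oddDer
  refine ⟨σ.pull D (L.square_zero hD), isData_iff.2 (hD.of_app_eq (σ.push_pull _ _)),
    fun Q' h' => σ.push_injective ?_⟩
  rw [(isData_iff.1 h').oddDer_unique hD, σ.push_pull]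

section BracketV

variable (L : LieTwoAlgebroid E V)

namespace LieTwoAlgebroid

lemma conn_neg_right (ψ : Sec E) (v : Sec V) : L.conn ψ (-v) = - L.conn ψ v := by
  have h := L.conn_add_right ψ v (-v)
  have h0 := L.conn_add_right ψ 0 0
  rw [add_zero, left_eq_add] at h0
  rw [add_neg_cancel, h0] at h
  exact (neg_eq_of_add_eq_zero_right h.symm).symm

lemma bracketV_skew (v1 v2 : Sec V) : L.bracketV v1 v2 = - L.bracketV v2 v1 :=
  L.conn_t_skew v1 v2

lemma bracketV_smul (v1 : Sec V) (f : GlobalFun n M) (v2 : Sec V) :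
    L.bracketV v1 (smulSec f v2) = smulSec f (L.bracketV v1 v2) := by
  ext x : 2
  refine (L.conn_leibniz (L.t.onSec v1) f v2 x).trans ?_
  have : dirDeriv f x (L.anchor.map x (L.t.onSec v1 x)) = 0 :=
    (congrArg (dirDeriv f x) (L.anchor_t x (v1 x))).trans (map_zero _)
  rw [this, zero_smul, zero_add]
  rfl

lemma bracketV_jacobi (v1 v2 v3 : Sec V) : L.bracketV v1 (L.bracketV v2 v3) +
    L.bracketV v2 (L.bracketV v3 v1) + L.bracketV v3 (L.bracketV v1 v2) =
      L.H.onSec ![L.t.onSec v1, L.t.onSec v2, L.t.onSec v3] := by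
  rw [← L.curvature, ← L.t_conn (L.t.onSec v1) v2, L.bracketV_skew v3 (L.bracketV v1 v2),
    L.bracketV_skew v3 v1]
  have : L.bracketV v2 (-L.bracketV v1 v3) = - L.bracketV v2 (L.bracketV v1 v3) :=
    L.conn_neg_right _ _
  rw [this]
  simp only [bracketV]
  abel

lemma conn_bracketV (ψ : Sec E) (v1 v2 : Sec V) : L.conn ψ (L.bracketV v1 v2) =
    L.bracketV (L.conn ψ v1) v2 + L.bracketV v1 (L.conn ψ v2) +
      L.H.onSec ![ψ, L.t.onSec v1, L.t.onSec v2] := by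
  rw [← L.curvature, ← L.t_conn ψ v1]
  simp only [bracketV]
  abel

end LieTwoAlgebroid

end BracketV

section FibreMaps

variable {E : Type u} {V : Type u'} [AddCommGroup E] [Module ℝ E] [AddCommGroup V] [Module ℝ V]
  {E' : Type v} {V' : Type v'} [AddCommGroup E'] [Module ℝ E'] [AddCommGroup V'] [Module ℝ V']
  {E'' : Type w} {V'' : Type w'} [AddCommGroup E''] [Module ℝ E''] [AddCommGroup V'']
  [Module ℝ V'']

lemma gr_two_induction {Q : DualGrAlg E V → Prop} (zero : Q 0)
    (add : ∀ a b, Q a → Q b → Q (a + b)) (smul : ∀ (c : ℝ) a, Q a → Q (c • a))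
    (one : ∀ α α', Q (ιOne α * ιOne α')) (two : ∀ β, Q (ιTwo β)) {a : DualGrAlg E V}
    (ha : a ∈ grDeg _ _ 2) : Q a := by
  refine grDeg_induction (P := fun k a => k = 2 → Q a) (fun h => absurd h (by omega))
    (fun k a b h h' hk => add _ _ (h hk) (h' hk)) (fun k c a h hk => smul _ _ (h hk))
    (fun k _ => zero) (fun k w a ha _ hk => ?_) (fun k w a ha _ hk => ?_) ha rfl
  · obtain ⟨w', rfl⟩ := (exists_generators ha).2 (by omega)
    exact one _ _
  · obtain ⟨c, rfl⟩ := (exists_generators ha).1 (by omega)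
    rw [ιTwo_comm, ← Algebra.smul_def]
    exact smul _ _ (two _)

lemma gr_three_induction {Q : DualGrAlg E V → Prop} (zero : Q 0)
    (add : ∀ a b, Q a → Q b → Q (a + b)) (smul : ∀ (c : ℝ) a, Q a → Q (c • a))
    (mul : ∀ α, ∀ η ∈ grDeg _ _ 2, Q (ιOne α * η)) {a : DualGrAlg E V}
    (ha : a ∈ grDeg _ _ 3) : Q a := by
  refine grDeg_induction (P := fun k a => k = 3 → Q a) (fun h => absurd h (by omega))
    (fun k a b h h' hk => add _ _ (h hk) (h' hk)) (fun k c a h hk => smul _ _ (h hk))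
    (fun k _ => zero) (fun k w a ha _ hk => ?_) (fun k w a ha _ hk => ?_) ha rfl
  · obtain rfl : k = 2 := by omega
    exact mul _ _ ha
  · obtain ⟨w', rfl⟩ := (exists_generators ha).2 (by omega)
    rw [ιTwo_comm]
    exact mul _ _ (ιTwo_mem_grDeg _)

/-- The homomorphism of graded algebras `Θ` is given by `F`, `G` and the two-form `τ`. -/
structure IsFib (Θ : DualGrAlg E' V' →ₐ[ℝ] DualGrAlg E V) (F : E →ₗ[ℝ] E') (G : V →ₗ[ℝ] V')
    (τ : E → E → V') : Prop where
  on_one : ∀ α, Θ (ιOne α) = ιOne (α ∘ₗ F)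
  deg_two : ∀ β, Θ (ιTwo β) ∈ grDeg _ _ 2
  on_two_zero : ∀ β v, evalGr (Θ (ιTwo β)) [] v = β (G v)
  on_two : ∀ β e e' v, evalGr (Θ (ιTwo β)) [e, e'] v = β (τ e e')

namespace IsFib

variable {Θ : DualGrAlg E' V' →ₐ[ℝ] DualGrAlg E V} {F : E →ₗ[ℝ] E'} {G : V →ₗ[ℝ] V'}
  {τ : E → E → V'} {Θ' : DualGrAlg E'' V'' →ₐ[ℝ] DualGrAlg E' V'} {F' : E' →ₗ[ℝ] E''}
  {G' : V' →ₗ[ℝ] V''} {τ' : E' → E' → V''} (h : IsFib Θ F G τ) (h' : IsFib Θ' F' G' τ')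
include h

lemma map_mem {k : ℕ} {a : DualGrAlg E' V'} (ha : a ∈ grDeg _ _ k) : Θ a ∈ grDeg _ _ k :=
  map_mem_grDeg (fun α => by rw [h.on_one]; exact ιOne_mem_grDeg _) h.deg_two ha

variable {c : DualGrAlg E' V'}

lemma eval_two (hc : c ∈ grDeg _ _ 2) (e e' : E) (v : V) (v' : V') :
    evalGr (Θ c) [e, e'] v = evalGr c [F e, F e'] v' + evalGr c [] (τ e e') := by
  refine gr_two_induction (Q := fun c => evalGr (Θ c) [e, e'] v = evalGr c [F e, F e'] v' +
    evalGr c [] (τ e e')) ?_ (fun a b ha hb => ?_) (fun r a ha => ?_) (fun α α' => ?_)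
    (fun β => ?_) hc
  · rw [map_zero, evalGr_zero, evalGr_zero, evalGr_zero, add_zero]
  · rw [map_add, evalGr_add, evalGr_add, evalGr_add, ha, hb]; ring
  · rw [map_smul, evalGr_smul, evalGr_smul, evalGr_smul, ha]; ring
  · rw [map_mul, h.on_one, h.on_one, evalGr_two_mul, evalGr_two_mul, evalGr_two_mul_nil, add_zero]
    rfl
  · rw [h.on_two, evalGr_ιTwo_cons, evalGr_ιTwo_nil, zero_add]

lemma eval_two_nil (hc : c ∈ grDeg _ _ 2) (v : V) :
    evalGr (Θ c) [] v = evalGr c [] (G v) := by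
  refine gr_two_induction (Q := fun c => evalGr (Θ c) [] v = evalGr c [] (G v)) ?_
    (fun a b ha hb => ?_) (fun r a ha => ?_) (fun α α' => ?_) (fun β => ?_) hc
  · rw [map_zero, evalGr_zero, evalGr_zero]
  · rw [map_add, evalGr_add, evalGr_add, ha, hb]
  · rw [map_smul, evalGr_smul, evalGr_smul, ha]
  · rw [map_mul, h.on_one, h.on_one, evalGr_two_mul_nil, evalGr_two_mul_nil]
  · rw [h.on_two_zero, evalGr_ιTwo_nil]

lemma eval_three (hc : c ∈ grDeg _ _ 3) (e₁ e₂ e₃ : E) (v : V) (v' : V') :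
    evalGr (Θ c) [e₁, e₂, e₃] v = evalGr c [F e₁, F e₂, F e₃] v' + evalGr c [F e₁] (τ e₂ e₃) -
      evalGr c [F e₂] (τ e₁ e₃) + evalGr c [F e₃] (τ e₁ e₂) := by
  refine gr_three_induction (Q := fun c => evalGr (Θ c) [e₁, e₂, e₃] v =
    evalGr c [F e₁, F e₂, F e₃] v' + evalGr c [F e₁] (τ e₂ e₃) -
      evalGr c [F e₂] (τ e₁ e₃) + evalGr c [F e₃] (τ e₁ e₂)) ?_ (fun a b ha hb => ?_)
    (fun r a ha => ?_) (fun α η hη => ?_) hc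
  · simp only [map_zero, evalGr_zero]; ring
  · simp only [map_add, evalGr_add, ha, hb]; ring
  · simp only [map_smul, evalGr_smul, ha]; ring
  · rw [map_mul, h.on_one, evalGr_mul _ _ _ (ιOne_mem_grDeg _), evalGr_mul _ _ _ (ιOne_mem_grDeg _),
      evalGr_mul _ _ _ (ιOne_mem_grDeg _), evalGr_mul _ _ _ (ιOne_mem_grDeg _),
      evalGr_mul _ _ _ (ιOne_mem_grDeg _)]
    simp only [mulEv, evalGr_ιOne_nil, evalGr_ιOne_one, evalGr_ιOne_two,
      h.eval_two hη _ _ v v', LinearMap.comp_apply]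
    ring

lemma eval_three_one (hc : c ∈ grDeg _ _ 3) (e : E) (v : V) :
    evalGr (Θ c) [e] v = evalGr c [F e] (G v) := by
  refine gr_three_induction (Q := fun c => evalGr (Θ c) [e] v = evalGr c [F e] (G v)) ?_
    (fun a b ha hb => ?_) (fun r a ha => ?_) (fun α η hη => ?_) hc
  · rw [map_zero, evalGr_zero, evalGr_zero]
  · rw [map_add, evalGr_add, evalGr_add, ha, hb]
  · rw [map_smul, evalGr_smul, evalGr_smul, ha]
  · rw [map_mul, h.on_one, evalGr_mul _ _ _ (ιOne_mem_grDeg _), evalGr_mul _ _ _ (ιOne_mem_grDeg _)]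
    simp only [mulEv, evalGr_ιOne_nil, evalGr_ιOne_one, h.eval_two_nil hη, LinearMap.comp_apply]
    ring

include h' in
lemma comp : IsFib (Θ.comp Θ') (F' ∘ₗ F) (G' ∘ₗ G)
    (fun e e' => τ' (F e) (F e') + G' (τ e e')) where
  on_one α := by
    rw [AlgHom.comp_apply, h'.on_one, h.on_one]; rfl
  deg_two β := h.map_mem (h'.deg_two β)
  on_two_zero β v := by
    rw [AlgHom.comp_apply, h.eval_two_nil (h'.deg_two β), h'.on_two_zero]; rfl
  on_two β e e' v := by
    rw [AlgHom.comp_apply, h.eval_two (h'.deg_two β) e e' v 0, h'.on_two, h'.on_two_zero, map_add]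

lemma ext [Module.Finite ℝ E] [Module.Finite ℝ V] {Θ₁ : DualGrAlg E' V' →ₐ[ℝ] DualGrAlg E V}
    (h₁ : IsFib Θ₁ F G τ) : Θ = Θ₁ :=
  grAlg_hom_ext (fun α => by rw [h.on_one, h₁.on_one]) fun β =>
    ext_two (h.deg_two β) (h₁.deg_two β) (fun e e' => by rw [h.on_two, h₁.on_two])
      fun v => by rw [h.on_two_zero, h₁.on_two_zero]

lemma unique [Module.Finite ℝ E'] [Module.Finite ℝ V'] {F₁ : E →ₗ[ℝ] E'} {G₁ : V →ₗ[ℝ] V'}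
    {τ₁ : E → E → V'} (h₁ : IsFib Θ F₁ G₁ τ₁) : F = F₁ ∧ G = G₁ ∧ τ = τ₁ := by
  refine ⟨LinearMap.ext fun e => (Module.forall_dual_apply_eq_zero_iff ℝ _).1 ?_ |> sub_eq_zero.1,
    LinearMap.ext fun v => (Module.forall_dual_apply_eq_zero_iff ℝ _).1 ?_ |> sub_eq_zero.1,
    funext fun e => funext fun e' => (Module.forall_dual_apply_eq_zero_iff ℝ _).1 ?_ |>
      sub_eq_zero.1⟩
  · intro α
    have := congrArg (fun a => evalGr a [e] 0) ((h.on_one α).symm.trans (h₁.on_one α))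
    simp only [evalGr_ιOne_one, LinearMap.comp_apply] at this
    rw [map_sub, this, sub_self]
  · intro β
    rw [map_sub, ← h.on_two_zero, h₁.on_two_zero, sub_self]
  · intro β
    rw [map_sub, ← h.on_two β e e' 0, h₁.on_two, sub_self]

end IsFib

lemma isFib_id : IsFib (AlgHom.id ℝ (DualGrAlg E V)) LinearMap.id LinearMap.id
    (fun _ _ => 0) where
  on_one _ := rfl
  deg_two β := ιTwo_mem_grDeg β
  on_two_zero _ _ := evalGr_ιTwo_nil _ _
  on_two β _ _ _ := (evalGr_ιTwo_cons _ _ _ _).trans (map_zero β).symm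

variable [Module.Finite ℝ E] [Module.Finite ℝ V] [Module.Finite ℝ E'] [Module.Finite ℝ V']

omit [Module.Finite ℝ E'] [Module.Finite ℝ V'] in
lemma exists_isFib (F : E →ₗ[ℝ] E') (G : V →ₗ[ℝ] V') {τ : E → E → V'} (hτ : Alt2 τ) :
    ∃ Θ, IsFib Θ F G τ := by
  let b := Module.finBasis ℝ E
  let d := Module.finBasis ℝ V
  have he : ∀ v, ∑ i, b.coord i v • b i = v := fun v => b.sum_repr v
  have hd : ∀ v, ∑ i, d.coord i v • d i = v := fun v => d.sum_repr v
  have hβ : ∀ β : Dual ℝ V', Alt2 fun e e' => β (τ e e') := fun β =>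
    ⟨fun a a' b => by rw [hτ.add, map_add], fun c a b => by rw [hτ.smul, map_smul],
      fun a b => by rw [hτ.swap, map_neg]⟩
  let N : Dual ℝ V' → DualGrAlg E V := fun β =>
    twoElem b (fun i => b.coord i) d (fun i => d.coord i) (fun e e' => β (τ e e')) (fun v => β (G v))
  have hN : ∀ β, N β ∈ grDeg _ _ 2 := fun β => twoElem_mem _ _ _ _ _ _
  have h2 : ∀ β e e' v, evalGr (N β) [e, e'] v = β (τ e e') := fun β e e' v =>
    evalGr_twoElem he (hβ β) _ e e' v
  have h0 : ∀ β v, evalGr (N β) [] v = β (G v) := fun β v =>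
    evalGr_twoElem_nil hd _ (fun a b => by rw [map_add, map_add])
      (fun c a => by rw [map_smul, map_smul]) v
  let g : Dual ℝ V' →ₗ[ℝ] DualGrAlg E V :=
    { toFun := N
      map_add' := fun β β' => ext_two (hN _) (Submodule.add_mem _ (hN _) (hN _))
        (fun e e' => by rw [evalGr_add, h2, h2, h2]; rfl)
        fun v => by rw [evalGr_add, h0, h0, h0]; rfl
      map_smul' := fun c β => ext_two (hN _) (Submodule.smul_mem _ _ (hN _))
        (fun e e' => by rw [evalGr_smul, h2, h2]; rfl)
        fun v => by rw [evalGr_smul, h0, h0]; rfl }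
  refine ⟨grGen F.dualMap g hN, fun α => ?_, fun β => ?_, fun β v => ?_, fun β e e' v => ?_⟩
  · rw [grGen_ιOne]; rfl
  · rw [grGen_ιTwo]; exact hN β
  · rw [grGen_ιTwo]; exact h0 β v
  · rw [grGen_ιTwo]; exact h2 β e e' v

lemma IsFib.exists_inverse {Θ : DualGrAlg E' V' →ₐ[ℝ] DualGrAlg E V} {F : E ≃ₗ[ℝ] E'}
    {G : V ≃ₗ[ℝ] V'} {τ : E → E → V'} (h : IsFib Θ F.toLinearMap G.toLinearMap τ) (hτ : Alt2 τ) :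
    ∃ Θ', IsFib Θ' F.symm.toLinearMap G.symm.toLinearMap
      (fun e e' => - G.symm (τ (F.symm e) (F.symm e'))) ∧
      Θ'.comp Θ = AlgHom.id ℝ _ ∧ Θ.comp Θ' = AlgHom.id ℝ _ := by
  obtain ⟨Θ', h'⟩ := exists_isFib F.symm.toLinearMap G.symm.toLinearMap
    (τ := fun e e' => - G.symm (τ (F.symm e) (F.symm e')))
    ⟨fun a a' b => by rw [map_add, hτ.add, map_add, neg_add],
      fun c a b => by rw [map_smul, hτ.smul, map_smul, smul_neg],
      fun a b => by rw [hτ.swap, map_neg]⟩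
  refine ⟨Θ', h', ?_, ?_⟩
  · have h1 := h'.comp h
    refine h1.ext ?_
    convert isFib_id (E := E') (V := V') using 1
    · ext e; exact F.apply_symm_apply e
    · ext v; exact G.apply_symm_apply v
    · funext e e'
      simp
  · have h1 := h.comp h'
    refine h1.ext ?_
    convert isFib_id (E := E) (V := V) using 1
    · ext e; exact F.symm_apply_apply e
    · ext v; exact G.symm_apply_apply v
    · funext e e'
      simp

lemma exists_eq_dual {ι : Type*} (c : ι → Dual ℝ E → ℝ)
    (hadd : ∀ i α β, c i (α + β) = c i α + c i β) (hsmul : ∀ i (r : ℝ) α, c i (r • α) = r * c i α) :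
    ∃ f : ι → E, ∀ i α, c i α = α (f i) := by
  refine ⟨fun i => (Module.evalEquiv ℝ E).symm ⟨⟨c i, hadd i⟩, hsmul i⟩, fun i α => ?_⟩
  rw [← Dual.eval_apply, ← Module.evalEquiv_toLinearMap]
  change _ = (Module.evalEquiv ℝ E) ((Module.evalEquiv ℝ E).symm _) α
  rw [LinearEquiv.apply_symm_apply]
  rfl

lemma dual_eq {e e' : E} (h : ∀ α : Dual ℝ E, α e = α e') : e = e' :=
  sub_eq_zero.1 ((Module.forall_dual_apply_eq_zero_iff ℝ _).1 fun α => by rw [map_sub, h, sub_self])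

lemma exists_isFib_of_graded (Θ : DualGrAlg E' V' →ₐ[ℝ] DualGrAlg E V)
    (h1 : ∀ α, Θ (ιOne α) ∈ grDeg _ _ 1) (h2 : ∀ β, Θ (ιTwo β) ∈ grDeg _ _ 2) :
    ∃ F G τ, Alt2 τ ∧ IsFib Θ F G τ := by
  obtain ⟨F, hF⟩ := exists_eq_dual (fun (e : E) α => evalGr (Θ (ιOne α)) [e] 0)
    (fun e α β => by rw [ιOne_add, map_add, evalGr_add])
    (fun e r α => by rw [ιOne_smul, map_smul, evalGr_smul])
  obtain ⟨G, hG⟩ := exists_eq_dual (fun (v : V) β => evalGr (Θ (ιTwo β)) [] v)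
    (fun e α β => by rw [ιTwo_add, map_add, evalGr_add])
    (fun e r α => by rw [ιTwo_smul, map_smul, evalGr_smul])
  obtain ⟨τ, hτ⟩ := exists_eq_dual (fun (p : E × E) β => evalGr (Θ (ιTwo β)) [p.1, p.2] 0)
    (fun e α β => by rw [ιTwo_add, map_add, evalGr_add])
    (fun e r α => by rw [ιTwo_smul, map_smul, evalGr_smul])
  have hA := fun β => alt2_evalGr (Θ (ιTwo β)) 0
  have hτ' : Alt2 fun e e' => τ (e, e') :=
    ⟨fun a a' b => dual_eq fun α => by
      rw [map_add]
      exact (hτ (a + a', b) α).symm.trans (((hA α).add a a' b).trans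
        (congrArg₂ (· + ·) (hτ (a, b) α) (hτ (a', b) α))),
    fun r a b => dual_eq fun α => by
      rw [map_smul]
      exact (hτ (r • a, b) α).symm.trans (((hA α).smul r a b).trans
        (congrArg (r • ·) (hτ (a, b) α))),
    fun a b => dual_eq fun α => by
      rw [map_neg]
      exact (hτ (a, b) α).symm.trans (((hA α).swap a b).trans (congrArg Neg.neg (hτ (b, a) α)))⟩
  let F' : E →ₗ[ℝ] E' :=
    { toFun := F
      map_add' := fun e e' => dual_eq fun α => by
        rw [map_add, ← hF, ← hF, ← hF, evalGr_cons_add]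
      map_smul' := fun r e => dual_eq fun α => by
        rw [RingHom.id_apply, map_smul, ← hF, ← hF, evalGr_cons_smul]; rfl }
  let G' : V →ₗ[ℝ] V' :=
    { toFun := G
      map_add' := fun e e' => dual_eq fun α => by
        obtain ⟨f, hf⟩ := evalGr_linear (h2 α) [] rfl
        rw [map_add, ← hG, ← hG, ← hG, hf, hf, hf, map_add]
      map_smul' := fun r e => dual_eq fun α => by
        obtain ⟨f, hf⟩ := evalGr_linear (h2 α) [] rfl
        rw [RingHom.id_apply, map_smul, ← hG, ← hG, hf, hf, map_smul] }
  refine ⟨F', G', _, hτ', fun α => ?_, h2, fun β v => hG v β, fun β e e' v =>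
    (evalGr_const (h2 β) [e, e'] rfl v 0).trans (hτ (e, e') β)⟩
  have hF' : ∀ e, (α ∘ₗ F') e = α (F e) := fun _ => rfl
  exact ext_one (h1 α) (ιOne_mem_grDeg _) fun e => by rw [hF, evalGr_ιOne_one, hF']

lemma exists_isFib_of_equiv (Θ : DualGrAlg E' V' →ₐ[ℝ] DualGrAlg E V)
    (Θ' : DualGrAlg E V →ₐ[ℝ] DualGrAlg E' V')
    (h1 : ∀ α, Θ (ιOne α) ∈ grDeg _ _ 1) (h2 : ∀ β, Θ (ιTwo β) ∈ grDeg _ _ 2)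
    (h1' : ∀ α, Θ' (ιOne α) ∈ grDeg _ _ 1) (h2' : ∀ β, Θ' (ιTwo β) ∈ grDeg _ _ 2)
    (hΘ : Θ'.comp Θ = AlgHom.id ℝ _) (hΘ' : Θ.comp Θ' = AlgHom.id ℝ _) :
    ∃ (F : E ≃ₗ[ℝ] E') (G : V ≃ₗ[ℝ] V') (τ : _), Alt2 τ ∧
      IsFib Θ F.toLinearMap G.toLinearMap τ := by
  obtain ⟨F, G, τ, hτ, h⟩ := exists_isFib_of_graded Θ h1 h2
  obtain ⟨F', G', τ', hτ', h'⟩ := exists_isFib_of_graded Θ' h1' h2'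
  have e1 := (hΘ ▸ h'.comp h).unique isFib_id
  have e2 := (hΘ' ▸ h.comp h').unique isFib_id
  exact ⟨LinearEquiv.ofLinearMap F F' e1.1 e2.1, LinearEquiv.ofLinearMap G G' e1.2.1 e2.2.1, τ, hτ, h⟩

end FibreMaps

lemma exists_fib {E0 : Type v} {V0 : Type v'} [AddCommGroup E0] [Module ℝ E0] [AddCommGroup V0]
    [Module ℝ V0] {x : M} (h : 𝒪[E,V].A ⊤ →ₐ[ℝ] DualGrAlg E0 V0)
    (h0 : ∀ f, h (ofFun E V f) = algebraMap ℝ _ (f x))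
    (h1 : ∀ α, h (ofDualE E V α) ∈ grDeg _ _ 1) (h2 : ∀ β, h (ofDualV E V β) ∈ grDeg _ _ 2) :
    ∃ Θ : FibAlg E V x →ₐ[ℝ] DualGrAlg E0 V0, (∀ α, Θ (ιOne α) ∈ grDeg _ _ 1) ∧
      (∀ β, Θ (ιTwo β) ∈ grDeg _ _ 2) ∧ ∀ a, h a = Θ (splitVal a x) := by
  have hsm : ∀ f a, h (ofFun E V f * a) = f x • h a := fun f a => by
    rw [map_mul, h0, ← Algebra.smul_def]
  obtain ⟨C₁, hC₁⟩ := exists_linear_of_tensorial x (fun α => h (ofDualE E V α))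
    (fun α β => by rw [ofDualE_add, map_add]) (fun f α => by rw [ofDualE_smul, hsm])
  obtain ⟨C₂, hC₂⟩ := exists_linear_of_tensorial x (fun β => h (ofDualV E V β))
    (fun α β => by rw [ofDualV_add, map_add]) (fun f α => by rw [ofDualV_smul, hsm])
  have d1 : ∀ α, C₁ α ∈ grDeg _ _ 1 := fun α => by
    obtain ⟨α, rfl⟩ := exists_dual_at x α
    rw [hC₁]; exact h1 α
  have d2 : ∀ β, C₂ β ∈ grDeg _ _ 2 := fun β => by
    obtain ⟨β, rfl⟩ := exists_dual_at x β
    rw [hC₂]; exact h2 β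
  let Θ := grLift C₁ (fun α => by
    obtain ⟨w, hw⟩ := (exists_generators (d1 α)).2 rfl
    rw [hw, ιOne_mul_self]) C₂ (fun β c => grDeg_two_comm (d2 β) c)
  have e1 : ∀ α, Θ (ιOne α) = C₁ α := grLift_ιOne _ _ _ _
  have e2 : ∀ α, Θ (ιTwo α) = C₂ α := grLift_ιTwo _ _ _ _
  refine ⟨Θ, fun α => e1 α ▸ d1 α, fun α => e2 α ▸ d2 α, fun a => ?_⟩
  obtain ⟨b, hb, hab⟩ := exists_global a ⟨x, trivial⟩
  have hab' : ∀ᶠ y in 𝓝 x, splitVal a y = splitVal b y := hab.mono fun y hy => hy trivial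
  obtain ⟨χ, hχ, hloc⟩ := exists_cutoff hab'
  have h3 := hsm χ a
  rw [hloc, hsm, hχ, one_smul, one_smul] at h3
  rw [← h3, hab'.self_of_nhds]
  clear h3 hloc hχ hab' hab
  refine adjoin_global_induction (P := fun b => h b = Θ (splitVal b x)) ?_ (fun a b ha hb => ?_)
    (fun c a ha => ?_) (fun f a ha => ?_) (fun α a ha => ?_) (fun β a ha => ?_) hb
  · rw [map_one, splitVal_one, map_one]
  · rw [map_add, splitVal_add, map_add, ha, hb]
  · rw [map_smul, splitVal_smul, map_smul, ha]
  · rw [hsm, ofFun_smul_val, map_smul, ha]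
  · rw [map_mul, splitVal_mul, map_mul, ha, splitVal_ofDualE, e1, hC₁]
  · rw [map_mul, splitVal_mul, map_mul, ha, splitVal_ofDualV, e2, hC₂]

lemma fib_hom_ext {A : Type*} [Ring A] [Algebra ℝ A] {x : M} {Θ Θ' : FibAlg E V x →ₐ[ℝ] A}
    (h : ∀ a : 𝒪[E,V].A ⊤, Θ (splitVal a x) = Θ' (splitVal a x)) : Θ = Θ' :=
  grAlg_hom_ext (fun α => by
    obtain ⟨α, rfl⟩ := exists_dual_at _ α
    rw [← splitVal_ofDualE (V := V), h]) (fun β => by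
    obtain ⟨β, rfl⟩ := exists_dual_at _ β
    rw [← splitVal_ofDualV (E := E), h])

lemma exists_push (φ : M ≃ₘ⟮𝓡 n, 𝓡 n'⟯ M') {P : M' → Type*} (f : ∀ x, P (φ x)) :
    ∃ g : ∀ y, P y, ∀ x, g (φ x) = f x := by
  have h : ∀ y, ∃ p : P y, ∀ x (h : φ x = y), h ▸ f x = p := by
    intro y
    obtain ⟨x, rfl⟩ := φ.surjective y
    refine ⟨f x, fun x' h => ?_⟩
    obtain rfl := φ.injective h
    rfl
  choose g hg using h
  exact ⟨g, fun x => (hg _ x rfl).symm⟩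

lemma contMDiffAt_push (φ : M ≃ₘ⟮𝓡 n, 𝓡 n'⟯ M') {f : M' → ℝ} {x : M}
    (h : ContMDiffAt (𝓡 n) 𝓘(ℝ, ℝ) ∞ (fun x => f (φ x)) x) :
    ContMDiffAt (𝓡 n') 𝓘(ℝ, ℝ) ∞ f (φ x) := by
  have h1 : ContMDiffAt (𝓡 n) 𝓘(ℝ, ℝ) ∞ (fun x => f (φ x)) (φ.symm (φ x)) := by
    rwa [φ.symm_apply_apply]
  have h2 := h1.comp (φ x) (φ.symm.contMDiff (φ x))
  refine h2.congr_of_eventuallyEq (Eventually.of_forall fun y => ?_)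
  exact congrArg f (φ.apply_symm_apply y).symm

lemma contMDiff_push (φ : M ≃ₘ⟮𝓡 n, 𝓡 n'⟯ M') {f : M' → ℝ}
    (h : ContMDiff (𝓡 n) 𝓘(ℝ, ℝ) ∞ fun x => f (φ x)) : ContMDiff (𝓡 n') 𝓘(ℝ, ℝ) ∞ f := by
  intro y
  obtain ⟨x, rfl⟩ := φ.surjective y
  exact contMDiffAt_push φ (h x)

lemma exists_push_sec (φ : M ≃ₘ⟮𝓡 n, 𝓡 n'⟯ M') (f : ∀ x, E'.fiber (φ x))
    (h : ∀ α : DualSec E', ContMDiff (𝓡 n) 𝓘(ℝ, ℝ) ∞ fun x => α.form (φ x) (f x)) :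
    ∃ ψ : Sec E', ∀ x, ψ (φ x) = f x := by
  obtain ⟨g, hg⟩ := exists_push φ f
  refine ⟨Sec.ofDual g fun α => contMDiff_push φ ?_, hg⟩
  simpa only [hg] using h α

/-- The pullback of a function by a diffeomorphism. -/
def pullFun (φ : M ≃ₘ⟮𝓡 n, 𝓡 n'⟯ M') (f : GlobalFun n' M') : GlobalFun n M :=
  mkFun (fun x => f (φ x)) (f.contMDiff.comp φ.contMDiff)

@[simp] theorem pullFun_apply (φ : M ≃ₘ⟮𝓡 n, 𝓡 n'⟯ M') (f : GlobalFun n' M') (x : M) :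
    pullFun φ f x = f (φ x) := rfl

variable (E V E' V') in
/-- An isomorphism `E[1] ⊕ V[2] → E'[1] ⊕ V'[2]` covering a diffeomorphism, given by the pullback
of functions. -/
structure GIso (φ : M ≃ₘ⟮𝓡 n, 𝓡 n'⟯ M') where
  pull : ∀ U : Opens M', 𝒪[E',V'].A U ≃ₐ[ℝ] 𝒪[E,V].A (preim φ U)
  natural : ∀ (U W : Opens M') (h : W ≤ U) (a : 𝒪[E',V'].A U),
    𝒪[E,V].res (preim_mono φ h) (pull U a) = pull W (𝒪[E',V'].res h a)
  map_deg : ∀ U k (a : 𝒪[E',V'].A U),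
    a ∈ 𝒪[E',V'].deg U k ↔ pull U a ∈ 𝒪[E,V].deg (preim φ U) k
  map_base : ∀ (U : Opens M') (f' : SmoothFun n' U) (f : SmoothFun n (preim φ U)),
    (∀ x : preim φ U, f x = f' ⟨φ x.1, x.2⟩) →
      pull U (𝒪[E',V'].base U f') = 𝒪[E,V].base (preim φ U) f

namespace GIso

variable (Φ : GIso E V E' V' φ)

/-- The pullback of global functions. -/
def glob : 𝒪[E',V'].A ⊤ ≃ₐ[ℝ] 𝒪[E,V].A ⊤ := Φ.pull ⊤

lemma glob_mem {k : ℕ} {a : 𝒪[E',V'].A ⊤} :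
    a ∈ 𝒪[E',V'].deg ⊤ k ↔ Φ.glob a ∈ 𝒪[E,V].deg ⊤ k := Φ.map_deg ⊤ k a

lemma glob_ofFun (f : GlobalFun n' M') : Φ.glob (ofFun E' V' f) = ofFun E V (pullFun φ f) :=
  Φ.map_base ⊤ (resGlobal f ⊤) (resGlobal (pullFun φ f) ⊤) fun _ => rfl

/-- The isomorphism is given on the fibres by the linear maps `F`, `G` and the two-forms `τ`. -/
def HasFib (F : ∀ x, E.fiber x →ₗ[ℝ] E'.fiber (φ x)) (G : ∀ x, V.fiber x →ₗ[ℝ] V'.fiber (φ x))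
    (τ : ∀ x, E.fiber x → E.fiber x → V'.fiber (φ x)) : Prop :=
  ∀ x, ∃ Θ, IsFib Θ (F x) (G x) (τ x) ∧ ∀ (U : Opens M') (a : 𝒪[E',V'].A U) (h : φ x ∈ U),
    valHom (⟨x, h⟩ : preim φ U) (Φ.pull U a) = Θ (valHom ⟨φ x, h⟩ a)

lemma valHom_eq_of_glob {x : M} {Θ : FibAlg E' V' (φ x) →ₐ[ℝ] FibAlg E V x}
    (h : ∀ a, splitVal (Φ.glob a) x = Θ (splitVal a (φ x))) (U : Opens M')
    (a : 𝒪[E',V'].A U) (hU : φ x ∈ U) :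
    valHom (⟨x, hU⟩ : preim φ U) (Φ.pull U a) = Θ (valHom ⟨φ x, hU⟩ a) := by
  obtain ⟨W, hW, hWo, hx⟩ := eventually_nhds_iff.1
    ((germ_eq a ⟨φ x, hU⟩).and (U.isOpen.mem_nhds hU))
  let W' : Opens M' := ⟨W, hWo⟩
  have hWU : W' ≤ U := fun y hy => (hW y hy).2
  have e : 𝒪[E',V'].res hWU a =
      𝒪[E',V'].res le_top (germ a ⟨φ x, hU⟩) :=
    split_ext fun y => (hW y.1 y.2).1 _
  have e' := congrArg (valHom (⟨x, hx⟩ : preim φ W')) (congrArg (Φ.pull W') e)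
  rw [← Φ.natural, ← Φ.natural] at e'
  refine e'.trans ((h _).trans (congrArg Θ ((hW _ hx).1 hU).symm))

lemma exists_hasFib : ∃ (F : ∀ x, E.fiber x ≃ₗ[ℝ] E'.fiber (φ x))
    (G : ∀ x, V.fiber x ≃ₗ[ℝ] V'.fiber (φ x)) (τ : ∀ x, E.fiber x → E.fiber x → V'.fiber (φ x)),
    (∀ x, Alt2 (τ x)) ∧ Φ.HasFib (fun x => (F x).toLinearMap) (fun x => (G x).toLinearMap) τ := by
  have key : ∀ x, ∃ (F : E.fiber x ≃ₗ[ℝ] E'.fiber (φ x)) (G : V.fiber x ≃ₗ[ℝ] V'.fiber (φ x))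
      (τ : E.fiber x → E.fiber x → V'.fiber (φ x)), Alt2 τ ∧ ∃ Θ,
      IsFib Θ F.toLinearMap G.toLinearMap τ ∧ ∀ a, splitVal (Φ.glob a) x = Θ (splitVal a (φ x)) := by
    intro x
    obtain ⟨Θ, h1, h2, hΘ⟩ := exists_fib (x := φ x)
      ((valHom (⟨x, trivial⟩ : (⊤ : Opens M))).comp Φ.glob.toAlgHom)
      (fun f => congrArg (fun a => splitVal a x) (Φ.glob_ofFun f))
      (fun α => Φ.glob_mem.1 (ofDualE_mem α) ⟨x, trivial⟩)
      (fun α => Φ.glob_mem.1 (ofDualV_mem α) ⟨x, trivial⟩)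
    have mem : ∀ {k : ℕ} {a : 𝒪[E,V].A ⊤}, a ∈ 𝒪[E,V].deg ⊤ k →
        Φ.glob.symm a ∈ 𝒪[E',V'].deg ⊤ k := fun h => Φ.glob_mem.2 <| by
      rwa [AlgEquiv.apply_symm_apply]
    obtain ⟨Θ', h1', h2', hΘ'⟩ := exists_fib (x := x)
      ((valHom (⟨φ x, trivial⟩ : (⊤ : Opens M'))).comp Φ.glob.symm.toAlgHom)
      (fun f => by
        obtain ⟨g, rfl⟩ : ∃ g, f = pullFun φ g := ⟨pullFun φ.symm f, by
          ext y; exact congrArg f (φ.symm_apply_apply y).symm⟩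
        have e : Φ.glob.symm (ofFun E V (pullFun φ g)) = ofFun E' V' g := by
          rw [← Φ.glob_ofFun, AlgEquiv.symm_apply_apply]
        change splitVal (Φ.glob.symm (ofFun E V (pullFun φ g))) (φ x) = _
        rw [e, splitVal_ofFun, pullFun_apply])
      (fun α => mem (ofDualE_mem α) ⟨φ x, trivial⟩)
      (fun α => mem (ofDualV_mem α) ⟨φ x, trivial⟩)
    have l1 : ∀ a, splitVal (Φ.glob a) x = Θ (splitVal a (φ x)) := hΘ
    have l2 : ∀ a, splitVal (Φ.glob.symm a) (φ x) = Θ' (splitVal a x) := hΘ'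
    have c1 : ∀ a, Θ' (Θ (splitVal a (φ x))) = splitVal a (φ x) := fun a => by
      rw [← l1, ← l2, AlgEquiv.symm_apply_apply]
    have c2 : ∀ a, Θ (Θ' (splitVal a x)) = splitVal a x := fun a => by
      rw [← l2, ← l1, AlgEquiv.apply_symm_apply]
    obtain ⟨F, G, τ, hτ, h⟩ := exists_isFib_of_equiv Θ Θ' h1 h2 h1' h2'
      (fib_hom_ext c1) (fib_hom_ext c2)
    exact ⟨F, G, τ, hτ, Θ, h, l1⟩
  choose F G τ hτ Θ h hΘ using key
  exact ⟨F, G, τ, hτ, fun x => ⟨Θ x, h x, Φ.valHom_eq_of_glob (hΘ x)⟩⟩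

section Values

variable {Φ} {F : ∀ x, E.fiber x →ₗ[ℝ] E'.fiber (φ x)} {G : ∀ x, V.fiber x →ₗ[ℝ] V'.fiber (φ x)}
    {τ : ∀ x, E.fiber x → E.fiber x → V'.fiber (φ x)} (h : Φ.HasFib F G τ) {x : M}
include h

lemma HasFib.glob_dualE (α : DualSec E') :
    splitVal (Φ.glob (ofDualE E' V' α)) x = ιOne (α.form (φ x) ∘ₗ F x) := by
  obtain ⟨Θ, hΘ, e⟩ := h x
  exact (e ⊤ _ trivial).trans (hΘ.on_one _)

lemma HasFib.glob_dualV_nil (β : DualSec V') (v : V.fiber x) :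
    evalGr (splitVal (Φ.glob (ofDualV E' V' β)) x) [] v = β.form (φ x) (G x v) := by
  obtain ⟨Θ, hΘ, e⟩ := h x
  exact (congrArg (fun a => evalGr a [] v) (e ⊤ _ trivial)).trans (hΘ.on_two_zero _ _)

lemma HasFib.glob_dualV_two (β : DualSec V') (e e' : E.fiber x) (v : V.fiber x) :
    evalGr (splitVal (Φ.glob (ofDualV E' V' β)) x) [e, e'] v = β.form (φ x) (τ x e e') := by
  obtain ⟨Θ, hΘ, e⟩ := h x
  exact (congrArg (fun a => evalGr a _ v) (e ⊤ _ trivial)).trans (hΘ.on_two _ _ _ _)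

lemma HasFib.pull_eq {Ψ : GIso E V E' V' φ} (h' : Ψ.HasFib F G τ) (U : Opens M')
    (a : 𝒪[E',V'].A U) : Φ.pull U a = Ψ.pull U a := by
  refine split_ext fun x => ?_
  obtain ⟨Θ, hΘ, e⟩ := h x.1
  obtain ⟨Θ', hΘ', e'⟩ := h' x.1
  exact (e U a x.2).trans ((congrArg (fun T => T (valHom ⟨φ x.1, x.2⟩ a)) (hΘ.ext hΘ')).trans
    (e' U a x.2).symm)

end Values

variable {F : ∀ x, E.fiber x ≃ₗ[ℝ] E'.fiber (φ x)} {G : ∀ x, V.fiber x ≃ₗ[ℝ] V'.fiber (φ x)}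
    {τ : ∀ x, E.fiber x → E.fiber x → V'.fiber (φ x)} {Φ}
    (h : Φ.HasFib (fun x => (F x).toLinearMap) (fun x => (G x).toLinearMap) τ)
include h

lemma HasFib.F_smooth (ψ : Sec E) : ∃ ψ' : Sec E', Related φ F ψ ψ' := by
  refine exists_push_sec φ (fun x => F x (ψ x)) fun α => ?_
  refine (evalSec (Φ.glob (ofDualE E' V' α)) [ψ] 0).contMDiff.congr fun x => ?_
  have e := congrArg (fun a => evalGr a [ψ x] 0) (h.glob_dualE α (x := x))
  exact (e.trans (evalGr_ιOne_one _ _ _)).symm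

lemma HasFib.G_smooth (v : Sec V) : ∃ v' : Sec V', Related φ G v v' := by
  refine exists_push_sec φ (fun x => G x (v x)) fun α => ?_
  refine (evalSec (Φ.glob (ofDualV E' V' α)) [] v).contMDiff.congr fun x => ?_
  rw [evalSec_apply]
  exact (h.glob_dualV_nil _ _).symm

lemma HasFib.exists_form (hτ : ∀ x, Alt2 (τ x)) :
    ∃ B : EForm 2 E V, ∀ x e e', τ x e e' = G x (B.form x ![e, e']) := by
  have hA : ∀ x, Alt2 fun e e' => (G x).symm (τ x e e') := fun x =>
    ⟨fun a a' b => by rw [(hτ x).add, map_add], fun c a b => by rw [(hτ x).smul, map_smul],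
      fun a b => by rw [(hτ x).swap, map_neg]⟩
  refine ⟨⟨fun x => (hA x).map, fun ψ x => sec_contMDiffAt fun β => ?_⟩, fun x e e' =>
    ((G x).apply_symm_apply _).symm⟩
  have hd : Φ.glob.symm (ofDualV E V β) ∈ 𝒪[E',V'].deg ⊤ 2 := Φ.glob_mem.2 <| by
    rw [AlgEquiv.apply_symm_apply]; exact ofDualV_mem β
  have hlin : ∀ y, ∃ f : Dual ℝ (V'.fiber y), ∀ v,
      evalGr (splitVal (Φ.glob.symm (ofDualV E V β)) y) [] v = f v := fun y =>
    evalGr_linear (hd ⟨y, trivial⟩) [] rfl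
  choose f hf using hlin
  let β' : DualSec V' := ⟨f, fun v =>
    (evalSec (Φ.glob.symm (ofDualV E V β)) [] v).contMDiff.congr fun y => (hf y (v y)).symm⟩
  have hβ' : ∀ y v, f (φ y) (G y v) = β.form y v := fun y v => by
    obtain ⟨Θ, hΘ, e⟩ := h y
    have e1 := e ⊤ (Φ.glob.symm (ofDualV E V β)) trivial
    have e2 : splitVal (Φ.glob (Φ.glob.symm (ofDualV E V β))) y =
        Θ (splitVal (Φ.glob.symm (ofDualV E V β)) (φ y)) := e1
    rw [AlgEquiv.apply_symm_apply, splitVal_ofDualV] at e2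
    have e3 := hΘ.eval_two_nil (hd ⟨φ y, trivial⟩) v
    rw [← hf]
    refine (e3.symm.trans (congrArg (fun a => evalGr a [] v) e2.symm)).trans (evalGr_ιTwo_nil _ _)
  refine (evalSec (Φ.glob (ofDualV E' V' β')) [ψ 0, ψ 1] 0).contMDiff.contMDiffAt.congr_of_eventuallyEq
    (Eventually.of_forall fun y => ?_)
  refine Eq.trans ?_ (h.glob_dualV_two β' (ψ 0 y) (ψ 1 y) 0).symm
  change β.form y ((G y).symm (τ y (ψ 0 y) (ψ 1 y))) = f (φ y) (τ y (ψ 0 y) (ψ 1 y))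
  rw [← hβ', LinearEquiv.apply_symm_apply]

end GIso

section GradedIsoOfMaps

lemma Alt2.comp_linear {E0 : Type u} {W W' : Type*} [AddCommGroup E0] [Module ℝ E0]
    [AddCommGroup W] [Module ℝ W] [AddCommGroup W'] [Module ℝ W'] {τ : E0 → E0 → W} (h : Alt2 τ)
    (L : W →ₗ[ℝ] W') : Alt2 fun a b => L (τ a b) :=
  ⟨fun a a' b => by rw [h.add, map_add], fun c a b => by rw [h.smul, map_smul],
    fun a b => by rw [h.swap, map_neg]⟩

section Related

variable {F : ∀ x, E.fiber x ≃ₗ[ℝ] E'.fiber (φ x)}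
  (hF : ∀ ψ : Sec E, ∃ ψ' : Sec E', Related φ F ψ ψ')
include hF

lemma exists_dual_pull (α : DualSec E') :
    ∃ α' : DualSec E, ∀ x, α'.form x = α.form (φ x) ∘ₗ (F x).toLinearMap := by
  refine ⟨⟨fun x => α.form (φ x) ∘ₗ (F x).toLinearMap, fun ψ => ?_⟩, fun _ => rfl⟩
  obtain ⟨ψ', h⟩ := hF ψ
  refine (pullFun φ (pair α ψ')).contMDiff.congr fun x => ?_
  exact congrArg (α.form (φ x)) (h x).symm

lemma exists_dual_push (α : DualSec E) :
    ∃ α' : DualSec E', ∀ x, α.form x = α'.form (φ x) ∘ₗ (F x).toLinearMap := by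
  obtain ⟨g, hg⟩ := exists_push φ (P := fun y => Dual ℝ (E'.fiber y))
    fun x => α.form x ∘ₗ (F x).symm.toLinearMap
  suffices hs : ∀ ψ' : Sec E', ∀ x, ContMDiffAt (𝓡 n) 𝓘(ℝ, ℝ) ∞ (fun x => g (φ x) (ψ' (φ x))) x by
    refine ⟨⟨g, fun ψ' => contMDiff_push φ (hs ψ')⟩, fun x => LinearMap.ext fun e => ?_⟩
    change α.form x e = g (φ x) (F x e)
    rw [hg]
    exact congrArg (α.form x) ((F x).symm_apply_apply e).symm
  intro ψ' x
  obtain ⟨W, hx, ⟨Fr⟩⟩ := exists_frame E x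
  choose e' he' using fun b => hF (Fr.e b)
  choose η hη using fun a => exists_dual_at (φ x) ((Fr.ξ a).form x ∘ₗ (F x).symm.toLinearMap)
  let A : Matrix (Fin E.rank) (Fin E.rank) (GlobalFun n M) := fun a b =>
    pullFun φ (pair (η a) (e' b))
  have hA : ∀ y a b, A a b y = (η a).form (φ y) (F y (Fr.e b y)) := fun y a b =>
    congrArg ((η a).form (φ y)) (he' b y)
  let ev : M → GlobalFun n M →+* ℝ := fun y => ContMDiffMap.evalRingHom y
  have hdet : ∀ᶠ y in 𝓝 x, A.det y ≠ 0 := by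
    refine A.det.contMDiff.continuous.continuousAt.eventually_ne ?_
    have : (ev x).mapMatrix A = 1 := by
      ext a b
      refine (hA x a b).trans ?_
      rw [hη, LinearMap.comp_apply]
      refine (congrArg ((Fr.ξ a).form x) ((F x).symm_apply_apply _)).trans ?_
      rw [Fr.dual x hx, Matrix.one_apply]
    change ev x A.det ≠ 0
    rw [RingHom.map_det, this, Matrix.det_one]
    exact one_ne_zero
  have hs : ContMDiffAt (𝓡 n) 𝓘(ℝ, ℝ) ∞ (fun y => (A.det y)⁻¹ * ∑ b, ∑ a, A.adjugate b a y *
      ((pullFun φ (pair (η a) ψ')) y * pair α (Fr.e b) y)) x :=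
    ContMDiffAt.mul (ContMDiffAt.inv₀ (A.det.contMDiff x) hdet.self_of_nhds)
      (contMDiffAt_finsetSum fun b _ => contMDiffAt_finsetSum fun a _ =>
        ((A.adjugate b a).contMDiff x).mul
          (((pullFun φ (pair (η a) ψ')).contMDiff x).mul ((pair α (Fr.e b)).contMDiff x)))
  refine hs.congr_of_eventuallyEq ?_
  filter_upwards [hdet, W.isOpen.mem_nhds hx] with y hy hyW
  rw [hg]
  change α.form y ((F y).symm (ψ' (φ y))) = _
  obtain ⟨v, hv⟩ : ∃ v, F y v = ψ' (φ y) := ⟨_, (F y).apply_symm_apply _⟩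
  rw [← hv, LinearEquiv.symm_apply_apply]
  let c : Fin E.rank → ℝ := fun b => (Fr.ξ b).form y v
  have hc : ((ev y).mapMatrix A).mulVec c = fun a => (η a).form (φ y) (ψ' (φ y)) := by
    funext a
    change ∑ b, A a b y * c b = _
    rw [← hv]
    conv_rhs => rw [← Fr.sum y hyW v, map_sum, map_sum]
    refine Finset.sum_congr rfl fun b _ => ?_
    rw [map_smul, map_smul, smul_eq_mul, mul_comm]
    exact congrArg (c b * ·) (hA y a b)
  have hc' : ((ev y).mapMatrix A.adjugate).mulVec
      (fun a => (η a).form (φ y) (ψ' (φ y))) = A.det y • c := by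
    rw [← hc, Matrix.mulVec_mulVec, ← map_mul, Matrix.adjugate_mul]
    funext b
    have : (ev y).mapMatrix (A.det • (1 : Matrix (Fin E.rank) (Fin E.rank) (GlobalFun n M))) =
        A.det y • (1 : Matrix (Fin E.rank) (Fin E.rank) ℝ) := by
      ext a b
      rw [RingHom.mapMatrix_apply, Matrix.map_apply, Matrix.smul_apply, Matrix.smul_apply,
        smul_eq_mul, map_mul, Matrix.one_apply, Matrix.one_apply]
      split_ifs
      · rw [map_one]; rfl
      · rw [map_zero]; rfl
    rw [this, Matrix.smul_mulVec, Matrix.one_mulVec]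
  have hsum : ∀ b, ∑ a, A.adjugate b a y * ((η a).form (φ y) (ψ' (φ y)) * α.form y (Fr.e b y)) =
      A.det y * c b * α.form y (Fr.e b y) := fun b => by
    rw [← smul_eq_mul (A.det y), ← Pi.smul_apply, ← hc', Matrix.mulVec, dotProduct, Finset.sum_mul]
    exact Finset.sum_congr rfl fun a _ => (mul_assoc _ _ _).symm
  change _ = (A.det y)⁻¹ * ∑ b, ∑ a, A.adjugate b a y *
    ((η a).form (φ y) (ψ' (φ y)) * α.form y (Fr.e b y))
  rw [Finset.sum_congr rfl fun b _ => hsum b, Finset.mul_sum]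
  conv_lhs => rw [← Fr.sum y hyW v, map_sum]
  refine Finset.sum_congr rfl fun b _ => ?_
  rw [map_smul, smul_eq_mul, mul_assoc, inv_mul_cancel_left₀ hy]

lemma exists_related_symm (ψ' : Sec E') : ∃ ψ : Sec E, Related φ F ψ ψ' := by
  refine ⟨Sec.ofDual (fun x => (F x).symm (ψ' (φ x))) fun α => ?_, fun x =>
    ((F x).apply_symm_apply _).symm⟩
  obtain ⟨α', h⟩ := exists_dual_push hF α
  refine (pullFun φ (pair α' ψ')).contMDiff.congr fun x => ?_
  rw [h]
  exact congrArg (α'.form (φ x)) ((F x).apply_symm_apply _)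

end Related

section IsPulled

variable (Θ : ∀ x, FibAlg E' V' (φ x) →ₐ[ℝ] FibAlg E V x)

/-- The function `c` is the pullback of `a` along a family of homomorphisms of the fibres. -/
def IsPulled (a : 𝒪[E',V'].A ⊤) (c : 𝒪[E,V].A ⊤) : Prop :=
  ∀ x, splitVal c x = Θ x (splitVal a (φ x))

variable {Θ} {a b : 𝒪[E',V'].A ⊤} {c d : 𝒪[E,V].A ⊤}

lemma isPulled_one : IsPulled Θ 1 1 := fun x => (map_one (Θ x)).symm

lemma isPulled_fun (f : GlobalFun n' M') :
    IsPulled Θ (ofFun E' V' f) (ofFun E V (pullFun φ f)) := fun x =>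
  ((Θ x).commutes (f (φ x))).symm

lemma IsPulled.add (h : IsPulled Θ a c) (h' : IsPulled Θ b d) : IsPulled Θ (a + b) (c + d) :=
  fun x => (congrArg₂ (· + ·) (h x) (h' x)).trans (map_add (Θ x) _ _).symm

lemma IsPulled.mul (h : IsPulled Θ a c) (h' : IsPulled Θ b d) : IsPulled Θ (a * b) (c * d) :=
  fun x => (congrArg₂ (· * ·) (h x) (h' x)).trans (map_mul (Θ x) _ _).symm

lemma IsPulled.smul (r : ℝ) (h : IsPulled Θ a c) : IsPulled Θ (r • a) (r • c) :=
  fun x => (congrArg (r • ·) (h x)).trans (map_smul (Θ x) _ _).symm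

end IsPulled

variable {F : ∀ x, E.fiber x ≃ₗ[ℝ] E'.fiber (φ x)} {G : ∀ x, V.fiber x ≃ₗ[ℝ] V'.fiber (φ x)}
  {B : EForm 2 E V} {Θ : ∀ x, FibAlg E' V' (φ x) →ₐ[ℝ] FibAlg E V x}
  (hF : ∀ ψ : Sec E, ∃ ψ' : Sec E', Related φ F ψ ψ')
  (hG : ∀ v : Sec V, ∃ v' : Sec V', Related φ G v v')
  (hΘ : ∀ x, IsFib (Θ x) (F x).toLinearMap (G x).toLinearMap fun e e' => G x (B.form x ![e, e']))

lemma form_smooth (B : EForm 2 E V) (β : DualSec V) (ψ ψ' : Sec E) :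
    ContMDiff (𝓡 n) 𝓘(ℝ, ℝ) ∞ fun y => β.form y (B.form y ![ψ y, ψ' y]) := by
  refine (pair β (B.onSec ![ψ, ψ'])).contMDiff.congr fun y => congrArg (β.form y)
    (congrArg (B.form y) ?_)
  funext k; fin_cases k <;> rfl

include hF hG hΘ

omit hF in
lemma exists_pulled_two (β : DualSec V') :
    ∃ b, IsPulled Θ (ofDualV E' V' β) b := by
  obtain ⟨β', h⟩ := exists_dual_pull hG β
  obtain ⟨b, hb, h2, h0⟩ := exists_deg_two (fun y e e' => β'.form y (B.form y ![e, e']))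
    (fun y => (alt2_of_map (B.form y)).comp_linear _) (form_smooth B β') β'
  refine ⟨b, fun x => ext_two (hb ⟨x, trivial⟩) ((hΘ x).deg_two (β.form (φ x)))
    (fun e e' => ?_) fun v => ?_⟩
  · refine (h2 x e e' 0).trans (Eq.trans ?_ ((hΘ x).on_two (β.form (φ x)) e e' 0).symm)
    rw [h]; rfl
  · refine (h0 x v).trans (Eq.trans ?_ ((hΘ x).on_two_zero (β.form (φ x)) v).symm)
    rw [h]; rfl

lemma exists_pushed_two (β : DualSec V) :
    ∃ b, IsPulled Θ b (ofDualV E V β) := by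
  obtain ⟨β', h⟩ := exists_dual_push hG β
  obtain ⟨τ, hτ⟩ := exists_push φ (P := fun y => E'.fiber y → E'.fiber y → ℝ) fun x e e' =>
    -(β.form x (B.form x ![(F x).symm e, (F x).symm e']))
  have hτ' : ∀ x e e', τ (φ x) e e' = -(β.form x (B.form x ![(F x).symm e, (F x).symm e'])) :=
    fun x e e' => by rw [hτ]
  have hA : ∀ y, Alt2 (τ y) := fun y => by
    obtain ⟨x, rfl⟩ : ∃ x, φ x = y := φ.surjective y
    have hA := alt2_of_map (B.form x)
    rw [hτ]
    exact ⟨fun a a' b => by rw [map_add, hA.add, map_add, neg_add],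
      fun c a b => by rw [map_smul, hA.smul, map_smul, smul_neg],
      fun a b => by rw [hA.swap, map_neg]⟩
  have hs : ∀ ψ1' ψ2' : Sec E', ContMDiff (𝓡 n') 𝓘(ℝ, ℝ) ∞ fun y => τ y (ψ1' y) (ψ2' y) :=
    fun ψ1' ψ2' => contMDiff_push φ <| by
      obtain ⟨ψ1, h₁⟩ := exists_related_symm hF ψ1'
      obtain ⟨ψ2, h₂⟩ := exists_related_symm hF ψ2'
      refine (form_smooth B β ψ1 ψ2).neg.congr fun x => ?_
      rw [hτ', h₁, h₂, LinearEquiv.symm_apply_apply, LinearEquiv.symm_apply_apply]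
  obtain ⟨b, hb, h2, h0⟩ := exists_deg_two (V := V') τ hA hs β'
  have hb' : ∀ x, splitVal b (φ x) ∈ grDeg _ _ 2 := fun x => hb ⟨φ x, trivial⟩
  have h' : ∀ x v, β.form x v = β'.form (φ x) (G x v) := fun x v => by rw [h]; rfl
  refine ⟨b, fun x => ext_two (ιTwo_mem_grDeg _) ((hΘ x).map_mem (hb' x)) (fun e e' => ?_)
    fun v => ?_⟩
  · rw [splitVal_ofDualV, evalGr_ιTwo_cons, (hΘ x).eval_two (hb' x) e e' 0 0, h2, h0, hτ', ← h']
    simp only [LinearEquiv.coe_coe, LinearEquiv.symm_apply_apply, neg_add_cancel]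
  · rw [splitVal_ofDualV, evalGr_ιTwo_nil, (hΘ x).eval_two_nil (hb' x), h0, h']
    rfl

lemma exists_pulled {a : 𝒪[E',V'].A ⊤} (ha : a ∈ Algebra.adjoin ℝ (globalGens E' V')) :
    ∃ c, IsPulled Θ a c := by
  refine adjoin_global_induction (P := fun a => ∃ c, IsPulled Θ a c) ⟨1, isPulled_one⟩
    (fun a b ⟨c, hc⟩ ⟨d, hd⟩ => ⟨c + d, hc.add hd⟩) (fun r a ⟨c, hc⟩ => ⟨r • c, hc.smul r⟩)
    (fun f a ⟨c, hc⟩ => ⟨_, (isPulled_fun f).mul hc⟩) (fun α a ⟨c, hc⟩ => ?_)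
    (fun β a ⟨c, hc⟩ => ?_) ha
  · obtain ⟨α', h⟩ := exists_dual_pull hF α
    have h1 : IsPulled Θ (ofDualE E' V' α) (ofDualE E V α') := fun x => by
      rw [splitVal_ofDualE, splitVal_ofDualE, (hΘ x).on_one, h]
    exact ⟨_, h1.mul hc⟩
  · obtain ⟨b, hb⟩ := exists_pulled_two hG hΘ β
    exact ⟨_, hb.mul hc⟩

lemma exists_pushed {c : 𝒪[E,V].A ⊤} (hc : c ∈ Algebra.adjoin ℝ (globalGens E V)) :
    ∃ a, IsPulled Θ a c := by
  refine adjoin_global_induction (P := fun c => ∃ a, IsPulled Θ a c) ⟨1, isPulled_one⟩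
    (fun a b ⟨c, hc⟩ ⟨d, hd⟩ => ⟨c + d, hc.add hd⟩) (fun r a ⟨c, hc⟩ => ⟨r • c, hc.smul r⟩)
    (fun f a ⟨c, hc⟩ => ?_) (fun α a ⟨c, hc⟩ => ?_) (fun β a ⟨c, hc⟩ => ?_) hc
  · have e : f = pullFun φ (pullFun φ.symm f) := by
      ext y; exact congrArg f (φ.symm_apply_apply y).symm
    rw [e]
    exact ⟨_, (isPulled_fun _).mul hc⟩
  · obtain ⟨α', h⟩ := exists_dual_push hF α
    have h1 : IsPulled Θ (ofDualE E' V' α') (ofDualE E V α) := fun x => by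
      rw [splitVal_ofDualE, splitVal_ofDualE, (hΘ x).on_one, h]
    exact ⟨_, h1.mul hc⟩
  · obtain ⟨b, hb⟩ := exists_pushed_two hF hG hΘ β
    exact ⟨_, hb.mul hc⟩

lemma smooth_pulled {U : Opens M'} (a : 𝒪[E',V'].A U) :
    IsSmoothSplit E V (preim φ U) fun x => Θ x (valHom ⟨φ x, x.2⟩ a) := by
  refine isSmoothSplit_iff.2 fun x => ?_
  obtain ⟨c, hc⟩ := exists_pulled hF hG hΘ (germ_mem a ⟨φ x, x.2⟩)
  refine (smoothAt_splitVal c x).congr ?_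
  filter_upwards [φ.continuous.continuousAt.eventually (germ_eq a ⟨φ x, x.2⟩),
    (preim φ U).isOpen.mem_nhds x.2] with y hy hyU
  rw [extZero_of_mem _ hyU, hc y]
  exact congrArg (Θ y) (hy hyU)

omit hF hG in
lemma pulled_deg {k : ℕ} {U : Opens M'} {a : 𝒪[E',V'].A U}
    (ha : a ∈ 𝒪[E',V'].deg U k) (x : preim φ U) :
    Θ x.1 (valHom ⟨φ x.1, x.2⟩ a) ∈ grDeg (Dual ℝ (E.fiber x.1))
      (Dual ℝ (V.fiber x.1)) k := by
  have h := mem_splitDeg.1 ha ⟨φ x.1, x.2⟩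
  exact (hΘ x.1).map_mem h

lemma pulled_mem {U : Opens M'} (a : 𝒪[E',V'].A U) :
    (fun x : preim φ U => Θ x (valHom ⟨φ x, x.2⟩ a)) ∈ splitAlg E V (preim φ U) := by
  refine homogeneous_induction (P := fun a => (fun x : preim φ U => Θ x (valHom ⟨φ x, x.2⟩ a)) ∈
    splitAlg E V (preim φ U)) (fun k a ha => ?_) (fun a b ha hb => ?_) a
  · exact Algebra.subset_adjoin ⟨smooth_pulled hF hG hΘ a, k, pulled_deg hΘ ha⟩
  · have e : (fun x : preim φ U => Θ x (valHom ⟨φ x, x.2⟩ (a + b))) =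
        (fun x : preim φ U => Θ x (valHom ⟨φ x, x.2⟩ a)) +
          fun x : preim φ U => Θ x (valHom ⟨φ x, x.2⟩ b) := funext fun x => by
      rw [map_add, map_add]; rfl
    rw [e]
    exact add_mem ha hb

lemma smooth_pushed {U : Opens M'} (c : 𝒪[E,V].A (preim φ U))
    {a : ∀ y : U, FibAlg E' V' y.1} (h : ∀ x : preim φ U, valHom x c = Θ x (a ⟨φ x, x.2⟩))
    (hinj : ∀ x, Function.Injective (Θ x)) : IsSmoothSplit E' V' U a := by
  refine isSmoothSplit_iff.2 ?_
  rintro ⟨y, hy⟩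
  obtain ⟨x, rfl⟩ : ∃ x, φ x = y := φ.surjective y
  obtain ⟨b, hb⟩ := exists_pushed hF hG hΘ (germ_mem c ⟨x, hy⟩)
  refine (smoothAt_splitVal b (φ x)).congr ?_
  have hn : 𝓝 (φ x) = map φ (𝓝 x) := (φ.toHomeomorph.map_nhds_eq x).symm
  change ∀ᶠ y in 𝓝 (φ x), _
  rw [hn, eventually_map]
  filter_upwards [germ_eq c ⟨x, hy⟩, (preim φ U).isOpen.mem_nhds hy] with z hz hzU
  rw [extZero_of_mem _ (show φ z ∈ U from hzU)]
  exact hinj z ((h ⟨z, hzU⟩).symm.trans ((hz hzU).trans (hb z)))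

lemma exists_pushed_hom {Θ' : ∀ x, FibAlg E V x →ₐ[ℝ] FibAlg E' V' (φ x)}
    (hl : ∀ x a, Θ' x (Θ x a) = a) (hr : ∀ x a, Θ x (Θ' x a) = a) {k : ℕ}
    (hk : ∀ x, ∀ b ∈ grDeg _ _ k, Θ' x b ∈ grDeg _ _ k) {U : Opens M'}
    {c : 𝒪[E,V].A (preim φ U)} (hc : c ∈ 𝒪[E,V].deg (preim φ U) k) :
    ∃ a : 𝒪[E',V'].A U, ∀ x : preim φ U, valHom x c = Θ x (valHom ⟨φ x, x.2⟩ a) := by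
  obtain ⟨g, hg⟩ := exists_push φ (P := fun y => y ∈ U → FibAlg E' V' y) fun x h =>
    Θ' x (valHom (⟨x, h⟩ : preim φ U) c)
  have hg' : ∀ x : preim φ U, valHom x c = Θ x (g (φ x) x.2) := fun x => by
    rw [hg, hr]
  refine ⟨ofHom U k (fun y => g y.1 y.2) (smooth_pushed hF hG hΘ c (a := fun y => g y.1 y.2) hg'
    fun x => Function.LeftInverse.injective (hl x)) ?_, hg'⟩
  rintro ⟨y, hy⟩
  obtain ⟨x, rfl⟩ : ∃ x, φ x = y := φ.surjective y
  have e : g (φ x) hy = Θ' x (valHom (⟨x, hy⟩ : preim φ U) c) := by rw [hg]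
  exact e ▸ hk x _ (hc ⟨x, hy⟩)

omit hΘ in
lemma GIso.exists_hasFib_of (B : EForm 2 E V) : ∃ Φ : GIso E V E' V' φ,
    Φ.HasFib (fun x => (F x).toLinearMap) (fun x => (G x).toLinearMap)
      fun x e e' => G x (B.form x ![e, e']) := by
  have hτ : ∀ x, Alt2 fun e e' => G x (B.form x ![e, e']) := fun x =>
    (alt2_of_map (B.form x)).comp_linear (G x).toLinearMap
  choose Θ hΘ using fun x => exists_isFib (F x).toLinearMap (G x).toLinearMap (hτ x)
  choose Θ' hΘ' hl hr using fun x => (hΘ x).exists_inverse (hτ x)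
  have hl' : ∀ x a, Θ' x (Θ x a) = a := fun x a => DFunLike.congr_fun (hl x) a
  have hr' : ∀ x a, Θ x (Θ' x a) = a := fun x a => DFunLike.congr_fun (hr x) a
  have hinj : ∀ x, Function.Injective (Θ x) := fun x => Function.LeftInverse.injective (hl' x)
  let P : ∀ U : Opens M', 𝒪[E',V'].A U →ₐ[ℝ] ∀ x : preim φ U, FibAlg E V x.1 := fun U =>
    AlgHom.pi fun x : preim φ U => (Θ x).comp (valHom ⟨φ x, x.2⟩)
  let p : ∀ U : Opens M', 𝒪[E',V'].A U →ₐ[ℝ] 𝒪[E,V].A (preim φ U) := fun U =>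
    (P U).codRestrict (splitAlg E V (preim φ U)) (pulled_mem hF hG hΘ)
  have hp : ∀ U a (x : preim φ U), valHom x (p U a) = Θ x (valHom ⟨φ x, x.2⟩ a) :=
    fun _ _ _ => rfl
  have hbij : ∀ U, Function.Bijective (p U) := by
    refine fun U => ⟨fun a b hab => split_ext ?_, fun c => ?_⟩
    · rintro ⟨y, hy⟩
      obtain ⟨x, rfl⟩ : ∃ x, φ x = y := φ.surjective y
      exact hinj x (congrArg (valHom (⟨x, hy⟩ : preim φ U)) hab)
    · refine homogeneous_induction (P := fun c => ∃ a, p U a = c) (fun k c hc => ?_)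
        (fun c d ⟨a, ha⟩ ⟨b, hb⟩ => ⟨a + b, by rw [map_add, ha, hb]⟩) c
      obtain ⟨a, ha⟩ := exists_pushed_hom hF hG hΘ hl' hr' (fun x b hb => (hΘ' x).map_mem hb) hc
      exact ⟨a, split_ext fun x => (ha x).symm⟩
  have hdeg : ∀ U k a, a ∈ 𝒪[E',V'].deg U k ↔ p U a ∈ 𝒪[E,V].deg _ k := by
    refine fun U k a => ⟨fun ha x => pulled_deg hΘ ha x, fun ha => ?_⟩
    rintro ⟨y, hy⟩
    obtain ⟨x, rfl⟩ : ∃ x, φ x = y := φ.surjective y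
    have := (hΘ' x).map_mem (mem_splitDeg.1 ha ⟨x, hy⟩)
    rwa [hp, hl'] at this
  refine ⟨⟨fun U => AlgEquiv.ofBijective (p U) (hbij U), fun U W h a => rfl, hdeg,
    fun U f' f hf => split_ext fun x => ?_⟩, fun x => ⟨Θ x, hΘ x, fun U a h => rfl⟩⟩
  refine Eq.trans ((Θ x).commutes (f' ⟨φ x, x.2⟩)) ?_
  rw [← hf]
  rfl

end GradedIsoOfMaps

lemma dirDeriv_pull (f : GlobalFun n' M') (x : M) (X : TangentSpace (𝓡 n) x) :
    dirDeriv (pullFun φ f) x X = dirDeriv f (φ x) (mfderiv (𝓡 n) (𝓡 n') φ x X) := by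
  have h := mfderiv_comp x (f.mdiff (φ x)) (φ.mdifferentiable (by simp) x)
  exact DFunLike.congr_fun h X

lemma IsFib.eval_one {E0 : Type u} {V0 : Type u'} [AddCommGroup E0] [Module ℝ E0]
    [AddCommGroup V0] [Module ℝ V0] {E1 : Type v} {V1 : Type v'} [AddCommGroup E1] [Module ℝ E1]
    [AddCommGroup V1] [Module ℝ V1] {Θ : DualGrAlg E1 V1 →ₐ[ℝ] DualGrAlg E0 V0}
    {F : E0 →ₗ[ℝ] E1} {G : V0 →ₗ[ℝ] V1} {τ : E0 → E0 → V1} (h : IsFib Θ F G τ)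
    {c : DualGrAlg E1 V1} (hc : c ∈ grDeg _ _ 1) (e : E0) (v : V0) (v' : V1) :
    evalGr (Θ c) [e] v = evalGr c [F e] v' := by
  obtain ⟨w, rfl⟩ := (exists_generators hc).2 rfl
  rw [h.on_one, evalGr_ιOne_one, evalGr_ιOne_one]
  rfl

namespace GIso

variable {Φ : GIso E V E' V' φ} {F : ∀ x, E.fiber x ≃ₗ[ℝ] E'.fiber (φ x)}
  {G : ∀ x, V.fiber x ≃ₗ[ℝ] V'.fiber (φ x)} {B : EForm 2 E V}
  (h : Φ.HasFib (fun x => (F x).toLinearMap) (fun x => (G x).toLinearMap)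
    fun x e e' => G x (B.form x ![e, e']))
  {a : 𝒪[E',V'].A ⊤} {ψ ψ1 ψ2 ψ3 : Sec E} {ψ' ψ1' ψ2' ψ3' : Sec E'}
  {v : Sec V} {v' : Sec V'} (x : M)

lemma splitVal_mem {k : ℕ} {a : 𝒪[E,V].A ⊤} (ha : a ∈ 𝒪[E,V].deg ⊤ k) (x : M) :
    splitVal a x ∈ grDeg (Dual ℝ (E.fiber x)) (Dual ℝ (V.fiber x)) k := ha ⟨x, trivial⟩

lemma onSec_two (B : EForm 2 E V) (ψ1 ψ2 : Sec E) (x : M) :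
    B.onSec ![ψ1, ψ2] x = B.form x ![ψ1 x, ψ2 x] :=
  congrArg (B.form x) (by funext k; fin_cases k <;> rfl)

lemma onSec_two_swap (B : EForm 2 E V) (ψ1 ψ2 : Sec E) :
    B.onSec ![ψ1, ψ2] = - B.onSec ![ψ2, ψ1] := by
  ext x
  refine (onSec_two B _ _ x).trans (((alt2_of_map (B.form x)).swap _ _).trans ?_)
  exact congrArg Neg.neg (onSec_two B ψ2 ψ1 x).symm

include h

lemma HasFib.exists_glob : ∃ Θ : FibAlg E' V' (φ x) →ₐ[ℝ] FibAlg E V x,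
    IsFib Θ (F x).toLinearMap (G x).toLinearMap (fun e e' => G x (B.form x ![e, e'])) ∧
      ∀ a, splitVal (Φ.glob a) x = Θ (splitVal a (φ x)) := by
  obtain ⟨Θ, hΘ, e⟩ := h x
  exact ⟨Θ, hΘ, fun a => e ⊤ a trivial⟩

lemma HasFib.evalSec_one (ha : a ∈ 𝒪[E',V'].deg ⊤ 1) (hψ : Related φ F ψ ψ') :
    evalSec (Φ.glob a) [ψ] v x = evalSec a [ψ'] 0 (φ x) := by
  obtain ⟨Θ, hΘ, e⟩ := h.exists_glob x
  rw [evalSec_apply, evalSec_apply, e]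
  simp only [List.map_cons, List.map_nil]
  rw [hΘ.eval_one (splitVal_mem ha _) _ _ 0, hψ]
  rfl

lemma HasFib.evalSec_two_nil (ha : a ∈ 𝒪[E',V'].deg ⊤ 2) (hv : Related φ G v v') :
    evalSec (Φ.glob a) [] v x = evalSec a [] v' (φ x) := by
  obtain ⟨Θ, hΘ, e⟩ := h.exists_glob x
  rw [evalSec_apply, evalSec_apply, e, List.map_nil, hΘ.eval_two_nil (splitVal_mem ha _), hv]
  rfl

lemma HasFib.evalSec_two (ha : a ∈ 𝒪[E',V'].deg ⊤ 2) (h₁ : Related φ F ψ1 ψ1')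
    (h₂ : Related φ F ψ2 ψ2') (hv : Related φ G (B.onSec ![ψ1, ψ2]) v') :
    evalSec (Φ.glob a) [ψ1, ψ2] v x = evalSec a [ψ1', ψ2'] 0 (φ x) + evalSec a [] v' (φ x) := by
  obtain ⟨Θ, hΘ, e⟩ := h.exists_glob x
  rw [evalSec_apply, evalSec_apply, evalSec_apply, e]
  simp only [List.map_cons, List.map_nil]
  rw [hΘ.eval_two (splitVal_mem ha _) _ _ _ 0, h₁, h₂, hv, onSec_two]
  rfl

lemma HasFib.evalSec_three_one (ha : a ∈ 𝒪[E',V'].deg ⊤ 3) (hψ : Related φ F ψ ψ')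
    (hv : Related φ G v v') : evalSec (Φ.glob a) [ψ] v x = evalSec a [ψ'] v' (φ x) := by
  obtain ⟨Θ, hΘ, e⟩ := h.exists_glob x
  rw [evalSec_apply, evalSec_apply, e]
  simp only [List.map_cons, List.map_nil]
  rw [hΘ.eval_three_one (splitVal_mem ha _), hψ, hv]
  rfl

lemma HasFib.evalSec_three (ha : a ∈ 𝒪[E',V'].deg ⊤ 3) (h₁ : Related φ F ψ1 ψ1')
    (h₂ : Related φ F ψ2 ψ2') (h₃ : Related φ F ψ3 ψ3') :
    evalSec (Φ.glob a) [ψ1, ψ2, ψ3] v x = evalSec a [ψ1', ψ2', ψ3'] 0 (φ x) +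
      evalSec (Φ.glob a) [ψ1] (B.onSec ![ψ2, ψ3]) x -
      evalSec (Φ.glob a) [ψ2] (B.onSec ![ψ1, ψ3]) x +
      evalSec (Φ.glob a) [ψ3] (B.onSec ![ψ1, ψ2]) x := by
  obtain ⟨Θ, hΘ, e⟩ := h.exists_glob x
  simp only [evalSec_apply, e, List.map_cons, List.map_nil,
    hΘ.eval_three_one (splitVal_mem ha _), onSec_two]
  rw [hΘ.eval_three (splitVal_mem ha _) _ _ _ _ 0, h₁, h₂, h₃]
  rfl

end GIso

namespace GIso

variable {Φ : GIso E V E' V' φ} {F : ∀ x, E.fiber x ≃ₗ[ℝ] E'.fiber (φ x)}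
  {G : ∀ x, V.fiber x ≃ₗ[ℝ] V'.fiber (φ x)} {B : EForm 2 E V}
  (h : Φ.HasFib (fun x => (F x).toLinearMap) (fun x => (G x).toLinearMap)
    fun x e e' => G x (B.form x ![e, e']))
  {D : OddDer E V} {L : LieTwoAlgebroid E V} (hD : D.HasData L.toPre)
  {D' : OddDer E' V'} {L' : LieTwoAlgebroid E' V'} (hD' : D'.HasData L'.toPre)
  {a : 𝒪[E',V'].A ⊤} {ψ ψ1 ψ2 ψ3 : Sec E} {ψ' ψ1' ψ2' ψ3' : Sec E'}
  {v : Sec V} {v' : Sec V'} (x : M)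

lemma lie_pull (hρ : ∀ x (e : E.fiber x),
      L'.anchor.map (φ x) (F x e) = mfderiv (𝓡 n) (𝓡 n') φ x (L.anchor.map x e))
    (hψ : Related φ F ψ ψ') (f : GlobalFun n' M') (x : M) :
    L.anchor.lie ψ (pullFun φ f) x = L'.anchor.lie ψ' f (φ x) := by
  rw [Anchor.lie_apply, Anchor.lie_apply, dirDeriv_pull, ← hρ, hψ]

include h

lemma HasFib.exists_dualE (α' : DualSec E') : ∃ α : DualSec E,
    Φ.glob (ofDualE E' V' α') = ofDualE E V α ∧
      ∀ x e, α.form x e = α'.form (φ x) (F x e) := by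
  obtain ⟨α, hα⟩ := exists_dual_pull h.F_smooth α'
  exact ⟨α, splitVal_ext fun x => by rw [h.glob_dualE, splitVal_ofDualE, hα], fun x e => by
    rw [hα]; rfl⟩

lemma HasFib.exists_dualV (β' : DualSec V') : ∃ β : DualSec V,
    (∀ x v, β.form x v = β'.form (φ x) (G x v)) ∧
    (∀ v, evalSec (Φ.glob (ofDualV E' V' β')) [] v = pair β v) ∧
    ∀ ψ1 ψ2 v, evalSec (Φ.glob (ofDualV E' V' β')) [ψ1, ψ2] v = pair β (B.onSec ![ψ1, ψ2]) := by
  obtain ⟨β, hβ⟩ := exists_dual_pull h.G_smooth β'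
  refine ⟨β, fun x v => by rw [hβ]; rfl, fun v => ?_, fun ψ1 ψ2 v => ?_⟩ <;> ext x <;>
    rw [evalSec_apply, pair_apply, hβ]
  · exact h.glob_dualV_nil β' (v x)
  · rw [onSec_two]
    exact h.glob_dualV_two β' (ψ1 x) (ψ2 x) (v x)

lemma pair_eq_pullFun {α : DualSec E} {α' : DualSec E'}
    (hα : ∀ x e, α.form x e = α'.form (φ x) (F x e)) (hψ : Related φ F ψ ψ') :
    pair α ψ = pullFun φ (pair α' ψ') := by
  ext x
  rw [pair_apply, pullFun_apply, pair_apply, hα, hψ]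

include hD in
lemma HasFib.app_fun (f : GlobalFun n' M') :
    evalSec (D.app ⊤ (Φ.glob (ofFun E' V' f))) [ψ] v x =
      dirDeriv f (φ x) (mfderiv (𝓡 n) (𝓡 n') φ x (L.anchor.map x (ψ x))) := by
  rw [Φ.glob_ofFun, hD.on_fun, Anchor.lie_apply, dirDeriv_pull]
  rfl

include hD' in
lemma HasFib.glob_fun (hψ : Related φ F ψ ψ') (f : GlobalFun n' M') :
    evalSec (Φ.glob (D'.app ⊤ (ofFun E' V' f))) [ψ] v x =
      dirDeriv f (φ x) (L'.anchor.map (φ x) (F x (ψ x))) := by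
  rw [h.evalSec_one x (D'.degree ⊤ 0 _ (ofFun_mem f)) hψ, hD'.on_fun, Anchor.lie_apply, hψ]
  rfl

include hD in
lemma HasFib.app_dualE_zero (α : DualSec E') :
    evalSec (D.app ⊤ (Φ.glob (ofDualE E' V' α))) [] v x =
      α.form (φ x) (F x (L.t.map x (v x))) := by
  obtain ⟨β, e, hβ⟩ := h.exists_dualE α
  rw [e, hD.on_dualE_zero, pair_apply, hβ]
  rfl

include hD' in
lemma HasFib.glob_dualE_zero (α : DualSec E') :
    evalSec (Φ.glob (D'.app ⊤ (ofDualE E' V' α))) [] v x =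
      α.form (φ x) (L'.t.map (φ x) (G x (v x))) := by
  obtain ⟨v', hv⟩ := h.G_smooth v
  rw [h.evalSec_two_nil x (D'.degree ⊤ 1 _ (ofDualE_mem α)) hv, hD'.on_dualE_zero, pair_apply, ← hv]
  rfl

variable (hρ : ∀ x (e : E.fiber x),
  L'.anchor.map (φ x) (F x e) = mfderiv (𝓡 n) (𝓡 n') φ x (L.anchor.map x e))
include hρ hD hD'

lemma HasFib.dualE_two (ht : ∀ x (v : V.fiber x), L'.t.map (φ x) (G x v) = F x (L.t.map x v))
    (h₁ : Related φ F ψ1 ψ1') (h₂ : Related φ F ψ2 ψ2') (α : DualSec E') :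
    evalSec (D.app ⊤ (Φ.glob (ofDualE E' V' α))) [ψ1, ψ2] v x +
      α.form (φ x) (F x ((L.bracket ψ1 ψ2 + L.t.onSec (B.onSec ![ψ1, ψ2])) x)) =
    evalSec (Φ.glob (D'.app ⊤ (ofDualE E' V' α))) [ψ1, ψ2] v x +
      α.form (φ x) (L'.bracket ψ1' ψ2' (φ x)) := by
  obtain ⟨β, e, hβ⟩ := h.exists_dualE α
  obtain ⟨w', hw⟩ := h.G_smooth (B.onSec ![ψ1, ψ2])
  rw [h.evalSec_two x (D'.degree ⊤ 1 _ (ofDualE_mem α)) h₁ h₂ hw, e, hD.on_dualE_two,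
    hD'.on_dualE_two, hD'.on_dualE_zero, pair_eq_pullFun h hβ h₁, pair_eq_pullFun h hβ h₂]
  have hw' : pair α (L'.t.onSec w') (φ x) = α.form (φ x) (F x (L.t.map x (B.onSec ![ψ1, ψ2] x))) := by
    rw [← ht, ← hw]; rfl
  have hs : F x ((L.bracket ψ1 ψ2 + L.t.onSec (B.onSec ![ψ1, ψ2])) x) =
      F x (L.bracket ψ1 ψ2 x) + F x (L.t.map x (B.onSec ![ψ1, ψ2] x)) := map_add (F x) _ _
  have l1 := lie_pull hρ h₁ (pair α ψ2') x
  have l2 := lie_pull hρ h₂ (pair α ψ1') x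
  rw [hs, map_add, ← hβ x (L.bracket ψ1 ψ2 x)]
  change L.anchor.lie ψ1 _ x - L.anchor.lie ψ2 _ x - pair β (L.bracket ψ1 ψ2) x +
    (pair β (L.bracket ψ1 ψ2) x + _) = L'.anchor.lie ψ1' _ (φ x) - L'.anchor.lie ψ2' _ (φ x) -
      pair α (L'.bracket ψ1' ψ2') (φ x) + pair α (L'.t.onSec w') (φ x) +
        pair α (L'.bracket ψ1' ψ2') (φ x)
  rw [l1, l2, hw']
  ring

lemma HasFib.dualV_one (hψ : Related φ F ψ ψ') (hv : Related φ G v v') (β' : DualSec V') :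
    evalSec (D.app ⊤ (Φ.glob (ofDualV E' V' β'))) [ψ] v x +
      β'.form (φ x) (G x ((L.conn ψ v + B.onSec ![ψ, L.t.onSec v]) x)) =
    evalSec (Φ.glob (D'.app ⊤ (ofDualV E' V' β'))) [ψ] v x +
      β'.form (φ x) (L'.conn ψ' v' (φ x)) := by
  obtain ⟨β, hβ, e0, e2⟩ := h.exists_dualV β'
  have hm := Φ.glob_mem.1 (ofDualV_mem (E := E') β')
  rw [h.evalSec_three_one x (D'.degree ⊤ 2 _ (ofDualV_mem β')) hψ hv, hD'.on_dualV_one,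
    hD.two_one _ _ _ hm, e0, e0, e2, ← hβ, onSec_two_swap]
  have hp : pair β v = pullFun φ (pair β' v') := by
    ext y
    rw [pair_apply, pullFun_apply, pair_apply, hβ, hv]
  have l := lie_pull hρ hψ (pair β' v') x
  have hs : ∀ s t : Sec V, β.form x ((s + t) x) = pair β s x + pair β t x := fun s t =>
    map_add (β.form x) _ _
  have hn : ∀ s : Sec V, pair β (-s) x = - pair β s x := fun s => map_neg (β.form x) _
  rw [hs, hp]
  change L.anchor.lie ψ _ x - pair β (L.conn ψ v) x + pair β (- B.onSec ![ψ, L.t.onSec v]) x + _ =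
    L'.anchor.lie ψ' _ (φ x) - pair β' (L'.conn ψ' v') (φ x) + pair β' (L'.conn ψ' v') (φ x)
  rw [l, hn]
  ring

omit hρ in
lemma HasFib.dualV_three (hc : ∀ β' ψ v x,
      evalSec (D.app ⊤ (Φ.glob (ofDualV E' V' β'))) [ψ] v x =
        evalSec (Φ.glob (D'.app ⊤ (ofDualV E' V' β'))) [ψ] v x)
    (h₁ : Related φ F ψ1 ψ1') (h₂ : Related φ F ψ2 ψ2') (h₃ : Related φ F ψ3 ψ3')
    (β' : DualSec V') :
    evalSec (D.app ⊤ (Φ.glob (ofDualV E' V' β'))) [ψ1, ψ2, ψ3] v x +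
      β'.form (φ x) (L'.H.onSec ![ψ1', ψ2', ψ3'] (φ x)) =
    evalSec (Φ.glob (D'.app ⊤ (ofDualV E' V' β'))) [ψ1, ψ2, ψ3] v x +
      β'.form (φ x) (G x ((L.H.onSec ![ψ1, ψ2, ψ3] +
        extCovDeriv L.bracket L.conn B ![ψ1, ψ2, ψ3] - cubicB L.t B ψ1 ψ2 ψ3) x)) := by
  obtain ⟨β, hβ, e0, e2⟩ := h.exists_dualV β'
  have hm := Φ.glob_mem.1 (ofDualV_mem (E := E') β')
  have hp : β'.form (φ x) (L'.H.onSec ![ψ1', ψ2', ψ3'] (φ x)) =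
    pair β' (L'.H.onSec ![ψ1', ψ2', ψ3']) (φ x) := rfl
  have ha : ∀ s t : Sec V, pair β (s + t) x = pair β s x + pair β t x := fun s t =>
    map_add (β.form x) _ _
  have hs : ∀ s t : Sec V, pair β (s - t) x = pair β s x - pair β t x := fun s t =>
    map_sub (β.form x) _ _
  have hn : ∀ s : Sec V, pair β (-s) x = - pair β s x := fun s => map_neg (β.form x) _
  rw [h.evalSec_three x (D'.degree ⊤ 2 _ (ofDualV_mem β')) h₁ h₂ h₃, ← hc, ← hc, ← hc,
    hD.two_three _ _ _ _ _ hm, hD.two_one _ _ _ hm, hD.two_one _ _ _ hm, hD.two_one _ _ _ hm,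
    ← hβ, hD'.on_dualV_three, hp, ← pair_apply β, extCovDeriv_two, cubicB]
  simp only [e0, e2, ha, hs]
  rw [onSec_two_swap B ψ3 ψ1]
  have ht : L.t.onSec (-B.onSec ![ψ1, ψ3]) = - L.t.onSec (B.onSec ![ψ1, ψ3]) := by
    ext y; exact map_neg (L.t.map y) _
  have hB : B.onSec ![-L.t.onSec (B.onSec ![ψ1, ψ3]), ψ2] =
      - B.onSec ![L.t.onSec (B.onSec ![ψ1, ψ3]), ψ2] := by
    ext y
    refine (onSec_two B _ _ y).trans (Eq.trans ?_ (congrArg Neg.neg (onSec_two B _ _ y)).symm)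
    have := (alt2_of_map (B.form y)).smul (-1) (L.t.onSec (B.onSec ![ψ1, ψ3]) y) (ψ2 y)
    rw [neg_one_smul, neg_one_smul] at this
    exact this
  rw [ht, hB, hn]
  simp only [LieTwoAlgebroid.toPre]
  ring

end GIso

namespace GIso

lemma hasFib_of_values (Φ : GIso E V E' V' φ) {F : ∀ x, E.fiber x ≃ₗ[ℝ] E'.fiber (φ x)}
    {G : ∀ x, V.fiber x ≃ₗ[ℝ] V'.fiber (φ x)} {τ : ∀ x, E.fiber x → E.fiber x → V'.fiber (φ x)}
    (h1 : ∀ α x e v, evalGr (splitVal (Φ.glob (ofDualE E' V' α)) x) [e] v = α.form (φ x) (F x e))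
    (h2 : ∀ β x v, evalGr (splitVal (Φ.glob (ofDualV E' V' β)) x) [] v = β.form (φ x) (G x v))
    (h3 : ∀ β x e e' v, evalGr (splitVal (Φ.glob (ofDualV E' V' β)) x) [e, e'] v =
      β.form (φ x) (τ x e e')) :
    Φ.HasFib (fun x => (F x).toLinearMap) (fun x => (G x).toLinearMap) τ := by
  obtain ⟨F', G', τ', hτ, h⟩ := Φ.exists_hasFib
  have e1 : F' = F := funext fun x => LinearEquiv.ext fun e => vec_ext_dual fun α => by
    rw [← h1 α x e 0, h.glob_dualE, evalGr_ιOne_one]; rfl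
  have e2 : G' = G := funext fun x => LinearEquiv.ext fun v => vec_ext_dual fun β => by
    rw [← h2 β x v, h.glob_dualV_nil]; rfl
  have e3 : τ' = τ := funext fun x => funext fun e => funext fun e' => vec_ext_dual fun β => by
    rw [← h3 β x e e' 0, h.glob_dualV_two]
  rwa [e1, e2, e3] at h

/-- The vector field on the source of an isomorphism which corresponds to one on the target. -/
def conj (Φ : GIso E V E' V' φ) (D : OddDer E V) : OddDer E' V' where
  app U := (Φ.pull U).symm.toLinearMap ∘ₗ D.app (preim φ U) ∘ₗ (Φ.pull U).toLinearMap
  natural U W h a := by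
    change 𝒪[E',V'].res h ((Φ.pull U).symm (D.app (preim φ U) (Φ.pull U a))) =
      (Φ.pull W).symm (D.app (preim φ W) (Φ.pull W (𝒪[E',V'].res h a)))
    rw [AlgEquiv.eq_symm_apply, ← Φ.natural, ← Φ.natural, AlgEquiv.apply_symm_apply, D.natural]
  degree U k a ha := by
    refine (Φ.map_deg U (k + 1) _).2 ?_
    change Φ.pull U ((Φ.pull U).symm (D.app (preim φ U) (Φ.pull U a))) ∈ _
    rw [AlgEquiv.apply_symm_apply]
    exact D.degree _ k _ ((Φ.map_deg U k _).1 ha)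
  leibniz U k a b ha := by
    change (Φ.pull U).symm (D.app (preim φ U) (Φ.pull U (a * b))) =
      (Φ.pull U).symm (D.app (preim φ U) (Φ.pull U a)) * b +
        (-1 : ℝ) ^ k • (a * (Φ.pull U).symm (D.app (preim φ U) (Φ.pull U b)))
    rw [map_mul, D.leibniz _ k _ _ ((Φ.map_deg U k _).1 ha), map_add, map_smul, map_mul, map_mul,
      AlgEquiv.symm_apply_apply, AlgEquiv.symm_apply_apply]

section

variable {Φ : GIso E V E' V' φ} {F : ∀ x, E.fiber x ≃ₗ[ℝ] E'.fiber (φ x)}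
  {G : ∀ x, V.fiber x ≃ₗ[ℝ] V'.fiber (φ x)} {B : EForm 2 E V}
  {D : OddDer E V} {L : LieTwoAlgebroid E V} (hD : D.HasData L.toPre)
  {D' : OddDer E' V'} {L' : LieTwoAlgebroid E' V'} (hD' : D'.HasData L'.toPre)
include hD hD'

lemma HasFib.exists_lieTwoIso (h : Φ.HasFib (fun x => (F x).toLinearMap)
      (fun x => (G x).toLinearMap) fun x e e' => G x (B.form x ![e, e']))
    (hc : ∀ a, D.app ⊤ (Φ.glob a) = Φ.glob (D'.app ⊤ a)) :
    ∃ g : LieTwoIso φ L L', g.F = F ∧ g.G = G ∧ g.B = B := by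
  have hρ : ∀ x (e : E.fiber x),
      L'.anchor.map (φ x) (F x e) = mfderiv (𝓡 n) (𝓡 n') φ x (L.anchor.map x e) := by
    intro x e
    obtain ⟨ψ, rfl⟩ := exists_sec x e
    refine tangent_ext fun f => ?_
    have e1 := h.glob_fun (v := 0) hD' x (h.F_smooth ψ).choose_spec f
    rw [← hc, h.app_fun hD] at e1
    exact e1.symm
  have ht : ∀ x (v : V.fiber x), L'.t.map (φ x) (G x v) = F x (L.t.map x v) := by
    intro x v
    obtain ⟨v, rfl⟩ := exists_sec x v
    refine vec_ext_dual fun α => ?_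
    have e1 := h.glob_dualE_zero (v := v) hD' x α
    rw [← hc, h.app_dualE_zero hD] at e1
    exact e1.symm
  refine ⟨⟨F, G, B, h.F_smooth, h.G_smooth, hρ, ht, fun ψ1 ψ2 ψ1' ψ2' h₁ h₂ x => ?_,
    fun ψ v ψ' v' h₁ h₂ x => ?_, fun ψ1 ψ2 ψ3 ψ1' ψ2' ψ3' h₁ h₂ h₃ x => ?_⟩, rfl, rfl, rfl⟩ <;>
    refine vec_ext_dual fun α => ?_
  · have := h.dualE_two (v := 0) hD hD' x hρ ht h₁ h₂ α
    rw [hc] at this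
    exact (add_left_cancel this).symm
  · have := h.dualV_one hD hD' x hρ h₁ h₂ α
    rw [hc] at this
    exact (add_left_cancel this).symm
  · have := h.dualV_three (v := 0) hD hD' x (fun β' ψ v x => by rw [hc]) h₁ h₂ h₃ α
    rw [hc] at this
    exact add_left_cancel this

lemma HasFib.intertwines (g : LieTwoIso φ L L') (h : Φ.HasFib (fun x => (g.F x).toLinearMap)
      (fun x => (g.G x).toLinearMap) fun x e e' => g.G x (g.B.form x ![e, e']))
    (U : Opens M') (a : 𝒪[E',V'].A U) :
    D.app (preim φ U) (Φ.pull U a) = Φ.pull U (D'.app U a) := by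
  have key : ∀ a, D.app ⊤ (Φ.glob a) = Φ.glob (D'.app ⊤ a) →
      (Φ.conj D).app ⊤ a = D'.app ⊤ a := fun a ha => (Φ.glob.symm_apply_eq).2 ha
  have hdeg : ∀ {k : ℕ} {a : 𝒪[E',V'].A ⊤}, a ∈ 𝒪[E',V'].deg ⊤ k →
      D.app ⊤ (Φ.glob a) ∈ 𝒪[E,V].deg ⊤ (k + 1) ∧
        Φ.glob (D'.app ⊤ a) ∈ 𝒪[E,V].deg ⊤ (k + 1) := fun {k a} ha =>
    ⟨D.degree ⊤ k _ (Φ.glob_mem.1 ha), Φ.glob_mem.1 (D'.degree ⊤ k _ ha)⟩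
  have h2 : ∀ β' ψ v x, evalSec (D.app ⊤ (Φ.glob (ofDualV E' V' β'))) [ψ] v x =
      evalSec (Φ.glob (D'.app ⊤ (ofDualV E' V' β'))) [ψ] v x := by
    intro β ψ v x
    obtain ⟨ψ', h₁⟩ := g.F_smooth ψ
    obtain ⟨v', h₂⟩ := g.G_smooth v
    have := h.dualV_one hD hD' x g.anchor_comm h₁ h₂ β
    rw [g.conn_comm ψ v ψ' v' h₁ h₂] at this
    exact add_right_cancel this
  have e : (Φ.conj D).app = D'.app := by
    refine OddDer.ext_gens (fun f => key _ ?_) (fun α => key _ ?_) (fun β => key _ ?_)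
    · refine global_ext_one (hdeg (ofFun_mem f)).1 (hdeg (ofFun_mem f)).2 fun ψ x => ?_
      rw [h.app_fun hD, h.glob_fun hD' x (g.F_smooth ψ).choose_spec, g.anchor_comm]
    · refine global_ext_two (hdeg (ofDualE_mem α)).1 (hdeg (ofDualE_mem α)).2
        (fun ψ1 ψ2 x => ?_) fun v x => ?_
      · obtain ⟨ψ1', h₁⟩ := g.F_smooth ψ1
        obtain ⟨ψ2', h₂⟩ := g.F_smooth ψ2
        have := h.dualE_two (v := 0) hD hD' x g.anchor_comm g.t_comm h₁ h₂ α
        rw [g.bracket_comm ψ1 ψ2 _ _ h₁ h₂] at this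
        exact add_right_cancel this
      · rw [h.app_dualE_zero hD, h.glob_dualE_zero hD', g.t_comm]
    · refine global_ext_three (hdeg (ofDualV_mem β)).1 (hdeg (ofDualV_mem β)).2
        (fun ψ1 ψ2 ψ3 x => ?_) fun ψ v x => h2 β ψ v x
      obtain ⟨ψ1', h₁⟩ := g.F_smooth ψ1
      obtain ⟨ψ2', h₂⟩ := g.F_smooth ψ2
      obtain ⟨ψ3', h₃⟩ := g.F_smooth ψ3
      have := h.dualV_three (v := 0) hD hD' x h2 h₁ h₂ h₃ β
      rw [g.H_comm ψ1 ψ2 ψ3 _ _ _ h₁ h₂ h₃] at this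
      exact add_right_cancel this
  exact (Φ.pull U).symm_apply_eq.1 (congrArg (fun T => T U a) e)

end

end GIso

section QIso

variable {X' : GradedSpace.{u', v'} n' M'} {Q : HomologicalVF X}
  {Q' : HomologicalVF X'} (σ : Splitting X E V) (σ' : Splitting X' E' V')

/-- An isomorphism of Q2-manifolds, expressed in splittings. -/
def QIso.toGIso (Φ : QIso φ Q Q') : GIso E V E' V' φ where
  pull U := (σ'.equiv U).symm.trans ((Φ.pull U).trans (σ.equiv (preim φ U)))
  natural U W h a := by
    change 𝒪[E,V].res _ (σ.equiv (preim φ U) (Φ.pull U ((σ'.equiv U).symm a))) =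
      σ.equiv (preim φ W) (Φ.pull W ((σ'.equiv W).symm (𝒪[E',V'].res h a)))
    rw [σ.natural, Φ.natural, σ'.symm_natural]
  map_deg U k a := by
    refine Iff.trans ?_ ((Φ.map_deg U k ((σ'.equiv U).symm a)).trans (σ.map_deg _ k _))
    rw [σ'.map_deg, AlgEquiv.apply_symm_apply]
  map_base U f' f hf := by
    change σ.equiv (preim φ U) (Φ.pull U ((σ'.equiv U).symm (𝒪[E',V'].base U f'))) = _
    rw [← σ'.map_base, AlgEquiv.symm_apply_apply, Φ.map_base U f' f hf, σ.map_base]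

/-- An isomorphism which intertwines the vector fields, as an isomorphism of Q2-manifolds. -/
def GIso.toQIso (Ψ : GIso E V E' V' φ) (h : ∀ U a,
      (σ.push Q).app (preim φ U) (Ψ.pull U a) = Ψ.pull U ((σ'.push Q').app U a)) :
    QIso φ Q Q' where
  pull U := (σ'.equiv U).trans ((Ψ.pull U).trans (σ.equiv (preim φ U)).symm)
  natural U W h a := by
    change X.res _ ((σ.equiv (preim φ U)).symm (Ψ.pull U (σ'.equiv U a))) =
      (σ.equiv (preim φ W)).symm (Ψ.pull W (σ'.equiv W (X'.res h a)))
    rw [σ.symm_natural, Ψ.natural, σ'.natural]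
  map_deg U k a := by
    refine ((σ'.map_deg U k a).trans (Ψ.map_deg U k _)).trans ?_
    change _ ↔ (σ.equiv (preim φ U)).symm (Ψ.pull U (σ'.equiv U a)) ∈ _
    rw [σ.map_deg, AlgEquiv.apply_symm_apply]
  map_base U f' f hf := by
    change (σ.equiv (preim φ U)).symm (Ψ.pull U (σ'.equiv U (X'.base U f'))) = _
    rw [σ'.map_base, Ψ.map_base U f' f hf, ← σ.map_base, AlgEquiv.symm_apply_apply]
  intertwines U a := by
    have := h U (σ'.equiv U a)
    rw [Splitting.push_app, Splitting.push_app, AlgEquiv.symm_apply_apply] at this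
    change Q.app _ ((σ.equiv (preim φ U)).symm (Ψ.pull U (σ'.equiv U a))) =
      (σ.equiv (preim φ U)).symm (Ψ.pull U (σ'.equiv U (Q'.app U a)))
    rw [← this, AlgEquiv.symm_apply_apply]

variable {σ σ'} {L : LieTwoAlgebroid E V} {L' : LieTwoAlgebroid E' V'}

lemma induces_iff {g : LieTwoIso φ L L'} {Φ : QIso φ Q Q'} : Induces σ σ' g Φ ↔
    (Φ.toGIso σ σ').HasFib (fun x => (g.F x).toLinearMap) (fun x => (g.G x).toLinearMap)
      fun x e e' => g.G x (g.B.form x ![e, e']) :=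
  ⟨fun h => GIso.hasFib_of_values _ h.on_dualE h.on_dualV_zero h.on_dualV_two, fun h =>
    ⟨fun α _ e v => (congrArg (fun a => evalGr a [e] v) (h.glob_dualE α)).trans
      (evalGr_ιOne_one _ _ _), fun β _ v => h.glob_dualV_nil β v,
      fun β _ e e' v => h.glob_dualV_two β e e' v⟩⟩

lemma existsUnique_lieTwoIso (hL : IsData σ Q L) (hL' : IsData σ' Q' L') (Φ : QIso φ Q Q') :
    ∃! g : LieTwoIso φ L L', Induces σ σ' g Φ := by
  obtain ⟨F, G, τ, hτ, h⟩ := (Φ.toGIso σ σ').exists_hasFib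
  obtain ⟨B, hB⟩ := h.exists_form hτ
  have e : τ = fun x e e' => G x (B.form x ![e, e']) :=
    funext fun x => funext fun e => funext fun e' => hB x e e'
  rw [e] at h
  have hc : ∀ a, (σ.push Q).app ⊤ ((Φ.toGIso σ σ').glob a) =
      (Φ.toGIso σ σ').glob ((σ'.push Q').app ⊤ a) := fun a => by
    have e1 : (σ.push Q).app (preim φ ⊤) ((Φ.toGIso σ σ').pull ⊤ a) =
        (Φ.toGIso σ σ').pull ⊤ ((σ'.push Q').app ⊤ a) := by
      change σ.equiv (preim φ ⊤) (Q.app (preim φ ⊤) ((σ.equiv (preim φ ⊤)).symm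
          (σ.equiv (preim φ ⊤) (Φ.pull ⊤ ((σ'.equiv ⊤).symm a))))) =
        σ.equiv (preim φ ⊤) (Φ.pull ⊤ ((σ'.equiv ⊤).symm
          (σ'.equiv ⊤ (Q'.app ⊤ ((σ'.equiv ⊤).symm a)))))
      rw [AlgEquiv.symm_apply_apply, AlgEquiv.symm_apply_apply, Φ.intertwines]
    exact e1
  obtain ⟨g, rfl, rfl, rfl⟩ := h.exists_lieTwoIso (isData_iff.1 hL) (isData_iff.1 hL') hc
  refine ⟨g, induces_iff.2 h, fun g' h' => ?_⟩
  have hg := induces_iff.2 h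
  have e1 : g'.F = g.F := funext fun x => LinearEquiv.ext fun e => vec_ext_dual fun α => by
    rw [← h'.on_dualE α x e 0, hg.on_dualE]
  have e2 : g'.G = g.G := funext fun x => LinearEquiv.ext fun v => vec_ext_dual fun α => by
    rw [← h'.on_dualV_zero α x v, hg.on_dualV_zero]
  refine LieTwoIso.ext e1 e2 (EForm.ext (funext fun x => AlternatingMap.ext fun w =>
    (g.G x).injective (vec_ext_dual fun β => ?_)))
  have hw : w = ![w 0, w 1] := by funext k; fin_cases k <;> rfl
  rw [hw, ← hg.on_dualV_two β x (w 0) (w 1) 0, h'.on_dualV_two, e2]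

lemma existsUnique_qIso (hL : IsData σ Q L) (hL' : IsData σ' Q' L') (g : LieTwoIso φ L L') :
    ∃! Φ : QIso φ Q Q', Induces σ σ' g Φ := by
  obtain ⟨Ψ, h⟩ := GIso.exists_hasFib_of (F := g.F) (G := g.G) g.F_smooth g.G_smooth g.B
  have hc := h.intertwines (isData_iff.1 hL) (isData_iff.1 hL') g
  have hΦ : Induces σ σ' g (Ψ.toQIso σ σ' hc) := by
    refine induces_iff.2 fun x => ?_
    obtain ⟨Θ, hΘ, e⟩ := h x
    refine ⟨Θ, hΘ, fun U a hx => (congrArg (valHom (⟨x, hx⟩ : preim φ U)) ?_).trans (e U a hx)⟩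
    change σ.equiv (preim φ U) ((σ.equiv (preim φ U)).symm
      (Ψ.pull U (σ'.equiv U ((σ'.equiv U).symm a)))) = _
    rw [AlgEquiv.apply_symm_apply, AlgEquiv.apply_symm_apply]
  refine ⟨_, hΦ, fun Φ h' => QIso.ext (funext fun U => AlgEquiv.ext fun a => ?_)⟩
  have := (induces_iff.1 h').pull_eq (induces_iff.1 hΦ) U (σ'.equiv U a)
  refine (σ.equiv (preim φ U)).injective ?_
  rw [← (σ'.equiv U).symm_apply_apply a]
  exact this

end QIso

/-- The isomorphism of `E[1] ⊕ V[2]` over the identity which relates two splittings. -/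
def Splitting.toGIso (σ σ' : Splitting X E V) : GIso E V E V (Diffeomorph.refl (𝓡 n) M ∞) where
  pull U := (σ'.equiv U).symm.trans (σ.equiv U)
  natural U W h a := by
    change 𝒪[E,V].res h (σ.equiv U ((σ'.equiv U).symm a)) =
      σ.equiv W ((σ'.equiv W).symm (𝒪[E,V].res h a))
    rw [σ.natural, σ'.symm_natural]
  map_deg U k a := by
    refine Iff.trans ?_ (σ.map_deg U k ((σ'.equiv U).symm a))
    rw [σ'.map_deg, AlgEquiv.apply_symm_apply]
  map_base U f' f hf := by
    change σ.equiv U ((σ'.equiv U).symm (𝒪[E,V].base U f')) = _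
    rw [← σ'.map_base, AlgEquiv.symm_apply_apply, σ.map_base]
    exact split_ext fun x => (congrArg (algebraMap ℝ (FibAlg E V x.1)) (hf x)).symm

/-- An isomorphism over the identity, as a family of automorphisms. -/
def GIso.self (Ψ : GIso E V E V (Diffeomorph.refl (𝓡 n) M ∞)) (U : Opens M) :
    𝒪[E,V].A U ≃ₐ[ℝ] 𝒪[E,V].A U := Ψ.pull U

/-- The splitting obtained from another one by an isomorphism over the identity. -/
def Splitting.change (σ : Splitting X E V) (Ψ : GIso E V E V (Diffeomorph.refl (𝓡 n) M ∞)) :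
    Splitting X E V where
  equiv U := (σ.equiv U).trans (Ψ.self U).symm
  natural U W h a := by
    change 𝒪[E,V].res h ((Ψ.self U).symm (σ.equiv U a)) =
      (Ψ.self W).symm (σ.equiv W (X.res h a))
    have e : 𝒪[E,V].res h (Ψ.self U ((Ψ.self U).symm (σ.equiv U a))) =
      Ψ.self W (𝒪[E,V].res h ((Ψ.self U).symm (σ.equiv U a))) := Ψ.natural U W h _
    rw [AlgEquiv.eq_symm_apply, ← e, AlgEquiv.apply_symm_apply, σ.natural]
  map_deg U k a := by
    have e : (Ψ.self U).symm (σ.equiv U a) ∈ 𝒪[E,V].deg U k ↔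
      Ψ.self U ((Ψ.self U).symm (σ.equiv U a)) ∈ 𝒪[E,V].deg U k := Ψ.map_deg U k _
    rw [AlgEquiv.apply_symm_apply, ← σ.map_deg] at e
    exact e.symm
  map_base U f := by
    have e : Ψ.self U (𝒪[E,V].base U f) = 𝒪[E,V].base U f :=
      Ψ.map_base U f f fun _ => rfl
    change (Ψ.self U).symm (σ.equiv U (X.base U f)) = _
    rw [AlgEquiv.symm_apply_eq, e, σ.map_base]

lemma differBy_iff {σ σ' : Splitting X E V} {B : EForm 2 E V} : DifferBy B σ σ' ↔
    (σ.toGIso σ').HasFib (fun x => (LinearEquiv.refl ℝ (E.fiber x)).toLinearMap)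
      (fun x => (LinearEquiv.refl ℝ (V.fiber x)).toLinearMap) fun x e e' => B.form x ![e, e'] :=
  ⟨fun h => GIso.hasFib_of_values (φ := Diffeomorph.refl (𝓡 n) M ∞) _
      (F := fun x => LinearEquiv.refl ℝ (E.fiber x)) (G := fun x => LinearEquiv.refl ℝ (V.fiber x))
      h.on_dualE h.on_dualV h.on_dualV_two, fun h =>
    ⟨⟨fun α _ e v => (congrArg (fun a => evalGr a [e] v) (h.glob_dualE α)).trans
      (evalGr_ιOne_one _ _ _), fun β _ v => h.glob_dualV_nil β v⟩,
      fun β _ e e' v => h.glob_dualV_two β e e' v⟩⟩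

lemma existsUnique_differBy {σ σ' : Splitting X E V} (h : SameBundles σ σ') :
    ∃! B : EForm 2 E V, DifferBy B σ σ' := by
  obtain ⟨F, G, τ, hτ, hf⟩ := (σ.toGIso σ').exists_hasFib
  obtain ⟨B, hB⟩ := hf.exists_form hτ
  have e2 : ∀ x v, G x v = v := fun x v => vec_ext_dual fun β =>
    (hf.glob_dualV_nil β v).symm.trans (h.on_dualV β x v)
  refine ⟨B, ⟨h, fun β x e e' v => ?_⟩, fun B' h' => EForm.ext (funext fun x =>
    AlternatingMap.ext fun w => vec_ext_dual fun β => ?_)⟩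
  · refine (hf.glob_dualV_two β e e' v).trans (congrArg (β.form x) ?_)
    rw [hB, e2]
  · have hw : w = ![w 0, w 1] := by funext k; fin_cases k <;> rfl
    rw [hw, ← h'.on_dualV_two β x (w 0) (w 1) 0]
    refine (hf.glob_dualV_two β (w 0) (w 1) 0).trans (congrArg (β.form x) ?_)
    rw [hB, e2]

lemma existsUnique_splitting (σ : Splitting X E V) (B : EForm 2 E V) :
    ∃! σ' : Splitting X E V, DifferBy B σ σ' := by
  obtain ⟨Ψ, h⟩ := GIso.exists_hasFib_of (φ := Diffeomorph.refl (𝓡 n) M ∞)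
    (F := fun x => LinearEquiv.refl ℝ (E.fiber x)) (G := fun x => LinearEquiv.refl ℝ (V.fiber x))
    (fun ψ => ⟨ψ, fun _ => rfl⟩) (fun v => ⟨v, fun _ => rfl⟩) B
  have hd : DifferBy B σ (σ.change Ψ) := by
    refine differBy_iff.2 fun x => ?_
    obtain ⟨Θ, hΘ, e⟩ := h x
    refine ⟨Θ, hΘ, fun U a hx => (congrArg (valHom (⟨x, hx⟩ : U)) ?_).trans (e U a hx)⟩
    change σ.equiv U ((σ.equiv U).symm (Ψ.pull U a)) = Ψ.pull U a
    exact (σ.equiv U).apply_symm_apply _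
  refine ⟨_, hd, fun σ' h' => Splitting.ext (funext fun U => AlgEquiv.ext fun a => ?_)⟩
  have := (differBy_iff.1 h').pull_eq (differBy_iff.1 hd) U (σ'.equiv U a)
  change σ.equiv U ((σ'.equiv U).symm (σ'.equiv U a)) =
    σ.equiv U (((σ.change Ψ).equiv U).symm (σ'.equiv U a)) at this
  rw [AlgEquiv.symm_apply_apply] at this
  exact ((AlgEquiv.eq_symm_apply _).1 ((σ.equiv U).injective this)).symm

lemma DifferBy.isChangeOfSplitting {σ σ' : Splitting X E V} {B : EForm 2 E V}
    (h : DifferBy B σ σ') {Q : HomologicalVF X} {L L' : LieTwoAlgebroid E V}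
    (hL : IsData σ Q L) (hL' : IsData σ' Q L') : IsChangeOfSplitting B L L' := by
  have hc : ∀ a, (σ.push Q).app ⊤ ((σ.toGIso σ').glob a) =
      (σ.toGIso σ').glob ((σ'.push Q).app ⊤ a) := by
    intro a
    change σ.equiv ⊤ (Q.app ⊤ ((σ.equiv ⊤).symm (σ.equiv ⊤ ((σ'.equiv ⊤).symm a)))) =
      σ.equiv ⊤ ((σ'.equiv ⊤).symm (σ'.equiv ⊤ (Q.app ⊤ ((σ'.equiv ⊤).symm a))))
    rw [AlgEquiv.symm_apply_apply, AlgEquiv.symm_apply_apply]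
  obtain ⟨g, hF, hG, hB⟩ := GIso.HasFib.exists_lieTwoIso (φ := Diffeomorph.refl (𝓡 n) M ∞)
    (F := fun x => LinearEquiv.refl ℝ (E.fiber x)) (G := fun x => LinearEquiv.refl ℝ (V.fiber x))
    (isData_iff.1 hL) (isData_iff.1 hL') (differBy_iff.1 h) hc
  have rF : ∀ {ψ ψ' : Sec E}, Related (Diffeomorph.refl (𝓡 n) M ∞) g.F ψ ψ' ↔ ψ' = ψ := by
    intro ψ ψ'
    rw [hF]
    exact ⟨fun h => ContMDiffSection.ext h, fun h x => by rw [h]; rfl⟩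
  have rG : ∀ {v v' : Sec V}, Related (Diffeomorph.refl (𝓡 n) M ∞) g.G v v' ↔ v' = v := by
    intro ψ ψ'
    rw [hG]
    exact ⟨fun h => ContMDiffSection.ext h, fun h x => by rw [h]; rfl⟩
  have ht : L'.t = L.t := BundleMap.ext (funext fun x => LinearMap.ext fun v => by
    have := g.t_comm x v
    rw [hF, hG] at this
    exact this)
  have hn : ∀ ψ v, L'.conn ψ v = L.conn ψ v + B.onSec ![ψ, L.t.onSec v] := fun ψ v => by
    rw [← hB]
    exact rG.1 (g.conn_comm ψ v ψ v (rF.2 rfl) (rG.2 rfl))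
  refine ⟨Anchor.ext (funext fun x => LinearMap.ext fun e => ?_), ht, fun ψ1 ψ2 => ?_, hn,
    fun ψ1 ψ2 ψ3 => ?_, fun v1 v2 => ?_⟩
  · have := g.anchor_comm x e
    rw [hF] at this
    refine this.trans ?_
    change mfderiv (𝓡 n) (𝓡 n) (id : M → M) x (L.anchor.map x e) = _
    rw [mfderiv_id]
    rfl
  · rw [← hB]
    exact rF.1 (g.bracket_comm ψ1 ψ2 ψ1 ψ2 (rF.2 rfl) (rF.2 rfl))
  · rw [← hB]
    exact rG.1 (g.H_comm ψ1 ψ2 ψ3 ψ1 ψ2 ψ3 (rF.2 rfl) (rF.2 rfl) (rF.2 rfl))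
  · rw [LieTwoAlgebroid.bracketV, ht, hn]
    rfl

section Cocycles

open Matrix

lemma exists_bundle_of_cocycle {r : ℕ} (U : M → Opens M) (hU : ∀ i, i ∈ U i)
    (g : M → M → M → Matrix (Fin r) (Fin r) ℝ) (hself : ∀ i, ∀ x ∈ U i, g i i x = 1)
    (hcomp : ∀ i j k x, x ∈ U i → x ∈ U j → x ∈ U k → g i j x * g j k x = g i k x)
    (hg : ∀ i j x, x ∈ U i → x ∈ U j → ∀ a b, ContMDiffAt (𝓡 n) 𝓘(ℝ, ℝ) ∞ (fun x => g i j x a b) x) :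
    ∃ (E : SmoothVB.{u, 0} n M) (he : E.rank = r) (W : M → Opens M) (F : ∀ i, Frame E (W i)),
      (∀ i, i ∈ W i ∧ W i ≤ U i) ∧ ∀ i j x, x ∈ W i → x ∈ W j → ∀ w : Fin r → ℝ,
        ∑ a, w (Fin.cast he a) • ((F i).ξ a).form x =
          ∑ a, (g j i x *ᵥ w) (Fin.cast he a) • ((F j).ξ a).form x := by
  let c : M → M → M → EuclideanSpace ℝ (Fin r) →L[ℝ] EuclideanSpace ℝ (Fin r) := fun i j x =>
    toEuclideanCLM (𝕜 := ℝ) (g i j x)ᵀ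
  have hc : ∀ i j, ContMDiffOn (𝓡 n) 𝓘(ℝ, EuclideanSpace ℝ (Fin r) →L[ℝ] EuclideanSpace ℝ (Fin r)) ∞
      (c i j) (U i ∩ U j) := by
    intro i j x hx
    have e : c i j = fun x => ∑ a, ∑ b, g i j x b a •
        (toEuclideanCLM (𝕜 := ℝ) (Matrix.single a b (1 : ℝ))) := by
      funext x
      change toEuclideanCLM (𝕜 := ℝ) (g i j x)ᵀ = _
      conv_lhs => rw [matrix_eq_sum_single (g i j x)ᵀ, map_sum]
      refine Finset.sum_congr rfl fun a _ => ?_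
      rw [map_sum]
      refine Finset.sum_congr rfl fun b _ => ?_
      rw [← map_smul, smul_single, smul_eq_mul, mul_one, transpose_apply]
    rw [e]
    exact (contMDiffAt_finsetSum fun a _ => contMDiffAt_finsetSum fun b _ =>
      (hg i j x hx.1 hx.2 b a).smul contMDiffAt_const).contMDiffWithinAt
  have hcc : ∀ i j k x, x ∈ U i → x ∈ U j → x ∈ U k → ∀ v, c j k x (c i j x v) = c i k x v := by
    intro i j k x hi hj hk v
    change (toEuclideanCLM (𝕜 := ℝ) (g j k x)ᵀ * toEuclideanCLM (𝕜 := ℝ) (g i j x)ᵀ) v = _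
    rw [← map_mul, ← transpose_mul, hcomp i j k x hi hj hk]
  let Z : VectorBundleCore ℝ M (EuclideanSpace ℝ (Fin r)) M :=
    { baseSet := fun i => U i
      isOpen_baseSet := fun i => (U i).isOpen
      indexAt := id
      mem_baseSet_at := hU
      coordChange := c
      coordChange_self := fun i x hx v => by
        change toEuclideanCLM (𝕜 := ℝ) (g i i x)ᵀ v = v
        rw [hself i x hx, transpose_one, map_one]
        rfl
      continuousOn_coordChange := fun i j => (hc i j).continuousOn
      coordChange_comp := fun i j k x hx v => hcc i j k x hx.1.1 hx.1.2 hx.2 v }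
  have : Z.IsContMDiff (𝓡 n) ∞ := ⟨hc⟩
  let E : SmoothVB.{u, 0} n M := { rank := r, fiber := Z.Fiber }
  have key := fun i => exists_frame_trivializationAt E i
  choose W hW F hF using key
  have hWU : ∀ i, W i ≤ U i := fun i x hx => (hF i x hx).1
  have hFc : ∀ i x, x ∈ W i → ∀ v : EuclideanSpace ℝ (Fin r),
      ∑ a, v a • (F i).e a x = (c i x x v : EuclideanSpace ℝ (Fin r)) := fun i x hx v =>
    ((hF i x hx).2 v).trans (Z.localTriv_symm_apply (i := i) (hWU i hx) v)
  have hval : ∀ i x, x ∈ W i → ∀ (w : Fin r → ℝ) (v : EuclideanSpace ℝ (Fin r)),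
      (∑ a, w a • ((F i).ξ a).form x) (∑ a, v a • (F i).e a x) = ∑ a, w a * v a := by
    intro i x hx w v
    simp only [LinearMap.sum_apply, LinearMap.smul_apply, map_sum, map_smul, (F i).dual x hx]
    exact Finset.sum_congr rfl fun a _ => by simp [mul_comm]
  refine ⟨E, rfl, W, F, fun i => ⟨hW i, hWU i⟩, fun i j x hi hj w => LinearMap.ext fun v => ?_⟩
  let v' : EuclideanSpace ℝ (Fin r) := WithLp.toLp 2 fun a => ((F i).ξ a).form x v
  have h1 : ∑ a, v' a • (F i).e a x = v := (F i).sum x hi v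
  have h2 : ∑ a, (c i j x v') a • (F j).e a x = v :=
    ((hFc j x hj _).trans ((hcc i j x x (hWU i hi) (hWU j hj) (hU x) v').trans
      (hFc i x hi v').symm)).trans h1
  have e1 := hval i x hi w v'
  have e2 := hval j x hj (g j i x *ᵥ w) (c i j x v')
  rw [h1] at e1
  rw [h2] at e2
  refine e1.trans (Eq.trans ?_ e2.symm)
  change w ⬝ᵥ v'.ofLp = (g j i x *ᵥ w) ⬝ᵥ ((g i j x)ᵀ *ᵥ v'.ofLp)
  rw [dotProduct_mulVec, ← mulVec_transpose, transpose_transpose, mulVec_mulVec,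
    hcomp i j i x (hWU i hi) (hWU j hj) (hWU i hi), hself i x (hWU i hi), one_mulVec]

end Cocycles

section Shear

variable {W1 : Type v} {W2 : Type v'} [AddCommGroup W1] [Module ℝ W1] [AddCommGroup W2]
  [Module ℝ W2]

variable (W1 W2) in
/-- The projection to the exterior algebra of the generators of degree one. -/
def projOne : GrAlg W1 W2 →ₐ[ℝ] GrAlg W1 W2 :=
  grGen LinearMap.id 0 fun _ => Submodule.zero_mem _

variable (W1 W2) in
/-- The coefficients of the generators of degree one. -/
def linOne : GrAlg W1 W2 →ₗ[ℝ] W1 :=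
  (TensorProduct.rid ℝ W1).toLinearMap ∘ₗ TensorProduct.map ExteriorAlgebra.ιInv
    (SymmetricAlgebra.lift (0 : W2 →ₗ[ℝ] ℝ)).toLinearMap

variable (W2) in
lemma exists_linTwo : ∃ f : GrAlg W1 W2 →ₗ[ℝ] W2, f ∘ₗ ιTwoL = LinearMap.id :=
  LinearMap.exists_leftInverse_of_injective _ (LinearMap.ker_eq_bot'.2 fun b hb =>
    (Module.forall_dual_apply_eq_zero_iff ℝ b).1 fun f => by
      have := congrArg (grLift (W1 := W1) 0 (fun _ => zero_mul _) f fun _ _ => mul_comm _ _) hb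
      rw [map_zero] at this
      exact (grLift_ιTwo _ _ _ _ b).symm.trans this)

variable (W1 W2) in
/-- The coefficients of the generators of degree two. -/
def linTwo : GrAlg W1 W2 →ₗ[ℝ] W2 :=
  (exists_linTwo W2).choose ∘ₗ (LinearMap.id - (projOne W1 W2).toLinearMap)

lemma projOne_ιOne (w : W1) : projOne W1 W2 (ιOne w) = ιOne w := grGen_ιOne _ _ _ w

lemma linOne_ιOne (w : W1) : linOne W1 W2 (ιOne w) = w := by
  simp [linOne, ιOne, ExteriorAlgebra.ι_leftInverse w]

lemma projOne_ιTwo (b : W2) : projOne W1 W2 (ιTwo b) = 0 := grGen_ιTwo _ _ _ b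

lemma linTwo_ιTwo (b : W2) : linTwo W1 W2 (ιTwo b) = b := by
  change (exists_linTwo W2).choose (ιTwo b - projOne W1 W2 (ιTwo b)) = b
  rw [projOne_ιTwo, sub_zero]
  exact LinearMap.congr_fun (exists_linTwo (W1 := W1) W2).choose_spec b

lemma projOne_idem (a : GrAlg W1 W2) : projOne W1 W2 (projOne W1 W2 a) = projOne W1 W2 a := by
  refine AlgHom.congr_fun (φ₁ := (projOne W1 W2).comp (projOne W1 W2)) (grAlg_hom_ext
    (fun w => ?_) fun b => ?_) a
  · rw [AlgHom.comp_apply, projOne_ιOne, projOne_ιOne]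
  · rw [AlgHom.comp_apply, projOne_ιTwo, map_zero]

lemma projOne_mem {k : ℕ} {a : GrAlg W1 W2} (ha : a ∈ grDeg W1 W2 k) :
    projOne W1 W2 a ∈ grDeg W1 W2 k := grGen_mem _ _ _ ha

lemma ιOne_linOne {a : GrAlg W1 W2} (ha : a ∈ grDeg W1 W2 1) : ιOne (linOne W1 W2 a) = a := by
  obtain ⟨w, rfl⟩ := (exists_generators ha).2 rfl
  rw [linOne_ιOne]

lemma projOne_one {a : GrAlg W1 W2} (ha : a ∈ grDeg W1 W2 1) : projOne W1 W2 a = a := by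
  rw [← ιOne_linOne ha, projOne_ιOne]

lemma linTwo_projOne (a : GrAlg W1 W2) : linTwo W1 W2 (projOne W1 W2 a) = 0 := by
  change (exists_linTwo W2).choose (projOne W1 W2 a - projOne W1 W2 (projOne W1 W2 a)) = 0
  rw [projOne_idem, sub_self, map_zero]

lemma projOne_add_linTwo {a : GrAlg W1 W2} (ha : a ∈ grDeg W1 W2 2) :
    projOne W1 W2 a + ιTwo (linTwo W1 W2 a) = a := by
  refine grDeg_induction (P := fun k a => k = 2 → projOne W1 W2 a + ιTwoL (linTwo W1 W2 a) = a)
    ?_ ?_ ?_ ?_ ?_ ?_ ha rfl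
  · intro h; omega
  · intro k a b ha hb h
    conv_rhs => rw [← ha h, ← hb h]
    rw [map_add, map_add, map_add]; abel
  · intro k c a ha h
    conv_rhs => rw [← ha h]
    rw [map_smul, map_smul, map_smul, smul_add]
  · intro k h; rw [map_zero, map_zero, map_zero, add_zero]
  · intro k w a ha _ h
    obtain ⟨w', rfl⟩ := (exists_generators ha).2 (by omega)
    have e : projOne W1 W2 (ιOne w * ιOne w') = ιOne w * ιOne w' := by
      rw [map_mul, projOne_ιOne, projOne_ιOne]
    rw [e, ← e, linTwo_projOne, map_zero, add_zero]
  · intro k b a ha _ h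
    obtain ⟨c, rfl⟩ := (exists_generators ha).1 (by omega)
    rw [← Algebra.commutes, ← Algebra.smul_def, map_smul, map_smul, map_smul, linTwo_ιTwo,
      projOne_ιTwo, smul_zero, zero_add]
    rfl

variable (q q' : W2 →ₗ[ℝ] GrAlg W1 W2) (hq : ∀ b, q b ∈ grDeg W1 W2 2)
  (hq' : ∀ b, q' b ∈ grDeg W1 W2 2)

/-- The automorphism which adds elements of the exterior algebra to the generators of degree
two. -/
def shear : GrAlg W1 W2 →ₐ[ℝ] GrAlg W1 W2 :=
  grGen LinearMap.id (ιTwoL + q) fun b => Submodule.add_mem _ (ιTwo_mem_grDeg b) (hq b)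

lemma shear_ιOne (w : W1) : shear q hq (ιOne w) = ιOne w := grGen_ιOne _ _ _ w

lemma shear_ιTwo (b : W2) : shear q hq (ιTwo b) = ιTwo b + q b := grGen_ιTwo _ _ _ b

lemma shear_mem {k : ℕ} {a : GrAlg W1 W2} (ha : a ∈ grDeg W1 W2 k) :
    shear q hq a ∈ grDeg W1 W2 k := grGen_mem _ _ _ ha

lemma shear_projOne (a : GrAlg W1 W2) : shear q hq (projOne W1 W2 a) = projOne W1 W2 a := by
  refine AlgHom.congr_fun (φ₁ := (shear q hq).comp (projOne W1 W2)) (grAlg_hom_ext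
    (fun w => ?_) fun b => ?_) a
  · rw [AlgHom.comp_apply, projOne_ιOne, shear_ιOne]
  · rw [AlgHom.comp_apply, projOne_ιTwo, map_zero]

lemma shear_two {a : GrAlg W1 W2} (ha : a ∈ grDeg W1 W2 2) :
    shear q hq a = a + q (linTwo W1 W2 a) := by
  conv_lhs => rw [← projOne_add_linTwo ha]
  rw [map_add, shear_projOne, shear_ιTwo, ← add_assoc, projOne_add_linTwo ha]

variable {q q'} in
lemma shear_shear (h : ∀ b, projOne W1 W2 (q b) = q b) (h' : ∀ b, q' b + q b = 0)
    (a : GrAlg W1 W2) : shear q' hq' (shear q hq a) = a := by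
  refine AlgHom.congr_fun (φ₁ := (shear q' hq').comp (shear q hq)) (φ₂ := AlgHom.id ℝ _)
    (grAlg_hom_ext (fun w => ?_) fun b => ?_) a
  · rw [AlgHom.comp_apply, shear_ιOne, shear_ιOne, AlgHom.id_apply]
  · rw [AlgHom.comp_apply, shear_ιTwo, map_add, ← h b, shear_projOne, h, shear_ιTwo, add_assoc, h',
      add_zero, AlgHom.id_apply]

end Shear

section LocalShear

variable {r s : ℕ} {U : Opens M}

lemma LocalIso.smoothAt_toFib_of (T : LocalIso E V r s U) {k : ℕ}
    {f : M → FinGrAlg r s} (hk : ∀ y, f y ∈ grDeg (Fin r → ℝ) (Fin s → ℝ) k)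
    (hf : ∀ (φ : FinGrAlg r s →ₗ[ℝ] ℝ), ∀ y ∈ U,
      ContMDiffAt (𝓡 n) 𝓘(ℝ, ℝ) ∞ (fun y => φ (f y)) y) {y : M} (hy : y ∈ U) :
    SmoothAt (fun y => T.toFib y (f y)) y := by
  obtain ⟨τ, -, hτ⟩ := exists_coord_mem (n := n) (U := U) (fun y => f y) (fun y => hk y)
    fun φ y => (hf φ y.1 y.2).comp y contMDiff_subtype_val.contMDiffAt
  refine (smoothAt_val (T.hom le_rfl τ) ⟨y, hy⟩).congr ?_
  filter_upwards [U.isOpen.mem_nhds hy] with z hz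
  rw [extZero_of_mem _ hz]
  exact congrArg (T.toFib z) (hτ ⟨z, hz⟩).symm

/-- The trivialization obtained from another one by adding elements of the exterior algebra to the
coordinates of degree two. -/
def LocalIso.shear (T : LocalIso E V r s U)
    (q : M → (Fin s → ℝ) →ₗ[ℝ] FinGrAlg r s)
    (hq : ∀ y b, q y b ∈ grDeg (Fin r → ℝ) (Fin s → ℝ) 2) (hp : ∀ y b, projOne _ _ (q y b) = q y b)
    (hs : ∀ b (φ : FinGrAlg r s →ₗ[ℝ] ℝ), ∀ y ∈ U,
      ContMDiffAt (𝓡 n) 𝓘(ℝ, ℝ) ∞ (fun y => φ (q y b)) y) : LocalIso E V r s U :=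
  have hn : ∀ y b, (-q y) b ∈ grDeg (Fin r → ℝ) (Fin s → ℝ) 2 := fun y b =>
    Submodule.neg_mem _ (hq y b)
  have hlin : ∀ y c, q y c = ∑ a, c a • q y (Pi.single a 1) := fun y c => by
    rw [LinearMap.pi_apply_eq_sum_univ (q y) c]
    refine Finset.sum_congr rfl fun a _ => ?_
    congr 2
    funext j
    rw [Pi.single_apply]
    simp only [eq_comm]
  { toFib := fun y => (T.toFib y).comp (QTwo.shear (q y) (hq y))
    ofFib := fun y => (QTwo.shear (-q y) (hn y)).comp (T.ofFib y)
    left := fun y hy a => by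
      rw [AlgHom.comp_apply, AlgHom.comp_apply, T.left y hy,
        shear_shear _ _ (hp y) fun b => neg_add_cancel (q y b)]
    right := fun y hy a => by
      rw [AlgHom.comp_apply, AlgHom.comp_apply, shear_shear _ _ (fun b => ?_) fun b =>
        add_neg_cancel (q y b), T.right y hy]
      rw [LinearMap.neg_apply, map_neg, hp]
    toFib_mem := fun y k a ha => T.toFib_mem _ _ _ (shear_mem _ (hq y) ha)
    ofFib_mem := fun y k a ha => shear_mem _ (hn y) (T.ofFib_mem _ _ _ ha)
    smooth_one := fun y hy w => (T.smooth_one y hy w).congr (Eventually.of_forall fun z => by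
      rw [AlgHom.comp_apply, shear_ιOne])
    smooth_two := fun y hy w => ((T.smooth_two y hy w).add (T.smoothAt_toFib_of (fun z => hq z w)
      (fun φ z hz => hs w φ z hz) hy)).congr (Eventually.of_forall fun z => by
        rw [AlgHom.comp_apply, shear_ιTwo, map_add])
    inv_smooth_one := fun α φ y hy => by
      refine (T.inv_smooth_one α φ y hy).congr_of_eventuallyEq (Eventually.of_forall fun z => ?_)
      have hz := T.ofFib_mem z 1 _ (ιOne_mem_grDeg (α.form z))
      change φ (QTwo.shear (-q z) (hn z) (T.ofFib z (ιOne (α.form z)))) = φ (T.ofFib z (ιOne (α.form z)))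
      rw [← projOne_one hz, shear_projOne]
    inv_smooth_two := fun β φ y hy => by
      have e : ∀ z, φ (QTwo.shear (-q z) (hn z) (T.ofFib z (ιTwo (β.form z)))) =
          φ (T.ofFib z (ιTwo (β.form z))) -
            ∑ a, (LinearMap.proj a ∘ₗ linTwo _ _) (T.ofFib z (ιTwo (β.form z))) *
              φ (q z (Pi.single a 1)) := fun z => by
        rw [shear_two _ _ (T.ofFib_mem z 2 _ (ιTwo_mem_grDeg (β.form z))), LinearMap.neg_apply,
          hlin, map_add, map_neg, map_sum, sub_eq_add_neg]
        congr 2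
        exact Finset.sum_congr rfl fun a _ => map_smul φ _ _
      change ContMDiffAt (𝓡 n) 𝓘(ℝ, ℝ) ∞ (fun z =>
        φ (QTwo.shear (-q z) (hn z) (T.ofFib z (ιTwo (β.form z))))) y
      simp only [e]
      exact (T.inv_smooth_two β φ y hy).sub (contMDiffAt_finsetSum fun a _ =>
        (T.inv_smooth_two β _ y hy).mul (hs _ φ y hy)) }

end LocalShear

section GradedCocycle

/-- Coordinate changes of degree zero between graded coordinate systems over open sets `U i`. -/
structure GrCocycle (n : ℕ) {M : Type u} [TopologicalSpace M]
    [ChartedSpace (EuclideanSpace ℝ (Fin n)) M] (r s : ℕ) (U : M → Opens M) where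
  T : M → M → M → FinGrAlg r s →ₐ[ℝ] FinGrAlg r s
  self : ∀ i, ∀ x ∈ U i, ∀ a, T i i x a = a
  comp : ∀ i j k x, x ∈ U i → x ∈ U j → x ∈ U k → ∀ a, T i j x (T j k x a) = T i k x a
  mem : ∀ i j x {k a}, a ∈ grDeg (Fin r → ℝ) (Fin s → ℝ) k →
    T i j x a ∈ grDeg (Fin r → ℝ) (Fin s → ℝ) k
  smooth : ∀ i j x, x ∈ U i → x ∈ U j → ∀ a (φ : FinGrAlg r s →ₗ[ℝ] ℝ),
    ContMDiffAt (𝓡 n) 𝓘(ℝ, ℝ) ∞ (fun x => φ (T i j x a)) x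

variable {r s : ℕ} {U : M → Opens M} (c : GrCocycle n r s U)

namespace GrCocycle

lemma smooth_comp {f : M → FinGrAlg r s} {k : ℕ}
    (hk : ∀ y, f y ∈ grDeg (Fin r → ℝ) (Fin s → ℝ) k) {i j x : M} (hi : x ∈ U i) (hj : x ∈ U j)
    (hf : ∀ φ : FinGrAlg r s →ₗ[ℝ] ℝ,
      ContMDiffAt (𝓡 n) 𝓘(ℝ, ℝ) ∞ (fun x => φ (f x)) x)
    (φ : FinGrAlg r s →ₗ[ℝ] ℝ) :
    ContMDiffAt (𝓡 n) 𝓘(ℝ, ℝ) ∞ (fun x => φ (c.T i j x (f x))) x := by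
  obtain ⟨ι, _, ψ, b, hb, h⟩ := exists_grDeg_basis (r := r) (s := s) k
  have e : ∀ y, φ (c.T i j y (f y)) = ∑ a, ψ a (f y) * φ (c.T i j y (b a)) := fun y => by
    conv_lhs => rw [← h _ (hk y), map_sum, map_sum]
    exact Finset.sum_congr rfl fun a _ => by rw [map_smul, map_smul, smul_eq_mul]
  simp only [e]
  exact contMDiffAt_finsetSum fun a _ => (hf _).mul (c.smooth i j x hi hj _ φ)

lemma projOne_T (i j x : M) (a : FinGrAlg r s) :
    projOne _ _ (c.T i j x (projOne _ _ a)) = c.T i j x (projOne _ _ a) := by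
  refine AlgHom.congr_fun (φ₁ := ((projOne _ _).comp (c.T i j x)).comp (projOne _ _))
    (φ₂ := (c.T i j x).comp (projOne _ _)) (grAlg_hom_ext (fun w => ?_) fun b => ?_) a
  · simp only [AlgHom.comp_apply, projOne_ιOne]
    exact projOne_one (c.mem _ _ _ (ιOne_mem_grDeg w))
  · simp only [AlgHom.comp_apply, projOne_ιTwo, map_zero]

lemma exists_correction [SecondCountableTopology M] (hU : ∀ i, i ∈ U i) :
    ∃ q : M → M → (Fin s → ℝ) →ₗ[ℝ] FinGrAlg r s,
      (∀ i y b, q i y b ∈ grDeg (Fin r → ℝ) (Fin s → ℝ) 2) ∧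
      (∀ i y b, projOne _ _ (q i y b) = q i y b) ∧
      (∀ i b (φ : FinGrAlg r s →ₗ[ℝ] ℝ), ∀ y ∈ U i,
        ContMDiffAt (𝓡 n) 𝓘(ℝ, ℝ) ∞ (fun y => φ (q i y b)) y) ∧
      ∀ i j x, x ∈ U i → x ∈ U j → ∀ b, c.T j i x (q i x b) =
        projOne _ _ (c.T j i x (ιTwo b)) + q j x (linTwo _ _ (c.T j i x (ιTwo b))) := by
  have : LocallyCompactSpace M := ChartedSpace.locallyCompactSpace (EuclideanSpace ℝ (Fin n)) M
  obtain ⟨χ, hχ⟩ := SmoothPartitionOfUnity.exists_isSubordinate (𝓡 n) (isClosed_univ (X := M))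
    (fun i => (U i : Set M)) (fun i => (U i).isOpen) fun x _ => Set.mem_iUnion.2 ⟨x, hU x⟩
  have hz : ∀ j x, x ∉ U j → χ j x = 0 := fun j x hx =>
    image_eq_zero_of_notMem_tsupport fun h => hx (hχ j h)
  let p : M → M → M → (Fin s → ℝ) →ₗ[ℝ] FinGrAlg r s := fun i j x =>
    (c.T i j x).toLinearMap ∘ₗ (projOne _ _).toLinearMap ∘ₗ (c.T j i x).toLinearMap ∘ₗ ιTwoL
  have hp : ∀ i j x b, p i j x b = c.T i j x (projOne _ _ (c.T j i x (ιTwo b))) :=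
    fun i j x b => rfl
  have hpm : ∀ i j x b, p i j x b ∈ grDeg (Fin r → ℝ) (Fin s → ℝ) 2 := fun i j x b =>
    c.mem _ _ _ (projOne_mem (c.mem _ _ _ (ιTwo_mem_grDeg b)))
  have hfin : ∀ x, ∃ S : Finset M, (∀ᶠ y in 𝓝 x, ∀ i b,
      (∑ᶠ j, χ j y • p i j y) b = ∑ j ∈ S, χ j y • p i j y b) ∧ ∑ j ∈ S, χ j x = 1 := by
    intro x
    obtain ⟨S, hS⟩ := χ.locallyFinite.exists_finset_support x
    refine ⟨S, hS.mono fun y hy i b => ?_, ?_⟩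
    · rw [finsum_eq_sum_of_support_subset _ (s := S) fun j hj => hy fun h => hj <| by
        exact (congrArg (fun t : ℝ => t • p i j y) h).trans (zero_smul ℝ _), LinearMap.sum_apply]
      rfl
    · rw [← finsum_eq_sum_of_support_subset _ hS.self_of_nhds]
      exact χ.sum_eq_one trivial
  refine ⟨fun i x => ∑ᶠ j, χ j x • p i j x, fun i y b => ?_, fun i y b => ?_,
    fun i b φ y hy => ?_, fun i j x hi hj b => ?_⟩
  · obtain ⟨S, hS, -⟩ := hfin y
    rw [hS.self_of_nhds]
    exact Submodule.sum_mem _ fun j _ => Submodule.smul_mem _ _ (hpm i j y b)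
  · obtain ⟨S, hS, -⟩ := hfin y
    rw [hS.self_of_nhds, map_sum]
    exact Finset.sum_congr rfl fun j _ => by rw [map_smul, hp, projOne_T]
  · obtain ⟨S, hS, -⟩ := hfin y
    have e : (fun z => φ ((∑ᶠ j, χ j z • p i j z) b)) =ᶠ[𝓝 y]
        fun z => ∑ j ∈ S, χ j z * φ (p i j z b) := hS.mono fun z hz => by
      change φ ((∑ᶠ j, χ j z • p i j z) b) = _
      rw [hz, map_sum]
      exact Finset.sum_congr rfl fun j _ => map_smul φ _ _
    refine ContMDiffAt.congr_of_eventuallyEq (contMDiffAt_finsetSum fun j _ => ?_) e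
    by_cases h : y ∈ tsupport (χ j)
    · have hj := hχ j h
      refine ((χ j).contMDiff y).mul (c.smooth_comp (fun z => projOne_mem (c.mem _ _ _
        (ιTwo_mem_grDeg b))) hy hj (fun ψ => ?_) φ)
      exact c.smooth j i y hj hy (ιTwo b) (ψ ∘ₗ (projOne _ _).toLinearMap)
    · refine (contMDiffAt_const (c := (0 : ℝ))).congr_of_eventuallyEq ?_
      filter_upwards [(notMem_tsupport_iff_eventuallyEq.1 h)] with z hz
      rw [hz]
      exact zero_mul _
  · obtain ⟨S, hS, h1⟩ := hfin x
    have e := hS.self_of_nhds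
    set a := c.T j i x (ιTwo b) with ha
    have ha2 : a ∈ grDeg (Fin r → ℝ) (Fin s → ℝ) 2 := c.mem _ _ _ (ιTwo_mem_grDeg b)
    rw [e, e, map_sum]
    conv_rhs => rw [← one_smul ℝ (projOne _ _ a), ← h1, Finset.sum_smul]
    rw [← Finset.sum_add_distrib]
    refine Finset.sum_congr rfl fun k _ => ?_
    by_cases hk : x ∈ U k
    · rw [map_smul, hp, hp, c.comp j i k x hj hi hk, ← smul_add]
      congr 1
      have e1 : c.T k i x (ιTwo b) = c.T k j x (projOne _ _ a) + c.T k j x (ιTwo (linTwo _ _ a)) := by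
        rw [← map_add, projOne_add_linTwo ha2, ha, c.comp k j i x hk hj hi]
      rw [e1, map_add, map_add, projOne_T, c.comp j k j x hj hk hj, c.self j x hj]
    · rw [hz k x hk, zero_smul, zero_smul, zero_smul, map_zero, add_zero]

lemma exists_bundles [SecondCountableTopology M] (hU : ∀ i, i ∈ U i) :
    ∃ (E V : SmoothVB.{u, 0} n M) (W : M → Opens M) (Λ : ∀ i, LocalIso E V r s (W i)),
      E.rank = r ∧ V.rank = s ∧ (∀ i, i ∈ W i ∧ W i ≤ U i) ∧
      ∀ i j x, x ∈ W i → x ∈ W j → ∀ a, (Λ i).toFib x a = (Λ j).toFib x (c.T j i x a) := by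
  obtain ⟨q, hq, hqp, hqs, hqT⟩ := c.exists_correction hU
  have one : ∀ i j x w, ιOne (linOne _ _ (c.T i j x (ιOne w))) = c.T i j x (ιOne w) :=
    fun i j x w => ιOne_linOne (c.mem _ _ _ (ιOne_mem_grDeg w))
  have two : ∀ i j k x, x ∈ U i → x ∈ U j → x ∈ U k → ∀ b,
      linTwo _ _ (c.T i j x (ιTwo (linTwo _ _ (c.T j k x (ιTwo b))))) =
        linTwo _ _ (c.T i k x (ιTwo b)) := fun i j k x hi hj hk b => by
    have := projOne_add_linTwo (c.mem j k x (ιTwo_mem_grDeg b))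
    rw [← c.comp i j k x hi hj hk]
    conv_rhs => rw [← this, map_add, map_add, ← projOne_T, linTwo_projOne, zero_add]
  obtain ⟨E, he, W1, F, hW₁, hF⟩ := exists_bundle_of_cocycle (n := n) (r := r) U hU
    (fun i j x => LinearMap.toMatrix' (linOne _ _ ∘ₗ (c.T i j x).toLinearMap ∘ₗ ιOneL))
    (fun i x hx => by
      rw [← LinearMap.toMatrix'_id]
      congr 1
      exact LinearMap.ext fun w => (congrArg _ (c.self i x hx _)).trans (linOne_ιOne w))
    (fun i j k x hi hj hk => by
      rw [← LinearMap.toMatrix'_comp]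
      congr 1
      refine LinearMap.ext fun w => ?_
      change linOne _ _ (c.T i j x (ιOne (linOne _ _ (c.T j k x (ιOne w))))) =
        linOne _ _ (c.T i k x (ιOne w))
      rw [one, c.comp i j k x hi hj hk])
    (fun i j x hi hj a b => by
      simp only [LinearMap.toMatrix'_apply]
      exact c.smooth i j x hi hj _ (LinearMap.proj a ∘ₗ linOne _ _))
  obtain ⟨V, hv, W2, G, hW₂, hG⟩ := exists_bundle_of_cocycle (n := n) (r := s) U hU
    (fun i j x => LinearMap.toMatrix' (linTwo _ _ ∘ₗ (c.T i j x).toLinearMap ∘ₗ ιTwoL))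
    (fun i x hx => by
      rw [← LinearMap.toMatrix'_id]
      congr 1
      exact LinearMap.ext fun w => (congrArg _ (c.self i x hx _)).trans (linTwo_ιTwo w))
    (fun i j k x hi hj hk => by
      rw [← LinearMap.toMatrix'_comp]
      congr 1
      exact LinearMap.ext fun w => two i j k x hi hj hk w)
    (fun i j x hi hj a b => by
      simp only [LinearMap.toMatrix'_apply]
      exact c.smooth i j x hi hj _ (LinearMap.proj a ∘ₗ linTwo _ _))
  subst he hv
  let K : ∀ i, LocalIso E V E.rank V.rank (W1 i ⊓ W2 i) := fun i =>
    LocalIso.ofFrames ((F i).restrict inf_le_left) ((G i).restrict inf_le_right)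
  have k1 : ∀ i j x, x ∈ W1 i → x ∈ W1 j → ∀ w,
      (K i).toFib x (ιOne w) = (K j).toFib x (c.T j i x (ιOne w)) := by
    intro i j x hi hj w
    rw [← one]
    refine (grMap_ιOne _ _ w).trans (Eq.trans (congrArg ιOne ?_) (grMap_ιOne _ _ _).symm)
    rw [Fintype.linearCombination_apply, Fintype.linearCombination_apply]
    refine (hF i j x hi hj w).trans ?_
    rw [LinearMap.toMatrix'_mulVec]
    rfl
  have k2 : ∀ i j x, x ∈ W2 i → x ∈ W2 j → ∀ b,
      (K i).toFib x (ιTwo b) = (K j).toFib x (ιTwo (linTwo _ _ (c.T j i x (ιTwo b)))) := by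
    intro i j x hi hj w
    refine (grMap_ιTwo _ _ w).trans (Eq.trans (congrArg ιTwo ?_) (grMap_ιTwo _ _ _).symm)
    rw [Fintype.linearCombination_apply, Fintype.linearCombination_apply]
    refine (hG i j x hi hj w).trans ?_
    rw [LinearMap.toMatrix'_mulVec]
    rfl
  have k3 : ∀ i j x, x ∈ W1 i → x ∈ W1 j → ∀ a, (K i).toFib x (projOne _ _ a) =
      (K j).toFib x (c.T j i x (projOne _ _ a)) := by
    intro i j x hi hj a
    refine AlgHom.congr_fun (φ₁ := ((K i).toFib x).comp (projOne _ _))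
      (φ₂ := (((K j).toFib x).comp (c.T j i x)).comp (projOne _ _))
      (grAlg_hom_ext (fun w => ?_) fun b => ?_) a
    · simp only [AlgHom.comp_apply, projOne_ιOne]
      exact k1 i j x hi hj w
    · simp only [AlgHom.comp_apply, projOne_ιTwo, map_zero]
  refine ⟨E, V, fun i => W1 i ⊓ W2 i, fun i => (K i).shear (q i) (hq i) (hqp i) fun b φ y hy =>
    hqs i b φ y ((hW₁ i).2 hy.1), rfl, rfl, fun i => ⟨⟨(hW₁ i).1, (hW₂ i).1⟩,
      inf_le_left.trans (hW₁ i).2⟩, fun i j x hi hj a => ?_⟩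
  change (K i).toFib x (shear (q i x) (hq i x) a) =
    (K j).toFib x (shear (q j x) (hq j x) (c.T j i x a))
  refine AlgHom.congr_fun (φ₁ := ((K i).toFib x).comp (shear (q i x) (hq i x)))
    (φ₂ := (((K j).toFib x).comp (shear (q j x) (hq j x))).comp (c.T j i x))
    (grAlg_hom_ext (fun w => ?_) fun b => ?_) a
  · simp only [AlgHom.comp_apply, shear_ιOne]
    rw [← one j i x w, shear_ιOne, one, k1 i j x hi.1 hj.1]
  · simp only [AlgHom.comp_apply]
    have h2 := c.mem j i x (ιTwo_mem_grDeg b)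
    rw [shear_two _ _ h2, shear_ιTwo, map_add, map_add, ← hqp i x b, k3 i j x hi.1 hj.1, hqp,
      hqT i j x ((hW₁ i).2 hi.1) ((hW₁ j).2 hj.1), k2 i j x hi.2 hj.2, map_add, ← add_assoc,
      ← map_add, add_comm (ιTwo _), projOne_add_linTwo h2]

end GrCocycle

end GradedCocycle

section ExistenceOfSplitting

variable {r s : ℕ}

section Coordinates

variable {U U' : Opens M} (C : X.Coordinates r s U) (C' : X.Coordinates r s U')

namespace GradedSpace.Coordinates

/-- The coordinate change between two graded coordinate systems. -/
def change (W : Opens M) (h : W ≤ U) (h' : W ≤ U') : CoordAlg n r s W ≃ₐ[ℝ] CoordAlg n r s W :=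
  (C.equiv W h).trans (C'.equiv W h').symm

lemma change_apply (W : Opens M) (h : W ≤ U) (h' : W ≤ U') (τ : CoordAlg n r s W) :
    C.change C' W h h' τ = (C'.equiv W h').symm (C.equiv W h τ) := rfl

lemma change_res {W Z : Opens M} (h : W ≤ U) (h' : W ≤ U') (hZ : Z ≤ W) (τ : CoordAlg n r s W) :
    C.change C' Z (hZ.trans h) (hZ.trans h') (resCoord r s hZ τ) =
      resCoord r s hZ (C.change C' W h h' τ) := by
  rw [change_apply, AlgEquiv.symm_apply_eq, ← C'.natural W Z h' hZ, change_apply,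
    AlgEquiv.apply_symm_apply, C.natural W Z h hZ]

/-- The coordinate change at a point. -/
def changeAt (x : M) (h : x ∈ U ⊓ U') :
    FinGrAlg r s →ₐ[ℝ] FinGrAlg r s :=
  (coordVal (⟨x, h⟩ : (U ⊓ U' : Opens M))).comp
    ((C.change C' (U ⊓ U') inf_le_left inf_le_right).toAlgHom.comp
      (Algebra.TensorProduct.includeRight : _ →ₐ[ℝ] CoordAlg n r s (U ⊓ U')))

lemma changeAt_apply (x : M) (h : x ∈ U ⊓ U') (a : FinGrAlg r s) :
    C.changeAt C' x h a = coordVal (⟨x, h⟩ : (U ⊓ U' : Opens M))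
      (C.change C' (U ⊓ U') inf_le_left inf_le_right (1 ⊗ₜ[ℝ] a)) := rfl

lemma coordVal_change {W : Opens M} (h : W ≤ U) (h' : W ≤ U') (y : W) (τ : CoordAlg n r s W) :
    coordVal y (C.change C' W h h' τ) = C.changeAt C' y.1 ⟨h y.2, h' y.2⟩ (coordVal y τ) := by
  induction τ using TensorProduct.induction_on with
  | zero => simp only [map_zero]
  | add a b ha hb => simp only [map_add, ha, hb]
  | tmul f g =>
    have e1 : C.change C' W h h' (f ⊗ₜ[ℝ] 1) = f ⊗ₜ[ℝ] 1 := by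
      rw [change_apply, C.map_base, AlgEquiv.symm_apply_eq, C'.map_base]
    have e2 : C.change C' W h h' (1 ⊗ₜ[ℝ] g) = resCoord r s (le_inf h h')
        (C.change C' (U ⊓ U') inf_le_left inf_le_right (1 ⊗ₜ[ℝ] g)) := by
      rw [← change_res]
      congr 1
    have e3 : (f ⊗ₜ[ℝ] g : CoordAlg n r s W) = (f ⊗ₜ[ℝ] 1) * (1 ⊗ₜ[ℝ] g) := by
      rw [Algebra.TensorProduct.tmul_mul_tmul, mul_one, one_mul]
    rw [e3, map_mul, map_mul, e1, e2, coordVal_res, map_mul, map_mul, coordVal_tmul, coordVal_tmul,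
      map_smul, map_one]
    exact congrArg (fun a => f y • 1 * C.changeAt C' y.1 ⟨h y.2, h' y.2⟩ a) (one_smul ℝ g).symm

lemma changeAt_mem {x : M} (h : x ∈ U ⊓ U') {k : ℕ} {a : FinGrAlg r s}
    (ha : a ∈ grDeg (Fin r → ℝ) (Fin s → ℝ) k) :
    C.changeAt C' x h a ∈ grDeg (Fin r → ℝ) (Fin s → ℝ) k := by
  refine coordVal_mem ((C'.map_deg _ inf_le_right k _).2 ?_) _
  change C'.equiv _ inf_le_right ((C'.equiv _ inf_le_right).symm
    (C.equiv _ inf_le_left (1 ⊗ₜ[ℝ] a))) ∈ _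
  rw [AlgEquiv.apply_symm_apply, ← C.map_deg]
  exact Submodule.apply_mem_map₂ _ trivial ha

end GradedSpace.Coordinates

open Classical in
/-- The cocycle of an atlas of graded coordinate systems. -/
def GrCocycle.ofAtlas {U : M → Opens M} (C : ∀ i, X.Coordinates r s (U i)) :
    GrCocycle n r s U where
  T i j x := if h : x ∈ U j ⊓ U i then (C j).changeAt (C i) x h else AlgHom.id ℝ _
  self i x hx a := by
    rw [dif_pos (show x ∈ U i ⊓ U i from ⟨hx, hx⟩), GradedSpace.Coordinates.changeAt_apply,
      GradedSpace.Coordinates.change_apply, AlgEquiv.symm_apply_apply, coordVal_tmul]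
    exact one_smul ℝ a
  comp i j k x hi hj hk a := by
    rw [dif_pos (show x ∈ U j ⊓ U i from ⟨hj, hi⟩), dif_pos (show x ∈ U k ⊓ U j from ⟨hk, hj⟩),
      dif_pos (show x ∈ U k ⊓ U i from ⟨hk, hi⟩)]
    let y : (U i ⊓ U j ⊓ U k : Opens M) := ⟨x, ⟨hi, hj⟩, hk⟩
    have hi' : U i ⊓ U j ⊓ U k ≤ U i := inf_le_left.trans inf_le_left
    have hj' : U i ⊓ U j ⊓ U k ≤ U j := inf_le_left.trans inf_le_right
    have e : coordVal y (1 ⊗ₜ[ℝ] a : CoordAlg n r s (U i ⊓ U j ⊓ U k)) = a :=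
      (coordVal_tmul _ _ _).trans (one_smul ℝ a)
    have e1 := (C k).coordVal_change (C j) inf_le_right hj' y (1 ⊗ₜ[ℝ] a)
    have e2 := (C k).coordVal_change (C i) inf_le_right hi' y (1 ⊗ₜ[ℝ] a)
    have e3 := (C j).coordVal_change (C i) hj' hi' y
      ((C k).change (C j) _ inf_le_right hj' (1 ⊗ₜ[ℝ] a))
    rw [e] at e1 e2
    rw [e1] at e3
    refine e3.symm.trans (Eq.trans ?_ e2)
    simp only [GradedSpace.Coordinates.change_apply, AlgEquiv.apply_symm_apply]
  mem i j x k a ha := by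
    split_ifs with h
    · exact (C j).changeAt_mem (C i) h ha
    · exact ha
  smooth i j x hi hj a φ := contMDiffAt_of_opens (W := U j ⊓ U i) (coordVal_smooth _ φ)
    (fun y => by rw [dif_pos y.2]; rfl) x ⟨hj, hi⟩

end Coordinates

section Gluing

variable (hX : X.IsNTwoManifold r s)
  {W : M → Opens M} (hW : ∀ i, i ∈ W i)
  (e : ∀ i (Z : Opens M), Z ≤ W i → X.A Z ≃ₐ[ℝ] 𝒪[E,V].A Z)
  (enat : ∀ i (Z Z' : Opens M) (h : Z ≤ W i) (h' : Z' ≤ Z) (a : X.A Z),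
    𝒪[E,V].res h' (e i Z h a) = e i Z' (h'.trans h) (X.res h' a))
  (edeg : ∀ i (Z : Opens M) (h : Z ≤ W i) k (a : X.A Z),
    a ∈ X.deg Z k ↔ e i Z h a ∈ 𝒪[E,V].deg Z k)
  (ebase : ∀ i (Z : Opens M) (h : Z ≤ W i) (f : SmoothFun n Z),
    e i Z h (X.base Z f) = 𝒪[E,V].base Z f)
  (eagree : ∀ i j (Z : Opens M) (h : Z ≤ W i) (h' : Z ≤ W j) (a : X.A Z), e i Z h a = e j Z h' a)

include hX hW enat edeg ebase eagree

lemma nonempty_splitting_of_local : Nonempty (Splitting X E V) := by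
  let val : ∀ (Z : Opens M) (y : Z), X.A Z →ₐ[ℝ] FibAlg E V y.1 := fun Z y =>
    (valHom (⟨y.1, y.2, hW y.1⟩ : (Z ⊓ W y.1 : Opens M))).comp
      ((e y.1 (Z ⊓ W y.1) inf_le_right : X.A (Z ⊓ W y.1) →ₐ[ℝ] _).comp (X.res inf_le_left))
  have hval : ∀ (Z Z' : Opens M) (hZ : Z' ≤ Z) i (hi : Z' ≤ W i) (y : Z') (a : X.A Z),
      val Z ⟨y.1, hZ y.2⟩ a = valHom y (e i Z' hi (X.res hZ a)) := by
    intro Z Z' hZ i hi y a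
    have h1 : Z' ⊓ W y.1 ≤ Z ⊓ W y.1 := inf_le_inf_right _ hZ
    have e1 := enat y.1 (Z ⊓ W y.1) (Z' ⊓ W y.1) inf_le_right h1 (X.res inf_le_left a)
    have e2 := enat i Z' (Z' ⊓ W y.1) hi inf_le_left (X.res hZ a)
    rw [hX.res_comp] at e1 e2
    rw [eagree _ i _ _ (inf_le_left.trans hi), ← e2] at e1
    exact congrArg (valHom (⟨y.1, y.2, hW y.1⟩ : (Z' ⊓ W y.1 : Opens M))) e1
  have hdeg : ∀ Z k (a : X.A Z), a ∈ X.deg Z k → ∀ y, val Z y a ∈ grDeg _ _ k := fun Z k a ha y =>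
    (edeg y.1 _ inf_le_right k _).1 (hX.res_deg _ _ inf_le_left k a ha) ⟨y.1, y.2, hW y.1⟩
  have hsm : ∀ Z (a : X.A Z), IsSmoothSplit E V Z fun y => val Z y a := fun Z a =>
    isSmoothSplit_iff.2 fun x => by
      refine (smoothAt_val (e x.1 (Z ⊓ W x.1) inf_le_right (X.res inf_le_left a))
        ⟨x.1, x.2, hW x.1⟩).congr ?_
      filter_upwards [(Z ⊓ W x.1).isOpen.mem_nhds ⟨x.2, hW x.1⟩] with y hy
      rw [extZero_of_mem _ hy.1, extZero_of_mem _ hy]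
      exact hval Z _ inf_le_left x.1 inf_le_right ⟨y, hy⟩ a
  have htop : ∀ Z, ⨆ k, X.deg Z k = ⊤ := fun Z => (hX.internal Z).submodule_iSup_eq_top
  have hmem : ∀ Z (a : X.A Z), (fun y => val Z y a) ∈ splitAlg E V Z := by
    intro Z a
    have ha : a ∈ ⨆ k, X.deg Z k := by rw [htop]; trivial
    induction ha using Submodule.iSup_induction' with
    | mem k a ha => exact Algebra.subset_adjoin ⟨hsm Z a, k, hdeg Z k a ha⟩
    | zero => simp only [map_zero]; exact zero_mem (splitAlg E V Z)
    | add a b _ _ ha hb => simp only [map_add]; exact add_mem ha hb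
  let σ : ∀ Z : Opens M, X.A Z →ₐ[ℝ] 𝒪[E,V].A Z := fun Z =>
    AlgHom.codRestrict (AlgHom.pi fun y : Z => val Z y) (splitAlg E V Z) (hmem Z)
  have hσ : ∀ (Z : Opens M) (a : X.A Z) (y : Z), valHom y (σ Z a) = val Z y a := fun _ _ _ => rfl
  have hcov : ∀ Z : Opens M, Z = ⨆ i, Z ⊓ W i := fun Z => by
    ext x
    simp only [SetLike.mem_coe, Opens.mem_iSup]
    exact ⟨fun h => ⟨x, h, hW x⟩, fun ⟨i, h⟩ => h.1⟩
  have hloc : ∀ (N : M → Opens M) Z, Z = ⨆ i, N i → ∀ k (b : X.A Z), b ∈ X.deg Z k →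
      (∀ i (h : N i ≤ Z), X.res h b = 0) → b = 0 := by
    rintro N Z rfl k b hb h
    obtain ⟨c, -, hc⟩ := hX.glue M N k (fun _ => 0) (fun _ => zero_mem _) fun _ _ => by
      rw [map_zero, map_zero]
    rw [hc b ⟨hb, fun i => h i _⟩, hc 0 ⟨zero_mem _, fun i => map_zero _⟩]
  have hglue : ∀ (N : M → Opens M) Z, Z = ⨆ i, N i → ∀ k (a : ∀ i, X.A (N i)),
      (∀ i, a i ∈ X.deg (N i) k) →
      (∀ i j, X.res (inf_le_left : N i ⊓ N j ≤ N i) (a i) =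
        X.res (inf_le_right : N i ⊓ N j ≤ N j) (a j)) →
      ∃ b ∈ X.deg Z k, ∀ i (h : N i ≤ Z), X.res h b = a i := by
    rintro N Z rfl k a ha h
    obtain ⟨c, hc, -⟩ := hX.glue M N k a ha h
    exact ⟨c, hc.1, fun i _ => hc.2 i⟩
  have hker : ∀ Z k (a : X.A Z), a ∈ X.deg Z k → (∀ y, val Z y a = 0) → a = 0 := by
    intro Z k a ha h
    refine hloc _ Z (hcov Z) k a ha fun i hi => (e i (Z ⊓ W i) inf_le_right).injective ?_
    rw [map_zero]
    refine split_ext fun y => ?_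
    rw [← hval Z _ hi i inf_le_right y a, h, map_zero]
  have hinj : ∀ Z, Function.Injective (σ Z) := by
    intro Z
    refine (injective_iff_map_eq_zero (σ Z)).2 fun a ha => ?_
    obtain ⟨f, hf, rfl⟩ := (Submodule.mem_iSup_iff_exists_finsupp _ a).1
      (show a ∈ ⨆ k, X.deg Z k by rw [htop]; trivial)
    refine Finset.sum_eq_zero fun k hk => hker Z k _ (hf k) fun y => ?_
    refine grDeg_sum_eq_zero (s := f.support) (a := fun k => val Z y (f k))
      (fun k => hdeg Z k _ (hf k) y) ?_ k hk
    rw [← map_sum]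
    exact congrArg (valHom y) ha
  have hsur : ∀ Z k (b : 𝒪[E,V].A Z), b ∈ 𝒪[E,V].deg Z k →
      ∃ a ∈ X.deg Z k, σ Z a = b := by
    intro Z k b hb
    have ea : ∀ i, e i (Z ⊓ W i) inf_le_right ((e i (Z ⊓ W i) inf_le_right).symm
      (𝒪[E,V].res inf_le_left b)) = 𝒪[E,V].res inf_le_left b := fun i =>
        AlgEquiv.apply_symm_apply _ _
    obtain ⟨a, ha, h⟩ := hglue _ Z (hcov Z) k
      (fun i => (e i (Z ⊓ W i) inf_le_right).symm (𝒪[E,V].res inf_le_left b))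
      (fun i => by
        rw [edeg i _ inf_le_right, ea]
        exact fun y => hb ⟨y.1, y.2.1⟩)
      fun i j => by
        refine (e i _ (inf_le_left.trans inf_le_right)).injective ?_
        rw [← enat i _ _ inf_le_right, ea, eagree i j _ _ (inf_le_right.trans inf_le_right),
          ← enat j _ _ inf_le_right, ea]
        rfl
    refine ⟨a, ha, split_ext fun y => ?_⟩
    rw [hσ, hval Z (Z ⊓ W y.1) inf_le_left y.1 inf_le_right ⟨y.1, y.2, hW y.1⟩ a, h, ea]
    rfl
  have hbij : ∀ Z, Function.Bijective (σ Z) := fun Z => ⟨hinj Z, fun b => by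
    refine homogeneous_induction (P := fun b => ∃ a, σ Z a = b) (fun k b hb => ?_) ?_ b
    · obtain ⟨a, -, ha⟩ := hsur Z k b hb
      exact ⟨a, ha⟩
    · rintro _ _ ⟨a, rfl⟩ ⟨b, rfl⟩
      exact ⟨a + b, map_add _ _ _⟩⟩
  refine ⟨⟨fun Z => AlgEquiv.ofBijective (σ Z) (hbij Z), fun Z Z' h a => split_ext fun y => ?_,
    fun Z k a => ⟨fun ha => hdeg Z k a ha, fun ha => ?_⟩, fun Z f => split_ext fun y => ?_⟩⟩
  · change val Z ⟨y.1, h y.2⟩ a = val Z' y (X.res h a)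
    have h' : Z' ⊓ W y.1 ≤ Z' := inf_le_left
    have e1 := hval Z (Z' ⊓ W y.1) (h'.trans h) y.1 inf_le_right ⟨y.1, y.2, hW y.1⟩ a
    have e2 := hval Z' (Z' ⊓ W y.1) h' y.1 inf_le_right ⟨y.1, y.2, hW y.1⟩ (X.res h a)
    rw [hX.res_comp] at e2
    exact e1.trans e2.symm
  · obtain ⟨b, hb, h⟩ := hsur Z k _ ha
    rwa [← hinj Z h]
  · change valHom _ (e y.1 (Z ⊓ W y.1) inf_le_right (X.res inf_le_left (X.base Z f))) = _
    rw [hX.res_base, ebase]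
    rfl

end Gluing

lemma exists_splitting [SecondCountableTopology M] (hX : X.IsNTwoManifold r s) :
    ∃ (E V : SmoothVB.{u, 0} n M), E.rank = r ∧ V.rank = s ∧ Nonempty (Splitting X E V) := by
  choose U hU C using hX.locallyTrivial
  let C := fun i => (C i).some
  obtain ⟨E, V, W, Λ, he, hv, hW, hΛ⟩ := (GrCocycle.ofAtlas C).exists_bundles hU
  refine ⟨E, V, he, hv, nonempty_splitting_of_local hX (fun i => (hW i).1)
    (fun i Z h => ((C i).equiv Z (h.trans (hW i).2)).symm.trans ((Λ i).coordinates.equiv Z h))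
    (fun i Z Z' h h' a => ?_) (fun i Z h k a => ?_) (fun i Z h f => ?_)
    fun i j Z h h' a => split_ext fun y => ?_⟩
  · change 𝒪[E,V].res h' ((Λ i).coordinates.equiv Z h (((C i).equiv Z _).symm a)) =
      (Λ i).coordinates.equiv Z' (h'.trans h) (((C i).equiv Z' (h'.trans (h.trans (hW i).2))).symm (X.res h' a))
    rw [(Λ i).coordinates.natural]
    congr 1
    rw [AlgEquiv.eq_symm_apply, ← (C i).natural Z Z' (h.trans (hW i).2) h', AlgEquiv.apply_symm_apply]
  · refine Iff.trans ?_ ((Λ i).coordinates.map_deg Z h k _)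
    rw [(C i).map_deg Z (h.trans (hW i).2)]
    exact (iff_of_eq (congrArg (· ∈ X.deg Z k) (AlgEquiv.apply_symm_apply _ a))).symm
  · change (Λ i).coordinates.equiv Z h (((C i).equiv Z _).symm (X.base Z f)) = _
    rw [← (C i).map_base Z (h.trans (hW i).2), AlgEquiv.symm_apply_apply,
      (Λ i).coordinates.map_base]
  · change (Λ i).toFib y.1 (coordVal y (((C i).equiv Z _).symm a)) =
      (Λ j).toFib y.1 (coordVal y (((C j).equiv Z _).symm a))
    have hi := h.trans (hW i).2
    have hj := h'.trans (hW j).2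
    have e1 := (C i).coordVal_change (C j) hi hj y (((C i).equiv Z hi).symm a)
    rw [GradedSpace.Coordinates.change_apply, AlgEquiv.apply_symm_apply] at e1
    rw [hΛ i j y.1 (h y.2) (h' y.2), e1]
    congr 1
    exact DFunLike.congr_fun (dif_pos (show y.1 ∈ U i ⊓ U j from ⟨hi y.2, hj y.2⟩)) _

end ExistenceOfSplitting

end QTwo

end

theorem theorem1p5
    {n : ℕ} {M : Type u} [TopologicalSpace M] [ChartedSpace (EuclideanSpace ℝ (Fin n)) M]
    [IsManifold (𝓡 n) ∞ M] [T2Space M] [SecondCountableTopology M]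
    {n' : ℕ} {M' : Type u'} [TopologicalSpace M'] [ChartedSpace (EuclideanSpace ℝ (Fin n')) M']
    [IsManifold (𝓡 n') ∞ M'] [T2Space M'] [SecondCountableTopology M'] :
    -- `E[1] ⊕ V[2]` is an N2-manifold
    (∀ (E : QTwo.SmoothVB.{u, w₁} n M) (V : QTwo.SmoothVB.{u, w₂} n M),
      (QTwo.splitSpace E V).IsNTwoManifold E.rank V.rank) ∧
    -- every N2-manifold admits a splitting
    (∀ (X : QTwo.GradedSpace.{u, v} n M) (r s : ℕ), X.IsNTwoManifold r s →
      ∃ (E : QTwo.SmoothVB.{u, 0} n M) (V : QTwo.SmoothVB.{u, 0} n M),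
        E.rank = r ∧ V.rank = s ∧ Nonempty (QTwo.Splitting X E V)) ∧
    -- with respect to a splitting, homological vector fields of degree one
    -- are the same as Lie 2-algebroid structures
    (∀ (X : QTwo.GradedSpace.{u, v} n M) (r s : ℕ), X.IsNTwoManifold r s →
      ∀ (E : QTwo.SmoothVB.{u, w₁} n M) (V : QTwo.SmoothVB.{u, w₂} n M)
        (σ : QTwo.Splitting X E V),
        (∀ Q : QTwo.HomologicalVF X, ∃! L : QTwo.LieTwoAlgebroid E V, QTwo.IsData σ Q L) ∧
        (∀ L : QTwo.LieTwoAlgebroid E V, ∃! Q : QTwo.HomologicalVF X, QTwo.IsData σ Q L)) ∧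
    -- every Lie 2-algebroid comes from a Q2-manifold, namely from `E[1] ⊕ V[2]`
    (∀ (E : QTwo.SmoothVB.{u, w₁} n M) (V : QTwo.SmoothVB.{u, w₂} n M)
      (L : QTwo.LieTwoAlgebroid E V),
      ∃! Q : QTwo.HomologicalVF (QTwo.splitSpace E V),
        QTwo.IsData (QTwo.Splitting.refl E V) Q L) ∧
    -- isomorphisms of Q2-manifolds are the same as isomorphisms of Lie 2-algebroids
    (∀ (X : QTwo.GradedSpace.{u, v} n M) (r s : ℕ), X.IsNTwoManifold r s →
      ∀ (X' : QTwo.GradedSpace.{u', v'} n' M') (r' s' : ℕ), X'.IsNTwoManifold r' s' →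
      ∀ (Q : QTwo.HomologicalVF X) (Q' : QTwo.HomologicalVF X')
        (E : QTwo.SmoothVB.{u, w₁} n M) (V : QTwo.SmoothVB.{u, w₂} n M)
        (E' : QTwo.SmoothVB.{u', w₁'} n' M') (V' : QTwo.SmoothVB.{u', w₂'} n' M')
        (σ : QTwo.Splitting X E V) (σ' : QTwo.Splitting X' E' V')
        (L : QTwo.LieTwoAlgebroid E V) (L' : QTwo.LieTwoAlgebroid E' V'),
        QTwo.IsData σ Q L → QTwo.IsData σ' Q' L' →
        ∀ φ : M ≃ₘ⟮𝓡 n, 𝓡 n'⟯ M',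
          (∀ Φ : QTwo.QIso φ Q Q', ∃! g : QTwo.LieTwoIso φ L L', QTwo.Induces σ σ' g Φ) ∧
          (∀ g : QTwo.LieTwoIso φ L L', ∃! Φ : QTwo.QIso φ Q Q', QTwo.Induces σ σ' g Φ)) ∧
    -- two splittings with the same bundles `E`, `V` differ by a unique `B`, every `B` occurs,
    -- and `B` acts on the Lie 2-algebroid data of `Q` by the stated formulas
    (∀ (X : QTwo.GradedSpace.{u, v} n M) (r s : ℕ), X.IsNTwoManifold r s →
      ∀ (E : QTwo.SmoothVB.{u, w₁} n M) (V : QTwo.SmoothVB.{u, w₂} n M)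
        (σ : QTwo.Splitting X E V),
        (∀ σ' : QTwo.Splitting X E V, QTwo.SameBundles σ σ' →
          ∃! B : QTwo.EForm 2 E V, QTwo.DifferBy B σ σ') ∧
        (∀ B : QTwo.EForm 2 E V, ∃! σ' : QTwo.Splitting X E V, QTwo.DifferBy B σ σ') ∧
        (∀ (B : QTwo.EForm 2 E V) (σ' : QTwo.Splitting X E V), QTwo.DifferBy B σ σ' →
          ∀ (Q : QTwo.HomologicalVF X) (L L' : QTwo.LieTwoAlgebroid E V),
            QTwo.IsData σ Q L → QTwo.IsData σ' Q L' → QTwo.IsChangeOfSplitting B L L')) ∧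
    -- the bracket `[v, w]_V = ∇_{t(v)} w` makes `V` a bundle of almost Lie algebras
    (∀ (E : QTwo.SmoothVB.{u, w₁} n M) (V : QTwo.SmoothVB.{u, w₂} n M)
      (L : QTwo.LieTwoAlgebroid E V),
      (∀ v₁ v₂, L.bracketV v₁ v₂ = - L.bracketV v₂ v₁) ∧
      (∀ v₁ v₂ v₃, L.bracketV v₁ (v₂ + v₃) = L.bracketV v₁ v₂ + L.bracketV v₁ v₃) ∧
      (∀ v₁ (f : QTwo.GlobalFun n M) v₂,
        L.bracketV v₁ (QTwo.smulSec f v₂) = QTwo.smulSec f (L.bracketV v₁ v₂)) ∧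
      (∀ v₁ v₂, L.t.onSec (L.bracketV v₁ v₂) = L.bracket (L.t.onSec v₁) (L.t.onSec v₂)) ∧
      (∀ v₁ v₂ v₃, L.bracketV v₁ (L.bracketV v₂ v₃) + L.bracketV v₂ (L.bracketV v₃ v₁) +
        L.bracketV v₃ (L.bracketV v₁ v₂) =
          L.H.onSec ![L.t.onSec v₁, L.t.onSec v₂, L.t.onSec v₃]) ∧
      (∀ ψ v₁ v₂, L.conn ψ (L.bracketV v₁ v₂) = L.bracketV (L.conn ψ v₁) v₂ +
        L.bracketV v₁ (L.conn ψ v₂) + L.H.onSec ![ψ, L.t.onSec v₁, L.t.onSec v₂])) := by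
  refine ⟨fun E V => QTwo.splitSpace_isNTwoManifold, fun X r s hX => QTwo.exists_splitting hX,
    fun X r s _ E V σ => ⟨QTwo.existsUnique_lie σ, QTwo.existsUnique_vf σ⟩,
    fun E V L => QTwo.existsUnique_vf (QTwo.Splitting.refl E V) L,
    fun X r s _ X' r' s' _ Q Q' E V E' V' σ σ' L L' hL hL' φ =>
      ⟨QTwo.existsUnique_lieTwoIso hL hL', QTwo.existsUnique_qIso hL hL'⟩,
    fun X r s _ E V σ => ⟨fun σ' h => QTwo.existsUnique_differBy h, QTwo.existsUnique_splitting σ,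
      fun B σ' h Q L L' hL hL' => h.isChangeOfSplitting hL hL'⟩,
    fun E V L => ⟨L.bracketV_skew, fun v₁ => L.conn_add_right _, L.bracketV_smul,
      fun v₁ v₂ => L.t_conn (L.t.onSec v₁) v₂, L.bracketV_jacobi, L.conn_bracketV⟩⟩
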